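/- Conventions. Let $X\subset\mathbb C_x$ be a domain. For $\theta\in\mathbb R$, $\delta>0$ let $S_\theta(\delta)=\{\hbar:\operatorname{Re}(e^{i\theta}/\hbar)>1/\delta\}$ (a Borel disc), and $A_\theta=(\theta-\frac\pi2,\theta+\frac\pi2)$. A sectorial domain with opening $A=(\vartheta_-,\vartheta_+)$, $0<|A|\le 2\pi$, is a simply connected domain $S\subset\mathbb C_\hbar\setminus\{0\}$ whose closure in the real-oriented blowup of $\mathbb C_\hbar$ at $0$ meets the boundary circle exactly in the closed arc $\bar A$, and which contains, for every compact subarc of $A$, a straight sector at $0$ over this subarc, and, for every $\theta$ with $A_\theta\subset A$, a Borel disc $S_\theta(\delta)$. Let $\pi\le|A|\le2\pi$, let $S$ be a sectorial domain with opening $A$, and let $\Theta=[\vartheta_-+\frac\pi2,\vartheta_+-\frac\pi2]$ be the arc of copolar directions, i.e. of those $\theta$ with $A_\theta\subset A$. Consider the Riccati equation $$\hbar\,\partial_xf=af^2+bf+c,$$ where $a,b,c$ are holomorphic on $X\times S$ and admit, locally uniformly in $x\in X$, Poincaré asymptotic expansions $\hat a=\sum a_k(x)\hbar^k$, $\hat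 b=\sum b_k(x)\hbar^k$, $\hat c=\sum c_k(x)\hbar^k$ with coefficients holomorphic on $X$, as $\hbar\to0$ along (every compact subarc of) $A$. Let $D_0=b_0^2-4a_0c_0$, let $x_0\in X$ with $D_0(x_0)\neq0$, let $\sqrt{D_0}$ be a holomorphic branch near $x_0$, and let $\alpha\in\{+,-\}$. Assume that the leading-order solution $f_0^\alpha$, i.e. the solution of $a_0f_0^2+b_0f_0+c_0=0$ with $2a_0f_0+b_0=\alpha\sqrt{D_0}$, is holomorphic at $x_0$ (given (1) below, this means: if $a_0(x_0)=0$, then $\sqrt{D_0(x_0)}=b_0(x_0)$). Let $\hat f_\alpha=\sum f^\alpha_k(x)\hbar^k$ be the formal power series solution near $x_0$, with holomorphic coefficients, that has leading order $f_0^\alpha$. Let $\Phi(x)=\int_{x_0}^x\sqrt{D_0(t)}\,dt$ near $x_0$. Assume: 1. For every $\theta\in\Theta$ there is a WKB $(\theta,\alpha)$-halfstrip $W_\theta\subset X$ containing $x_0$: that is, there are $z_1\in\mathbb C$ and $r>0$ such that $H=\{z:\operatorname{dist}(z,z_1+\alpha e^{i\theta}[0,\infty))<r\}$ contains $0=\Phi(x_0)$,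 the local inverse $\Phi^{-1}$ at $0$ continues analytically to $H$ with values in $X$, and $W_\theta=\Phi^{-1}(H)$. If $\alpha=-$, then $a_0$ has no zeros on $W_\theta$. 2. The expansions of $a,b,c$ hold with Gevrey bounds along $\bar A_\theta$ with respect to $\sqrt{D_0}$ on $W_\theta$ for every $\theta\in\Theta$, uniformly in $\theta$: there are $\delta,\mathsf A,\mathsf B>0$ such that for all $\theta\in\Theta$ one has $S_\theta(\delta)\subset S$ and, for all $n\ge0$, $x\in W_\theta$ and $\hbar\in S_\theta(\delta)$, $$\Big|a(x,\hbar)-\sum_{k=0}^{n-1}a_k(x)\hbar^k\Big|\le\Big|\sqrt{D_0(x)}\Big|\,\mathsf A\,\mathsf B^n\,n!\,|\hbar|^n,$$ and likewise for $b$ and $c$. Then there are a connected open neighbourhood $U_0\subset X$ of $x_0$ and a sectorial domain $S_0\subset S$ with the same opening $A$ such that $\hat f_\alpha$ exists on $U_0$ and is unique, and such that the Riccati equation has a unique holomorphic solution $f$ on $U_0\times S_0$ which is Gevrey asymptotic to $\hat f_\alpha$ as $\hbar\to0$ along the closed arc $\bar A$ uniformly for $x\in U_0$, i.e. for which there are a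 sectorial domain $T\subset S_0$ with opening $A$ and $\mathsf C,\mathsf M>0$ with $$\Big|f(x,\hbar)-\sum_{k=0}^{n-1}f_k^\alpha(x)\hbar^k\Big|\le\mathsf C\,\mathsf M^n\,n!\,|\hbar|^n\qquad(n\ge0,\ x\in U_0,\ \hbar\in T).$$ Moreover $f$ is glued from the Laplace transforms in the directions $\theta\in\Theta$: for some $\eta>0$ the formal Borel transform $\sum_k\frac1{k!}f^\alpha_{k+1}(x)\xi^k$ converges for $x\in U_0$, $|\xi|<\eta$, and extends to a holomorphic function $\phi$ on $U_0\times\{\xi:\operatorname{dist}(\xi,\Sigma_\Theta)<\eta\}$, $\Sigma_\Theta=\{te^{i\theta}:t\ge0,\theta\in\Theta\}$, with $|\phi(x,\xi)|\le\mathsf Ke^{\mathsf L|\xi|}$ there for some $\mathsf K,\mathsf L>0$; and for some $\delta_0>0$ and every $\theta\in\Theta$ one has $S_\theta(\delta_0)\subset S_0$ and, with an absolutely convergent integral, $f(x,\hbar)=f^\alpha_0(x)+\int_{e^{i\theta}\mathbb R_+}e^{-\xi/\hbar}\phi(x,\xi)\,d\xi$ for all $x\in U_0$, $\hbar\in S_\theta(\delta_0)$.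 -/

import Mathlib

open scoped Topology

noncomputable section

/-! ### Sectorial domains at the origin of the `ħ`-plane -/

/-- The straight sector of radius `R` with directions in the set `I` (of real arguments). -/
def straightSector (I : Set ℝ) (R : ℝ) : Set ℂ :=
  {ħ | ∃ r : ℝ, 0 < r ∧ r < R ∧ ∃ φ ∈ I, ħ = (r : ℂ) * Complex.exp ((φ : ℂ) * Complex.I)}

/-- The Borel disc of diameter `δ` bisected by the direction `θ`. -/
def borelDisc (θ δ : ℝ) : Set ℂ :=
  {ħ | 1 / δ < (Complex.exp ((θ : ℂ) * Complex.I) / ħ).re}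

/-- The directions (unit complex numbers) in which the closure of `S` in the real-oriented blowup
of the plane at the origin meets the boundary circle; a nonzero `ħ` has blowup
coordinates `(‖ħ‖, ħ / ‖ħ‖)`. -/
def limitDirections (S : Set ℂ) : Set ℂ :=
  {u | ((0 : ℝ), u) ∈ closure ((fun ħ : ℂ => (‖ħ‖, ħ / (‖ħ‖ : ℂ))) '' S)}

/-- The arc of copolar directions of the arc `(ϑ₁, ϑ₂)`: the directions `θ` for which the half-plane
arc `(θ - π/2, θ + π/2)` is contained in `(ϑ₁, ϑ₂)`. -/
def copolarArc (ϑ₁ ϑ₂ : ℝ) : Set ℝ :=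
  Set.Icc (ϑ₁ + Real.pi / 2) (ϑ₂ - Real.pi / 2)

/-- `S` is a sectorial domain at the origin with opening the open arc `(ϑ₁, ϑ₂)`, which is given by
real lifts of its end points (`ϑ₁ < ϑ₂ ≤ ϑ₁ + 2π`). The last two fields express that `S` really
fills its opening near the origin: it contains a straight sector over every compact
subarc, and a Borel disc over every half-plane arc inside the opening. -/
structure IsSectorialDomain (S : Set ℂ) (ϑ₁ ϑ₂ : ℝ) : Prop where
  isOpen : IsOpen S
  isSimplyConnected : IsSimplyConnected S
  zero_notMem : (0 : ℂ) ∉ S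
  limitDirections_eq :
    limitDirections S = (fun φ : ℝ => Complex.exp ((φ : ℂ) * Complex.I)) '' Set.Icc ϑ₁ ϑ₂
  exists_straightSector : ∀ φ₁ φ₂ : ℝ, ϑ₁ < φ₁ → φ₁ ≤ φ₂ → φ₂ < ϑ₂ →
    ∃ R > 0, straightSector (Set.Icc φ₁ φ₂) R ⊆ S
  exists_borelDisc : ∀ θ ∈ copolarArc ϑ₁ ϑ₂, ∃ δ > 0, borelDisc θ δ ⊆ S

/-! ### Asymptotics as `ħ → 0`

A formal power series `∑ gₖ(x) ħᵏ` is given by its sequence of coefficients `gₖ : ℂ → ℂ`. -/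

/-- The order `n` remainder of `g` with respect to the series `∑ gₖ(x) ħᵏ`. -/
def remainder (g : ℂ × ℂ → ℂ) (gk : ℕ → ℂ → ℂ) (n : ℕ) (x ħ : ℂ) : ℂ :=
  g (x, ħ) - ∑ k ∈ Finset.range n, gk k x * ħ ^ k

/-- Poincaré asymptotics `g ∼ ∑ gₖ ħᵏ` as `ħ → 0` along the open arc `(ϑ₁, ϑ₂)`, locally uniformly
for `x ∈ X`, for a function `g` on `X × S`. -/
def HasLocUnifAsymptotics (g : ℂ × ℂ → ℂ) (gk : ℕ → ℂ → ℂ) (X S : Set ℂ) (ϑ₁ ϑ₂ : ℝ) : Prop :=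
  ∀ x' ∈ X, ∃ V ∈ 𝓝 x', V ⊆ X ∧ ∀ (n : ℕ) (φ₁ φ₂ : ℝ), ϑ₁ < φ₁ → φ₁ ≤ φ₂ → φ₂ < ϑ₂ →
    ∃ R > 0, ∃ C > 0, straightSector (Set.Icc φ₁ φ₂) R ⊆ S ∧
      ∀ x ∈ V, ∀ ħ ∈ straightSector (Set.Icc φ₁ φ₂) R, ‖remainder g gk n x ħ‖ ≤ C * ‖ħ‖ ^ n

/-- The Gevrey bounds on `V × T` with constants `A`, `B`, with respect to the asymptotic
scale `w`. -/
def HasGevreyBounds (g : ℂ × ℂ → ℂ) (gk : ℕ → ℂ → ℂ) (w : ℂ → ℝ) (V T : Set ℂ) (A B : ℝ) : Prop :=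
  ∀ n : ℕ, ∀ x ∈ V, ∀ ħ ∈ T, ‖remainder g gk n x ħ‖ ≤ w x * (A * B ^ n * (n.factorial : ℝ) * ‖ħ‖ ^ n)

/-- Gevrey asymptotics `g ≃ ∑ gₖ ħᵏ` as `ħ → 0` along the closed arc `[ϑ₁, ϑ₂]`, uniformly
for `x ∈ V`, for a function `g` on `V × S`. -/
def HasUnifGevreyAsymptotics (g : ℂ × ℂ → ℂ) (gk : ℕ → ℂ → ℂ) (V S : Set ℂ) (ϑ₁ ϑ₂ : ℝ) : Prop :=
  ∃ T ⊆ S, IsSectorialDomain T ϑ₁ ϑ₂ ∧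
    ∃ C > 0, ∃ M > 0, HasGevreyBounds g gk (fun _ => 1) V T C M

/-! ### The Riccati equation -/

/-- `f` is a holomorphic solution on `U × S` of `ħ ∂ₓ f = a f² + b f + c`. -/
def IsHolomorphicSolution (a b c f : ℂ × ℂ → ℂ) (U S : Set ℂ) : Prop :=
  DifferentiableOn ℂ f (U ×ˢ S) ∧ ∀ x ∈ U, ∀ ħ ∈ S,
    ħ * deriv (fun y => f (y, ħ)) x = a (x, ħ) * f (x, ħ) ^ 2 + b (x, ħ) * f (x, ħ) + c (x, ħ)

/-- `∑ fₖ(x) ħᵏ` is a formal solution on `U`, with coefficients holomorphic on `U`, of the formal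
Riccati equation with coefficients `∑ aₖ ħᵏ`, `∑ bₖ ħᵏ`, `∑ cₖ ħᵏ`. -/
def IsFormalSolution (ak bk ck fk : ℕ → ℂ → ℂ) (U : Set ℂ) : Prop :=
  (∀ k, DifferentiableOn ℂ (fk k) U) ∧ ∀ x ∈ U,
    (PowerSeries.X * PowerSeries.mk fun k => deriv (fk k) x : PowerSeries ℂ) =
      (PowerSeries.mk fun k => ak k x) * (PowerSeries.mk fun k => fk k x) ^ 2 +
        (PowerSeries.mk fun k => bk k x) * (PowerSeries.mk fun k => fk k x) +
        PowerSeries.mk fun k => ck k x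

/-- The leading-order discriminant `D₀ = b₀² - 4 a₀ c₀`. -/
def leadingDiscriminant (ak bk ck : ℕ → ℂ → ℂ) (x : ℂ) : ℂ :=
  bk 0 x ^ 2 - 4 * ak 0 x * ck 0 x

/-- `∑ fₖ ħᵏ` is the formal solution `f̂_α` on `U`, where `ε = ±1` is the sign `α` and `s` is the
chosen branch of `√D₀`: the formal solution whose leading order `f₀` is
`(-b₀ + ε s) / (2 a₀)`, that is, `ε s = 2 a₀ f₀ + b₀` (which also makes sense where `a₀`
vanishes; if `a₀` and `b₀ - ε s` vanish identically then `f₀ = -c₀ / b₀`). -/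
def IsLabelledFormalSolution (ak bk ck : ℕ → ℂ → ℂ) (s : ℂ → ℂ) (ε : ℝ) (fk : ℕ → ℂ → ℂ)
    (U : Set ℂ) : Prop :=
  IsFormalSolution ak bk ck fk U ∧ ∀ x ∈ U, 2 * ak 0 x * fk 0 x + bk 0 x = (ε : ℂ) * s x

/-! ### WKB geometry -/

/-- The Liouville transformation `Φ(x) = ∫ s(t) dt` from `x₀` to `x`, near `x₀` (the integral is
taken along the straight segment). -/
def liouville (s : ℂ → ℂ) (x₀ x : ℂ) : ℂ :=
  ∫ t in (0 : ℝ)..1, s (x₀ + (t : ℂ) * (x - x₀)) * (x - x₀)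

/-- The halfstrip of points at distance less than `r` from the
ray `z₁ + ε e^{iθ} [0, ∞)` (`ε = ±1`). -/
def halfstrip (z₁ : ℂ) (r θ ε : ℝ) : Set ℂ :=
  Metric.thickening r
    {z | ∃ t : ℝ, 0 ≤ t ∧ z = z₁ + (ε : ℂ) * (t : ℂ) * Complex.exp ((θ : ℂ) * Complex.I)}

/-- `W ⊆ X` is a WKB `(θ, ε)`-halfstrip domain containing `x₀`: it is the image `Φ⁻¹(H)` of a
halfstrip `H` that contains `0 = Φ(x₀)`, where `Φ⁻¹` is the analytic continuation
to `H`, with values in `X`, of the inverse of the Liouville transformation near `x₀`. -/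
def IsWKBHalfstrip (X : Set ℂ) (s : ℂ → ℂ) (x₀ : ℂ) (θ ε : ℝ) (W : Set ℂ) : Prop :=
  ∃ (z₁ : ℂ) (r : ℝ) (ψ : ℂ → ℂ), 0 < r ∧ (0 : ℂ) ∈ halfstrip z₁ r θ ε ∧
    DifferentiableOn ℂ ψ (halfstrip z₁ r θ ε) ∧ Set.MapsTo ψ (halfstrip z₁ r θ ε) X ∧
    (∀ᶠ x in 𝓝 x₀, ψ (liouville s x₀ x) = x) ∧ W = ψ '' halfstrip z₁ r θ ε

/-! ### Laplace transforms -/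

/-- The closed infinite sector of the Borel plane with directions in `Θ` and vertex `0`. -/
def infiniteSector (Θ : Set ℝ) : Set ℂ :=
  {ξ | ∃ t : ℝ, 0 ≤ t ∧ ∃ θ ∈ Θ, ξ = (t : ℂ) * Complex.exp ((θ : ℂ) * Complex.I)}

/-- The integrand, on the ray `ξ = t e^{iθ}`, of the Laplace transform in the direction `θ`. -/
def laplaceIntegrand (φ : ℂ × ℂ → ℂ) (θ : ℝ) (x ħ : ℂ) (t : ℝ) : ℂ :=
  Complex.exp (-((t : ℂ) * Complex.exp ((θ : ℂ) * Complex.I)) / ħ) *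
    φ (x, (t : ℂ) * Complex.exp ((θ : ℂ) * Complex.I)) * Complex.exp ((θ : ℂ) * Complex.I)

/-- `f` on `U × S` is glued from Laplace transforms in the directions `θ ∈ Θ`: the formal Borel
transform `∑ fₖ₊₁(x) ξᵏ / k!` continues to a holomorphic function `φ`, of uniformly
at most exponential growth, on the product of `U` with a neighbourhood of constant thickness of
the sector of directions `Θ`, and on Borel discs of a common diameter bisected
by `θ` one has `f = f₀ + 𝔏_θ[φ]`, for every `θ ∈ Θ`. -/
def IsGluedFromLaplace (f : ℂ × ℂ → ℂ) (fk : ℕ → ℂ → ℂ) (U S : Set ℂ) (Θ : Set ℝ) : Prop :=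
  ∃ (φ : ℂ × ℂ → ℂ) (η δ K L : ℝ), 0 < η ∧ 0 < δ ∧ 0 < K ∧ 0 < L ∧
    DifferentiableOn ℂ φ (U ×ˢ Metric.thickening η (infiniteSector Θ)) ∧
    (∀ x ∈ U, ∀ ξ ∈ Metric.thickening η (infiniteSector Θ),
      ‖φ (x, ξ)‖ ≤ K * Real.exp (L * ‖ξ‖)) ∧
    (∀ x ∈ U, ∀ ξ : ℂ, ‖ξ‖ < η →
      HasSum (fun k : ℕ => fk (k + 1) x / (k.factorial : ℂ) * ξ ^ k) (φ (x, ξ))) ∧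
    ∀ θ ∈ Θ, borelDisc θ δ ⊆ S ∧ ∀ x ∈ U, ∀ ħ ∈ borelDisc θ δ,
      MeasureTheory.IntegrableOn (laplaceIntegrand φ θ x ħ) (Set.Ioi 0) ∧
      f (x, ħ) = fk 0 x + ∫ t in Set.Ioi (0 : ℝ), laplaceIntegrand φ θ x ħ t

end

noncomputable section

/-! ### Holomorphic dependence on parameters -/

/-! The Riccati equation is linearised: f = w₁/w₂ for solutions w of ħw' = Aw with the trace-free
matrix A of `companionOp`. In the Liouville coordinate z = Φ(x) its leading part has eigenvalues
±1/2. Since |Ψ'|·√|D₀| = 1 for Ψ = Φ⁻¹, the Gevrey bounds relative to √D₀ turn into uniform bounds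
along the whole halfstrips. The leading-order solution is the slope of the range of the spectral
projector P for the eigenvalue -ε/2, and an exact solution is the slope of the range of an invariant
projector P + N. Far out in a halfstrip the slope may have poles, whereas the projectors stay
bounded.

The correction satisfies N' = (ε/ħ)N + (terms of degree at most two in N, with bounded
coefficients). Integrating from infinity along rays of direction εe^{iθ} is damped when ħ lies in a
Borel disc bisected by θ, and is a contraction when the disc is small (`exists_nonlinear_solution`).
A small solution is unique; the same kind of estimate forces PN = 0 and N(1 - P) = 0, which makes P
+ N a projector (`exists_projector`).

Uniqueness also glues the directions. The halfstrips of all intermediate directions cover the cone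
between two directions at most π/2 apart, so N can be solved for on that cone and agrees with the
corrections of both boundary directions. As Θ has length at most π, its end points and midpoint
suffice (`exists_glued_projectorCorrection`), and discs of half the diameter in the other copolar
directions lie in the three discs obtained.

The result is a solution near x₀ that is close to f₀ for small ħ (`exists_local_riccati_solution`).
Its Gevrey expansion is then automatic: the normalized remainders ρₙ = (f - ∑_{k<n} fₖħᵏ)/ħⁿ satisfy
(a₀(f + f₀) + b₀)ρₙ₊₁ = ρₙ' - (lower order), where the factor on the left is close to ε√D₀. The loss
of one derivative per step is paid for by weights that blow up at the boundary of a disc, and this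
produces exactly the factor n! (`hasGevreyBounds_of_bounded`).

Nevanlinna's theorem converts Gevrey bounds on a Borel disc into a Laplace representation whose
integrand continues the formal Borel transform to a strip. The continuations for different
directions have the same germ at 0 and hence glue (`isGluedFromLaplace_of_gevrey`). Applied to a
difference of two solutions, whose expansion vanishes, the same theorem yields uniqueness
(`GevreyHalfPlane.eq_zero`). -/

theorem differentiableOn_integral_of_dominated {α E : Type*} [MeasurableSpace α]
    {μ : MeasureTheory.Measure α} [NormedAddCommGroup E] [NormedSpace ℂ E] [CompleteSpace E]
    {F : ℂ → α → E} {U : Set ℂ} (hU : IsOpen U) {bound : α → ℝ}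
    (hmeas : ∀ z ∈ U, MeasureTheory.AEStronglyMeasurable (F z) μ)
    (hd : ∀ᵐ a ∂μ, DifferentiableOn ℂ (fun z => F z a) U)
    (hb : ∀ᵐ a ∂μ, ∀ z ∈ U, ‖F z a‖ ≤ bound a) (hi : MeasureTheory.Integrable bound μ) :
    DifferentiableOn ℂ (fun z => ∫ a, F z a ∂μ) U := by
  intro z₀ hz₀
  obtain ⟨r, hr, hrU⟩ := Metric.isOpen_iff.1 hU z₀ hz₀
  have hr2 : 0 < r / 2 := by positivity
  have hsub : ∀ z ∈ Metric.ball z₀ (r / 2), Metric.closedBall z (r / 2) ⊆ Metric.ball z₀ r := by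
    intro z hz w hw
    rw [Metric.mem_ball] at *
    rw [Metric.mem_closedBall] at hw
    calc dist w z₀ ≤ dist w z + dist z z₀ := dist_triangle _ _ _
      _ < r := by linarith
  have hder : ∀ᵐ a ∂μ, ∀ z ∈ Metric.ball z₀ (r / 2),
      HasDerivAt (fun z => F z a) (deriv (fun z => F z a) z) z := by
    filter_upwards [hd] with a ha z hz
    have hzU : z ∈ U := hrU (hsub z hz (Metric.mem_closedBall_self hr2.le))
    exact ((ha z hzU).differentiableAt (hU.mem_nhds hzU)).hasDerivAt
  -- No bound on the derivative is assumed: Cauchy's estimate on circles of radius r/2 provides the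
  -- dominating function bound/(r/2).
  have key := hasDerivAt_integral_of_dominated_loc_of_deriv_le (μ := μ) (F := F) (x₀ := z₀)
    (F' := fun z a => deriv (fun z => F z a) z) (bound := fun a => bound a / (r / 2))
    (Metric.ball_mem_nhds z₀ hr2)
    (by filter_upwards [hU.mem_nhds hz₀] with z hz using hmeas z hz)
    ((hi.mono' (hmeas z₀ hz₀)) (by filter_upwards [hb] with a ha using ha z₀ hz₀))
    ?_ ?_ (hi.div_const _) hder
  · exact key.2.differentiableAt.differentiableWithinAt
  -- The derivative at z₀ is measurable in the integration variable as a limit of difference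
  -- quotients along a sequence of increments smaller than r.
  · have hlim : Filter.Tendsto (fun n : ℕ => ((r / 2 * (1 / ((n : ℝ) + 1)) / 2 : ℝ) : ℂ))
        Filter.atTop (𝓝[≠] 0) := by
      refine tendsto_nhdsWithin_iff.2 ⟨?_, Filter.Eventually.of_forall fun n => ?_⟩
      · have := ((tendsto_one_div_add_atTop_nhds_zero_nat (𝕜 := ℝ)).const_mul (r / 2)).div_const 2
        have h2 := (Complex.continuous_ofReal.tendsto _).comp this
        simpa [Function.comp_def] using h2
      · have : (r / 2 * (1 / ((n : ℝ) + 1)) / 2 : ℝ) ≠ 0 := by positivity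
        exact Complex.ofReal_ne_zero.2 this
    have hmem : ∀ n : ℕ, z₀ + ((r / 2 * (1 / ((n : ℝ) + 1)) / 2 : ℝ) : ℂ) ∈ U := by
      intro n
      apply hrU
      rw [Metric.mem_ball, dist_eq_norm, add_sub_cancel_left, Complex.norm_real, Real.norm_eq_abs,
        abs_of_pos (by positivity)]
      have : 1 / ((n : ℝ) + 1) ≤ 1 := by
        rw [div_le_one (by positivity)]; linarith [(Nat.cast_nonneg n : (0 : ℝ) ≤ n)]
      nlinarith
    refine aestronglyMeasurable_of_tendsto_ae Filter.atTop
      (f := fun (n : ℕ) a => ((r / 2 * (1 / ((n : ℝ) + 1)) / 2 : ℝ) : ℂ)⁻¹ •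
        (F (z₀ + ((r / 2 * (1 / ((n : ℝ) + 1)) / 2 : ℝ) : ℂ)) a - F z₀ a))
      (fun n => ((hmeas _ (hmem n)).sub (hmeas z₀ hz₀)).const_smul _) ?_
    filter_upwards [hder] with a ha
    exact ((ha z₀ (Metric.mem_ball_self hr2)).tendsto_slope_zero).comp hlim
  · filter_upwards [hb, hd] with a ha hda z hz
    refine Complex.norm_deriv_le_of_forall_mem_sphere_norm_le hr2 ?_ ?_
    · refine DifferentiableOn.diffContOnCl ?_
      rw [closure_ball _ hr2.ne']
      exact hda.mono ((hsub z hz).trans hrU)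
    · intro w hw
      exact ha w (hrU (hsub z hz (Metric.sphere_subset_closedBall hw)))

/-- A bounded function on `ball z R` that is holomorphic there varies at most by the Cauchy bound. -/
theorem norm_sub_le_of_ball {E : Type*} [NormedAddCommGroup E] [NormedSpace ℂ E] [CompleteSpace E]
    {f : ℂ → E} {z : ℂ} {R C : ℝ} (hR : 0 < R) (hd : DifferentiableOn ℂ f (Metric.ball z (2 * R)))
    (hC : ∀ w ∈ Metric.ball z (2 * R), ‖f w‖ ≤ C) {x y : ℂ} (hx : x ∈ Metric.ball z R)
    (hy : y ∈ Metric.ball z R) : ‖f x - f y‖ ≤ 2 * C / R * ‖x - y‖ := by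
  have hsub : ∀ w ∈ Metric.ball z R, Metric.closedBall w (R / 2) ⊆ Metric.ball z (2 * R) := by
    intro w hw v hv
    rw [Metric.mem_ball] at *
    rw [Metric.mem_closedBall] at hv
    linarith [dist_triangle v w z]
  refine Convex.norm_image_sub_le_of_norm_deriv_le (s := Metric.ball z R) (fun w hw => ?_)
    (fun w hw => ?_) (convex_ball z R) hy hx
  · refine (hd w ?_).differentiableAt (Metric.isOpen_ball.mem_nhds ?_) <;>
    exact hsub w hw (Metric.mem_closedBall_self (by positivity))
  · have : ‖deriv f w‖ ≤ C / (R / 2) := by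
      refine Complex.norm_deriv_le_of_forall_mem_sphere_norm_le (by positivity) ?_ ?_
      · refine DifferentiableOn.diffContOnCl ?_
        rw [closure_ball _ (by positivity)]
        exact hd.mono (hsub w hw)
      · intro v hv
        exact hC v (hsub w hw (Metric.sphere_subset_closedBall hv))
    calc ‖deriv f w‖ ≤ C / (R / 2) := this
      _ = 2 * C / R := by field_simp

/-- The function f(·, y) - f(·, y₀) is of size O(|y - y₀|) by boundedness and holomorphy in y;
Cauchy's estimate in x passes this to the derivatives, and continuity in x is known at y₀. -/
theorem continuousAt_deriv_fst_of_separately {f : ℂ → ℂ → ℂ} {x₀ y₀ : ℂ} {R C : ℝ} (hR : 0 < R)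
    (h1 : ∀ y ∈ Metric.ball y₀ (2 * R), DifferentiableOn ℂ (fun x => f x y) (Metric.ball x₀ (2 * R)))
    (h2 : ∀ x ∈ Metric.ball x₀ (2 * R), DifferentiableOn ℂ (fun y => f x y) (Metric.ball y₀ (2 * R)))
    (hC : ∀ x ∈ Metric.ball x₀ (2 * R), ∀ y ∈ Metric.ball y₀ (2 * R), ‖f x y‖ ≤ C) :
    ContinuousAt (fun p : ℂ × ℂ => deriv (fun x => f x p.2) p.1) (x₀, y₀) := by
  have hy₀ : y₀ ∈ Metric.ball y₀ R := Metric.mem_ball_self hR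
  have hy₀' : y₀ ∈ Metric.ball y₀ (2 * R) := Metric.mem_ball_self (by positivity)
  have hsub : ∀ w ∈ Metric.ball x₀ R, Metric.closedBall w (R / 2) ⊆ Metric.ball x₀ (2 * R) := by
    intro w hw v hv
    rw [Metric.mem_ball] at *
    rw [Metric.mem_closedBall] at hv
    linarith [dist_triangle v w x₀]
  have hself : ∀ w ∈ Metric.ball x₀ R, w ∈ Metric.ball x₀ (2 * R) := fun w hw =>
    hsub w hw (Metric.mem_closedBall_self (by positivity))
  have hRR : Metric.ball y₀ R ⊆ Metric.ball y₀ (2 * R) := Metric.ball_subset_ball (by linarith)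
  have hdiff : ∀ x ∈ Metric.ball x₀ R, ∀ y ∈ Metric.ball y₀ R,
      ‖deriv (fun x => f x y) x - deriv (fun x => f x y₀) x‖ ≤
        (2 * C / R * ‖y - y₀‖) / (R / 2) := by
    intro x hx y hy
    have hAt : ∀ y ∈ Metric.ball y₀ (2 * R), DifferentiableAt ℂ (fun x => f x y) x := fun y hy =>
      (h1 y hy x (hself x hx)).differentiableAt (Metric.isOpen_ball.mem_nhds (hself x hx))
    rw [← deriv_fun_sub (hAt y (hRR hy)) (hAt y₀ hy₀')]
    refine Complex.norm_deriv_le_of_forall_mem_sphere_norm_le (by positivity) ?_ ?_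
    · refine DifferentiableOn.diffContOnCl ?_
      rw [closure_ball _ (by positivity)]
      exact ((h1 y (hRR hy)).fun_sub (h1 y₀ hy₀')).mono (hsub x hx)
    · intro v hv
      have hv' := hsub x hx (Metric.sphere_subset_closedBall hv)
      exact norm_sub_le_of_ball hR (h2 v hv') (fun w hw => hC v hv' w hw) hy hy₀
  have hcont : ContinuousAt (deriv fun x => f x y₀) x₀ :=
    ((h1 y₀ hy₀').deriv Metric.isOpen_ball).continuousOn.continuousAt
      (Metric.isOpen_ball.mem_nhds (Metric.mem_ball_self (by positivity)))
  have hA : Filter.Tendsto (fun p : ℂ × ℂ => deriv (fun x => f x y₀) p.1) (𝓝 (x₀, y₀))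
      (𝓝 (deriv (fun x => f x y₀) x₀)) :=
    Filter.Tendsto.comp (f := Prod.fst) hcont continuousAt_fst
  have hB : Filter.Tendsto (fun p : ℂ × ℂ => deriv (fun x => f x p.2) p.1 -
      deriv (fun x => f x y₀) p.1) (𝓝 (x₀, y₀)) (𝓝 0) := by
    refine squeeze_zero_norm' (a := fun p : ℂ × ℂ => (2 * C / R * ‖p.2 - y₀‖) / (R / 2)) ?_ ?_
    · have : Metric.ball x₀ R ×ˢ Metric.ball y₀ R ∈ 𝓝 (x₀, y₀) :=
        prod_mem_nhds (Metric.ball_mem_nhds _ hR) (Metric.ball_mem_nhds _ hR)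
      filter_upwards [this] with p hp using hdiff p.1 hp.1 p.2 hp.2
    · have : Continuous fun p : ℂ × ℂ => (2 * C / R * ‖p.2 - y₀‖) / (R / 2) := by fun_prop
      simpa using this.tendsto (x₀, y₀)
  simpa [ContinuousAt] using hB.add hA

/-- A bounded separately holomorphic function of two variables is holomorphic. -/
theorem differentiableOn_prod_of_separately {f : ℂ × ℂ → ℂ} {U V : Set ℂ} (hU : IsOpen U)
    (hV : IsOpen V) (h1 : ∀ y ∈ V, DifferentiableOn ℂ (fun x => f (x, y)) U)
    (h2 : ∀ x ∈ U, DifferentiableOn ℂ (fun y => f (x, y)) V)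
    (hC : ∀ x ∈ U, ∀ y ∈ V, ∃ U' ∈ 𝓝 x, ∃ V' ∈ 𝓝 y, ∃ C, ∀ x' ∈ U', ∀ y' ∈ V', ‖f (x', y')‖ ≤ C) :
    DifferentiableOn ℂ f (U ×ˢ V) := by
  rintro ⟨x₀, y₀⟩ ⟨hx₀, hy₀⟩
  obtain ⟨U', hU', V', hV', C, hC⟩ := hC x₀ hx₀ y₀ hy₀
  obtain ⟨r₁, hr₁, hr₁U⟩ := Metric.mem_nhds_iff.1 (Filter.inter_mem (hU.mem_nhds hx₀) hU')
  obtain ⟨r₂, hr₂, hr₂V⟩ := Metric.mem_nhds_iff.1 (Filter.inter_mem (hV.mem_nhds hy₀) hV')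
  obtain ⟨R, hR, hR1, hR2⟩ : ∃ R > 0, 2 * R ≤ r₁ ∧ 2 * R ≤ r₂ :=
    ⟨min r₁ r₂ / 2, by positivity, by linarith [min_le_left r₁ r₂], by linarith [min_le_right r₁ r₂]⟩
  have hUb : Metric.ball x₀ (2 * R) ⊆ U ∩ U' := (Metric.ball_subset_ball hR1).trans hr₁U
  have hVb : Metric.ball y₀ (2 * R) ⊆ V ∩ V' := (Metric.ball_subset_ball hR2).trans hr₂V
  have c1 := continuousAt_deriv_fst_of_separately (f := fun x y => f (x, y)) hR
    (fun y hy => (h1 y (hVb hy).1).mono fun x hx => (hUb hx).1)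
    (fun x hx => (h2 x (hUb hx).1).mono fun y hy => (hVb hy).1)
    (fun x hx y hy => hC x (hUb hx).2 y (hVb hy).2)
  have c2 := continuousAt_deriv_fst_of_separately (f := fun y x => f (x, y)) hR
    (fun x hx => (h2 x (hUb hx).1).mono fun y hy => (hVb hy).1)
    (fun y hy => (h1 y (hVb hy).1).mono fun x hx => (hUb hx).1)
    (fun y hy x hx => hC x (hUb hx).2 y (hVb hy).2)
  have c2' : ContinuousAt (fun p : ℂ × ℂ => deriv (fun y => f (p.1, y)) p.2) (x₀, y₀) :=
    ContinuousAt.comp (f := Prod.swap) (x := (x₀, y₀)) c2 continuous_swap.continuousAt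
  have hnear : U ×ˢ V ∈ 𝓝 (x₀, y₀) := prod_mem_nhds (hU.mem_nhds hx₀) (hV.mem_nhds hy₀)
  -- Both partial derivatives are jointly continuous, which gives total differentiability.
  have key := hasStrictFDerivAt_uncurry_coprod (𝕜 := ℂ) (u := (x₀, y₀)) (f := fun x y => f (x, y))
    (f₁ := fun x y => ContinuousLinearMap.toSpanSingleton ℂ (deriv (fun x => f (x, y)) x))
    (f₂ := fun x y => ContinuousLinearMap.toSpanSingleton ℂ (deriv (fun y => f (x, y)) y))
    (by
      filter_upwards [hnear] with p hp
      exact ((h1 p.2 hp.2 p.1 hp.1).differentiableAt (hU.mem_nhds hp.1)).hasDerivAt.hasFDerivAt)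
    (by
      filter_upwards [hnear] with p hp
      exact ((h2 p.1 hp.1 p.2 hp.2).differentiableAt (hV.mem_nhds hp.2)).hasDerivAt.hasFDerivAt)
    ((ContinuousLinearMap.toSpanSingletonCLE (𝕜 := ℂ) (E := ℂ)).continuous.continuousAt.comp c1)
    ((ContinuousLinearMap.toSpanSingletonCLE (𝕜 := ℂ) (E := ℂ)).continuous.continuousAt.comp c2')
  exact key.hasFDerivAt.differentiableAt.differentiableWithinAt

end

noncomputable section

/-! ### Inverse Laplace transforms -/

/-- The point at height `2πy` on the vertical line with abscissa `c`. -/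
def vline (c y : ℝ) : ℂ := (c : ℂ) + 2 * Real.pi * y * Complex.I

/-- The inverse Laplace transform (Bromwich integral) of `h` along the line of abscissa `c`. -/
def bromwich (h : ℂ → ℂ) (c t : ℝ) : ℂ :=
  ∫ y : ℝ, Complex.exp (vline c y * t) * h (vline c y)

@[simp] theorem vline_re (c y : ℝ) : (vline c y).re = c := by simp [vline]

@[simp] theorem vline_im (c y : ℝ) : (vline c y).im = 2 * Real.pi * y := by simp [vline]

theorem continuous_vline (c : ℝ) : Continuous (vline c) := by unfold vline; fun_prop

theorem norm_exp_vline (c y t : ℝ) : ‖Complex.exp (vline c y * t)‖ = Real.exp (c * t) := by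
  rw [Complex.norm_exp, Complex.re_mul_ofReal, vline_re]

theorem one_div_norm_vline_sq_le {c : ℝ} (hc : 0 < c) (y : ℝ) :
    1 / ‖vline c y‖ ^ 2 ≤ 1 / min (c ^ 2) 1 * (1 + y ^ 2)⁻¹ := by
  have hm : 0 < min (c ^ 2) 1 := lt_min (by positivity) one_pos
  rw [← one_div (1 + y ^ 2), div_mul_div_comm, one_mul]
  refine one_div_le_one_div_of_le (by positivity) ?_
  rw [← Complex.normSq_eq_norm_sq, Complex.normSq_apply, vline_re, vline_im]
  have h1 := min_le_left (c ^ 2) 1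
  have h2 := min_le_right (c ^ 2) 1
  have h3 : (1 : ℝ) ≤ 2 * Real.pi := by linarith [Real.pi_gt_three]
  have h4 : (1 : ℝ) ≤ (2 * Real.pi) * (2 * Real.pi) := by nlinarith
  nlinarith [sq_nonneg y, mul_le_mul_of_nonneg_right h2 (sq_nonneg y),
    mul_le_mul_of_nonneg_right h4 (sq_nonneg y)]

theorem integrable_one_div_norm_vline_sq {c : ℝ} (hc : 0 < c) :
    MeasureTheory.Integrable fun y => 1 / ‖vline c y‖ ^ 2 := by
  refine (integrable_inv_one_add_sq.const_mul (1 / min (c ^ 2) 1)).mono' ?_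
    (Filter.Eventually.of_forall fun y => ?_)
  · refine Continuous.aestronglyMeasurable ?_
    refine continuous_const.div ((continuous_vline c).norm.pow 2) fun y h => ?_
    have : vline c y = 0 := by simpa using h
    have := congrArg Complex.re this
    simp at this
    exact hc.ne' this
  · rw [Real.norm_of_nonneg (by positivity)]
    exact one_div_norm_vline_sq_le hc y

/-- Functions that are holomorphic and `O(|w|⁻²)` on a right half-plane. -/
structure HalfPlaneDecay (h : ℂ → ℂ) (R K : ℝ) : Prop where
  nonneg : 0 ≤ R
  diff : DifferentiableOn ℂ h {w | R < w.re}
  bound : ∀ w : ℂ, R < w.re → ‖h w‖ ≤ K * (1 / ‖w‖ ^ 2)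

namespace HalfPlaneDecay

variable {h : ℂ → ℂ} {R K : ℝ}

theorem continuous_comp_vline (hh : HalfPlaneDecay h R K) {c : ℝ} (hc : R < c) :
    Continuous fun y => h (vline c y) := by
  refine ContinuousOn.comp_continuous hh.diff.continuousOn (continuous_vline c) fun y => ?_
  simpa using hc

theorem integrable_comp_vline (hh : HalfPlaneDecay h R K) {c : ℝ} (hc : R < c) :
    MeasureTheory.Integrable fun y => h (vline c y) := by
  refine ((integrable_one_div_norm_vline_sq (hh.nonneg.trans_lt hc)).const_mul K).mono'
    (hh.continuous_comp_vline hc).aestronglyMeasurable (Filter.Eventually.of_forall fun y => ?_)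
  exact hh.bound _ (by simpa using hc)

theorem nonneg_const (hh : HalfPlaneDecay h R K) : 0 ≤ K := by
  have := (norm_nonneg _).trans (hh.bound ((R + 1 : ℝ) : ℂ) (by simp))
  have h2 : 0 < 1 / ‖((R + 1 : ℝ) : ℂ)‖ ^ 2 := by
    have : (0 : ℝ) < R + 1 := by linarith [hh.nonneg]
    have : ((R + 1 : ℝ) : ℂ) ≠ 0 := by exact_mod_cast this.ne'
    positivity
  exact nonneg_of_mul_nonneg_left this h2

theorem norm_bromwich_le (hh : HalfPlaneDecay h R K) {c : ℝ} (hc : R < c) (t : ℝ) :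
    ‖bromwich h c t‖ ≤ Real.exp (c * t) * (K * (∫ y : ℝ, 1 / ‖vline c y‖ ^ 2)) := by
  rw [← MeasureTheory.integral_const_mul, ← MeasureTheory.integral_const_mul]
  refine MeasureTheory.norm_integral_le_of_norm_le ?_ (Filter.Eventually.of_forall fun y => ?_)
  · exact ((integrable_one_div_norm_vline_sq (hh.nonneg.trans_lt hc)).const_mul K).const_mul _
  · rw [norm_mul, norm_exp_vline]
    gcongr
    exact hh.bound _ (by simpa using hc)

theorem integrable_bromwich (hh : HalfPlaneDecay h R K) {c : ℝ} (hc : R < c) (t : ℝ) :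
    MeasureTheory.Integrable fun y => Complex.exp (vline c y * t) * h (vline c y) := by
  refine (hh.integrable_comp_vline hc).bdd_mul (c := Real.exp (c * t)) ?_
    (Filter.Eventually.of_forall fun y => (norm_exp_vline c y t).le)
  have := continuous_vline c
  exact (by fun_prop : Continuous fun y => Complex.exp (vline c y * t)).aestronglyMeasurable

theorem continuous_bromwich (hh : HalfPlaneDecay h R K) {c : ℝ} (hc : R < c) :
    Continuous (bromwich h c) := by
  refine continuous_iff_continuousAt.2 fun t₀ => ?_
  refine MeasureTheory.continuousAt_of_dominated
    (bound := fun y => Real.exp (|c| * (|t₀| + 1)) * ‖h (vline c y)‖) ?_ ?_ ?_ ?_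
  · exact Filter.Eventually.of_forall fun t => (hh.integrable_bromwich hc t).aestronglyMeasurable
  · filter_upwards [Metric.ball_mem_nhds t₀ one_pos] with t ht
    refine Filter.Eventually.of_forall fun y => ?_
    rw [norm_mul, norm_exp_vline]
    refine mul_le_mul_of_nonneg_right (Real.exp_le_exp.2 ?_) (norm_nonneg _)
    rw [Metric.mem_ball, Real.dist_eq] at ht
    have : |t| ≤ |t₀| + 1 := by
      have := abs_add_le (t - t₀) t₀
      simp at this
      linarith
    calc c * t ≤ |c * t| := le_abs_self _
      _ = |c| * |t| := abs_mul _ _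
      _ ≤ _ := by gcongr
  · exact (hh.integrable_comp_vline hc).norm.const_mul _
  · refine Filter.Eventually.of_forall fun y => ?_
    exact Continuous.continuousAt (by fun_prop)

/-- This replaces the shift of contour. As a function of a complex abscissa ζ the integral is
holomorphic near the real points, and it is invariant under imaginary translations of ζ, because
these only translate y. So its complex derivative vanishes. -/
theorem bromwich_eq (hh : HalfPlaneDecay h R K) {c c' : ℝ} (hc : R < c) (hc' : R < c') (t : ℝ) :
    bromwich h c t = bromwich h c' t := by
  set A : ℂ → ℂ := fun ζ => ∫ y : ℝ, Complex.exp ((ζ + vline 0 y) * t) * h (ζ + vline 0 y) with hA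
  have hv : ∀ c y, vline c y = (c : ℂ) + vline 0 y := fun c y => by simp [vline]
  have hAb : ∀ c : ℝ, bromwich h c t = A c := fun c => by
    simp only [hA, bromwich]
    congr 1
    ext y
    rw [hv c y]
  have htrans : ∀ (ζ : ℂ) (s : ℝ), A (ζ + s * Complex.I) = A ζ := by
    intro ζ s
    simp only [hA]
    rw [← MeasureTheory.integral_add_right_eq_self _ (-(s / (2 * Real.pi)))]
    congr 1
    ext y
    have : ζ + s * Complex.I + vline 0 (y + -(s / (2 * Real.pi))) = ζ + vline 0 y := by
      have hpi : (Real.pi : ℂ) ≠ 0 := by exact_mod_cast Real.pi_ne_zero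
      simp only [vline]
      push_cast
      field_simp
      ring
    rw [this]
  have hdiff : ∀ c : ℝ, R < c → DifferentiableAt ℂ A c := by
    intro c hc
    have hc0 : 0 < c := hh.nonneg.trans_lt hc
    -- The radius c - R keeps the shifted line in the half-plane; the radius c/2 keeps ‖z + vline 0
    -- y‖ ≥ ‖vline c y‖/2, whence the factor 4 in the majorant.
    set r := min (c / 2) (c - R) with hr
    have hr0 : 0 < r := lt_min (by linarith) (by linarith)
    have hre : ∀ z ∈ Metric.ball (c : ℂ) r, |z.re - c| < r := by
      intro z hz
      rw [Metric.mem_ball, dist_eq_norm] at hz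
      have := Complex.abs_re_le_norm (z - c)
      simp only [Complex.sub_re, Complex.ofReal_re] at this
      linarith
    have hpos : ∀ z ∈ Metric.ball (c : ℂ) r, ∀ y, R < (z + vline 0 y).re := by
      intro z hz y
      have := abs_lt.1 (hre z hz)
      simp
      linarith [min_le_right (c / 2) (c - R)]
    have hD : DifferentiableOn ℂ A (Metric.ball (c : ℂ) r) := by
      refine differentiableOn_integral_of_dominated Metric.isOpen_ball
        (bound := fun y => Real.exp (2 * c * |t|) * (K * (4 * (1 / ‖vline c y‖ ^ 2)))) ?_ ?_ ?_ ?_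
      · intro z hz
        refine Continuous.aestronglyMeasurable (Continuous.mul ?_ ?_)
        · have := continuous_vline 0
          fun_prop
        · refine ContinuousOn.comp_continuous hh.diff.continuousOn ?_ fun y => hpos z hz y
          have := continuous_vline 0
          fun_prop
      · refine Filter.Eventually.of_forall fun y => ?_
        refine DifferentiableOn.mul (by fun_prop) ?_
        refine hh.diff.comp (by fun_prop) fun z hz => hpos z hz y
      · refine Filter.Eventually.of_forall fun y z hz => ?_
        rw [norm_mul]
        have hK := hh.nonneg_const
        gcongr
        · rw [Complex.norm_exp, Complex.re_mul_ofReal]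
          refine Real.exp_le_exp.2 ?_
          have hz' := abs_lt.1 (hre z hz)
          have hle := min_le_left (c / 2) (c - R)
          have h1 : 0 ≤ (z + vline 0 y).re := by simp; linarith
          have h2 : (z + vline 0 y).re ≤ 2 * c := by simp; linarith
          calc (z + vline 0 y).re * t ≤ (z + vline 0 y).re * |t| := by
                gcongr; exact le_abs_self t
            _ ≤ _ := by gcongr
        · refine (hh.bound _ (hpos z hz y)).trans ?_
          gcongr
          have hn : ‖vline c y‖ / 2 ≤ ‖z + vline 0 y‖ := by
            have e1 : vline c y = (z + vline 0 y) - (z - c) := by rw [hv c y]; ring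
            have e2 : ‖vline c y‖ ≤ ‖z + vline 0 y‖ + ‖z - c‖ := by
              conv_lhs => rw [e1]
              exact norm_sub_le _ _
            have e3 : ‖z - c‖ < r := by rw [← dist_eq_norm]; exact hz
            have e4 : c ≤ ‖vline c y‖ := by
              have := Complex.re_le_norm (vline c y)
              simpa using this
            linarith [min_le_left (c / 2) (c - R)]
          have hpos' : 0 < ‖vline c y‖ := by
            have := Complex.re_le_norm (vline c y)
            simp at this; linarith
          calc 1 / ‖z + vline 0 y‖ ^ 2 ≤ 1 / (‖vline c y‖ / 2) ^ 2 := by gcongr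
            _ = 4 * (1 / ‖vline c y‖ ^ 2) := by field_simp; norm_num
      · exact (((integrable_one_div_norm_vline_sq hc0).const_mul 4).const_mul K).const_mul _
    exact hD.differentiableAt (Metric.ball_mem_nhds _ hr0)
  have hderiv : ∀ c : ℝ, R < c → HasDerivAt (fun x : ℝ => A x) 0 c := by
    intro c hc
    have h1 := (hdiff c hc).hasDerivAt
    have h2 : HasDerivAt (fun s : ℝ => A ((c : ℂ) + s * Complex.I)) (deriv A c * Complex.I) 0 := by
      have h3 : HasDerivAt (fun s : ℝ => (c : ℂ) + s * Complex.I) Complex.I 0 := by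
        simpa using ((Complex.ofRealCLM.hasDerivAt (x := (0 : ℝ))).mul_const Complex.I).const_add
          (c : ℂ)
      have h1' : HasDerivAt A (deriv A c) ((c : ℂ) + (0 : ℝ) * Complex.I) := by simpa using h1
      exact h1'.comp (0 : ℝ) h3
    have h4 : deriv A c * Complex.I = 0 := by
      have h5 : (fun s : ℝ => A ((c : ℂ) + s * Complex.I)) = fun _ => A c := by
        ext s; exact htrans c s
      rw [h5] at h2
      exact h2.unique (hasDerivAt_const _ _)
    have h6 : deriv A c = 0 := by simpa using h4
    rw [h6] at h1
    exact h1.comp_ofReal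
  rw [hAb, hAb]
  exact isOpen_Ioi.is_const_of_deriv_eq_zero (f := fun x : ℝ => A x) isPreconnected_Ioi
    (fun x hx => (hderiv x hx).differentiableAt.differentiableWithinAt)
    (fun x hx => (hderiv x hx).deriv) hc hc'

/-- For t < 0 the abscissa is pushed to +∞, where e^{ct} tends to 0; the case t = 0 follows by
continuity. -/
theorem bromwich_eq_zero (hh : HalfPlaneDecay h R K) {c : ℝ} (hc : R < c) {t : ℝ} (ht : t ≤ 0) :
    bromwich h c t = 0 := by
  have hneg : ∀ t < 0, bromwich h c t = 0 := by
    intro t ht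
    -- For abscissas at least 1 the integral of 1/‖vline c' y‖² is at most that of 1/(1 + y²), which
    -- is π.
    have hlim : Filter.Tendsto (fun c' : ℝ => Real.exp (c' * t) * (K * Real.pi)) Filter.atTop
        (𝓝 0) := by
      have : Filter.Tendsto (fun c' : ℝ => c' * t) Filter.atTop Filter.atBot :=
        Filter.tendsto_id.atTop_mul_const_of_neg ht
      simpa using (Real.tendsto_exp_atBot.comp this).mul_const (K * Real.pi)
    refine norm_eq_zero.1 (le_antisymm (ge_of_tendsto hlim ?_) (norm_nonneg _))
    filter_upwards [Filter.eventually_gt_atTop (max R 1)] with c' hc'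
    have hR : R < c' := (le_max_left _ _).trans_lt hc'
    have h1 : 1 < c' := (le_max_right _ _).trans_lt hc'
    rw [hh.bromwich_eq hc hR]
    refine (hh.norm_bromwich_le hR t).trans ?_
    have hK := hh.nonneg_const
    gcongr
    rw [← integral_univ_inv_one_add_sq]
    refine MeasureTheory.integral_mono (integrable_one_div_norm_vline_sq (by linarith))
      integrable_inv_one_add_sq fun y => ?_
    refine (one_div_norm_vline_sq_le (by linarith) y).trans ?_
    rw [min_eq_right (by nlinarith)]
    simp
  rcases ht.lt_or_eq with h1 | rfl
  · exact hneg t h1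
  · have hcont := (hh.continuous_bromwich hc).continuousWithinAt (s := Set.Iio 0) (x := 0)
    have h2 : Filter.Tendsto (bromwich h c) (𝓝[<] 0) (𝓝 0) :=
      tendsto_const_nhds.congr' (by filter_upwards [self_mem_nhdsWithin] with s hs using
        (hneg s hs).symm)
    exact tendsto_nhds_unique hcont h2

theorem integrableOn_exp_mul_bromwich (hh : HalfPlaneDecay h R K) {c : ℝ} (hc : R < c) {w : ℂ}
    (hw : R < w.re) :
    MeasureTheory.IntegrableOn (fun t : ℝ => Complex.exp (-(w * t)) * bromwich h c t)
      (Set.Ioi 0) := by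
  obtain ⟨c', h1, h2⟩ := exists_between hw
  have hcont := hh.continuous_bromwich hc
  refine MeasureTheory.Integrable.mono'
    (g := fun t => Real.exp (-(w.re - c') * t) * (K * (∫ y : ℝ, 1 / ‖vline c' y‖ ^ 2)))
    ((exp_neg_integrableOn_Ioi 0 (sub_pos.2 h2)).mul_const _) ?_
    (Filter.Eventually.of_forall fun t => ?_)
  · exact (by fun_prop : Continuous fun t : ℝ => Complex.exp (-(w * t)) * bromwich h c t)
      |>.aestronglyMeasurable
  · rw [norm_mul, hh.bromwich_eq hc h1, Complex.norm_exp]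
    refine (mul_le_mul_of_nonneg_left (hh.norm_bromwich_le h1 t) (Real.exp_nonneg _)).trans ?_
    rw [← mul_assoc, ← Real.exp_add]
    refine le_of_eq ?_
    congr 2
    simp
    ring

/-- With the factor 2π in `vline`, e^{-ct} times the Bromwich integral is the inverse Fourier
transform of h on the line of abscissa c = Re w. Since it vanishes for t ≤ 0, its Fourier transform
is a one-sided Laplace integral, and Fourier inversion recovers h. -/
theorem eq_integral_bromwich (hh : HalfPlaneDecay h R K) {c : ℝ} (hc : R < c) {w : ℂ}
    (hw : R < w.re) :
    h w = ∫ t in Set.Ioi (0 : ℝ), Complex.exp (-(w * t)) * bromwich h c t := by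
  set H : ℝ → ℂ := fun y => h (vline w.re y) with hH
  have hinv : ∀ t : ℝ, FourierTransformInv.fourierInv H t =
      Complex.exp (-((w.re : ℂ) * t)) * bromwich h c t := by
    intro t
    rw [Real.fourierInv_eq', hh.bromwich_eq hc hw, bromwich, ← MeasureTheory.integral_const_mul]
    congr 1
    ext y
    rw [← mul_assoc, ← Complex.exp_add, smul_eq_mul]
    congr 2
    simp [vline]
    ring
  have hind : (fun t : ℝ => Complex.exp (-(w * t)) * bromwich h c t) =
      (Set.Ioi 0).indicator (fun t : ℝ => Complex.exp (-(w * t)) * bromwich h c t) := by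
    ext t
    by_cases ht : t ∈ Set.Ioi (0 : ℝ)
    · rw [Set.indicator_of_mem ht]
    · rw [Set.indicator_of_notMem ht, hh.bromwich_eq_zero hc (by simpa using ht), mul_zero]
  have hind' : (fun t : ℝ => Complex.exp (-((w.re : ℂ) * t)) * bromwich h c t) =
      (Set.Ioi 0).indicator (fun t : ℝ => Complex.exp (-((w.re : ℂ) * t)) * bromwich h c t) := by
    ext t
    by_cases ht : t ∈ Set.Ioi (0 : ℝ)
    · rw [Set.indicator_of_mem ht]
    · rw [Set.indicator_of_notMem ht, hh.bromwich_eq_zero hc (by simpa using ht), mul_zero]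
  have hint : MeasureTheory.Integrable (FourierTransformInv.fourierInv H) := by
    rw [show FourierTransformInv.fourierInv H = _ from funext hinv, hind',
      MeasureTheory.integrable_indicator_iff measurableSet_Ioi]
    have := hh.integrableOn_exp_mul_bromwich hc (w := (w.re : ℂ)) (by simpa using hw)
    exact this
  have key : FourierTransform.fourier (FourierTransformInv.fourierInv H) (w.im / (2 * Real.pi)) =
      H (w.im / (2 * Real.pi)) := by
    have hHi : MeasureTheory.Integrable H := hh.integrable_comp_vline hw
    have hF : MeasureTheory.Integrable (FourierTransform.fourier H) := by
      have : FourierTransform.fourier H = fun t => FourierTransformInv.fourierInv H (-t) := by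
        ext t
        rw [Real.fourierInv_eq_fourier_neg, neg_neg]
      rw [this]
      exact hint.comp_neg
    rw [(hh.continuous_comp_vline hw).fourier_fourierInv_eq hHi hF]
  have hwv : vline w.re (w.im / (2 * Real.pi)) = w := by
    have hpi : Real.pi ≠ 0 := Real.pi_ne_zero
    apply Complex.ext
    · simp
    · rw [vline_im]; field_simp
  rw [hH] at key
  simp only [hwv] at key
  rw [← key, Real.fourier_real_eq_integral_exp_smul, ← MeasureTheory.integral_indicator
    measurableSet_Ioi, ← hind]
  congr 1
  ext t
  rw [← hH, hinv t, smul_eq_mul, ← mul_assoc, ← Complex.exp_add]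
  congr 2
  conv_rhs => rw [← Complex.re_add_im w]
  have hpi : (Real.pi : ℂ) ≠ 0 := by exact_mod_cast Real.pi_ne_zero
  push_cast
  field_simp
  ring

theorem div_id (hh : HalfPlaneDecay h R K) (hR : 0 < R) :
    HalfPlaneDecay (fun w => h w / w) R (K / R) where
  nonneg := hR.le
  diff := hh.diff.div differentiableOn_id fun w hw h0 => by
    simp only [Set.mem_ofPred_eq] at hw
    rw [show w = 0 from h0] at hw
    simp at hw
    linarith
  bound w hw := by
    rw [norm_div]
    have h1 : R ≤ ‖w‖ := hw.le.trans (Complex.re_le_norm w)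
    have hK := hh.nonneg_const
    calc ‖h w‖ / ‖w‖ ≤ (K * (1 / ‖w‖ ^ 2)) / R := by
          gcongr
          exact hh.bound w hw
      _ = K / R * (1 / ‖w‖ ^ 2) := by ring

/-- Differentiation in t brings down the factor w of the exponent, so division by w on the Laplace
side is taking a primitive in t. This links the tails of consecutive orders. -/
theorem hasDerivAt_bromwich_div_id (hh : HalfPlaneDecay h R K) {c : ℝ} (hR : 0 < R)
    (hc : R < c) (t : ℝ) :
    HasDerivAt (bromwich (fun w => h w / w) c) (bromwich h c t) t := by
  have hh' := hh.div_id hR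
  refine (hasDerivAt_integral_of_dominated_loc_of_deriv_le (s := Metric.ball t 1)
    (bound := fun y => Real.exp (|c| * (|t| + 1)) * ‖h (vline c y)‖)
    (F := fun (t : ℝ) y => Complex.exp (vline c y * t) * (h (vline c y) / vline c y))
    (F' := fun (t : ℝ) y => Complex.exp (vline c y * t) * h (vline c y))
    (Metric.ball_mem_nhds t one_pos)
    (Filter.Eventually.of_forall fun t => (hh'.integrable_bromwich hc t).aestronglyMeasurable)
    (hh'.integrable_bromwich hc t) (hh.integrable_bromwich hc t).aestronglyMeasurable
    (Filter.Eventually.of_forall fun y s hs => ?_)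
    ((hh.integrable_comp_vline hc).norm.const_mul _)
    (Filter.Eventually.of_forall fun y s hs => ?_)).2
  · rw [norm_mul, norm_exp_vline]
    refine mul_le_mul_of_nonneg_right (Real.exp_le_exp.2 ?_) (norm_nonneg _)
    rw [Metric.mem_ball, Real.dist_eq] at hs
    have : |s| ≤ |t| + 1 := by
      have := abs_add_le (s - t) t
      simp at this
      linarith
    calc c * s ≤ |c * s| := le_abs_self _
      _ = |c| * |s| := abs_mul _ _
      _ ≤ _ := by gcongr
  · have h0 : vline c y ≠ 0 := fun h0 => by
      have := congrArg Complex.re h0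
      simp at this
      linarith
    have h1 : HasDerivAt (fun s : ℝ => vline c y * (s : ℂ)) (vline c y) s := by
      simpa using (Complex.ofRealCLM.hasDerivAt (x := s)).const_mul (vline c y)
    have h2 := (h1.cexp).mul_const (h (vline c y) / vline c y)
    refine h2.congr_deriv ?_
    rw [mul_assoc, mul_div_cancel₀ _ h0]

end HalfPlaneDecay

theorem integral_Ioi_mul_exp_neg {w : ℂ} (hw : 0 < w.re) :
    MeasureTheory.IntegrableOn (fun t : ℝ => (t : ℂ) * Complex.exp (-(w * t))) (Set.Ioi 0) ∧
    ∫ t in Set.Ioi (0 : ℝ), (t : ℂ) * Complex.exp (-(w * t)) = 1 / w ^ 2 := by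
  have h0 : w ≠ 0 := fun h => by simp [h] at hw
  have hint : MeasureTheory.IntegrableOn (fun t : ℝ => (t : ℂ) * Complex.exp (-(w * t)))
      (Set.Ioi 0) := by
    have := integrableOn_rpow_mul_exp_neg_mul_rpow (s := 1) (p := 1) (by norm_num) one_pos hw
    refine MeasureTheory.Integrable.mono' this
      (by fun_prop : Continuous fun t : ℝ => (t : ℂ) * Complex.exp (-(w * t))).aestronglyMeasurable
      ?_
    filter_upwards [MeasureTheory.ae_restrict_mem measurableSet_Ioi] with t ht
    rw [norm_mul, Complex.norm_exp, Complex.norm_real, Real.norm_of_nonneg (le_of_lt ht)]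
    simp
  refine ⟨hint, ?_⟩
  have hlim : Filter.Tendsto (fun t : ℝ => -((t : ℂ) / w + 1 / w ^ 2) * Complex.exp (-(w * t)))
      Filter.atTop (𝓝 0) := by
    have e1 : Filter.Tendsto (fun t : ℝ => t ^ 1 * Real.exp (-w.re * t)) Filter.atTop (𝓝 0) := by
      simpa using tendsto_rpow_mul_exp_neg_mul_atTop_nhds_zero 1 w.re hw
    have e2 : Filter.Tendsto (fun t : ℝ => t ^ 0 * Real.exp (-w.re * t)) Filter.atTop (𝓝 0) := by
      simpa using tendsto_rpow_mul_exp_neg_mul_atTop_nhds_zero 0 w.re hw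
    have e3 := (e1.mul_const (1 / ‖w‖)).add (e2.mul_const (1 / ‖w‖ ^ 2))
    simp only [zero_mul, add_zero] at e3
    refine squeeze_zero_norm' ?_ e3
    filter_upwards [Filter.eventually_gt_atTop 0] with t ht
    rw [norm_mul, Complex.norm_exp, norm_neg]
    have : ‖(t : ℂ) / w + 1 / w ^ 2‖ ≤ t * (1 / ‖w‖) + 1 / ‖w‖ ^ 2 := by
      refine (norm_add_le _ _).trans ?_
      rw [norm_div, norm_div, norm_pow, Complex.norm_real, Real.norm_of_nonneg ht.le, norm_one]
      exact le_of_eq (by ring)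
    calc _ ≤ (t * (1 / ‖w‖) + 1 / ‖w‖ ^ 2) * Real.exp (-(w * t)).re := by gcongr
      _ = _ := by simp; ring
  have key := MeasureTheory.integral_Ioi_of_hasDerivAt_of_tendsto' (a := (0 : ℝ))
    (f := fun t : ℝ => -((t : ℂ) / w + 1 / w ^ 2) * Complex.exp (-(w * t)))
    (f' := fun t : ℝ => (t : ℂ) * Complex.exp (-(w * t))) (m := 0) ?_ hint hlim
  · rw [key]; simp
  · intro t _
    have h1 : HasDerivAt (fun s : ℝ => (s : ℂ)) 1 t := Complex.ofRealCLM.hasDerivAt (x := t)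
    have h2 := ((h1.div_const w).add_const (1 / w ^ 2)).neg.mul ((h1.const_mul w).neg.cexp)
    refine h2.congr_deriv ?_
    simp only [Pi.neg_apply]
    field_simp
    ring

theorem halfPlaneDecay_inv_sq {R : ℝ} (hR : 0 ≤ R) :
    HalfPlaneDecay (fun w => 1 / w ^ 2) R 1 where
  nonneg := hR
  diff := by
    refine DifferentiableOn.div (by fun_prop) (by fun_prop) fun w hw h0 => ?_
    have : w = 0 := by simpa using h0
    simp only [Set.mem_ofPred_eq, this, Complex.zero_re] at hw
    linarith
  bound w _ := by simp

/-- Fourier inversion for t e^{-ct} cut off at 0, which is continuous and integrable, and whose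
transform 1/w² is integrable on the line. -/
theorem bromwich_inv_sq {c : ℝ} (hc : 0 < c) {t : ℝ} (ht : 0 ≤ t) :
    bromwich (fun w => 1 / w ^ 2) c t = t := by
  set F : ℝ → ℂ := (Set.Ioi 0).indicator fun t : ℝ => (t : ℂ) * Complex.exp (-((c : ℂ) * t)) with hF
  have hFi : MeasureTheory.Integrable F := by
    rw [hF, MeasureTheory.integrable_indicator_iff measurableSet_Ioi]
    exact (integral_Ioi_mul_exp_neg (w := c) (by simpa using hc)).1
  have hFF : FourierTransform.fourier F = fun y => 1 / (vline c y) ^ 2 := by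
    ext y
    rw [Real.fourier_real_eq_integral_exp_smul,
      ← (integral_Ioi_mul_exp_neg (w := vline c y) (by simpa using hc)).2,
      ← MeasureTheory.integral_indicator measurableSet_Ioi]
    congr 1
    ext s
    by_cases hs : s ∈ Set.Ioi (0 : ℝ)
    · rw [hF, Set.indicator_of_mem hs, Set.indicator_of_mem hs, smul_eq_mul, mul_left_comm,
        ← Complex.exp_add]
      congr 2
      simp [vline]
      ring
    · rw [hF, Set.indicator_of_notMem hs, Set.indicator_of_notMem hs, smul_zero]
  have hFc : Continuous F := by
    have : F = fun t : ℝ => ((max t 0 : ℝ) : ℂ) * Complex.exp (-((c : ℂ) * t)) := by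
      ext s
      by_cases hs : s ∈ Set.Ioi (0 : ℝ)
      · rw [hF, Set.indicator_of_mem hs, max_eq_left (le_of_lt hs)]
      · rw [hF, Set.indicator_of_notMem hs, max_eq_right (by simpa using hs)]
        simp
    rw [this]
    have : Continuous fun t : ℝ => ((max t 0 : ℝ) : ℂ) :=
      Complex.continuous_ofReal.comp (continuous_id.max continuous_const)
    fun_prop
  have hh := halfPlaneDecay_inv_sq le_rfl
  have key := hFc.fourierInv_fourier_eq hFi (by rw [hFF]; exact hh.integrable_comp_vline hc)
  have h1 := congrFun key t
  rw [hFF, Real.fourierInv_eq'] at h1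
  have h2 : bromwich (fun w => 1 / w ^ 2) c t = Complex.exp (c * t) * F t := by
    rw [← h1, bromwich, ← MeasureTheory.integral_const_mul]
    congr 1
    ext y
    rw [smul_eq_mul, ← mul_assoc, ← Complex.exp_add]
    congr 2
    simp [vline]
    ring
  rw [h2]
  rcases ht.eq_or_lt with rfl | ht
  · simp [hF]
  · rw [hF, Set.indicator_of_mem (Set.mem_Ioi.2 ht), mul_left_comm, ← Complex.exp_add]
    simp

end

noncomputable section

/-! ### Analytic continuation of Taylor series along a half-line -/

/-- The Taylor coefficients `β n t` at the points `t ≥ 0` of the half-line of a function that is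
holomorphic in a strip of width `1 / q` around it. -/
structure HalfLineTaylor (β : ℕ → ℝ → ℂ) (K c q : ℝ) : Prop where
  q_pos : 0 < q
  c_nonneg : 0 ≤ c
  hasDerivAt : ∀ n t, 0 < t → HasDerivAt (β n) ((n + 1 : ℂ) * β (n + 1) t) t
  continuousOn : ∀ n, ContinuousOn (β n) (Set.Ici 0)
  bound : ∀ n t, 0 ≤ t → ‖β n t‖ ≤ K * Real.exp (c * t) * q ^ n

/-- The function on a strip around the half-line with given Taylor coefficients. -/
def stripSum (β : ℕ → ℝ → ℂ) (ξ : ℂ) : ℂ :=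
  ∑' n, β n (max ξ.re 0) * (ξ - (max ξ.re 0 : ℝ)) ^ n

/-- The expansion point in `stripSum` is the point of the half-line nearest to ξ, so it is
admissible as soon as some t ≥ 0 is. -/
theorem norm_sub_max_re_le (ξ : ℂ) {t : ℝ} (ht : 0 ≤ t) :
    ‖ξ - (max ξ.re 0 : ℝ)‖ ≤ ‖ξ - t‖ := by
  rw [← Real.sqrt_sq (norm_nonneg (ξ - t)), ← Real.sqrt_sq (norm_nonneg (ξ - (max ξ.re 0 : ℝ)))]
  apply Real.sqrt_le_sqrt
  rw [← Complex.normSq_eq_norm_sq, ← Complex.normSq_eq_norm_sq, Complex.normSq_apply,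
    Complex.normSq_apply]
  simp only [Complex.sub_re, Complex.ofReal_re, Complex.sub_im, Complex.ofReal_im]
  rcases le_total ξ.re 0 with h | h
  · rw [max_eq_right h]; nlinarith
  · rw [max_eq_left h]; nlinarith [sq_nonneg (ξ.re - t)]

namespace HalfLineTaylor

variable {β : ℕ → ℝ → ℂ} {K c q : ℝ}

theorem nonneg_const (hβ : HalfLineTaylor β K c q) : 0 ≤ K := by
  have := (norm_nonneg _).trans (hβ.bound 0 0 le_rfl)
  simpa using this

theorem norm_term_le (hβ : HalfLineTaylor β K c q) {ξ : ℂ} {t r : ℝ} (ht : 0 ≤ t)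
    (hξ : ‖ξ - t‖ ≤ r) (n : ℕ) :
    ‖β n t * (ξ - t) ^ n‖ ≤ K * Real.exp (c * t) * (q * r) ^ n := by
  rw [norm_mul, norm_pow, mul_pow, ← mul_assoc]
  have hK := hβ.nonneg_const
  have hq := hβ.q_pos
  gcongr
  exact hβ.bound n t ht

theorem summable_term (hβ : HalfLineTaylor β K c q) {ξ : ℂ} {t : ℝ} (ht : 0 ≤ t)
    (hξ : ‖ξ - t‖ < 1 / q) : Summable fun n => β n t * (ξ - t) ^ n := by
  have hq := hβ.q_pos
  refine Summable.of_norm_bounded (g := fun n => K * Real.exp (c * t) * (q * ‖ξ - t‖) ^ n) ?_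
    (fun n => hβ.norm_term_le ht le_rfl n)
  refine (summable_geometric_of_lt_one (by positivity) ?_).mul_left _
  rwa [lt_div_iff₀ hq, mul_comm] at hξ

/-- Moving the centre t changes nothing: the derivative of the n-th term is h (n + 1) - h n with h n
= n βₙ(t)(ξ - t)^{n-1}, so the derivative of the sum telescopes to -h 0 = 0. The admissible centres
form an interval. -/
theorem tsum_eq_of_pos (hβ : HalfLineTaylor β K c q) {ξ : ℂ} {a b : ℝ} (ha : 0 < a) (hb : 0 < b)
    (haξ : ‖ξ - a‖ < 1 / q) (hbξ : ‖ξ - b‖ < 1 / q) :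
    ∑' n, β n a * (ξ - a) ^ n = ∑' n, β n b * (ξ - b) ^ n := by
  have hq := hβ.q_pos
  have hK := hβ.nonneg_const
  have hc := hβ.c_nonneg
  obtain ⟨r, hr1, hr2⟩ := exists_between (max_lt haξ hbξ)
  have hr0 : 0 < r := lt_of_le_of_lt (norm_nonneg _) ((le_max_left _ _).trans_lt hr1)
  have hqr : q * r < 1 := by rwa [lt_div_iff₀ hq, mul_comm] at hr2
  have hqr0 : 0 ≤ q * r := by positivity
  obtain ⟨B, hB⟩ := exists_gt (max a b)
  set V : Set ℝ := Set.Ioo 0 B ∩ {t | ‖ξ - t‖ < r} with hV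
  have hVo : IsOpen V := isOpen_Ioo.inter (isOpen_lt (by fun_prop) continuous_const)
  have hVc : Convex ℝ V := by
    refine (convex_Ioo 0 B).inter ?_
    have : {t : ℝ | ‖ξ - t‖ < r} = Complex.ofRealCLM ⁻¹' Metric.ball ξ r := by
      ext t
      simp [dist_eq_norm, norm_sub_rev]
    rw [this]
    exact (convex_ball ξ r).is_linear_preimage
      (Complex.ofRealCLM : ℝ →ₗ[ℝ] ℂ).isLinear
  have haV : a ∈ V := ⟨⟨ha, (le_max_left _ _).trans_lt hB⟩, (le_max_left _ _).trans_lt hr1⟩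
  have hbV : b ∈ V := ⟨⟨hb, (le_max_right _ _).trans_lt hB⟩, (le_max_right _ _).trans_lt hr1⟩
  -- the terms of the telescoping derivative
  set h : ℕ → ℝ → ℂ := fun n t => (n : ℂ) * β n t * (ξ - t) ^ (n - 1) with hh
  have hterm : ∀ n, ∀ t ∈ V, ‖h (n + 1) t‖ ≤
      K * Real.exp (c * B) * q * ((n + 1 : ℝ) * (q * r) ^ n) := by
    intro n t ht
    simp only [hh, add_tsub_cancel_right]
    rw [norm_mul, norm_mul, norm_pow]
    have h1 := hβ.bound (n + 1) t ht.1.1.le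
    have h2 : Real.exp (c * t) ≤ Real.exp (c * B) := by
      gcongr
      exact ht.1.2.le
    have h3 : ‖((n + 1 : ℕ) : ℂ)‖ = n + 1 := by
      rw [Complex.norm_natCast]; push_cast; ring
    rw [h3]
    have h4 : ‖ξ - t‖ ≤ r := le_of_lt ht.2
    calc (n + 1 : ℝ) * ‖β (n + 1) t‖ * ‖ξ - t‖ ^ n
        ≤ (n + 1 : ℝ) * (K * Real.exp (c * B) * q ^ (n + 1)) * r ^ n := by
          gcongr
          exact h1.trans (by gcongr)
      _ = _ := by rw [mul_pow]; ring
  have hsum : Summable fun n : ℕ => ((n + 1 : ℝ) * (q * r) ^ n) := by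
    have h1 := summable_pow_mul_geometric_of_norm_lt_one (R := ℝ) 1 (r := q * r)
      (by rwa [Real.norm_of_nonneg hqr0])
    have h2 := summable_geometric_of_lt_one hqr0 hqr
    refine (h1.add h2).congr fun n => ?_
    simp
    ring
  set u : ℕ → ℝ := fun n => K * Real.exp (c * B) * q * ((n + 1 : ℝ) * (q * r) ^ n) with hu
  have hus : Summable u := hsum.mul_left _
  -- `h n` is bounded by the shifted majorant
  set v : ℕ → ℝ := fun n => Nat.casesOn n 0 u with hv
  have hvs : Summable v := (summable_nat_add_iff 1).1 hus
  have hhv : ∀ n, ∀ t ∈ V, ‖h n t‖ ≤ v n := by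
    intro n t ht
    cases n with
    | zero => simp [hh, hv]
    | succ n => exact hterm n t ht
  have hg : ∀ n, ∀ t ∈ V, HasDerivAt (fun t : ℝ => β n t * (ξ - t) ^ n)
      (h (n + 1) t - h n t) t := by
    intro n t ht
    have h1 := hβ.hasDerivAt n t ht.1.1
    have h2 : HasDerivAt (fun t : ℝ => ξ - (t : ℂ)) (-1) t :=
      (Complex.ofRealCLM.hasDerivAt (x := t)).const_sub ξ
    refine (h1.mul (h2.pow n)).congr_deriv ?_
    simp only [hh, add_tsub_cancel_right]
    push_cast
    simp only [Pi.pow_apply]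
    ring
  have hder : ∀ t ∈ V, HasDerivAt (fun t : ℝ => ∑' n, β n t * (ξ - t) ^ n) 0 t := by
    intro t ht
    have h1 := hasDerivAt_tsum_of_isPreconnected (hus.add hvs) hVo hVc.isPreconnected hg
      (fun n t ht => (norm_sub_le _ _).trans (add_le_add (hterm n t ht) (hhv n t ht))) haV
      (hβ.summable_term ha.le haξ) ht
    have hs1 : Summable fun n => h n t := Summable.of_norm_bounded hvs fun n => hhv n t ht
    have hs2 : Summable fun n => h (n + 1) t := (summable_nat_add_iff 1).2 hs1
    rw [hs2.tsum_sub hs1, hs1.tsum_eq_zero_add] at h1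
    have h0 : h 0 t = 0 := by simp [hh]
    rwa [h0, zero_add, sub_self] at h1
  exact hVo.is_const_of_deriv_eq_zero hVc.isPreconnected
    (fun t ht => (hder t ht).differentiableAt.differentiableWithinAt)
    (fun t ht => (hder t ht).deriv) haV hbV

/-- The Taylor coefficients are only assumed differentiable for t > 0, so the centre 0 is reached as
a limit: on 0 ≤ t ≤ r - ‖ξ‖ the distance ‖ξ - t‖ stays at most r and the series converges uniformly.
-/
theorem tsum_eq_zero_of_pos (hβ : HalfLineTaylor β K c q) {ξ : ℂ} {b : ℝ} (hb : 0 < b)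
    (haξ : ‖ξ‖ < 1 / q) (hbξ : ‖ξ - b‖ < 1 / q) :
    ∑' n, β n 0 * ξ ^ n = ∑' n, β n b * (ξ - b) ^ n := by
  have hq := hβ.q_pos
  have hK := hβ.nonneg_const
  have hc := hβ.c_nonneg
  obtain ⟨r, hr1, hr2⟩ := exists_between haξ
  have hr0 : 0 < r := (norm_nonneg _).trans_lt hr1
  have hqr : q * r < 1 := by rwa [lt_div_iff₀ hq, mul_comm] at hr2
  have hcont : ContinuousOn (fun t : ℝ => ∑' n, β n t * (ξ - t) ^ n)
      (Set.Icc 0 (r - ‖ξ‖)) := by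
    refine continuousOn_tsum (u := fun n => K * Real.exp (c * r) * (q * r) ^ n) (fun n => ?_)
      ((summable_geometric_of_lt_one (by positivity) hqr).mul_left _) fun n t ht => ?_
    · refine ((hβ.continuousOn n).mono Set.Icc_subset_Ici_self).mul ?_
      exact Continuous.continuousOn (by fun_prop)
    · have h1 : ‖ξ - t‖ ≤ r := by
        refine (norm_sub_le _ _).trans ?_
        rw [Complex.norm_real, Real.norm_of_nonneg ht.1]
        linarith [ht.2]
      refine (hβ.norm_term_le ht.1 h1 n).trans ?_
      gcongr
      linarith [ht.2, norm_nonneg ξ]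
  have hpos : 0 < r - ‖ξ‖ := by linarith
  have h0 := (hcont 0 ⟨le_rfl, hpos.le⟩).mono (Set.Ioo_subset_Icc_self)
  have hlim : Filter.Tendsto (fun t : ℝ => ∑' n, β n t * (ξ - t) ^ n)
      (𝓝[Set.Ioo 0 (r - ‖ξ‖)] 0) (𝓝 (∑' n, β n b * (ξ - b) ^ n)) := by
    refine tendsto_const_nhds.congr' ?_
    filter_upwards [self_mem_nhdsWithin] with t ht
    refine hβ.tsum_eq_of_pos hb ht.1 hbξ ?_
    refine (norm_sub_le _ _).trans_lt ?_
    rw [Complex.norm_real, Real.norm_of_nonneg ht.1.le]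
    linarith [ht.2]
  have hne : (𝓝[Set.Ioo 0 (r - ‖ξ‖)] (0 : ℝ)).NeBot := by
    rw [← mem_closure_iff_nhdsWithin_neBot, closure_Ioo hpos.ne]
    exact ⟨le_rfl, hpos.le⟩
  have := tendsto_nhds_unique h0 hlim
  simpa using this

theorem tsum_eq (hβ : HalfLineTaylor β K c q) {ξ : ℂ} {a b : ℝ} (ha : 0 ≤ a) (hb : 0 ≤ b)
    (haξ : ‖ξ - a‖ < 1 / q) (hbξ : ‖ξ - b‖ < 1 / q) :
    ∑' n, β n a * (ξ - a) ^ n = ∑' n, β n b * (ξ - b) ^ n := by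
  rcases ha.eq_or_lt with rfl | ha
  · rcases hb.eq_or_lt with rfl | hb
    · rfl
    · simpa using hβ.tsum_eq_zero_of_pos hb (by simpa using haξ) hbξ
  · rcases hb.eq_or_lt with rfl | hb
    · simpa using (hβ.tsum_eq_zero_of_pos ha (by simpa using hbξ) haξ).symm
    · exact hβ.tsum_eq_of_pos ha hb haξ hbξ

theorem hasSum_stripSum (hβ : HalfLineTaylor β K c q) {ξ : ℂ} {t : ℝ} (ht : 0 ≤ t)
    (hξ : ‖ξ - t‖ < 1 / q) : HasSum (fun n => β n t * (ξ - t) ^ n) (stripSum β ξ) := by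
  rw [stripSum, hβ.tsum_eq (le_max_right _ _) ht
    ((norm_sub_max_re_le ξ ht).trans_lt hξ) hξ]
  exact (hβ.summable_term ht hξ).hasSum

theorem stripSum_ofReal (hβ : HalfLineTaylor β K c q) {t : ℝ} (ht : 0 ≤ t) :
    stripSum β t = β 0 t := by
  have h1 := hβ.hasSum_stripSum (ξ := t) ht (by simpa using hβ.q_pos)
  have h2 : HasSum (fun n => β n t * ((t : ℂ) - t) ^ n) (β 0 t) := by
    convert hasSum_single 0 ?_ using 1
    · simp
    · intro n hn; simp [hn]
  exact h1.unique h2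

theorem norm_stripSum_le (hβ : HalfLineTaylor β K c q) {ξ : ℂ} {t : ℝ} (ht : 0 ≤ t)
    (hξ : ‖ξ - t‖ < 1 / (2 * q)) : ‖stripSum β ξ‖ ≤ 2 * K * Real.exp (c * ‖ξ‖) := by
  have hq := hβ.q_pos
  have hK := hβ.nonneg_const
  have hc := hβ.c_nonneg
  have h1 := (norm_sub_max_re_le ξ ht).trans hξ.le
  have h2 : q * (1 / (2 * q)) = 1 / 2 := by field_simp
  refine (tsum_of_norm_bounded (g := fun n => K * Real.exp (c * max ξ.re 0) * (1 / 2 : ℝ) ^ n)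
    (hasSum_geometric_two.mul_left _) fun n => ?_).trans ?_
  · rw [← h2]
    exact hβ.norm_term_le (le_max_right _ _) h1 n
  · have h3 : max ξ.re 0 ≤ ‖ξ‖ := max_le (Complex.re_le_norm ξ) (norm_nonneg _)
    have : Real.exp (c * max ξ.re 0) ≤ Real.exp (c * ‖ξ‖) := by gcongr
    nlinarith

theorem differentiableAt_stripSum (hβ : HalfLineTaylor β K c q) {ξ : ℂ} {t : ℝ} (ht : 0 ≤ t)
    (hξ : ‖ξ - t‖ < 1 / q) : DifferentiableAt ℂ (stripSum β) ξ := by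
  have hq := hβ.q_pos
  obtain ⟨r, hr1, hr2⟩ := exists_between hξ
  have hr0 : 0 < r := (norm_nonneg _).trans_lt hr1
  have hqr : q * r < 1 := by rwa [lt_div_iff₀ hq, mul_comm] at hr2
  have hd : DifferentiableOn ℂ (fun ξ => ∑' n, β n t * (ξ - t) ^ n) (Metric.ball (t : ℂ) r) := by
    refine Complex.differentiableOn_tsum_of_summable_norm
      ((summable_geometric_of_lt_one (by positivity) hqr).mul_left (K * Real.exp (c * t)))
      (fun n => by fun_prop) Metric.isOpen_ball fun n w hw => ?_
    refine hβ.norm_term_le ht ?_ n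
    rw [← dist_eq_norm]
    exact (Metric.mem_ball.1 hw).le
  have hmem : Metric.ball (t : ℂ) r ∈ 𝓝 ξ :=
    Metric.isOpen_ball.mem_nhds (by rwa [Metric.mem_ball, dist_eq_norm])
  refine (hd.differentiableAt hmem).congr_of_eventuallyEq ?_
  filter_upwards [hmem] with w hw
  refine (hβ.hasSum_stripSum ht ?_).tsum_eq.symm
  rw [← dist_eq_norm]
  exact (Metric.mem_ball.1 hw).trans hr2

end HalfLineTaylor

/-! ### Nevanlinna's theorem -/

/-- Gevrey asymptotics at infinity on a right half-plane. -/
structure GevreyHalfPlane (G : ℂ → ℂ) (g : ℕ → ℂ) (R C M : ℝ) : Prop where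
  R_pos : 0 < R
  C_nonneg : 0 ≤ C
  M_pos : 0 < M
  diff : DifferentiableOn ℂ G {w | R < w.re}
  bound : ∀ (n : ℕ) (w : ℂ), R < w.re →
    ‖G w - ∑ k ∈ Finset.range n, g k * (1 / w) ^ k‖ ≤ C * M ^ n * n.factorial * (1 / ‖w‖) ^ n

/-- `wⁿ` times the remainder of order `n + 2`. -/
def gevreyTail (G : ℂ → ℂ) (g : ℕ → ℂ) (n : ℕ) (w : ℂ) : ℂ :=
  w ^ n * (G w - ∑ k ∈ Finset.range (n + 2), g k * (1 / w) ^ k)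

/-- The Taylor coefficients on the half-line of the Borel transform. -/
def borelTaylor (G : ℂ → ℂ) (g : ℕ → ℂ) (c : ℝ) (n : ℕ) (t : ℝ) : ℂ :=
  (g (n + 1) + bromwich (gevreyTail G g n) c t) / n.factorial

namespace GevreyHalfPlane

variable {G : ℂ → ℂ} {g : ℕ → ℂ} {R C M : ℝ}

theorem ne_zero (hG : GevreyHalfPlane G g R C M) {w : ℂ} (hw : R < w.re) : w ≠ 0 := by
  rintro rfl
  simp only [Complex.zero_re] at hw
  linarith [hG.R_pos]

theorem norm_coeff_le (hG : GevreyHalfPlane G g R C M) (n : ℕ) :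
    ‖g n‖ ≤ C * M ^ n * n.factorial := by
  have hlim : Filter.Tendsto (fun t : ℝ => C * M ^ n * n.factorial +
      C * M ^ (n + 1) * (n + 1).factorial * (1 / t)) Filter.atTop
      (𝓝 (C * M ^ n * n.factorial + C * M ^ (n + 1) * (n + 1).factorial * 0)) := by
    refine tendsto_const_nhds.add (Filter.Tendsto.const_mul _ ?_)
    exact tendsto_const_nhds.div_atTop Filter.tendsto_id
  rw [mul_zero, add_zero] at hlim
  refine ge_of_tendsto hlim ?_
  filter_upwards [Filter.eventually_gt_atTop R] with t ht
  have ht0 : 0 < t := hG.R_pos.trans ht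
  have h1 := hG.bound n t (by simpa using ht)
  have h2 := hG.bound (n + 1) t (by simpa using ht)
  have h3 : g n * (1 / (t : ℂ)) ^ n = (G t - ∑ k ∈ Finset.range n, g k * (1 / (t : ℂ)) ^ k) -
      (G t - ∑ k ∈ Finset.range (n + 1), g k * (1 / (t : ℂ)) ^ k) := by
    rw [Finset.sum_range_succ]; ring
  have h4 : ‖g n‖ * (1 / t) ^ n ≤ C * M ^ n * n.factorial * (1 / t) ^ n +
      C * M ^ (n + 1) * (n + 1).factorial * (1 / t) ^ (n + 1) := by
    have : ‖g n * (1 / (t : ℂ)) ^ n‖ = ‖g n‖ * (1 / t) ^ n := by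
      rw [norm_mul, norm_pow, norm_div, norm_one, Complex.norm_real, Real.norm_of_nonneg ht0.le]
    rw [← this, h3]
    rw [Complex.norm_real, Real.norm_of_nonneg ht0.le] at h1 h2
    exact (norm_sub_le _ _).trans (add_le_add h1 h2)
  have h5 : (0 : ℝ) < (1 / t) ^ n := by positivity
  rw [← mul_le_mul_iff_left₀ h5]
  refine h4.trans (le_of_eq ?_)
  ring

theorem halfPlaneDecay (hG : GevreyHalfPlane G g R C M) (n : ℕ) :
    HalfPlaneDecay (gevreyTail G g n) R (C * M ^ (n + 2) * (n + 2).factorial) where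
  nonneg := hG.R_pos.le
  diff := by
    refine DifferentiableOn.mul (by fun_prop) (hG.diff.fun_sub ?_)
    refine DifferentiableOn.fun_sum fun k _ => DifferentiableOn.const_mul ?_ _
    refine DifferentiableOn.pow (DifferentiableOn.div (by fun_prop) (by fun_prop) ?_) k
    exact fun w hw => hG.ne_zero hw
  bound w hw := by
    have hw0 : 0 < ‖w‖ := norm_pos_iff.2 (hG.ne_zero hw)
    rw [gevreyTail, norm_mul, norm_pow]
    calc ‖w‖ ^ n * _ ≤ ‖w‖ ^ n * (C * M ^ (n + 2) * (n + 2).factorial * (1 / ‖w‖) ^ (n + 2)) := by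
          gcongr
          exact hG.bound (n + 2) w hw
      _ = C * M ^ (n + 2) * (n + 2).factorial * (1 / ‖w‖ ^ 2) := by
          rw [one_div_pow, pow_add ‖w‖]; field_simp

/-- On the Bromwich side the quotient by w is a primitive and 1/w² becomes t. Hence the derivative
of the n-th transform is the (n + 1)-st transform plus the coefficient of index n + 2. -/
theorem gevreyTail_eq (hG : GevreyHalfPlane G g R C M) (n : ℕ) {w : ℂ} (hw : R < w.re) :
    gevreyTail G g n w = gevreyTail G g (n + 1) w / w + g (n + 2) * (1 / w ^ 2) := by
  have h0 := hG.ne_zero hw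
  rw [gevreyTail, gevreyTail, Finset.sum_range_succ _ (n + 2), one_div_pow _ (n + 2)]
  generalize ∑ k ∈ Finset.range (n + 2), g k * (1 / w) ^ k = s
  have e1 : w ^ (n + 2) = w ^ n * w ^ 2 := pow_add _ _ _
  have e2 : w ^ (n + 1) = w ^ n * w := pow_succ _ _
  rw [e1, e2]
  have h1 : w ^ n ≠ 0 := pow_ne_zero _ h0
  field_simp
  ring

theorem bromwich_gevreyTail (hG : GevreyHalfPlane G g R C M) (n : ℕ) {c : ℝ} (hc : R < c) (t : ℝ)
    (ht : 0 ≤ t) : bromwich (gevreyTail G g n) c t =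
      bromwich (fun w => gevreyTail G g (n + 1) w / w) c t + g (n + 2) * t := by
  rw [← bromwich_inv_sq (hG.R_pos.trans hc) ht, bromwich, bromwich, bromwich,
    ← MeasureTheory.integral_const_mul, ← MeasureTheory.integral_add]
  · congr 1
    ext y
    rw [hG.gevreyTail_eq n (w := vline c y) (by simpa using hc)]
    ring
  · exact ((hG.halfPlaneDecay (n + 1)).div_id hG.R_pos).integrable_bromwich hc t
  · exact ((halfPlaneDecay_inv_sq hG.R_pos.le).integrable_bromwich hc t).const_mul _

/-- Formally, the n-th derivative of the Borel transform is g (n + 1) plus the inverse Laplace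
transform of wⁿ times the remainder. Two extra terms are subtracted in the tail so that it decays
like |w|⁻² and its Bromwich integral converges absolutely. -/
theorem halfLineTaylor (hG : GevreyHalfPlane G g R C M) {c : ℝ} (hc : R < c) :
    HalfLineTaylor (borelTaylor G g c)
      (C * M + 2 * C * M ^ 2 * ∫ y : ℝ, 1 / ‖vline c y‖ ^ 2) c (3 * M) where
  q_pos := by linarith [hG.M_pos]
  c_nonneg := (hG.R_pos.trans hc).le
  continuousOn n := by
    refine Continuous.continuousOn ?_
    have := (hG.halfPlaneDecay n).continuous_bromwich hc
    unfold borelTaylor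
    fun_prop
  hasDerivAt n t ht := by
    have h1 := (hG.halfPlaneDecay (n + 1)).hasDerivAt_bromwich_div_id hG.R_pos hc t
    have h2 : HasDerivAt (fun s : ℝ => g (n + 2) * (s : ℂ)) (g (n + 2)) t := by
      simpa using (Complex.ofRealCLM.hasDerivAt (x := t)).const_mul (g (n + 2))
    have h3 : HasDerivAt (bromwich (gevreyTail G g n) c)
        (bromwich (gevreyTail G g (n + 1)) c t + g (n + 2)) t := by
      refine (h1.add h2).congr_of_eventuallyEq ?_
      filter_upwards [Ioi_mem_nhds ht] with s hs
      exact hG.bromwich_gevreyTail n hc s (le_of_lt hs)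
    refine ((h3.const_add (g (n + 1))).div_const (n.factorial : ℂ)).congr_deriv ?_
    rw [borelTaylor, Nat.factorial_succ]
    have : (n.factorial : ℂ) ≠ 0 := by exact_mod_cast n.factorial_ne_zero
    have h4 : (n + 1 : ℂ) ≠ 0 := by exact_mod_cast n.succ_ne_zero
    push_cast
    field_simp
    ring
  bound n t ht := by
    have hC := hG.C_nonneg
    have hM := hG.M_pos
    set I := ∫ y : ℝ, 1 / ‖vline c y‖ ^ 2 with hI
    have hI0 : 0 ≤ I := MeasureTheory.integral_nonneg fun y => by positivity
    have h1 := (hG.halfPlaneDecay n).norm_bromwich_le hc t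
    have h2 := hG.norm_coeff_le (n + 1)
    have hf : (0 : ℝ) < n.factorial := by exact_mod_cast n.factorial_pos
    have he : 1 ≤ Real.exp (c * t) :=
      Real.one_le_exp (mul_nonneg (hG.R_pos.trans hc).le ht)
    -- After division by n!, the coefficient of index n + 1 contributes n + 1 and the remainder of
    -- order n + 2 contributes (n + 1)(n + 2). Absorbing both into 3ⁿ reduces the strip width from
    -- 1/M to 1/(3M).
    have h3 : ∀ n : ℕ, ((n : ℝ) + 1) ≤ 3 ^ n ∧ ((n : ℝ) + 1) * (n + 2) ≤ 2 * 3 ^ n := by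
      intro n
      induction n with
      | zero => norm_num
      | succ n ih =>
        push_cast
        rw [pow_succ]
        have hn : (0 : ℝ) ≤ n := Nat.cast_nonneg n
        constructor <;> nlinarith [ih.1, ih.2]
    rw [borelTaylor, norm_div, Complex.norm_natCast, div_le_iff₀ hf]
    refine (norm_add_le _ _).trans ((add_le_add h2 h1).trans ?_)
    rw [← hI, Nat.factorial_succ (n + 1), Nat.factorial_succ n]
    push_cast
    have e1 : C * M ^ (n + 1) * (((n : ℝ) + 1) * n.factorial) ≤
        C * M * Real.exp (c * t) * (3 * M) ^ n * n.factorial := by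
      rw [mul_pow, pow_succ]
      calc C * (M ^ n * M) * (((n : ℝ) + 1) * n.factorial)
          = C * M * (n.factorial * M ^ n) * ((n : ℝ) + 1) * 1 := by ring
        _ ≤ C * M * (n.factorial * M ^ n) * 3 ^ n * Real.exp (c * t) := by
          gcongr
          exact (h3 n).1
        _ = _ := by ring
    have e2 : Real.exp (c * t) * (C * M ^ (n + 2) * (((n : ℝ) + 1 + 1) * (((n : ℝ) + 1) *
        n.factorial)) * I) ≤ 2 * C * M ^ 2 * I * Real.exp (c * t) * (3 * M) ^ n * n.factorial := by
      rw [mul_pow, pow_add]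
      calc _ = Real.exp (c * t) * C * M ^ 2 * M ^ n * I * n.factorial *
            (((n : ℝ) + 1) * (n + 2)) := by ring
        _ ≤ Real.exp (c * t) * C * M ^ 2 * M ^ n * I * n.factorial * (2 * 3 ^ n) :=
          mul_le_mul_of_nonneg_left (h3 n).2 (by positivity)
        _ = _ := by ring
    refine (add_le_add e1 e2).trans (le_of_eq ?_)
    ring

theorem borelTaylor_zero (hG : GevreyHalfPlane G g R C M) {c : ℝ} (hc : R < c) (n : ℕ) :
    borelTaylor G g c n 0 = g (n + 1) / n.factorial := by
  rw [borelTaylor, (hG.halfPlaneDecay n).bromwich_eq_zero hc le_rfl, add_zero]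

/-- Only the tail of order 0 is inverted: the term g 1 / w is the Laplace transform of the constant
g 1, and the remainder of order 2 is recovered from its Bromwich integral. -/
theorem laplace (hG : GevreyHalfPlane G g R C M) {c : ℝ} (hc : R < c) {w : ℂ} (hw : R < w.re) :
    MeasureTheory.IntegrableOn (fun t : ℝ => Complex.exp (-(w * t)) *
      stripSum (borelTaylor G g c) t) (Set.Ioi 0) ∧
    G w = g 0 + ∫ t in Set.Ioi (0 : ℝ), Complex.exp (-(w * t)) *
      stripSum (borelTaylor G g c) t := by
  have h0 := hG.ne_zero hw
  have hwre : 0 < w.re := hG.R_pos.trans hw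
  have hh := hG.halfPlaneDecay 0
  have hi1 : MeasureTheory.IntegrableOn (fun t : ℝ => g 1 * Complex.exp (-w * t)) (Set.Ioi 0) :=
    (integrableOn_exp_mul_complex_Ioi (by simpa using hwre) 0).const_mul _
  have hi2 := hh.integrableOn_exp_mul_bromwich hc hw
  have heq : Set.EqOn (fun t : ℝ => g 1 * Complex.exp (-w * t) + Complex.exp (-(w * t)) *
      bromwich (gevreyTail G g 0) c t) (fun t : ℝ => Complex.exp (-(w * t)) *
      stripSum (borelTaylor G g c) t) (Set.Ioi 0) := by
    intro t ht
    simp only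
    rw [(hG.halfLineTaylor hc).stripSum_ofReal (le_of_lt ht), borelTaylor]
    simp
    ring
  refine ⟨(hi1.add hi2).congr_fun heq measurableSet_Ioi, ?_⟩
  rw [← MeasureTheory.setIntegral_congr_fun measurableSet_Ioi heq,
    MeasureTheory.integral_add hi1 hi2, ← hh.eq_integral_bromwich hc hw,
    MeasureTheory.integral_const_mul, integral_exp_mul_complex_Ioi (by simpa using hwre)]
  simp [gevreyTail, Finset.sum_range_succ]
  field_simp
  ring

/-- A function with vanishing Gevrey asymptotics on a half-plane vanishes. -/
theorem eq_zero (hG : GevreyHalfPlane G (fun _ => 0) R C M) {w : ℂ} (hw : R < w.re) : G w = 0 := by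
  have hc : R < R + 1 := by linarith
  set β := borelTaylor G (fun _ => 0) (R + 1) with hβdef
  have hβ := hG.halfLineTaylor hc
  have hq := hβ.q_pos
  set η := 1 / (3 * M) with hη
  have hη0 : 0 < η := by positivity
  set V : Set ℂ := Metric.thickening η ((fun t : ℝ => (t : ℂ)) '' Set.Ici 0) with hV
  have hmem : ∀ ξ ∈ V, ∃ t : ℝ, 0 ≤ t ∧ ‖ξ - t‖ < η := by
    intro ξ hξ
    obtain ⟨z, ⟨t, ht, rfl⟩, hz⟩ := Metric.mem_thickening_iff.1 hξ
    exact ⟨t, ht, by rwa [← dist_eq_norm]⟩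
  have hconv : Convex ℝ V :=
    ((convex_Ici (0 : ℝ)).linear_image (Complex.ofRealCLM : ℝ →ₗ[ℝ] ℂ)).thickening η
  have h0V : (0 : ℂ) ∈ V := Metric.mem_thickening_iff.2 ⟨0, ⟨0, by simp, by simp⟩, by simpa⟩
  have hd : DifferentiableOn ℂ (stripSum β) V := fun ξ hξ => by
    obtain ⟨t, ht, hξt⟩ := hmem ξ hξ
    exact (hβ.differentiableAt_stripSum ht hξt).differentiableWithinAt
  -- At t = 0 the Taylor coefficients are g (n + 1)/n! = 0, so the continued Borel transform
  -- vanishes near 0, then on the connected strip, and so does its Laplace transform.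
  have hloc : stripSum β =ᶠ[𝓝 0] 0 := by
    filter_upwards [Metric.ball_mem_nhds (0 : ℂ) hη0] with ξ hξ
    have h1 := hβ.hasSum_stripSum (ξ := ξ) le_rfl (by simpa only [Complex.ofReal_zero, sub_zero, mem_ball_zero_iff] using hξ)
    have h2 : (fun n => borelTaylor G (fun _ => 0) (R + 1) n 0 * (ξ - (0 : ℝ)) ^ n) =
        fun _ => 0 := by
      ext n
      rw [hG.borelTaylor_zero hc]
      simp
    rw [h2] at h1
    exact h1.unique hasSum_zero
  have hEq := (hd.analyticOnNhd Metric.isOpen_thickening).eqOn_zero_of_preconnected_of_eventuallyEq_zero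
    hconv.isPreconnected h0V hloc
  rw [(hG.laplace hc hw).2, zero_add]
  refine MeasureTheory.setIntegral_eq_zero_of_forall_eq_zero fun t ht => ?_
  have : (t : ℂ) ∈ V := Metric.self_subset_thickening hη0 _ ⟨t, Set.mem_Ici.2 (le_of_lt ht), rfl⟩
  rw [hEq this]
  simp

end GevreyHalfPlane

end

noncomputable section

/-! ### Laplace representation in all copolar directions -/

theorem isOpen_borelDisc (θ δ : ℝ) (hδ : 0 < δ) : IsOpen (borelDisc θ δ) := by
  have h0 : borelDisc θ δ ⊆ {0}ᶜ := by
    rintro ħ hħ rfl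
    simp only [borelDisc, Set.mem_ofPred_eq, div_zero, Complex.zero_re] at hħ
    have : 0 < 1 / δ := by positivity
    linarith
  have hcont : ContinuousOn (fun ħ : ℂ => (Complex.exp ((θ : ℂ) * Complex.I) / ħ).re) {0}ᶜ :=
    Complex.continuous_re.comp_continuousOn
      (continuousOn_const.div continuousOn_id fun x hx => hx)
  have : borelDisc θ δ =
      {0}ᶜ ∩ (fun ħ : ℂ => (Complex.exp ((θ : ℂ) * Complex.I) / ħ).re) ⁻¹' Set.Ioi (1 / δ) := by
    ext ħ
    exact ⟨fun h => ⟨h0 h, h⟩, fun h => h.2⟩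
  rw [this]
  exact hcont.isOpen_inter_preimage isOpen_compl_singleton isOpen_Ioi

theorem ne_zero_of_mem_borelDisc {θ δ : ℝ} (hδ : 0 < δ) {ħ : ℂ} (h : ħ ∈ borelDisc θ δ) :
    ħ ≠ 0 := by
  rintro rfl
  simp only [borelDisc, Set.mem_ofPred_eq, div_zero, Complex.zero_re] at h
  have : 0 < 1 / δ := by positivity
  linarith

theorem borelDisc_mono {θ δ δ' : ℝ} (hδ : 0 < δ) (h : δ ≤ δ') : borelDisc θ δ ⊆ borelDisc θ δ' := by
  intro ħ hħ
  have : 1 / δ' ≤ 1 / δ := one_div_le_one_div_of_le hδ h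
  exact lt_of_le_of_lt this hħ

/-- In the coordinate `w = e^{iθ} / ħ`, Gevrey asymptotics on a Borel disc become Gevrey asymptotics
on a half-plane. -/
theorem gevreyHalfPlane_of_borelDisc {F : ℂ → ℂ} {g : ℕ → ℂ} {θ δ C M : ℝ} (hδ : 0 < δ)
    (hC : 0 ≤ C) (hM : 0 < M) (hd : DifferentiableOn ℂ F (borelDisc θ δ))
    (hb : ∀ n : ℕ, ∀ ħ ∈ borelDisc θ δ,
      ‖F ħ - ∑ k ∈ Finset.range n, g k * ħ ^ k‖ ≤ C * M ^ n * n.factorial * ‖ħ‖ ^ n) :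
    GevreyHalfPlane (fun w => F (Complex.exp ((θ : ℂ) * Complex.I) / w))
      (fun k => g k * Complex.exp ((θ : ℂ) * Complex.I) ^ k) (1 / δ) C M := by
  set e := Complex.exp ((θ : ℂ) * Complex.I) with he
  have he0 : e ≠ 0 := Complex.exp_ne_zero _
  have hmem : ∀ w : ℂ, 1 / δ < w.re → e / w ∈ borelDisc θ δ := by
    intro w hw
    have hw0 : w ≠ 0 := by
      rintro rfl
      simp only [Complex.zero_re] at hw
      have : 0 < 1 / δ := by positivity
      linarith
    simp only [borelDisc, Set.mem_ofPred_eq, ← he]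
    rwa [div_div_cancel₀ he0]
  refine ⟨by positivity, hC, hM, ?_, fun n w hw => ?_⟩
  · refine hd.comp ?_ fun w hw => hmem w hw
    refine DifferentiableOn.div (by fun_prop) (by fun_prop) fun w hw h0 => ?_
    rw [Set.mem_ofPred_eq, h0, Complex.zero_re] at hw
    have : 0 < 1 / δ := by positivity
    linarith
  · have h1 := hb n _ (hmem w hw)
    rw [norm_div, he, Complex.norm_exp_ofReal_mul_I, ← he] at h1
    have h2 : ∀ k, g k * e ^ k * (1 / w) ^ k = g k * (e / w) ^ k := fun k => by
      rw [mul_assoc, ← mul_pow, mul_one_div]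
    simpa only [h2] using h1

/-- A strip of half-width `η` around the ray of direction `θ`. -/
def rayStrip (θ η : ℝ) : Set ℂ :=
  {ξ | ∃ t : ℝ, 0 ≤ t ∧ ‖ξ - (t : ℂ) * Complex.exp ((θ : ℂ) * Complex.I)‖ < η}

theorem rayStrip_eq_thickening (θ η : ℝ) : rayStrip θ η = Metric.thickening η
    ((fun t : ℝ => (t : ℂ) * Complex.exp ((θ : ℂ) * Complex.I)) '' Set.Ici 0) := by
  ext ξ
  simp only [Metric.mem_thickening_iff, Set.exists_mem_image, dist_eq_norm]
  rfl

theorem isOpen_rayStrip (θ η : ℝ) : IsOpen (rayStrip θ η) := by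
  rw [rayStrip_eq_thickening]; exact Metric.isOpen_thickening

theorem convex_rayStrip (θ η : ℝ) : Convex ℝ (rayStrip θ η) := by
  rw [rayStrip_eq_thickening]
  refine Convex.thickening ?_ η
  exact (convex_Ici (0 : ℝ)).is_linear_image (f := fun t : ℝ => (t : ℂ) *
    Complex.exp ((θ : ℂ) * Complex.I))
    { map_add := fun x y => by push_cast; ring
      map_smul := fun c x => by simp; ring }

theorem ball_subset_rayStrip (θ η : ℝ) : Metric.ball 0 η ⊆ rayStrip θ η := fun ξ hξ =>
  ⟨0, le_rfl, by simpa using hξ⟩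

theorem mem_thickening_infiniteSector {Θ : Set ℝ} {η : ℝ} {ξ : ℂ} :
    ξ ∈ Metric.thickening η (infiniteSector Θ) ↔ ∃ θ ∈ Θ, ξ ∈ rayStrip θ η := by
  rw [Metric.mem_thickening_iff]
  constructor
  · rintro ⟨_, ⟨t, ht, θ, hθ, rfl⟩, h⟩
    exact ⟨θ, hθ, t, ht, by rwa [← dist_eq_norm]⟩
  · rintro ⟨θ, hθ, t, ht, h⟩
    exact ⟨_, ⟨t, ht, θ, hθ, rfl⟩, by rwa [dist_eq_norm]⟩

theorem norm_rotate_sub (θ t : ℝ) (ξ : ℂ) :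
    ‖Complex.exp (-((θ : ℂ) * Complex.I)) * ξ - t‖ =
      ‖ξ - (t : ℂ) * Complex.exp ((θ : ℂ) * Complex.I)‖ := by
  have : ξ - (t : ℂ) * Complex.exp ((θ : ℂ) * Complex.I) =
      Complex.exp ((θ : ℂ) * Complex.I) * (Complex.exp (-((θ : ℂ) * Complex.I)) * ξ - t) := by
    rw [mul_sub, ← mul_assoc, ← Complex.exp_add]
    simp
    ring
  rw [this, norm_mul, Complex.norm_exp_ofReal_mul_I, one_mul]

/-- The Borel transform in the direction `θ` of the function `F` on `borelDisc θ δ` with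
asymptotic expansion `∑ gₖ ħᵏ`. -/
def borelTransform (F : ℂ → ℂ) (g : ℕ → ℂ) (θ δ : ℝ) (ξ : ℂ) : ℂ :=
  Complex.exp (-((θ : ℂ) * Complex.I)) *
    stripSum (borelTaylor (fun w => F (Complex.exp ((θ : ℂ) * Complex.I) / w))
      (fun k => g k * Complex.exp ((θ : ℂ) * Complex.I) ^ k) (1 / δ + 1))
      (Complex.exp (-((θ : ℂ) * Complex.I)) * ξ)

section

variable {F : ℂ → ℂ} {g : ℕ → ℂ} {θ δ C M : ℝ}

theorem hasSum_borelTransform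
    (hG : GevreyHalfPlane (fun w => F (Complex.exp ((θ : ℂ) * Complex.I) / w))
      (fun k => g k * Complex.exp ((θ : ℂ) * Complex.I) ^ k) (1 / δ) C M)
    {ξ : ℂ} (hξ : ‖ξ‖ < 1 / (3 * M)) :
    HasSum (fun k : ℕ => g (k + 1) / (k.factorial : ℂ) * ξ ^ k) (borelTransform F g θ δ ξ) := by
  have hc : 1 / δ < 1 / δ + 1 := by linarith
  set e := Complex.exp ((θ : ℂ) * Complex.I) with he
  have he' : Complex.exp (-((θ : ℂ) * Complex.I)) = e⁻¹ := Complex.exp_neg _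
  have he0 : e ≠ 0 := Complex.exp_ne_zero _
  have h1 := (hG.halfLineTaylor hc).hasSum_stripSum
    (ξ := Complex.exp (-((θ : ℂ) * Complex.I)) * ξ) le_rfl (by rw [norm_rotate_sub]; simpa using hξ)
  have h2 := h1.mul_left (Complex.exp (-((θ : ℂ) * Complex.I)))
  refine h2.congr_fun ?_
  intro k
  rw [hG.borelTaylor_zero hc, he']
  simp only [Complex.ofReal_zero, sub_zero]
  rw [mul_pow, inv_pow, pow_succ]
  have : e ^ k ≠ 0 := pow_ne_zero _ he0
  field_simp

theorem differentiableOn_borelTransform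
    (hG : GevreyHalfPlane (fun w => F (Complex.exp ((θ : ℂ) * Complex.I) / w))
      (fun k => g k * Complex.exp ((θ : ℂ) * Complex.I) ^ k) (1 / δ) C M) :
    DifferentiableOn ℂ (borelTransform F g θ δ) (rayStrip θ (1 / (3 * M))) := by
  have hc : 1 / δ < 1 / δ + 1 := by linarith
  rintro ξ ⟨t, ht, hξ⟩
  have h1 := (hG.halfLineTaylor hc).differentiableAt_stripSum
    (ξ := Complex.exp (-((θ : ℂ) * Complex.I)) * ξ) ht (by rwa [norm_rotate_sub])
  have h2 : DifferentiableAt ℂ (fun ξ => Complex.exp (-((θ : ℂ) * Complex.I)) * ξ) ξ := by fun_prop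
  exact ((DifferentiableAt.comp ξ h1 h2).const_mul _).differentiableWithinAt

theorem norm_borelTransform_le
    (hG : GevreyHalfPlane (fun w => F (Complex.exp ((θ : ℂ) * Complex.I) / w))
      (fun k => g k * Complex.exp ((θ : ℂ) * Complex.I) ^ k) (1 / δ) C M)
    {ξ : ℂ} (hξ : ξ ∈ rayStrip θ (1 / (6 * M))) :
    ‖borelTransform F g θ δ ξ‖ ≤
      2 * (C * M + 2 * C * M ^ 2 * ∫ y : ℝ, 1 / ‖vline (1 / δ + 1) y‖ ^ 2) *
        Real.exp ((1 / δ + 1) * ‖ξ‖) := by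
  have hc : 1 / δ < 1 / δ + 1 := by linarith
  obtain ⟨t, ht, hξ⟩ := hξ
  have h1 := (hG.halfLineTaylor hc).norm_stripSum_le
    (ξ := Complex.exp (-((θ : ℂ) * Complex.I)) * ξ) ht
    (by rw [norm_rotate_sub]; convert hξ using 2; ring)
  have h2 : ‖Complex.exp (-((θ : ℂ) * Complex.I))‖ = 1 := by
    rw [Complex.exp_neg, norm_inv, Complex.norm_exp_ofReal_mul_I, inv_one]
  rw [norm_mul, h2, one_mul] at h1
  rw [borelTransform, norm_mul, h2, one_mul]
  exact h1

theorem laplace_borelTransform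
    (hG : GevreyHalfPlane (fun w => F (Complex.exp ((θ : ℂ) * Complex.I) / w))
      (fun k => g k * Complex.exp ((θ : ℂ) * Complex.I) ^ k) (1 / δ) C M)
    {ħ : ℂ} (hħ : ħ ∈ borelDisc θ δ) :
    MeasureTheory.IntegrableOn (fun t : ℝ =>
      Complex.exp (-((t : ℂ) * Complex.exp ((θ : ℂ) * Complex.I)) / ħ) *
      borelTransform F g θ δ ((t : ℂ) * Complex.exp ((θ : ℂ) * Complex.I)) *
      Complex.exp ((θ : ℂ) * Complex.I)) (Set.Ioi 0) ∧
    F ħ = g 0 + ∫ t in Set.Ioi (0 : ℝ),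
      Complex.exp (-((t : ℂ) * Complex.exp ((θ : ℂ) * Complex.I)) / ħ) *
      borelTransform F g θ δ ((t : ℂ) * Complex.exp ((θ : ℂ) * Complex.I)) *
      Complex.exp ((θ : ℂ) * Complex.I) := by
  have hc : 1 / δ < 1 / δ + 1 := by linarith
  obtain ⟨h1, h2⟩ := hG.laplace hc (w := Complex.exp ((θ : ℂ) * Complex.I) / ħ) hħ
  have he0 : Complex.exp ((θ : ℂ) * Complex.I) ≠ 0 := Complex.exp_ne_zero _
  have heq : (fun t : ℝ => Complex.exp (-((t : ℂ) * Complex.exp ((θ : ℂ) * Complex.I)) / ħ) *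
      borelTransform F g θ δ ((t : ℂ) * Complex.exp ((θ : ℂ) * Complex.I)) *
      Complex.exp ((θ : ℂ) * Complex.I)) = fun t : ℝ =>
      Complex.exp (-(Complex.exp ((θ : ℂ) * Complex.I) / ħ * t)) *
      stripSum (borelTaylor (fun w => F (Complex.exp ((θ : ℂ) * Complex.I) / w))
      (fun k => g k * Complex.exp ((θ : ℂ) * Complex.I) ^ k) (1 / δ + 1)) t := by
    ext t
    have e1 : Complex.exp (-((θ : ℂ) * Complex.I)) * ((t : ℂ) * Complex.exp ((θ : ℂ) * Complex.I)) =
        t := by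
      rw [mul_left_comm, ← Complex.exp_add]
      simp
    have e2 : Complex.exp (-((θ : ℂ) * Complex.I)) * Complex.exp ((θ : ℂ) * Complex.I) = 1 := by
      rw [← Complex.exp_add]
      simp
    have e3 : -((t : ℂ) * Complex.exp ((θ : ℂ) * Complex.I)) / ħ =
        -(Complex.exp ((θ : ℂ) * Complex.I) / ħ * t) := by ring
    rw [borelTransform, e1, e3]
    generalize stripSum _ _ = s
    linear_combination Complex.exp (-(Complex.exp ((θ : ℂ) * Complex.I) / ħ * t)) * s * e2
  rw [heq]
  refine ⟨h1, ?_⟩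
  rw [div_div_cancel₀ he0, pow_zero, mul_one] at h2
  exact h2

end

/-- The centre of the expansion depends on ξ only. So for fixed ξ this is a uniformly convergent
series in x whose terms are Bromwich integrals of functions holomorphic in x, dominated uniformly in
x. -/
theorem differentiableOn_borelTransform_param {f : ℂ × ℂ → ℂ} {fk : ℕ → ℂ → ℂ} {U : Set ℂ}
    (hU : IsOpen U) {θ δ C M : ℝ} (hδ : 0 < δ)
    (hfk : ∀ k, DifferentiableOn ℂ (fk k) U)
    (hf : ∀ ħ ∈ borelDisc θ δ, DifferentiableOn ℂ (fun x => f (x, ħ)) U)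
    (hG : ∀ x ∈ U, GevreyHalfPlane (fun w => f (x, Complex.exp ((θ : ℂ) * Complex.I) / w))
      (fun k => fk k x * Complex.exp ((θ : ℂ) * Complex.I) ^ k) (1 / δ) C M)
    {ξ : ℂ} (hξ : ξ ∈ rayStrip θ (1 / (3 * M))) :
    DifferentiableOn ℂ (fun x => borelTransform (fun ħ => f (x, ħ)) (fun k => fk k x) θ δ ξ) U := by
  have hc : 1 / δ < 1 / δ + 1 := by linarith
  rcases U.eq_empty_or_nonempty with rfl | ⟨x₁, hx₁⟩
  · exact differentiableOn_empty
  have hM := (hG x₁ hx₁).M_pos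
  obtain ⟨t, ht, hξ⟩ := hξ
  rw [← norm_rotate_sub] at hξ
  set ζ := Complex.exp (-((θ : ℂ) * Complex.I)) * ξ with hζ
  have hζ' := (norm_sub_max_re_le ζ ht).trans_lt hξ
  set s := max ζ.re 0 with hs
  have hs0 : 0 ≤ s := le_max_right _ _
  refine DifferentiableOn.const_mul ?_ _
  unfold stripSum
  refine Complex.differentiableOn_tsum_of_summable_norm
    (u := fun n => (C * M + 2 * C * M ^ 2 * ∫ y : ℝ, 1 / ‖vline (1 / δ + 1) y‖ ^ 2) *
      Real.exp ((1 / δ + 1) * s) * (3 * M * ‖ζ - (s : ℝ)‖) ^ n) ?_ (fun n => ?_) hU fun n x hx => ?_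
  · refine (summable_geometric_of_lt_one (by positivity) ?_).mul_left _
    rwa [lt_div_iff₀ (by positivity), mul_comm] at hζ'
  · refine DifferentiableOn.mul_const ?_ _
    unfold borelTaylor
    refine DifferentiableOn.div_const (((hfk _).mul_const _).fun_add ?_) _
    refine differentiableOn_integral_of_dominated hU
      (bound := fun y => Real.exp ((1 / δ + 1) * s) *
        (C * M ^ (n + 2) * (n + 2).factorial * (1 / ‖vline (1 / δ + 1) y‖ ^ 2)))
      (fun x hx => ?_) (Filter.Eventually.of_forall fun y => ?_)
      (Filter.Eventually.of_forall fun y x hx => ?_) ?_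
    · exact (((hG x hx).halfPlaneDecay n).integrable_bromwich hc s).aestronglyMeasurable
    · refine DifferentiableOn.const_mul ?_ _
      unfold gevreyTail
      refine DifferentiableOn.const_mul (DifferentiableOn.fun_sub ?_ ?_) _
      · refine hf _ ?_
        simp only [borelDisc, Set.mem_ofPred_eq]
        rw [div_div_cancel₀ (Complex.exp_ne_zero _), vline_re]
        exact hc
      · exact DifferentiableOn.fun_sum fun k _ => ((hfk k).mul_const _).mul_const _
    · rw [norm_mul, norm_exp_vline]
      gcongr
      exact ((hG x hx).halfPlaneDecay n).bound _ (by rw [vline_re]; exact hc)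
    · refine ((integrable_one_div_norm_vline_sq ?_).const_mul _).const_mul _
      positivity
  · exact ((hG x hx).halfLineTaylor hc).norm_term_le hs0 le_rfl n

/-- Functions with uniform Gevrey asymptotics on a union of Borel discs are glued from Laplace
transforms. -/
theorem isGluedFromLaplace_of_gevrey {f : ℂ × ℂ → ℂ} {fk : ℕ → ℂ → ℂ} {U S : Set ℂ} {Θ : Set ℝ}
    (hU : IsOpen U) (hΘ : Θ.Nonempty) {δ C M : ℝ} (hδ : 0 < δ) (hC : 0 < C) (hM : 0 < M)
    (hS : ∀ θ ∈ Θ, borelDisc θ δ ⊆ S) (hf : DifferentiableOn ℂ f (U ×ˢ S))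
    (hfk : ∀ k, DifferentiableOn ℂ (fk k) U) (hb : HasGevreyBounds f fk (fun _ => 1) U S C M) :
    IsGluedFromLaplace f fk U S Θ := by
  classical
  have hG : ∀ θ ∈ Θ, ∀ x ∈ U,
      GevreyHalfPlane (fun w => f (x, Complex.exp ((θ : ℂ) * Complex.I) / w))
      (fun k => fk k x * Complex.exp ((θ : ℂ) * Complex.I) ^ k) (1 / δ) C M := by
    intro θ hθ x hx
    refine gevreyHalfPlane_of_borelDisc (F := fun ħ => f (x, ħ)) (g := fun k => fk k x) hδ hC.le hM
      ?_ fun n ħ hħ => ?_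
    · exact hf.comp (by fun_prop) fun ħ hħ => ⟨hx, hS θ hθ hħ⟩
    · simpa [remainder] using hb n x hx ħ (hS θ hθ hħ)
  set B : ℂ → ℝ → ℂ → ℂ := fun x θ ξ => borelTransform (fun ħ => f (x, ħ)) (fun k => fk k x) θ δ ξ
    with hB
  have h63 : 1 / (6 * M) ≤ 1 / (3 * M) := one_div_le_one_div_of_le (by positivity) (by linarith)
  have hstrip : ∀ θ, rayStrip θ (1 / (6 * M)) ⊆ rayStrip θ (1 / (3 * M)) :=
    fun θ ξ ⟨t, ht, h⟩ => ⟨t, ht, h.trans_le h63⟩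
  -- Any strip containing ξ may be used, by `hagree`; the value 0 outside all strips plays no role.
  set φ : ℂ × ℂ → ℂ := fun p =>
    if h : ∃ θ ∈ Θ, p.2 ∈ rayStrip θ (1 / (6 * M)) then B p.1 h.choose p.2 else 0 with hφ
  -- Two strips meet in a convex set containing 0, and near 0 both transforms are the sum of the
  -- same series, which does not involve the direction; the identity theorem does the rest.
  have hagree : ∀ x ∈ U, ∀ θ ∈ Θ, ∀ θ' ∈ Θ, ∀ ξ, ξ ∈ rayStrip θ (1 / (3 * M)) →
      ξ ∈ rayStrip θ' (1 / (3 * M)) → B x θ ξ = B x θ' ξ := by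
    intro x hx θ hθ θ' hθ' ξ hξ hξ'
    have d1 := (differentiableOn_borelTransform (F := fun ħ => f (x, ħ)) (g := fun k => fk k x)
      (hG θ hθ x hx)).mono (Set.inter_subset_left (t := rayStrip θ' (1 / (3 * M))))
    have d2 := (differentiableOn_borelTransform (F := fun ħ => f (x, ħ)) (g := fun k => fk k x)
      (hG θ' hθ' x hx)).mono (Set.inter_subset_right (s := rayStrip θ (1 / (3 * M))))
    have ho := (isOpen_rayStrip θ (1 / (3 * M))).inter (isOpen_rayStrip θ' (1 / (3 * M)))
    have hη0 : 0 < 1 / (3 * M) := by positivity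
    have h0 : (0 : ℂ) ∈ rayStrip θ (1 / (3 * M)) ∩ rayStrip θ' (1 / (3 * M)) :=
      ⟨ball_subset_rayStrip _ _ (Metric.mem_ball_self hη0),
        ball_subset_rayStrip _ _ (Metric.mem_ball_self hη0)⟩
    refine (d1.analyticOnNhd ho).eqOn_of_preconnected_of_eventuallyEq (d2.analyticOnNhd ho)
      ((convex_rayStrip _ _).inter (convex_rayStrip _ _)).isPreconnected h0 ?_ ⟨hξ, hξ'⟩
    filter_upwards [Metric.ball_mem_nhds (0 : ℂ) hη0] with z hz
    have hz' : ‖z‖ < 1 / (3 * M) := by simpa only [mem_ball_zero_iff] using hz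
    exact (hasSum_borelTransform (F := fun ħ => f (x, ħ)) (g := fun k => fk k x)
      (hG θ hθ x hx) hz').unique (hasSum_borelTransform (F := fun ħ => f (x, ħ))
      (g := fun k => fk k x) (hG θ' hθ' x hx) hz')
  have hφB : ∀ x ∈ U, ∀ θ ∈ Θ, ∀ ξ ∈ rayStrip θ (1 / (6 * M)), φ (x, ξ) = B x θ ξ := by
    intro x hx θ hθ ξ hξ
    have h : ∃ θ ∈ Θ, ξ ∈ rayStrip θ (1 / (6 * M)) := ⟨θ, hθ, hξ⟩
    simp only [hφ]
    rw [dif_pos h]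
    exact hagree x hx _ h.choose_spec.1 _ hθ ξ (hstrip _ h.choose_spec.2) (hstrip _ hξ)
  set I := ∫ y : ℝ, 1 / ‖vline (1 / δ + 1) y‖ ^ 2 with hI
  have hI0 : 0 ≤ I := MeasureTheory.integral_nonneg fun y => by positivity
  have hbound : ∀ x ∈ U, ∀ ξ ∈ Metric.thickening (1 / (6 * M)) (infiniteSector Θ),
      ‖φ (x, ξ)‖ ≤ 2 * (C * M + 2 * C * M ^ 2 * I) * Real.exp ((1 / δ + 1) * ‖ξ‖) := by
    intro x hx ξ hξ
    obtain ⟨θ, hθ, hξ⟩ := mem_thickening_infiniteSector.1 hξ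
    rw [hφB x hx θ hθ ξ hξ]
    exact norm_borelTransform_le (hG θ hθ x hx) hξ
  refine ⟨φ, 1 / (6 * M), δ, 2 * (C * M + 2 * C * M ^ 2 * I), 1 / δ + 1, by positivity, hδ,
    by positivity, by positivity, ?_, hbound, ?_, ?_⟩
  · refine differentiableOn_prod_of_separately hU Metric.isOpen_thickening ?_ ?_ ?_
    · intro ξ hξ
      obtain ⟨θ, hθ, hξ⟩ := mem_thickening_infiniteSector.1 hξ
      refine (differentiableOn_borelTransform_param hU hδ hfk (fun ħ hħ => ?_) (hG θ hθ)
        (hstrip _ hξ)).congr fun x hx => hφB x hx θ hθ ξ hξ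
      exact hf.comp (by fun_prop) fun x hx => ⟨hx, hS θ hθ hħ⟩
    · intro x hx ξ hξ
      obtain ⟨θ, hθ, hξ⟩ := mem_thickening_infiniteSector.1 hξ
      have h1 := (differentiableOn_borelTransform (F := fun ħ => f (x, ħ)) (g := fun k => fk k x)
        (hG θ hθ x hx)).mono (hstrip θ)
      have hnhds := (isOpen_rayStrip θ (1 / (6 * M))).mem_nhds hξ
      refine ((h1.differentiableAt hnhds).congr_of_eventuallyEq ?_).differentiableWithinAt
      filter_upwards [hnhds] with ζ hζ using hφB x hx θ hθ ζ hζ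
    · intro x hx ξ hξ
      refine ⟨U, hU.mem_nhds hx, Metric.ball ξ 1 ∩ Metric.thickening (1 / (6 * M))
        (infiniteSector Θ), Filter.inter_mem (Metric.ball_mem_nhds _ one_pos)
        (Metric.isOpen_thickening.mem_nhds hξ), 2 * (C * M + 2 * C * M ^ 2 * I) *
        Real.exp ((1 / δ + 1) * (‖ξ‖ + 1)), fun x' hx' ξ' hξ' => ?_⟩
      refine (hbound x' hx' ξ' hξ'.2).trans ?_
      have : ‖ξ'‖ ≤ ‖ξ‖ + 1 := by
        have h1 := hξ'.1
        rw [Metric.mem_ball, dist_eq_norm] at h1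
        have h2 := norm_sub_norm_le ξ' ξ
        linarith
      gcongr
  · intro x hx ξ hξ
    obtain ⟨θ, hθ⟩ := hΘ
    rw [hφB x hx θ hθ ξ (ball_subset_rayStrip _ _ (by rwa [mem_ball_zero_iff]))]
    exact hasSum_borelTransform (F := fun ħ => f (x, ħ)) (g := fun k => fk k x)
      (hG θ hθ x hx) (hξ.trans_le h63)
  · intro θ hθ
    refine ⟨hS θ hθ, fun x hx ħ hħ => ?_⟩
    have h1 := laplace_borelTransform (F := fun ħ => f (x, ħ)) (g := fun k => fk k x)
      (hG θ hθ x hx) hħ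
    have heq : Set.EqOn (laplaceIntegrand φ θ x ħ) (fun t : ℝ =>
        Complex.exp (-((t : ℂ) * Complex.exp ((θ : ℂ) * Complex.I)) / ħ) *
        B x θ ((t : ℂ) * Complex.exp ((θ : ℂ) * Complex.I)) *
        Complex.exp ((θ : ℂ) * Complex.I)) (Set.Ioi 0) := by
      intro t ht
      simp only [laplaceIntegrand]
      rw [hφB x hx θ hθ]
      exact ⟨t, le_of_lt ht, by simpa using hM⟩
    refine ⟨h1.1.congr_fun heq.symm measurableSet_Ioi, ?_⟩
    rw [MeasureTheory.setIntegral_congr_fun measurableSet_Ioi heq]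
    exact h1.2

end

noncomputable section

/-! ### Unions of Borel discs are sectorial domains -/

/-- The union of the Borel discs of diameter `δ` bisected by the copolar directions. -/
def copolarDomain (ϑ₁ ϑ₂ δ : ℝ) : Set ℂ := ⋃ θ ∈ copolarArc ϑ₁ ϑ₂, borelDisc θ δ

/-- The polar coordinates `(φ, r)` of the points of `copolarDomain ϑ₁ ϑ₂ δ`. -/
def copolarCoords (ϑ₁ ϑ₂ δ : ℝ) : Set (ℝ × ℝ) :=
  {p | ∃ θ ∈ copolarArc ϑ₁ ϑ₂, |p.1 - θ| < Real.pi / 2 ∧ 0 < p.2 ∧ p.2 < δ * Real.cos (p.1 - θ)}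

theorem polar_mem_borelDisc_iff {θ δ φ r : ℝ} (hδ : 0 < δ) (hr : 0 < r) :
    (r : ℂ) * Complex.exp ((φ : ℂ) * Complex.I) ∈ borelDisc θ δ ↔ r < δ * Real.cos (φ - θ) := by
  have h1 : Complex.exp ((θ : ℂ) * Complex.I) / ((r : ℂ) * Complex.exp ((φ : ℂ) * Complex.I)) =
      ((1 / r : ℝ) : ℂ) * Complex.exp (((θ - φ : ℝ) : ℂ) * Complex.I) := by
    push_cast
    rw [sub_mul, Complex.exp_sub]
    have := Complex.exp_ne_zero ((φ : ℂ) * Complex.I)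
    have hr' : (r : ℂ) ≠ 0 := by exact_mod_cast hr.ne'
    field_simp
  simp only [borelDisc, Set.mem_ofPred_eq]
  rw [h1, Complex.re_ofReal_mul, Complex.exp_ofReal_mul_I_re, ← Real.cos_neg, neg_sub,
    one_div_mul_eq_div, div_lt_div_iff₀ hδ hr, one_mul, mul_comm]

theorem exists_polar_of_mem_borelDisc {θ δ : ℝ} (hδ : 0 < δ) {ħ : ℂ} (h : ħ ∈ borelDisc θ δ) :
    ∃ φ : ℝ, |φ - θ| < Real.pi / 2 ∧ ‖ħ‖ < δ * Real.cos (φ - θ) ∧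
      ħ = (‖ħ‖ : ℂ) * Complex.exp ((φ : ℂ) * Complex.I) := by
  have hħ0 := ne_zero_of_mem_borelDisc hδ h
  set u := Complex.exp ((θ : ℂ) * Complex.I) / ħ with hu
  have hre : 0 < u.re := lt_trans (by positivity) h
  have harg : |u.arg| < Real.pi / 2 := Complex.abs_arg_lt_pi_div_two_iff.2 (Or.inl hre)
  have hrep : ħ = (‖ħ‖ : ℂ) * Complex.exp (((θ - u.arg : ℝ) : ℂ) * Complex.I) := by
    have h1 := Complex.norm_mul_exp_arg_mul_I u
    have h2 : ‖u‖ = 1 / ‖ħ‖ := by rw [hu, norm_div, Complex.norm_exp_ofReal_mul_I]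
    rw [h2] at h1
    have h3 : (‖ħ‖ : ℂ) ≠ 0 := by exact_mod_cast (norm_pos_iff.2 hħ0).ne'
    have h4 := Complex.exp_ne_zero ((u.arg : ℂ) * Complex.I)
    have h5 : (1 / ‖ħ‖ : ℂ) * Complex.exp ((u.arg : ℂ) * Complex.I) * ħ =
        Complex.exp ((θ : ℂ) * Complex.I) := by
      push_cast at h1
      rw [h1, hu, div_mul_cancel₀ _ hħ0]
    push_cast
    rw [sub_mul, Complex.exp_sub, ← h5]
    field_simp
  refine ⟨θ - u.arg, by simpa using harg, ?_, hrep⟩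
  rw [hrep, polar_mem_borelDisc_iff hδ (norm_pos_iff.2 hħ0)] at h
  exact h

theorem copolarDomain_eq_image {ϑ₁ ϑ₂ δ : ℝ} (hδ : 0 < δ) :
    copolarDomain ϑ₁ ϑ₂ δ =
      (fun p : ℝ × ℝ => (p.2 : ℂ) * Complex.exp ((p.1 : ℂ) * Complex.I)) ''
        copolarCoords ϑ₁ ϑ₂ δ := by
  ext ħ
  simp only [copolarDomain, Set.mem_iUnion, exists_prop]
  constructor
  · rintro ⟨θ, hθ, h⟩
    obtain ⟨φ, h1, h2, h3⟩ := exists_polar_of_mem_borelDisc hδ h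
    exact ⟨(φ, ‖ħ‖), ⟨θ, hθ, h1, norm_pos_iff.2 (ne_zero_of_mem_borelDisc hδ h), h2⟩, h3.symm⟩
  · rintro ⟨⟨φ, r⟩, ⟨θ, hθ, -, h2, h3⟩, rfl⟩
    exact ⟨θ, hθ, (polar_mem_borelDisc_iff hδ h2).2 h3⟩

/-- By concavity of the cosine on [-π/2, π/2], the condition r < δ cos(φ - θ) is convex jointly in
φ, r and θ. Eliminating θ from its interval is a projection and preserves convexity. -/
theorem convex_copolarCoords {ϑ₁ ϑ₂ δ : ℝ} (hδ : 0 < δ) : Convex ℝ (copolarCoords ϑ₁ ϑ₂ δ) := by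
  rintro ⟨φ, r⟩ ⟨θ, hθ, h1, h2, h3⟩ ⟨φ', r'⟩ ⟨θ', hθ', h1', h2', h3'⟩ a b ha hb hab
  simp only at h1 h2 h3 h1' h2' h3'
  have hc := strictConcaveOn_cos_Icc.concaveOn.2 (abs_le.1 h1.le) (abs_le.1 h1'.le) ha hb hab
  have hmem := convex_Icc _ _ hθ hθ' ha hb hab
  simp only [smul_eq_mul] at hc hmem
  refine ⟨a * θ + b * θ', hmem, ?_⟩
  simp only [Prod.smul_mk, Prod.mk_add_mk, smul_eq_mul]
  have e : a * φ + b * φ' - (a * θ + b * θ') = a * (φ - θ) + b * (φ' - θ') := by ring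
  rw [e]
  rw [abs_lt] at *
  rcases ha.eq_or_lt with rfl | ha
  · obtain rfl : b = 1 := by linarith
    simp only [zero_mul, zero_add, one_mul]
    exact ⟨h1', h2', h3'⟩
  · refine ⟨⟨?_, ?_⟩, by positivity, ?_⟩ <;> nlinarith

theorem mem_Ioo_of_mem_copolarCoords {ϑ₁ ϑ₂ δ : ℝ} {p : ℝ × ℝ} (hp : p ∈ copolarCoords ϑ₁ ϑ₂ δ) :
    p.1 ∈ Set.Ioo ϑ₁ ϑ₂ ∧ 0 < p.2 := by
  obtain ⟨θ, hθ, h1, h2, -⟩ := hp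
  rw [abs_lt] at h1
  exact ⟨⟨by linarith [hθ.1], by linarith [hθ.2]⟩, h2⟩

theorem arg_polar_rotate {φ m r : ℝ} (hr : 0 < r) (h : |φ - m| < Real.pi) :
    m + Complex.arg ((r : ℂ) * Complex.exp ((φ : ℂ) * Complex.I) *
      Complex.exp (-((m : ℂ) * Complex.I))) = φ := by
  have : (r : ℂ) * Complex.exp ((φ : ℂ) * Complex.I) * Complex.exp (-((m : ℂ) * Complex.I)) =
      (r : ℂ) * Complex.exp (((φ - m : ℝ) : ℂ) * Complex.I) := by
    rw [mul_assoc, ← Complex.exp_add]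
    congr 2
    push_cast
    ring
  rw [this, Complex.exp_mul_I, Complex.arg_mul_cos_add_sin_mul_I hr]
  · ring
  · rw [abs_lt] at h
    exact ⟨h.1, h.2.le⟩

/-- Polar coordinates identify the domain with a convex set. All angles are at distance less than π
from the midpoint m of the arc, even for |A| = 2π, so the argument after rotation by -m is a
continuous inverse. -/
theorem isSimplyConnected_copolarDomain {ϑ₁ ϑ₂ δ : ℝ} (hδ : 0 < δ) (hA₁ : Real.pi ≤ ϑ₂ - ϑ₁)
    (hA₂ : ϑ₂ - ϑ₁ ≤ 2 * Real.pi) : IsSimplyConnected (copolarDomain ϑ₁ ϑ₂ δ) := by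
  have hpi := Real.pi_pos
  set m := (ϑ₁ + ϑ₂) / 2 with hm
  have hφm : ∀ p ∈ copolarCoords ϑ₁ ϑ₂ δ, |p.1 - m| < Real.pi := by
    intro p hp
    have := (mem_Ioo_of_mem_copolarCoords hp).1
    rw [abs_lt]
    constructor <;> linarith [this.1, this.2]
  set F : ℝ × ℝ → ℂ := fun p => (p.2 : ℂ) * Complex.exp ((p.1 : ℂ) * Complex.I) with hF
  set Gm : ℂ → ℝ × ℝ := fun ħ => (m + Complex.arg (ħ * Complex.exp (-((m : ℂ) * Complex.I))), ‖ħ‖)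
    with hGm
  have hGF : ∀ p ∈ copolarCoords ϑ₁ ϑ₂ δ, Gm (F p) = p := by
    intro p hp
    have h0 := (mem_Ioo_of_mem_copolarCoords hp).2
    ext
    · exact arg_polar_rotate h0 (hφm p hp)
    · simp [hGm, hF, Complex.norm_exp_ofReal_mul_I, abs_of_pos h0]
  have hFmem : ∀ p ∈ copolarCoords ϑ₁ ϑ₂ δ, F p ∈ copolarDomain ϑ₁ ϑ₂ δ := fun p hp => by
    rw [copolarDomain_eq_image hδ]; exact ⟨p, hp, rfl⟩
  have hGmem : ∀ ħ ∈ copolarDomain ϑ₁ ϑ₂ δ, Gm ħ ∈ copolarCoords ϑ₁ ϑ₂ δ ∧ F (Gm ħ) = ħ := by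
    intro ħ hħ
    rw [copolarDomain_eq_image hδ] at hħ
    obtain ⟨p, hp, rfl⟩ := hħ
    have := hGF p hp
    simp only [hF] at this ⊢
    rw [this]
    exact ⟨hp, rfl⟩
  have hGc : ContinuousOn Gm (copolarDomain ϑ₁ ϑ₂ δ) := by
    refine ContinuousOn.prodMk (continuousOn_const.add ?_) continuous_norm.continuousOn
    refine Complex.continuousOn_arg.comp (by fun_prop) ?_
    intro ħ hħ
    rw [copolarDomain_eq_image hδ] at hħ
    obtain ⟨p, hp, rfl⟩ := hħ
    have h0 := (mem_Ioo_of_mem_copolarCoords hp).2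
    have h1 := arg_polar_rotate h0 (hφm p hp)
    have h2 := abs_lt.1 (hφm p hp)
    rw [Complex.mem_slitPlane_iff_arg]
    refine ⟨fun h => ?_, ?_⟩
    · simp only at h
      linarith
    · simp [Complex.exp_ne_zero, h0.ne']
  let e : copolarCoords ϑ₁ ϑ₂ δ ≃ₜ copolarDomain ϑ₁ ϑ₂ δ :=
    { toFun := fun p => ⟨F p, hFmem p p.2⟩
      invFun := fun ħ => ⟨Gm ħ, (hGmem ħ ħ.2).1⟩
      left_inv := fun p => Subtype.ext (hGF p p.2)
      right_inv := fun ħ => Subtype.ext (hGmem ħ ħ.2).2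
      continuous_toFun := by
        refine Continuous.subtype_mk ?_ _
        simp only [hF]
        fun_prop
      continuous_invFun := by
        refine Continuous.subtype_mk ?_ _
        exact hGc.domRestrict }
  have hne : (copolarCoords ϑ₁ ϑ₂ δ).Nonempty := by
    refine ⟨(ϑ₁ + Real.pi / 2, δ / 2), ϑ₁ + Real.pi / 2, ⟨le_rfl, by linarith⟩, ?_, ?_, ?_⟩
    · simp [hpi]
    · simp [hδ]
    · simp [hδ]
  have : ContractibleSpace (copolarCoords ϑ₁ ϑ₂ δ) := (convex_copolarCoords hδ).contractibleSpace hne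
  have h1 : SimplyConnectedSpace (copolarCoords ϑ₁ ϑ₂ δ) := inferInstance
  exact e.toHomotopyEquiv.simplyConnectedSpace_iff.1 h1

/-- The direction θ is φ clamped to the copolar arc. The angular margin κ then gives cos(φ - θ) ≥
sin κ, hence a sector of radius δ sin κ. -/
theorem exists_copolar_near {ϑ₁ ϑ₂ φ₁ φ₂ φ κ : ℝ} (hA₁ : Real.pi ≤ ϑ₂ - ϑ₁)
    (hκ₁ : κ ≤ φ₁ - ϑ₁) (hκ₂ : κ ≤ ϑ₂ - φ₂) (hκ : κ ≤ Real.pi / 2) (hφ : φ ∈ Set.Icc φ₁ φ₂) :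
    ∃ θ ∈ copolarArc ϑ₁ ϑ₂, |φ - θ| ≤ Real.pi / 2 - κ := by
  obtain ⟨h1, h2⟩ := hφ
  by_cases c1 : φ < ϑ₁ + Real.pi / 2
  · refine ⟨ϑ₁ + Real.pi / 2, ⟨le_rfl, by linarith⟩, ?_⟩
    rw [abs_le]; constructor <;> linarith
  · by_cases c2 : ϑ₂ - Real.pi / 2 < φ
    · refine ⟨ϑ₂ - Real.pi / 2, ⟨by linarith, le_rfl⟩, ?_⟩
      rw [abs_le]; constructor <;> linarith
    · refine ⟨φ, ⟨by linarith, by linarith⟩, ?_⟩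
      simp
      linarith

theorem isSectorialDomain_copolarDomain {ϑ₁ ϑ₂ δ : ℝ} (hδ : 0 < δ) (hA₁ : Real.pi ≤ ϑ₂ - ϑ₁)
    (hA₂ : ϑ₂ - ϑ₁ ≤ 2 * Real.pi) : IsSectorialDomain (copolarDomain ϑ₁ ϑ₂ δ) ϑ₁ ϑ₂ := by
  have hpi := Real.pi_pos
  have hsector : ∀ φ₁ φ₂ : ℝ, ϑ₁ < φ₁ → φ₁ ≤ φ₂ → φ₂ < ϑ₂ →
      ∃ R > 0, straightSector (Set.Icc φ₁ φ₂) R ⊆ copolarDomain ϑ₁ ϑ₂ δ := by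
    intro φ₁ φ₂ h1 h12 h2
    set κ := min (min (φ₁ - ϑ₁) (ϑ₂ - φ₂)) (Real.pi / 2) with hκ
    have hκ0 : 0 < κ := lt_min (lt_min (by linarith) (by linarith)) (by linarith)
    have k1 : κ ≤ φ₁ - ϑ₁ := (min_le_left _ _).trans (min_le_left _ _)
    have k2 : κ ≤ ϑ₂ - φ₂ := (min_le_left _ _).trans (min_le_right _ _)
    have k3 : κ ≤ Real.pi / 2 := min_le_right _ _
    have hsin : 0 < Real.sin κ := Real.sin_pos_of_pos_of_lt_pi hκ0 (by linarith)
    refine ⟨δ * Real.sin κ, by positivity, ?_⟩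
    rintro _ ⟨r, hr0, hr, φ, hφ, rfl⟩
    obtain ⟨θ, hθ, hφθ⟩ := exists_copolar_near hA₁ k1 k2 k3 hφ
    simp only [copolarDomain, Set.mem_iUnion, exists_prop]
    refine ⟨θ, hθ, (polar_mem_borelDisc_iff hδ hr0).2 (hr.trans_le ?_)⟩
    gcongr
    rw [← Real.cos_pi_div_two_sub, ← Real.cos_abs (φ - θ)]
    exact Real.cos_le_cos_of_nonneg_of_le_pi (abs_nonneg _) (by linarith) hφθ
  refine ⟨isOpen_biUnion fun θ _ => isOpen_borelDisc θ δ hδ,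
    isSimplyConnected_copolarDomain hδ hA₁ hA₂, ?_, ?_, hsector,
    fun θ hθ => ⟨δ, hδ, Set.subset_biUnion_of_mem (u := fun θ => borelDisc θ δ) hθ⟩⟩
  · intro h
    simp only [copolarDomain, Set.mem_iUnion, exists_prop] at h
    obtain ⟨θ, -, h⟩ := h
    exact ne_zero_of_mem_borelDisc hδ h rfl
  · set E : ℝ → ℂ := fun φ => Complex.exp ((φ : ℂ) * Complex.I) with hE
    have hEc : Continuous E := by simp only [hE]; fun_prop
    apply Set.Subset.antisymm
    · have hclosed : IsClosed (E '' Set.Icc ϑ₁ ϑ₂) := (isCompact_Icc.image hEc).isClosed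
      have hsub : closure ((fun ħ : ℂ => (‖ħ‖, ħ / (‖ħ‖ : ℂ))) '' copolarDomain ϑ₁ ϑ₂ δ) ⊆
          Prod.snd ⁻¹' (E '' Set.Icc ϑ₁ ϑ₂) := by
        refine closure_minimal ?_ (hclosed.preimage continuous_snd)
        rw [copolarDomain_eq_image hδ]
        rintro _ ⟨_, ⟨p, hp, rfl⟩, rfl⟩
        obtain ⟨h1, h2⟩ := mem_Ioo_of_mem_copolarCoords hp
        refine ⟨p.1, Set.Ioo_subset_Icc_self h1, ?_⟩
        have : (p.2 : ℂ) ≠ 0 := by exact_mod_cast h2.ne'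
        simp only [norm_mul, Complex.norm_exp_ofReal_mul_I, mul_one, Complex.norm_real,
          Real.norm_of_nonneg h2.le, hE]
        field_simp
      intro u hu
      exact hsub hu
    · have hcl : IsClosed (limitDirections (copolarDomain ϑ₁ ϑ₂ δ)) :=
        isClosed_closure.preimage (by fun_prop : Continuous fun u : ℂ => ((0 : ℝ), u))
      -- Interior directions are limits along their own rays; the two end points follow because the
      -- set of limit directions is closed.
      have hopen : Set.MapsTo E (Set.Ioo ϑ₁ ϑ₂) (limitDirections (copolarDomain ϑ₁ ϑ₂ δ)) := by
        intro φ hφ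
        obtain ⟨R, hR, hsub⟩ := hsector φ φ hφ.1 le_rfl hφ.2
        have hlim : Filter.Tendsto (fun r : ℝ => (r, E φ)) (𝓝[>] 0) (𝓝 ((0 : ℝ), E φ)) := by
          have : Continuous fun r : ℝ => (r, E φ) := by fun_prop
          exact (this.tendsto 0).mono_left nhdsWithin_le_nhds
        refine mem_closure_of_tendsto hlim ?_
        filter_upwards [Ioo_mem_nhdsGT hR] with r hr
        refine ⟨(r : ℂ) * E φ, hsub ⟨r, hr.1, hr.2, φ, ⟨le_rfl, le_rfl⟩, rfl⟩, ?_⟩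
        have : (r : ℂ) ≠ 0 := by exact_mod_cast hr.1.ne'
        simp only [hE, norm_mul, Complex.norm_exp_ofReal_mul_I, mul_one, Complex.norm_real,
          Real.norm_of_nonneg hr.1.le]
        congr 1
        field_simp
      rintro _ ⟨φ, hφ, rfl⟩
      have h1 : φ ∈ closure (Set.Ioo ϑ₁ ϑ₂) := by
        rw [closure_Ioo (by linarith : ϑ₁ < ϑ₂).ne]; exact hφ
      exact (hopen.closure hEc) h1 |> fun h => by rwa [hcl.closure_eq] at h

end

noncomputable section

/-! ### Normalized remainders of formal power series -/

/-- `ρ n` are the normalized remainders at `ħ` with respect to the formal power series `∑ gₖ ħᵏ` of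
a quantity with value `ρ 0`; at `ħ = 0` they are the coefficients themselves. -/
def IsTail (ħ : ℂ) (g ρ : ℕ → ℂ) : Prop := ∀ n, ρ n = g n + ħ * ρ (n + 1)

/-- Normalized remainders of a product. -/
def tailProd (g ρ ρ' : ℕ → ℂ) (n : ℕ) : ℂ :=
  ρ n * ρ' 0 + ∑ k ∈ Finset.range n, g k * ρ' (n - k)

theorem isTail_remainder {ħ : ℂ} (hħ : ħ ≠ 0) (g : ℕ → ℂ) (v : ℂ) :
    IsTail ħ g fun n => (v - ∑ k ∈ Finset.range n, g k * ħ ^ k) / ħ ^ n := by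
  intro n
  have h1 : ħ ^ n ≠ 0 := pow_ne_zero _ hħ
  simp only [Finset.sum_range_succ, pow_succ]
  field_simp
  ring

/-- For ħ ≠ 0 the relation determines each remainder from the preceding one; for ħ = 0 it says that
the remainders are the coefficients. -/
theorem IsTail.eq_of_zero {ħ : ℂ} {g ρ ρ' : ℕ → ℂ} (h : IsTail ħ g ρ) (h' : IsTail ħ g ρ')
    (h0 : ρ 0 = ρ' 0) : ρ = ρ' := by
  ext n
  by_cases hħ : ħ = 0
  · rw [h n, h' n, hħ]; simp
  · induction n with
    | zero => exact h0
    | succ n ih =>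
      have e1 := h n
      rw [ih, h' n] at e1
      exact (mul_left_cancel₀ hħ (add_left_cancel e1)).symm

theorem IsTail.add {ħ : ℂ} {g g' ρ ρ' : ℕ → ℂ} (h : IsTail ħ g ρ) (h' : IsTail ħ g' ρ') :
    IsTail ħ (fun n => g n + g' n) (fun n => ρ n + ρ' n) := fun n => by
  simp only [h n, h' n]
  ring

/-- `tailProd g g g'` is the Cauchy product, so one algebra governs formal coefficients and exact
remainders, and later one estimate bounds both. -/
theorem IsTail.mul {ħ : ℂ} {g g' ρ ρ' : ℕ → ℂ} (h : IsTail ħ g ρ) (h' : IsTail ħ g' ρ') :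
    IsTail ħ (tailProd g g g') (tailProd g ρ ρ') := by
  intro n
  have e1 : ∀ k ∈ Finset.range n, g k * ρ' (n - k) = g k * g' (n - k) +
      ħ * (g k * ρ' (n + 1 - k)) := by
    intro k hk
    rw [h' (n - k), Nat.sub_add_comm (Finset.mem_range.1 hk).le]
    ring
  simp only [tailProd]
  rw [Finset.sum_congr rfl e1, Finset.sum_add_distrib, ← Finset.mul_sum, Finset.sum_range_succ,
    add_tsub_cancel_left, h n]
  have e2 := h' 0
  simp only [zero_add] at e2
  rw [mul_add, mul_add]
  linear_combination g n * e2

/-- The part of the Riccati recursion of order `n` that involves only terms of order `< n` of the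
unknown. -/
def riccatiRest (a b f ρa ρb ρc ρf : ℕ → ℂ) (n : ℕ) : ℂ :=
  ρa n * ρf 0 ^ 2 + a 0 * ∑ k ∈ Finset.Ico 1 n, f k * ρf (n - k) +
    ∑ k ∈ Finset.Ico 1 n, a k * tailProd f ρf ρf (n - k) +
    ρb n * ρf 0 + ∑ k ∈ Finset.Ico 1 n, b k * ρf (n - k) + ρc n

theorem tailProd_succ (g ρ ρ' : ℕ → ℂ) {n : ℕ} (hn : 1 ≤ n) :
    tailProd g ρ ρ' n = ρ n * ρ' 0 + g 0 * ρ' n + ∑ k ∈ Finset.Ico 1 n, g k * ρ' (n - k) := by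
  rw [tailProd, Finset.range_eq_Ico, Finset.sum_eq_sum_Ico_succ_bot (by omega : 0 < n)]
  simp
  ring

/-- This isolates the unknown of highest order. Its factor is the linearisation of the quadratic,
which for the formal solution is 2a₀f₀ + b₀ = ε√D₀ and so can be divided by. -/
theorem riccati_tail_eq (a b f ρa ρb ρc ρf : ℕ → ℂ) {n : ℕ} (hn : 1 ≤ n) :
    tailProd a ρa (tailProd f ρf ρf) n + tailProd b ρb ρf n + ρc n =
      (a 0 * (ρf 0 + f 0) + b 0) * ρf n + riccatiRest a b f ρa ρb ρc ρf n := by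
  rw [tailProd_succ a _ _ hn, tailProd_succ b _ _ hn, tailProd_succ f _ _ hn, riccatiRest]
  simp [tailProd]
  ring

/-- The normalized remainders of a solution of the Riccati equation. -/
theorem riccati_tail {ħ : ℂ} {a b c f f' ρa ρb ρc ρf ρf' : ℕ → ℂ} (ha : IsTail ħ a ρa)
    (hb : IsTail ħ b ρb) (hc : IsTail ħ c ρc) (hf : IsTail ħ f ρf) (hf' : IsTail ħ f' ρf')
    (hformal : ∀ n, (Nat.casesOn n 0 f' : ℂ) =
      tailProd a a (tailProd f f f) n + tailProd b b f n + c n)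
    (hric : ħ * ρf' 0 = ρa 0 * ρf 0 ^ 2 + ρb 0 * ρf 0 + ρc 0) (n : ℕ) :
    (a 0 * (ρf 0 + f 0) + b 0) * ρf (n + 1) =
      ρf' n - riccatiRest a b f ρa ρb ρc ρf (n + 1) := by
  have h1 := ((ha.mul (hf.mul hf)).add (hb.mul hf)).add hc
  -- Multiplication by ħ shifts orders by one: the remainder of order 0 is the value ħ · ρf' 0, and
  -- that of order n + 1 is ρf' n.
  have h2 : IsTail ħ (fun n => (Nat.casesOn n 0 f' : ℂ)) (fun n => Nat.casesOn n (ħ * ρf' 0) ρf') := by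
    intro n
    cases n with
    | zero => simp
    | succ n => exact hf' n
  have h3 := h2
  rw [show (fun n => (Nat.casesOn n 0 f' : ℂ)) = _ from funext hformal] at h3
  have h4 := h1.eq_of_zero h3 (by simp [tailProd]; linear_combination -hric)
  have h5 := congrFun h4 (n + 1)
  rw [riccati_tail_eq _ _ _ _ _ _ _ (by omega)] at h5
  linear_combination h5

/-- Well-founded recursion in which entries of index at least n are filled with `default`; the
hypothesis says that they do not influence the n-th step. -/
theorem exists_seq_of_rec {α : Type*} [Inhabited α] (Φ : ℕ → (ℕ → α) → α)
    (hΦ : ∀ n e e', (∀ k < n, e k = e' k) → Φ n e = Φ n e') : ∃ s : ℕ → α, ∀ n, s n = Φ n s := by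
  classical
  let G : ∀ n : ℕ, (∀ m : ℕ, m < n → α) → α := fun n prev =>
    Φ n fun k => if h : k < n then prev k h else default
  refine ⟨Nat.lt_wfRel.wf.fix G, fun n => ?_⟩
  rw [Nat.lt_wfRel.wf.fix_eq]
  refine hΦ n _ _ fun k hk => ?_
  rw [dif_pos hk]

theorem tailProd_congr {f f' : ℕ → ℂ} {n : ℕ} (h : ∀ k ≤ n, f k = f' k) :
    tailProd f f f n = tailProd f' f' f' n := by
  simp only [tailProd]
  rw [h n le_rfl, h 0 (Nat.zero_le _)]
  congr 1
  refine Finset.sum_congr rfl fun k hk => ?_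
  rw [h k (Finset.mem_range.1 hk).le, h (n - k) (Nat.sub_le _ _)]

theorem riccatiRest_congr (a b c : ℕ → ℂ) {f f' : ℕ → ℂ} {n : ℕ} (hn : 1 ≤ n)
    (h : ∀ k < n, f k = f' k) :
    riccatiRest a b f a b c f n = riccatiRest a b f' a b c f' n := by
  simp only [riccatiRest]
  rw [h 0 (by omega)]
  have e1 : ∀ k ∈ Finset.Ico 1 n, f k * f (n - k) = f' k * f' (n - k) := fun k hk => by
    have := Finset.mem_Ico.1 hk
    rw [h k (by omega), h (n - k) (by omega)]
  have e2 : ∀ k ∈ Finset.Ico 1 n, a k * tailProd f f f (n - k) = a k * tailProd f' f' f' (n - k) :=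
    fun k hk => by
      have := Finset.mem_Ico.1 hk
      rw [tailProd_congr fun j hj => h j (by omega)]
  have e3 : ∀ k ∈ Finset.Ico 1 n, b k * f (n - k) = b k * f' (n - k) := fun k hk => by
    have := Finset.mem_Ico.1 hk
    rw [h (n - k) (by omega)]
  rw [Finset.sum_congr rfl e1, Finset.sum_congr rfl e2, Finset.sum_congr rfl e3]

theorem coeff_mk_mul_mk (g h : ℕ → ℂ) (n : ℕ) :
    PowerSeries.coeff n (PowerSeries.mk g * PowerSeries.mk h) = tailProd g g h n := by
  rw [PowerSeries.coeff_mul, Finset.Nat.sum_antidiagonal_eq_sum_range_succ_mk,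
    Finset.sum_range_succ, tailProd]
  simp
  ring

theorem mk_mul_mk (g h : ℕ → ℂ) :
    PowerSeries.mk g * PowerSeries.mk h = PowerSeries.mk (tailProd g g h) := by
  ext n
  rw [coeff_mk_mul_mk, PowerSeries.coeff_mk]

theorem formal_riccati_iff (a b c f f' : ℕ → ℂ) :
    ((PowerSeries.X * PowerSeries.mk f' : PowerSeries ℂ) = PowerSeries.mk a * PowerSeries.mk f ^ 2 +
      PowerSeries.mk b * PowerSeries.mk f + PowerSeries.mk c) ↔
    ∀ n, (Nat.casesOn n 0 f' : ℂ) = tailProd a a (tailProd f f f) n + tailProd b b f n + c n := by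
  rw [sq, mk_mul_mk f f, mk_mul_mk a, mk_mul_mk b, PowerSeries.ext_iff]
  refine forall_congr' fun n => ?_
  cases n with
  | zero => simp
  | succ n => simp [PowerSeries.coeff_succ_X_mul]

theorem formal_riccati_iff' (a b c f f' : ℕ → ℂ) :
    (∀ n, (Nat.casesOn n 0 f' : ℂ) = tailProd a a (tailProd f f f) n + tailProd b b f n + c n) ↔
    a 0 * f 0 ^ 2 + b 0 * f 0 + c 0 = 0 ∧
    ∀ n, (2 * a 0 * f 0 + b 0) * f (n + 1) = f' n - riccatiRest a b f a b c f (n + 1) := by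
  constructor
  · intro h
    refine ⟨?_, fun n => ?_⟩
    · have := h 0
      simp [tailProd] at this
      linear_combination -this
    · have := h (n + 1)
      rw [riccati_tail_eq _ _ _ _ _ _ _ (by omega)] at this
      simp only at this
      linear_combination -this
  · rintro ⟨h0, h⟩ n
    cases n with
    | zero =>
      simp [tailProd]
      linear_combination -h0
    | succ n =>
      rw [riccati_tail_eq _ _ _ _ _ _ _ (by omega)]
      simp only
      linear_combination -(h n)

/-! ### The formal solution -/

/-- Each order is a linear equation for the next coefficient with nonvanishing factor 2a₀f₀ + b₀, so
all coefficients are obtained by differentiation, algebra and division, and remain holomorphic on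
the same set. -/
theorem exists_formal_solution {ak bk ck : ℕ → ℂ → ℂ} {f0 : ℂ → ℂ} {U : Set ℂ} (hU : IsOpen U)
    (hak : ∀ k, DifferentiableOn ℂ (ak k) U) (hbk : ∀ k, DifferentiableOn ℂ (bk k) U)
    (hck : ∀ k, DifferentiableOn ℂ (ck k) U) (hf0 : DifferentiableOn ℂ f0 U)
    (hne : ∀ x ∈ U, 2 * ak 0 x * f0 x + bk 0 x ≠ 0)
    (h0 : ∀ x ∈ U, ak 0 x * f0 x ^ 2 + bk 0 x * f0 x + ck 0 x = 0) :
    ∃ fk : ℕ → ℂ → ℂ, fk 0 = f0 ∧ IsFormalSolution ak bk ck fk U := by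
  classical
  obtain ⟨s, hs⟩ := exists_seq_of_rec (α := ℂ → ℂ) (fun n e => Nat.casesOn n f0 fun m x =>
      (deriv (e m) x - riccatiRest (fun k => ak k x) (fun k => bk k x) (fun k => e k x)
        (fun k => ak k x) (fun k => bk k x) (fun k => ck k x) (fun k => e k x) (m + 1)) /
        (2 * ak 0 x * f0 x + bk 0 x)) (by
    intro n e e' h
    cases n with
    | zero => rfl
    | succ m =>
      ext x
      simp only
      rw [h m (by omega), riccatiRest_congr _ _ _ (by omega) fun k hk => by rw [h k hk]])
  have hs0 : s 0 = f0 := hs 0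
  have hss : ∀ m x, s (m + 1) x = (deriv (s m) x - riccatiRest (fun k => ak k x)
      (fun k => bk k x) (fun k => s k x) (fun k => ak k x) (fun k => bk k x) (fun k => ck k x)
      (fun k => s k x) (m + 1)) / (2 * ak 0 x * f0 x + bk 0 x) := fun m x => by
    conv_lhs => rw [hs (m + 1)]
  have hdiff : ∀ n, DifferentiableOn ℂ (s n) U := by
    intro n
    induction n using Nat.strong_induction_on with
    | _ n ih =>
      cases n with
      | zero => rw [hs0]; exact hf0
      | succ m =>
        rw [show s (m + 1) = _ from funext (hss m)]
        have hprod : ∀ j < m + 1, DifferentiableOn ℂ (fun x => tailProd (fun k => s k x)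
            (fun k => s k x) (fun k => s k x) j) U := by
          intro j hj
          refine ((ih j hj).mul (ih 0 (by omega))).fun_add
            (DifferentiableOn.fun_sum fun k hk => ?_)
          have := Finset.mem_range.1 hk
          exact (ih k (by omega)).mul (ih (j - k) (by omega))
        refine DifferentiableOn.div (((ih m (by omega)).deriv hU).fun_sub ?_) ?_ hne
        · unfold riccatiRest
          refine (((((((hak _).mul ((ih 0 (by omega)).pow 2))).fun_add ((hak 0).mul
            (DifferentiableOn.fun_sum fun k hk => ?_))).fun_add
            (DifferentiableOn.fun_sum fun k hk => ?_)).fun_add ((hbk _).mul (ih 0 (by omega)))).fun_add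
            (DifferentiableOn.fun_sum fun k hk => ?_)).fun_add (hck _)
          all_goals have := Finset.mem_Ico.1 hk
          · exact (ih k (by omega)).mul (ih _ (by omega))
          · exact (hak k).mul (hprod _ (by omega))
          · exact (hbk k).mul (ih _ (by omega))
        · exact (((hak 0).const_mul 2).mul hf0).fun_add (hbk 0)
  refine ⟨s, hs0, hdiff, fun x hx => ?_⟩
  rw [formal_riccati_iff, formal_riccati_iff']
  refine ⟨?_, fun n => ?_⟩
  · simp only [hs0]; exact h0 x hx
  · rw [hss n x, hs0, mul_div_cancel₀ _ (hne x hx)]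

theorem formal_solution_unique {ak bk ck fk gk : ℕ → ℂ → ℂ} {U : Set ℂ} (hU : IsOpen U)
    (hf : IsFormalSolution ak bk ck fk U) (hg : IsFormalSolution ak bk ck gk U)
    (hne : ∀ x ∈ U, 2 * ak 0 x * fk 0 x + bk 0 x ≠ 0) (h0 : Set.EqOn (gk 0) (fk 0) U) (k : ℕ) :
    Set.EqOn (gk k) (fk k) U := by
  induction k using Nat.strong_induction_on with
  | _ k ih =>
    cases k with
    | zero => exact h0
    | succ n =>
      intro x hx
      have e1 := ((formal_riccati_iff' _ _ _ _ _).1 ((formal_riccati_iff _ _ _ _ _).1 (hf.2 x hx))).2 n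
      have e2 := ((formal_riccati_iff' _ _ _ _ _).1 ((formal_riccati_iff _ _ _ _ _).1 (hg.2 x hx))).2 n
      have e3 : deriv (gk n) x = deriv (fk n) x :=
        ((ih n (by omega)).eventuallyEq_of_mem (hU.mem_nhds hx)).deriv_eq
      rw [riccatiRest_congr (f' := fun k => fk k x) _ _ _ (by omega) fun k hk => ih k hk hx, e3,
        ← e1, h0 hx] at e2
      exact mul_left_cancel₀ (hne x hx) e2

end

noncomputable section

/-! ### Gevrey bounds for solutions of the Riccati equation -/

/-- The weights in the Gevrey estimates at distance `d` from the boundary. -/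
def gevreyWeight (M d : ℝ) (n : ℕ) : ℝ := M ^ (n - 1) * n.factorial / d ^ n

theorem gevreyWeight_nonneg {M d : ℝ} (hM : 0 ≤ M) (hd : 0 ≤ d) (n : ℕ) :
    0 ≤ gevreyWeight M d n := by
  unfold gevreyWeight
  positivity

theorem factorial_mul_factorial_le_pred (p q : ℕ) :
    (p + 1).factorial * (q + 1).factorial ≤ (p + q + 1).factorial := by
  induction q with
  | zero => simp
  | succ q ih =>
    rw [Nat.factorial_succ (q + 1), show p + (q + 1) + 1 = (p + q + 1) + 1 by ring,
      Nat.factorial_succ (p + q + 1)]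
    calc (p + 1).factorial * ((q + 1 + 1) * (q + 1).factorial)
        = (q + 1 + 1) * ((p + 1).factorial * (q + 1).factorial) := by ring
      _ ≤ (p + q + 1 + 1) * (p + q + 1).factorial := Nat.mul_le_mul (by omega) ih

/-- For 1 ≤ k < m each summand is at most (m - 1)!, and there are m - 1 of them. -/
theorem sum_factorial_mul_factorial_le (m : ℕ) :
    ∑ k ∈ Finset.Ico 1 m, k.factorial * (m - k).factorial ≤ m.factorial := by
  cases m with
  | zero => simp
  | succ m =>
    calc ∑ k ∈ Finset.Ico 1 (m + 1), k.factorial * (m + 1 - k).factorial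
        ≤ ∑ k ∈ Finset.Ico 1 (m + 1), m.factorial := by
          refine Finset.sum_le_sum fun k hk => ?_
          obtain ⟨h1, h2⟩ := Finset.mem_Ico.1 hk
          have := factorial_mul_factorial_le_pred (k - 1) (m - k)
          rwa [Nat.sub_add_cancel h1, show m - k + 1 = m + 1 - k by omega,
            show k - 1 + (m - k) + 1 = m by omega] at this
      _ ≤ (m + 1).factorial := by
          rw [Finset.sum_const, Nat.card_Ico, smul_eq_mul, Nat.factorial_succ]
          exact Nat.mul_le_mul_right _ (by omega)

/-- This is why the weight has M^{n-1} and not Mⁿ: a product of two weights of positive orders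
carries only M^{m-2}. Every convolution gains 1/M, and a large M absorbs the nonlinear terms. -/
theorem sum_gevreyWeight_le {M d : ℝ} (hM : 0 < M) (hd : 0 < d) (m : ℕ) :
    ∑ k ∈ Finset.Ico 1 m, gevreyWeight M d k * gevreyWeight M d (m - k) ≤
      gevreyWeight M d m / M := by
  have e : ∀ k ∈ Finset.Ico 1 m, gevreyWeight M d k * gevreyWeight M d (m - k) =
      M ^ (m - 2) / d ^ m * ((k.factorial * (m - k).factorial : ℕ) : ℝ) := by
    intro k hk
    obtain ⟨h1, h2⟩ := Finset.mem_Ico.1 hk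
    have e1 : M ^ (m - 2) = M ^ (k - 1) * M ^ (m - k - 1) := by
      rw [← pow_add]; congr 1; omega
    have e2 : d ^ m = d ^ k * d ^ (m - k) := by rw [← pow_add]; congr 1; omega
    rw [gevreyWeight, gevreyWeight, e1, e2]
    push_cast
    field_simp
  rw [Finset.sum_congr rfl e, ← Finset.mul_sum, ← Nat.cast_sum]
  by_cases hm : 2 ≤ m
  · have e1 : M ^ (m - 1) = M ^ (m - 2) * M := by rw [← pow_succ]; congr 1; omega
    have e3 : gevreyWeight M d m / M = M ^ (m - 2) / d ^ m * (m.factorial : ℝ) := by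
      rw [gevreyWeight, e1]; field_simp
    rw [e3]
    exact mul_le_mul_of_nonneg_left (by exact_mod_cast sum_factorial_mul_factorial_le m)
      (by positivity)
  · rw [Finset.Ico_eq_empty (by omega)]
    simp only [Finset.sum_empty, Nat.cast_zero, mul_zero]
    exact div_nonneg (gevreyWeight_nonneg hM.le hd.le m) hM.le

/-- The Cauchy estimate for functions that blow up at the boundary of a disc. -/
theorem norm_deriv_le_of_blowup {h : ℂ → ℂ} {x₀ x : ℂ} {R K : ℝ} (m : ℕ)
    (hh : DifferentiableOn ℂ h (Metric.ball x₀ R)) (hK : 0 ≤ K)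
    (hb : ∀ z ∈ Metric.ball x₀ R, ‖h z‖ ≤ K / (R - dist z x₀) ^ m) (hx : x ∈ Metric.ball x₀ R) :
    ‖deriv h x‖ ≤ 6 * K * (m + 1) / (R - dist x x₀) ^ (m + 1) := by
  set d := R - dist x x₀ with hd
  have hd0 : 0 < d := by rw [hd]; linarith [Metric.mem_ball.1 hx]
  have hm0 : (0 : ℝ) < m + 1 := by positivity
  set q : ℝ := (m + 1) / (m + 2) with hq
  have hq0 : 0 < q := by positivity
  -- The Cauchy radius d/(m + 2) leaves distance dq to the boundary, with (1/q)^m = (1 + 1/(m +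
  -- 1))^m ≤ e ≤ 3. Together with m + 2 ≤ 2(m + 1) this gives the factor 6.
  have hr : 0 < d / (m + 2) := by positivity
  have hrd : d - d / (m + 2) = d * q := by rw [hq]; field_simp; ring
  have hsub : Metric.closedBall x (d / (m + 2)) ⊆ Metric.ball x₀ R := by
    intro z hz
    have h1 := dist_triangle z x x₀
    have h2 := Metric.mem_closedBall.1 hz
    have h3 : 0 < d * q := by positivity
    rw [Metric.mem_ball]
    linarith
  have h1 : ‖deriv h x‖ ≤ K / (d * q) ^ m / (d / (m + 2)) := by
    refine Complex.norm_deriv_le_of_forall_mem_sphere_norm_le hr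
      (hh.diffContOnCl_ball hsub) fun z hz => ?_
    refine (hb z (hsub (Metric.sphere_subset_closedBall hz))).trans ?_
    have h1 := dist_triangle z x x₀
    have h2 := Metric.mem_sphere.1 hz
    refine div_le_div_of_nonneg_left hK (by positivity) ?_
    exact pow_le_pow_left₀ (by positivity) (by linarith) m
  refine h1.trans ?_
  have h2 : (1 / q) ^ m ≤ 3 := by
    have e1 : 1 / q = 1 / (m + 1) + 1 := by rw [hq]; field_simp; ring
    calc (1 / q) ^ m ≤ Real.exp (1 / (m + 1)) ^ m := by
          refine pow_le_pow_left₀ (by positivity) ?_ m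
          rw [e1]; exact Real.add_one_le_exp _
      _ = Real.exp (m * (1 / (m + 1))) := (Real.exp_nat_mul _ _).symm
      _ ≤ Real.exp 1 := by
          refine Real.exp_le_exp.2 ?_
          rw [mul_one_div, div_le_one hm0]; linarith
      _ ≤ 3 := by linarith [Real.exp_one_lt_d9]
  have e4 : K / (d * q) ^ m / (d / (m + 2)) = K / d ^ (m + 1) * ((1 / q) ^ m * (m + 2)) := by
    rw [mul_pow, one_div, inv_pow, pow_succ]
    field_simp
  rw [e4]
  calc K / d ^ (m + 1) * ((1 / q) ^ m * (m + 2)) ≤ K / d ^ (m + 1) * (3 * (2 * (m + 1))) := by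
        refine mul_le_mul_of_nonneg_left ?_ (by positivity)
        exact mul_le_mul h2 (by linarith) (by positivity) (by norm_num)
    _ = 6 * K * (m + 1) / d ^ (m + 1) := by ring

theorem norm_sum_mul_le {f ρ : ℕ → ℂ} {K₁ K₂ M d : ℝ} (hM : 0 < M) (hd : 0 < d) (hK₁ : 0 ≤ K₁)
    (hK₂ : 0 ≤ K₂) {m : ℕ} (hf : ∀ k, 1 ≤ k → k < m → ‖f k‖ ≤ K₁ * gevreyWeight M d k)
    (hρ : ∀ k, 1 ≤ k → k < m → ‖ρ k‖ ≤ K₂ * gevreyWeight M d k) :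
    ‖∑ k ∈ Finset.Ico 1 m, f k * ρ (m - k)‖ ≤ K₁ * K₂ / M * gevreyWeight M d m := by
  have hw := gevreyWeight_nonneg hM.le hd.le
  calc ‖∑ k ∈ Finset.Ico 1 m, f k * ρ (m - k)‖
      ≤ ∑ k ∈ Finset.Ico 1 m, K₁ * K₂ * (gevreyWeight M d k * gevreyWeight M d (m - k)) := by
        refine norm_sum_le_of_le _ fun k hk => ?_
        obtain ⟨h1, h2⟩ := Finset.mem_Ico.1 hk
        rw [norm_mul]
        calc ‖f k‖ * ‖ρ (m - k)‖ ≤ K₁ * gevreyWeight M d k * (K₂ * gevreyWeight M d (m - k)) :=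
              mul_le_mul (hf k h1 h2) (hρ (m - k) (by omega) (by omega)) (norm_nonneg _)
                (mul_nonneg hK₁ (hw k))
          _ = _ := by ring
    _ ≤ K₁ * K₂ * (gevreyWeight M d m / M) := by
        rw [← Finset.mul_sum]
        exact mul_le_mul_of_nonneg_left (sum_gevreyWeight_le hM hd m) (by positivity)
    _ = _ := by ring

theorem norm_tailProd_le {f ρ : ℕ → ℂ} {K₀ K₁ M d : ℝ} (hM : 1 ≤ M) (hd : 0 < d) (hK₁ : 0 ≤ K₁)
    {m : ℕ} (hm : 1 ≤ m) (hf0 : ‖f 0‖ ≤ K₀) (hρ0 : ‖ρ 0‖ ≤ K₀)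
    (hf : ∀ k, 1 ≤ k → k ≤ m → ‖f k‖ ≤ K₁ * gevreyWeight M d k)
    (hρ : ∀ k, 1 ≤ k → k ≤ m → ‖ρ k‖ ≤ K₁ * gevreyWeight M d k) :
    ‖tailProd f ρ ρ m‖ ≤ (2 * K₀ * K₁ + K₁ ^ 2) * gevreyWeight M d m := by
  have hM0 : 0 < M := by linarith
  have hw := gevreyWeight_nonneg hM0.le hd.le m
  have h3 := norm_sum_mul_le (f := f) (ρ := ρ) hM0 hd hK₁ hK₁ (fun k h1 h2 => hf k h1 h2.le)
    fun k h1 h2 => hρ k h1 h2.le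
  have h4 : ‖ρ m * ρ 0‖ ≤ K₁ * gevreyWeight M d m * K₀ := by
    rw [norm_mul]
    exact mul_le_mul (hρ m hm le_rfl) hρ0 (norm_nonneg _) (by positivity)
  have h5 : ‖f 0 * ρ m‖ ≤ K₀ * (K₁ * gevreyWeight M d m) := by
    rw [norm_mul]
    exact mul_le_mul hf0 (hρ m hm le_rfl) (norm_nonneg _) ((norm_nonneg _).trans hf0)
  have h6 : K₁ * K₁ / M * gevreyWeight M d m ≤ K₁ * K₁ * gevreyWeight M d m :=
    mul_le_mul_of_nonneg_right (div_le_self (by positivity) hM) hw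
  rw [tailProd_succ _ _ _ hm]
  refine (norm_add₃_le).trans ?_
  linarith

/-- The majorant constant in the recursion for the normalized remainders. -/
def riccatiMajorant (A₀ A₁ K₀ K₁ M : ℝ) : ℝ :=
  A₁ * (K₀ ^ 2 + K₀ + 1) + 6 * K₀ +
    (A₀ * K₁ ^ 2 + A₁ * (2 * K₀ * K₁ + K₁ ^ 2) + A₁ * K₁ + 6 * K₁) / M

/-- The part without 1/M comes from the order n remainders of the coefficients themselves; all other
terms are convolutions of positive orders and gain 1/M. -/
theorem norm_riccatiRest_le {a b f ρa ρb ρc ρ : ℕ → ℂ} {A₀ A₁ K₀ K₁ M d : ℝ} (hM : 1 ≤ M)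
    (hd : 0 < d) (hA₁ : 0 ≤ A₁) (hK₁ : 0 ≤ K₁) {n : ℕ} (ha0 : ‖a 0‖ ≤ A₀)
    (hf0 : ‖f 0‖ ≤ K₀) (hρ0 : ‖ρ 0‖ ≤ K₀)
    (ha : ∀ k, 1 ≤ k → ‖a k‖ ≤ A₁ * gevreyWeight M d k)
    (hb : ∀ k, 1 ≤ k → ‖b k‖ ≤ A₁ * gevreyWeight M d k)
    (hρa : ‖ρa n‖ ≤ A₁ * gevreyWeight M d n) (hρb : ‖ρb n‖ ≤ A₁ * gevreyWeight M d n)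
    (hρc : ‖ρc n‖ ≤ A₁ * gevreyWeight M d n)
    (hf : ∀ k, 1 ≤ k → k < n → ‖f k‖ ≤ K₁ * gevreyWeight M d k)
    (hρ : ∀ k, 1 ≤ k → k < n → ‖ρ k‖ ≤ K₁ * gevreyWeight M d k) :
    ‖riccatiRest a b f ρa ρb ρc ρ n‖ ≤ (A₁ * (K₀ ^ 2 + K₀ + 1) +
      (A₀ * K₁ ^ 2 + A₁ * (2 * K₀ * K₁ + K₁ ^ 2) + A₁ * K₁) / M) * gevreyWeight M d n := by
  have hM0 : 0 < M := by linarith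
  have hw := gevreyWeight_nonneg hM0.le hd.le n
  have hK₀ : 0 ≤ K₀ := (norm_nonneg _).trans hf0
  have hA₀ : 0 ≤ A₀ := (norm_nonneg _).trans ha0
  have h1 : ‖ρa n * ρ 0 ^ 2‖ ≤ A₁ * gevreyWeight M d n * K₀ ^ 2 := by
    rw [norm_mul, norm_pow]
    exact mul_le_mul hρa (pow_le_pow_left₀ (norm_nonneg _) hρ0 2) (by positivity) (by positivity)
  have h2 : ‖a 0 * ∑ k ∈ Finset.Ico 1 n, f k * ρ (n - k)‖ ≤
      A₀ * (K₁ * K₁ / M * gevreyWeight M d n) := by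
    rw [norm_mul]
    exact mul_le_mul ha0 (norm_sum_mul_le hM0 hd hK₁ hK₁ hf hρ) (norm_nonneg _) hA₀
  have h3 := norm_sum_mul_le (f := a) (ρ := tailProd f ρ ρ) (K₂ := 2 * K₀ * K₁ + K₁ ^ 2) (m := n)
    hM0 hd hA₁ (by positivity) (fun k h _ => ha k h) fun k h1 h2 =>
      norm_tailProd_le hM hd hK₁ h1 hf0 hρ0 (fun j hj hjk => hf j hj (by omega))
        fun j hj hjk => hρ j hj (by omega)
  have h4 : ‖ρb n * ρ 0‖ ≤ A₁ * gevreyWeight M d n * K₀ := by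
    rw [norm_mul]
    exact mul_le_mul hρb hρ0 (by positivity) (by positivity)
  have h5 := norm_sum_mul_le (f := b) (ρ := ρ) (m := n) hM0 hd hA₁ hK₁ (fun k h _ => hb k h) hρ
  rw [riccatiRest]
  refine (norm_add_le_of_le (norm_add_le_of_le (norm_add_le_of_le (norm_add_le_of_le
    (norm_add_le_of_le h1 h2) h3) h4) h5) hρc).trans (le_of_eq ?_)
  ring

/-- The induction for the bounds of the normalized remainders of a solution of the Riccati
equation. -/
theorem norm_tail_le {a b f ρa ρb ρc ρ ρ' : ℕ → ℂ → ℂ} {x₀ : ℂ} {R A₀ A₁ K₀ K₁ M σ : ℝ}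
    (hM : 1 ≤ M) (hA₁ : 0 ≤ A₁) (hK₀ : 0 ≤ K₀) (hK₁ : 0 ≤ K₁) (hσ : 0 < σ)
    (hmaj : riccatiMajorant A₀ A₁ K₀ K₁ M ≤ σ * K₁)
    (ha0 : ∀ x ∈ Metric.ball x₀ R, ‖a 0 x‖ ≤ A₀)
    (hf0 : ∀ x ∈ Metric.ball x₀ R, ‖f 0 x‖ ≤ K₀)
    (hρ0 : ∀ x ∈ Metric.ball x₀ R, ‖ρ 0 x‖ ≤ K₀)
    (ha : ∀ x ∈ Metric.ball x₀ R, ∀ k, 1 ≤ k → ‖a k x‖ ≤ A₁ * gevreyWeight M (R - dist x x₀) k)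
    (hb : ∀ x ∈ Metric.ball x₀ R, ∀ k, 1 ≤ k → ‖b k x‖ ≤ A₁ * gevreyWeight M (R - dist x x₀) k)
    (hρa : ∀ x ∈ Metric.ball x₀ R, ∀ k, 1 ≤ k → ‖ρa k x‖ ≤ A₁ * gevreyWeight M (R - dist x x₀) k)
    (hρb : ∀ x ∈ Metric.ball x₀ R, ∀ k, 1 ≤ k → ‖ρb k x‖ ≤ A₁ * gevreyWeight M (R - dist x x₀) k)
    (hρc : ∀ x ∈ Metric.ball x₀ R, ∀ k, 1 ≤ k → ‖ρc k x‖ ≤ A₁ * gevreyWeight M (R - dist x x₀) k)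
    (hd : ∀ n, DifferentiableOn ℂ (ρ n) (Metric.ball x₀ R))
    (hρ' : ∀ n, ∀ x ∈ Metric.ball x₀ R, ρ' n x = deriv (ρ n) x)
    (hlow : ∀ x ∈ Metric.ball x₀ R, σ ≤ ‖a 0 x * (ρ 0 x + f 0 x) + b 0 x‖)
    (hrec : ∀ x ∈ Metric.ball x₀ R, ∀ n, (a 0 x * (ρ 0 x + f 0 x) + b 0 x) * ρ (n + 1) x = ρ' n x -
      riccatiRest (fun k => a k x) (fun k => b k x) (fun k => f k x) (fun k => ρa k x)
        (fun k => ρb k x) (fun k => ρc k x) (fun k => ρ k x) (n + 1))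
    (hf : ∀ n, (∀ k, 1 ≤ k → k ≤ n → ∀ x ∈ Metric.ball x₀ R,
        ‖ρ k x‖ ≤ K₁ * gevreyWeight M (R - dist x x₀) k) →
      ∀ k, 1 ≤ k → k ≤ n → ∀ x ∈ Metric.ball x₀ R,
        ‖f k x‖ ≤ K₁ * gevreyWeight M (R - dist x x₀) k)
    (n : ℕ) (hn : 1 ≤ n) (x : ℂ) (hx : x ∈ Metric.ball x₀ R) :
    ‖ρ n x‖ ≤ K₁ * gevreyWeight M (R - dist x x₀) n := by
  have hM0 : 0 < M := by linarith
  induction n using Nat.strong_induction_on generalizing x with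
  | _ n ih =>
    obtain ⟨n, rfl⟩ : ∃ m, n = m + 1 := ⟨n - 1, by omega⟩
    have hdx : 0 < R - dist x x₀ := by linarith [Metric.mem_ball.1 hx]
    have hw := gevreyWeight_nonneg hM0.le hdx.le (n + 1)
    have h1 := norm_riccatiRest_le hM hdx hA₁ hK₁ (n := n + 1) (ha0 x hx) (hf0 x hx) (hρ0 x hx) (ha x hx)
      (hb x hx) (hρa x hx _ hn) (hρb x hx _ hn) (hρc x hx _ hn)
      (f := fun k => f k x) (ρ := fun k => ρ k x) (a := fun k => a k x) (b := fun k => b k x)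
      (ρa := fun k => ρa k x) (ρb := fun k => ρb k x) (ρc := fun k => ρc k x)
      (fun k h1 h2 => hf n (fun j hj hjn y hy => ih j (by omega) hj y hy) k h1 (by omega) x hx)
      fun k h1 h2 => ih k h2 h1 x hx
    have h2 : ‖ρ' n x‖ ≤ (6 * K₀ + 6 * K₁ / M) * gevreyWeight M (R - dist x x₀) (n + 1) := by
      rw [hρ' n x hx]
      -- Differentiation costs a factor n + 1 and one power of the distance, exactly as the weights
      -- grow, with a gain of 1/M. Only from order 0 to order 1 is there no gain, since the weight
      -- of order 1 has no M; hence the separate term 6K₀.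
      rcases Nat.eq_zero_or_pos n with rfl | hn'
      · have h3 := norm_deriv_le_of_blowup 0 (hd 0) hK₀
          (fun z hz => by simpa using hρ0 z hz) hx
        have h4 : gevreyWeight M (R - dist x x₀) 1 = 1 / (R - dist x x₀) := by
          simp [gevreyWeight]
        have h5 : 0 ≤ 6 * K₁ / M * (1 / (R - dist x x₀)) := by positivity
        rw [zero_add, h4]
        have h6 : 6 * K₀ * ((0 : ℕ) + 1) / (R - dist x x₀) ^ (0 + 1) =
          6 * K₀ * (1 / (R - dist x x₀)) := by simp; ring
        rw [h6] at h3
        linarith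
      · have h3 := norm_deriv_le_of_blowup n (hd n)
          (K := K₁ * (M ^ (n - 1) * n.factorial)) (by positivity)
          (fun z hz => (ih n (by omega) hn' z hz).trans_eq (by rw [gevreyWeight]; ring)) hx
        have h4 : 6 * (K₁ * (M ^ (n - 1) * n.factorial)) * (n + 1) / (R - dist x x₀) ^ (n + 1) =
            6 * K₁ / M * gevreyWeight M (R - dist x x₀) (n + 1) := by
          have e1 : M ^ n = M ^ (n - 1) * M := by rw [← pow_succ]; congr 1; omega
          rw [gevreyWeight, Nat.add_sub_cancel, e1, Nat.factorial_succ]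
          push_cast
          field_simp
        rw [h4] at h3
        have h5 : 0 ≤ 6 * K₀ * gevreyWeight M (R - dist x x₀) (n + 1) := by positivity
        linarith
    have h3 : ‖a 0 x * (ρ 0 x + f 0 x) + b 0 x‖ * ‖ρ (n + 1) x‖ ≤
        σ * (K₁ * gevreyWeight M (R - dist x x₀) (n + 1)) := by
      rw [← norm_mul, hrec x hx n]
      refine (norm_sub_le_of_le h2 h1).trans ?_
      refine le_trans (le_of_eq ?_) ((mul_le_mul_of_nonneg_right hmaj hw).trans_eq (by ring))
      rw [riccatiMajorant]
      ring
    have h4 := (mul_le_mul_of_nonneg_right (hlow x hx) (norm_nonneg (ρ (n + 1) x))).trans h3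
    exact le_of_mul_le_mul_left h4 hσ

/-- The constant K₁ is chosen so that σK₁ exceeds the part free of M by 1; only then is M taken so
large that the part over M is at most 1. -/
theorem exists_riccatiMajorant_le (A₀ A₁ K₀ : ℝ) {σ : ℝ} (hσ : 0 < σ) (B : ℝ) (hA₁ : 0 ≤ A₁)
    (hK₀ : 0 ≤ K₀) :
    ∃ K₁ M, 0 ≤ K₁ ∧ 1 ≤ M ∧ B ≤ M ∧ riccatiMajorant A₀ A₁ K₀ K₁ M ≤ σ * K₁ := by
  set K₁ := (A₁ * (K₀ ^ 2 + K₀ + 1) + 6 * K₀ + 1) / σ with hK₁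
  set N := A₀ * K₁ ^ 2 + A₁ * (2 * K₀ * K₁ + K₁ ^ 2) + A₁ * K₁ + 6 * K₁ with hN
  refine ⟨K₁, max 1 (max B N), by positivity, le_max_left _ _,
    (le_max_left _ _).trans (le_max_right _ _), ?_⟩
  have h1 : σ * K₁ = A₁ * (K₀ ^ 2 + K₀ + 1) + 6 * K₀ + 1 := mul_div_cancel₀ _ hσ.ne'
  rw [h1, riccatiMajorant, ← hN]
  have h2 : N / max 1 (max B N) ≤ 1 := by
    rw [div_le_one (by positivity)]
    exact (le_max_right _ _).trans (le_max_right _ _)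
  linarith

/-- One factor B moves into the constant because the weight has exponent k - 1, and d ≤ 1 makes the
division by d^k harmless. -/
theorem le_gevreyWeight {A B M d v : ℝ} (hA : 0 ≤ A) (hB : 0 ≤ B) (hBM : B ≤ M) (hd : 0 < d)
    (hd1 : d ≤ 1) {k : ℕ} (hk : 1 ≤ k) (h : v ≤ A * B ^ k * k.factorial) :
    v ≤ A * B * gevreyWeight M d k := by
  have e1 : B ^ k = B ^ (k - 1) * B := by rw [← pow_succ]; congr 1; omega
  have h1 : B ^ (k - 1) ≤ M ^ (k - 1) := pow_le_pow_left₀ hB hBM _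
  have h2 : M ^ (k - 1) * k.factorial ≤ gevreyWeight M d k :=
    le_div_self (by have := hB.trans hBM; positivity) (by positivity) (pow_le_one₀ hd.le hd1)
  calc v ≤ A * B * (B ^ (k - 1) * k.factorial) := h.trans_eq (by rw [e1]; ring)
    _ ≤ A * B * (M ^ (k - 1) * k.factorial) := by gcongr
    _ ≤ _ := by gcongr

theorem norm_remainder_div_pow_le {g : ℂ × ℂ → ℂ} {gk : ℕ → ℂ → ℂ} {U T : Set ℂ} {A B : ℝ}
    (h : HasGevreyBounds g gk (fun _ => 1) U T A B) (n : ℕ) {x ħ : ℂ} (hx : x ∈ U) (hħ : ħ ∈ T)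
    (hħ0 : ħ ≠ 0) : ‖remainder g gk n x ħ / ħ ^ n‖ ≤ A * B ^ n * n.factorial := by
  rw [norm_div, norm_pow, div_le_iff₀ (by positivity)]
  simpa using h n x hx ħ hħ

/-- Gevrey bounds hold automatically for a bounded solution of the Riccati equation. -/
theorem hasGevreyBounds_of_bounded {a b c f : ℂ × ℂ → ℂ} {ak bk ck fk : ℕ → ℂ → ℂ} {x₀ : ℂ}
    {R A B K₀ σ : ℝ} {T : Set ℂ} (hR : 0 < R) (hR1 : R ≤ 1) (hA : 0 ≤ A) (hB : 0 ≤ B)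
    (hσ : 0 < σ) (hT : ∀ ħ ∈ T, ħ ≠ 0)
    (ha : HasGevreyBounds a ak (fun _ => 1) (Metric.ball x₀ R) T A B)
    (hb : HasGevreyBounds b bk (fun _ => 1) (Metric.ball x₀ R) T A B)
    (hc : HasGevreyBounds c ck (fun _ => 1) (Metric.ball x₀ R) T A B)
    (hak : ∀ k, ∀ x ∈ Metric.ball x₀ R, ‖ak k x‖ ≤ A * B ^ k * k.factorial)
    (hbk : ∀ k, ∀ x ∈ Metric.ball x₀ R, ‖bk k x‖ ≤ A * B ^ k * k.factorial)
    (hck : ∀ k, ∀ x ∈ Metric.ball x₀ R, ‖ck k x‖ ≤ A * B ^ k * k.factorial)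
    (hfk : IsFormalSolution ak bk ck fk (Metric.ball x₀ R))
    (hf : ∀ ħ ∈ T, DifferentiableOn ℂ (fun x => f (x, ħ)) (Metric.ball x₀ R))
    (hric : ∀ x ∈ Metric.ball x₀ R, ∀ ħ ∈ T, ħ * deriv (fun y => f (y, ħ)) x =
      a (x, ħ) * f (x, ħ) ^ 2 + b (x, ħ) * f (x, ħ) + c (x, ħ))
    (hf0 : ∀ x ∈ Metric.ball x₀ R, ‖fk 0 x‖ ≤ K₀)
    (hfb : ∀ x ∈ Metric.ball x₀ R, ∀ ħ ∈ T, ‖f (x, ħ)‖ ≤ K₀)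
    (hlow0 : ∀ x ∈ Metric.ball x₀ R, σ ≤ ‖2 * ak 0 x * fk 0 x + bk 0 x‖)
    (hlow : ∀ x ∈ Metric.ball x₀ R, ∀ ħ ∈ T, σ ≤ ‖ak 0 x * (f (x, ħ) + fk 0 x) + bk 0 x‖) :
    ∃ C > 0, ∃ M > 0, HasGevreyBounds f fk (fun _ => 1) (Metric.ball x₀ (R / 2)) T C M := by
  have hK₀ : 0 ≤ K₀ := (norm_nonneg _).trans (hf0 x₀ (Metric.mem_ball_self hR))
  obtain ⟨K₁, M, hK₁, hM, hBM, hmaj⟩ :=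
    exists_riccatiMajorant_le A (A * B) K₀ hσ B (by positivity) hK₀
  have hM0 : 0 < M := by linarith
  have hd : ∀ x ∈ Metric.ball x₀ R, 0 < R - dist x x₀ ∧ R - dist x x₀ ≤ 1 := fun x hx =>
    ⟨by linarith [Metric.mem_ball.1 hx], by linarith [dist_nonneg (x := x) (y := x₀)]⟩
  have hcoef : ∀ {g : ℕ → ℂ → ℂ},
      (∀ k, ∀ x ∈ Metric.ball x₀ R, ‖g k x‖ ≤ A * B ^ k * k.factorial) →
      ∀ x ∈ Metric.ball x₀ R, ∀ k, 1 ≤ k → ‖g k x‖ ≤ A * B * gevreyWeight M (R - dist x x₀) k :=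
    fun h x hx k hk => le_gevreyWeight hA hB hBM (hd x hx).1 (hd x hx).2 hk (h k x hx)
  have ha0 : ∀ x ∈ Metric.ball x₀ R, ‖ak 0 x‖ ≤ A := fun x hx => by simpa using hak 0 x hx
  have hformal := fun x hx => (formal_riccati_iff _ _ _ _ _).1 (hfk.2 x hx)
  -- The formal coefficients are the case where the remainders are the coefficients themselves, so
  -- the bound required for f in the induction is the induction hypothesis.
  have h1 : ∀ n, 1 ≤ n → ∀ x ∈ Metric.ball x₀ R,
      ‖fk n x‖ ≤ K₁ * gevreyWeight M (R - dist x x₀) n := by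
    refine norm_tail_le (a := ak) (b := bk) (f := fk) (ρa := ak) (ρb := bk) (ρc := ck) hM
      (by positivity) hK₀ hK₁ hσ hmaj ha0 hf0 hf0 (hcoef hak) (hcoef hbk) (hcoef hak) (hcoef hbk)
      (hcoef hck) hfk.1 (fun _ _ _ => rfl) (fun x hx => ?_) (fun x hx n => ?_)
      fun n h k h1 h2 x hx => h k h1 h2 x hx
    · rw [← two_mul, mul_left_comm, ← mul_assoc]; exact hlow0 x hx
    · have := ((formal_riccati_iff' _ _ _ _ _).1 (hformal x hx)).2 n
      rw [← this]; ring
  -- For fixed ħ the same induction runs on the exact remainders, with the formal coefficients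
  -- already bounded by `h1`. All constants are independent of ħ.
  have h2 : ∀ ħ ∈ T, ∀ n, 1 ≤ n → ∀ x ∈ Metric.ball x₀ R,
      ‖remainder f fk n x ħ / ħ ^ n‖ ≤ K₁ * gevreyWeight M (R - dist x x₀) n := by
    intro ħ hħ
    have hrem : ∀ {g : ℂ × ℂ → ℂ} {gk : ℕ → ℂ → ℂ},
        HasGevreyBounds g gk (fun _ => 1) (Metric.ball x₀ R) T A B →
        ∀ x ∈ Metric.ball x₀ R, ∀ k, 1 ≤ k →
          ‖remainder g gk k x ħ / ħ ^ k‖ ≤ A * B * gevreyWeight M (R - dist x x₀) k :=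
      fun h x hx k hk => le_gevreyWeight hA hB hBM (hd x hx).1 (hd x hx).2 hk
        (norm_remainder_div_pow_le h k hx hħ (hT ħ hħ))
    have hdf : ∀ n, DifferentiableOn ℂ (fun x => remainder f fk n x ħ) (Metric.ball x₀ R) :=
      fun n => (hf ħ hħ).fun_sub (DifferentiableOn.fun_sum fun k _ => (hfk.1 k).mul_const _)
    have htail : ∀ (g : ℂ × ℂ → ℂ) (gk : ℕ → ℂ → ℂ) (x : ℂ),
        IsTail ħ (fun k => gk k x) fun n => remainder g gk n x ħ / ħ ^ n :=
      fun g gk x => isTail_remainder (hT ħ hħ) _ _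
    refine norm_tail_le (a := ak) (b := bk) (f := fk)
      (ρa := fun n x => remainder a ak n x ħ / ħ ^ n)
      (ρb := fun n x => remainder b bk n x ħ / ħ ^ n)
      (ρc := fun n x => remainder c ck n x ħ / ħ ^ n)
      (ρ := fun n x => remainder f fk n x ħ / ħ ^ n)
      (ρ' := fun n x => (deriv (fun y => f (y, ħ)) x -
        ∑ k ∈ Finset.range n, deriv (fk k) x * ħ ^ k) / ħ ^ n) hM
      (by positivity) hK₀ hK₁ hσ hmaj ha0 hf0 ?_ (hcoef hak) (hcoef hbk) (hrem ha) (hrem hb)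
      (hrem hc) (fun n => (hdf n).div_const _) ?_ ?_ ?_ fun n _ k h3 h4 x hx => h1 k h3 x hx
    · intro x hx; simpa [remainder] using hfb x hx ħ hħ
    · intro n x hx
      have hx' := Metric.isOpen_ball.mem_nhds hx
      rw [deriv_div_const]
      congr 1
      unfold remainder
      rw [deriv_fun_sub ((hf ħ hħ).differentiableAt hx')
        (DifferentiableAt.fun_sum fun k _ => ((hfk.1 k).differentiableAt hx').mul_const _),
        deriv_fun_sum fun k _ => ((hfk.1 k).differentiableAt hx').mul_const _]
      congr 1
      exact Finset.sum_congr rfl fun k _ =>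
        (deriv_mul_const ((hfk.1 k).differentiableAt hx') _).symm
    · intro x hx; simpa [remainder] using hlow x hx ħ hħ
    · intro x hx n
      exact riccati_tail (htail a ak x) (htail b bk x) (htail c ck x) (htail f fk x)
        (isTail_remainder (hT ħ hħ) (fun k => deriv (fk k) x) _) (hformal x hx)
        (by simpa [remainder] using hric x hx ħ hħ) n
  -- On the half disc the distance to the boundary is at least R/2, so the weight is at most (2M/R)ⁿ
  -- n!.
  refine ⟨K₀ + K₁ + 1, by positivity, 2 * M / R, by positivity, fun n x hx ħ hħ => ?_⟩
  have hħ0 : 0 < ‖ħ‖ := norm_pos_iff.2 (hT ħ hħ)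
  have hx' : x ∈ Metric.ball x₀ R := Metric.ball_subset_ball (by linarith) hx
  rw [one_mul, ← div_le_iff₀ (by positivity), ← norm_pow, ← norm_div]
  rcases Nat.eq_zero_or_pos n with rfl | hn
  · have := hfb x hx' ħ hħ
    simp [remainder]
    linarith
  · refine (h2 ħ hħ n hn x hx').trans ?_
    have hdx : R / 2 ≤ R - dist x x₀ := by linarith [Metric.mem_ball.1 hx]
    have e1 : gevreyWeight M (R - dist x x₀) n ≤ (2 * M / R) ^ n * n.factorial := by
      have e2 : (2 * M / R) ^ n * n.factorial = M ^ n * n.factorial / (R / 2) ^ n := by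
        rw [div_pow, div_pow, mul_pow]; field_simp
      rw [e2, gevreyWeight]
      have h3 : M ^ (n - 1) ≤ M ^ n := pow_le_pow_right₀ hM (by omega)
      gcongr
    rw [mul_assoc]
    exact mul_le_mul (by linarith) e1 (gevreyWeight_nonneg hM0.le (by linarith) n) (by positivity)

end

noncomputable section

/-! ### Linear equations with a large parameter -/

section RayIntegral

variable {E : Type*} [NormedAddCommGroup E] [NormedSpace ℂ E]

/-- The integral from infinity, along rays of direction `e`, that solves `u' = l u + g`. -/
def rayIntegral (e l : ℂ) (g : ℂ → E) (z : ℂ) : E :=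
  -(e • ∫ t in Set.Ioi (0 : ℝ), Complex.exp (-(l * e * t)) • g (z + e * t))

/-- `Ω` is invariant under translations in the direction `e`. -/
def IsRayInvariant (e : ℂ) (Ω : Set ℂ) : Prop := ∀ z ∈ Ω, ∀ t : ℝ, 0 ≤ t → z + e * t ∈ Ω

theorem norm_exp_neg_le {l e : ℂ} {κ t : ℝ} (hl : κ ≤ (l * e).re) (ht : 0 ≤ t) :
    ‖Complex.exp (-(l * e * t))‖ ≤ Real.exp (-κ * t) := by
  rw [Complex.norm_exp]
  refine Real.exp_le_exp.2 ?_
  rw [Complex.neg_re, Complex.re_mul_ofReal]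
  nlinarith

theorem continuousOn_ray {Ω : Set ℂ} {e l : ℂ} {g : ℂ → E} (hΩ : IsRayInvariant e Ω)
    (hg : ContinuousOn g Ω) {z : ℂ} (hz : z ∈ Ω) :
    ContinuousOn (fun t : ℝ => Complex.exp (-(l * e * t)) • g (z + e * t)) (Set.Ici 0) := by
  refine ContinuousOn.smul (by fun_prop) (hg.comp (by fun_prop) fun t ht => hΩ z hz t ht)

theorem norm_ray_le {Ω : Set ℂ} {e l : ℂ} {g : ℂ → E} {κ K : ℝ} (hΩ : IsRayInvariant e Ω)
    (hl : κ ≤ (l * e).re) (hb : ∀ z ∈ Ω, ‖g z‖ ≤ K) {z : ℂ} (hz : z ∈ Ω) {t : ℝ} (ht : 0 ≤ t) :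
    ‖Complex.exp (-(l * e * t)) • g (z + e * t)‖ ≤ Real.exp (-κ * t) * K := by
  rw [norm_smul]
  exact mul_le_mul (norm_exp_neg_le hl ht) (hb _ (hΩ z hz t ht)) (norm_nonneg _) (Real.exp_nonneg _)

theorem integrableOn_exp_mul {κ : ℝ} (hκ : 0 < κ) (K : ℝ) :
    MeasureTheory.IntegrableOn (fun t => Real.exp (-κ * t) * K) (Set.Ioi 0) :=
  (integrableOn_exp_mul_Ioi (by linarith) 0).mul_const K

theorem integrableOn_ray {Ω : Set ℂ} {e l : ℂ} {g : ℂ → E} {κ K : ℝ} (hΩ : IsRayInvariant e Ω)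
    (hκ : 0 < κ) (hl : κ ≤ (l * e).re) (hg : ContinuousOn g Ω) (hb : ∀ z ∈ Ω, ‖g z‖ ≤ K) {z : ℂ}
    (hz : z ∈ Ω) :
    MeasureTheory.IntegrableOn (fun t : ℝ => Complex.exp (-(l * e * t)) • g (z + e * t))
      (Set.Ioi 0) := by
  refine MeasureTheory.Integrable.mono' (integrableOn_exp_mul hκ K)
    (((continuousOn_ray hΩ hg hz).mono Set.Ioi_subset_Ici_self).aestronglyMeasurable
      measurableSet_Ioi) ?_
  filter_upwards [MeasureTheory.ae_restrict_mem measurableSet_Ioi] with t ht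
  exact norm_ray_le hΩ hl hb hz (le_of_lt ht)

theorem norm_rayIntegral_le {Ω : Set ℂ} {e l : ℂ} {g : ℂ → E} {κ K : ℝ} (hΩ : IsRayInvariant e Ω)
    (he : ‖e‖ = 1) (hκ : 0 < κ) (hl : κ ≤ (l * e).re) (hb : ∀ z ∈ Ω, ‖g z‖ ≤ K) {z : ℂ}
    (hz : z ∈ Ω) : ‖rayIntegral e l g z‖ ≤ K / κ := by
  rw [rayIntegral, norm_neg, norm_smul, he, one_mul]
  refine (MeasureTheory.norm_integral_le_of_norm_le (integrableOn_exp_mul hκ K) ?_).trans ?_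
  · filter_upwards [MeasureTheory.ae_restrict_mem measurableSet_Ioi] with t ht
    exact norm_ray_le hΩ hl hb hz (le_of_lt ht)
  · rw [MeasureTheory.integral_mul_const, integral_exp_mul_Ioi (by linarith)]
    simp
    rw [div_eq_mul_inv, mul_comm]

theorem rayIntegral_sub {Ω : Set ℂ} {e l : ℂ} {g h : ℂ → E} {κ K : ℝ} (hΩ : IsRayInvariant e Ω)
    (hκ : 0 < κ) (hl : κ ≤ (l * e).re) (hg : ContinuousOn g Ω) (hb : ∀ z ∈ Ω, ‖g z‖ ≤ K)
    (hh : ContinuousOn h Ω) (hbh : ∀ z ∈ Ω, ‖h z‖ ≤ K) {z : ℂ} (hz : z ∈ Ω) :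
    rayIntegral e l g z - rayIntegral e l h z = rayIntegral e l (fun z => g z - h z) z := by
  simp only [rayIntegral, smul_sub]
  rw [MeasureTheory.integral_sub (integrableOn_ray hΩ hκ hl hg hb hz)
    (integrableOn_ray hΩ hκ hl hh hbh hz), smul_sub]
  abel

variable [CompleteSpace E]

theorem differentiableOn_rayIntegral {Ω : Set ℂ} {e l : ℂ} {g : ℂ → E} {κ K : ℝ}
    (hΩo : IsOpen Ω) (hΩ : IsRayInvariant e Ω)
    (hκ : 0 < κ) (hl : κ ≤ (l * e).re) (hg : DifferentiableOn ℂ g Ω) (hb : ∀ z ∈ Ω, ‖g z‖ ≤ K) :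
    DifferentiableOn ℂ (rayIntegral e l g) Ω := by
  refine (DifferentiableOn.const_smul (differentiableOn_integral_of_dominated
    (bound := fun t => Real.exp (-κ * t) * K) hΩo
    (fun z hz => (integrableOn_ray hΩ hκ hl hg.continuousOn hb hz).aestronglyMeasurable) ?_ ?_
    (integrableOn_exp_mul hκ K)) e).neg
  · filter_upwards [MeasureTheory.ae_restrict_mem measurableSet_Ioi] with t ht
    exact (hg.comp (by fun_prop) fun z hz => hΩ z hz t (le_of_lt ht)).const_smul _
  · filter_upwards [MeasureTheory.ae_restrict_mem measurableSet_Ioi] with t ht z hz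
    exact norm_ray_le hΩ hl hb hz (le_of_lt ht)

theorem differentiableOn_rayIntegral_param {Ω T : Set ℂ} {e : ℂ} {l : ℂ → ℂ} {g : ℂ → ℂ → E}
    {κ K : ℝ} (hT : IsOpen T) (hΩ : IsRayInvariant e Ω) (hκ : 0 < κ)
    (hl : ∀ ħ ∈ T, κ ≤ (l ħ * e).re) (hld : DifferentiableOn ℂ l T)
    (hg : ∀ ħ ∈ T, ContinuousOn (fun z => g z ħ) Ω)
    (hgd : ∀ z ∈ Ω, DifferentiableOn ℂ (g z) T) (hb : ∀ z ∈ Ω, ∀ ħ ∈ T, ‖g z ħ‖ ≤ K) {z : ℂ}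
    (hz : z ∈ Ω) : DifferentiableOn ℂ (fun ħ => rayIntegral e (l ħ) (fun z => g z ħ) z) T := by
  refine (DifferentiableOn.const_smul (differentiableOn_integral_of_dominated
    (bound := fun t => Real.exp (-κ * t) * K) hT
    (fun ħ hħ => (integrableOn_ray hΩ hκ (hl ħ hħ) (hg ħ hħ) (fun z hz => hb z hz ħ hħ)
      hz).aestronglyMeasurable) ?_ ?_ (integrableOn_exp_mul hκ K)) e).neg
  · filter_upwards [MeasureTheory.ae_restrict_mem measurableSet_Ioi] with t ht
    exact (((hld.mul_const e).mul_const (t : ℂ)).neg.cexp).smul (hgd _ (hΩ z hz t (le_of_lt ht)))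
  · filter_upwards [MeasureTheory.ae_restrict_mem measurableSet_Ioi] with t ht ħ hħ
    exact norm_ray_le hΩ (hl ħ hħ) (fun z hz => hb z hz ħ hħ) hz (le_of_lt ht)

/-- The integral is already known to be holomorphic in z, so its derivative may be computed along
the ray alone. There a shift of the integration variable turns it into an exponential times an
integral over (s, ∞), to be differentiated from the right at s = 0. -/
theorem hasDerivAt_rayIntegral {Ω : Set ℂ} {e l : ℂ} {g : ℂ → E} {κ K : ℝ}
    (hΩo : IsOpen Ω) (hΩ : IsRayInvariant e Ω) (he : ‖e‖ = 1)
    (hκ : 0 < κ) (hl : κ ≤ (l * e).re) (hg : DifferentiableOn ℂ g Ω) (hb : ∀ z ∈ Ω, ‖g z‖ ≤ K)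
    {z : ℂ} (hz : z ∈ Ω) :
    HasDerivAt (rayIntegral e l g) (l • rayIntegral e l g z + g z) z := by
  have he0 : e ≠ 0 := norm_ne_zero_iff.1 (by rw [he]; exact one_ne_zero)
  have hu := ((differentiableOn_rayIntegral hΩo hΩ hκ hl hg hb).differentiableAt
    (hΩo.mem_nhds hz)).hasDerivAt
  set f : ℝ → E := fun t => Complex.exp (-(l * e * t)) • g (z + e * t) with hf
  have hfc : ContinuousOn f (Set.Ici 0) := continuousOn_ray hΩ hg.continuousOn hz
  have hfi : MeasureTheory.IntegrableOn f (Set.Ioi 0) :=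
    integrableOn_ray hΩ hκ hl hg.continuousOn hb hz
  have hshift : ∀ s ∈ Set.Ici (0 : ℝ), rayIntegral e l g (z + e * s) =
      -(e • Complex.exp (l * e * s) • ((∫ t in Set.Ioi (0 : ℝ), f t) - ∫ t in (0 : ℝ)..s, f t)) := by
    intro s hs
    have h1 : ∫ t in Set.Ioi (0 : ℝ), Complex.exp (-(l * e * t)) • g (z + e * s + e * t) =
        ∫ t in Set.Ioi (0 : ℝ), Complex.exp (l * e * s) • f (t + s) := by
      refine MeasureTheory.integral_congr_ae (Filter.Eventually.of_forall fun t => ?_)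
      simp only [hf, smul_smul, ← Complex.exp_add]
      congr 2
      · push_cast; ring
      · push_cast; ring
    have h2 : ∫ t in Set.Ioi (0 : ℝ), f (t + s) = ∫ t in Set.Ioi s, f t := by
      have := (MeasureTheory.measurePreserving_add_right MeasureTheory.volume
        s).setIntegral_preimage_emb (measurableEmbedding_addRight s) f (Set.Ioi s)
      rwa [Set.preimage_add_const_Ioi, sub_self] at this
    rw [rayIntegral, h1, MeasureTheory.integral_smul, h2,
      ← intervalIntegral.integral_Ioi_sub_Ioi' hfi (hfi.mono_set (Set.Ioi_subset_Ioi hs)),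
      sub_sub_cancel]
  have h2 : HasDerivWithinAt (fun s : ℝ => rayIntegral e l g (z + e * s))
      (e • (l • rayIntegral e l g z + g z)) (Set.Ici 0) 0 := by
    have h3 : HasDerivWithinAt (fun s : ℝ => ∫ t in (0 : ℝ)..s, f t) (f 0) (Set.Ici 0) 0 := by
      refine intervalIntegral.integral_hasDerivWithinAt_right (by simp)
        (s := Set.Ici 0) (t := Set.Ioi 0) ?_ ?_
      · exact ⟨Set.Ioi 0, self_mem_nhdsWithin,
          (hfc.mono Set.Ioi_subset_Ici_self).aestronglyMeasurable measurableSet_Ioi⟩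
      · exact (hfc 0 (by simp)).mono Set.Ioi_subset_Ici_self
    have h4 : HasDerivAt (fun s : ℝ => Complex.exp (l * e * s)) (l * e) 0 := by
      have := ((Complex.ofRealCLM.hasDerivAt (x := (0 : ℝ))).const_mul (l * e)).cexp
      simpa using this
    have h5 := ((h4.hasDerivWithinAt.smul (h3.const_sub (∫ t in Set.Ioi (0 : ℝ), f t))).const_smul
      e).neg
    refine (h5.congr hshift (hshift 0 (by simp))).congr_deriv ?_
    simp [hf, rayIntegral, smul_smul]
  have h6 : HasDerivWithinAt (fun s : ℝ => rayIntegral e l g (z + e * s))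
      (e • deriv (rayIntegral e l g) z) (Set.Ici 0) 0 := by
    have h7 : HasDerivAt (fun s : ℝ => z + e * s) e 0 := by
      simpa using ((Complex.ofRealCLM.hasDerivAt (x := (0 : ℝ))).const_mul e).const_add z
    have h8 : HasDerivAt (rayIntegral e l g) (deriv (rayIntegral e l g) z) (z + e * (0 : ℝ)) := by
      simpa using hu
    exact (h8.scomp (0 : ℝ) h7).hasDerivWithinAt
  have h9 := (uniqueDiffWithinAt_Ici (0 : ℝ)).eq_deriv _ h2 h6
  rw [smul_right_injective E he0 h9]
  exact hu

/-- A bounded solution of `u' = l u + g` is the integral from infinity. -/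
theorem eq_rayIntegral {Ω : Set ℂ} {e l : ℂ} {g u : ℂ → E} {κ K C : ℝ} (hΩ : IsRayInvariant e Ω)
    (hκ : 0 < κ) (hl : κ ≤ (l * e).re) (hg : ContinuousOn g Ω)
    (hb : ∀ z ∈ Ω, ‖g z‖ ≤ K) (hu : ∀ z ∈ Ω, HasDerivAt u (l • u z + g z) z)
    (hC : ∀ z ∈ Ω, ‖u z‖ ≤ C) {z : ℂ} (hz : z ∈ Ω) : u z = rayIntegral e l g z := by
  have h1 : ∀ t ∈ Set.Ici (0 : ℝ), HasDerivAt
      (fun t : ℝ => Complex.exp (-(l * e * t)) • u (z + e * t))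
      (e • Complex.exp (-(l * e * t)) • g (z + e * t)) t := by
    intro t ht
    have h2 : HasDerivAt (fun s : ℝ => z + e * s) e t := by
      simpa using ((Complex.ofRealCLM.hasDerivAt (x := t)).const_mul e).const_add z
    have h3 := (hu _ (hΩ z hz t ht)).scomp t h2
    have h4 : HasDerivAt (fun s : ℝ => Complex.exp (-(l * e * s)))
        (Complex.exp (-(l * e * t)) * -(l * e)) t := by
      have := ((Complex.ofRealCLM.hasDerivAt (x := t)).const_mul (l * e)).neg.cexp
      simpa using this
    refine (h4.smul h3).congr_deriv ?_
    simp only [smul_add, smul_smul, Function.comp_apply]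
    module
  have h5 : Filter.Tendsto (fun t : ℝ => Complex.exp (-(l * e * t)) • u (z + e * t)) Filter.atTop
      (𝓝 0) := by
    have h6 : Filter.Tendsto (fun t : ℝ => Real.exp (-κ * t) * C) Filter.atTop (𝓝 0) := by
      have := (Real.tendsto_exp_atBot.comp
        (Filter.tendsto_id.const_mul_atTop_of_neg (r := -κ) (by linarith))).mul_const C
      simpa using this
    refine squeeze_zero_norm' ?_ h6
    filter_upwards [Filter.eventually_ge_atTop 0] with t ht
    exact norm_ray_le hΩ hl hC hz ht
  have h7 := MeasureTheory.integral_Ioi_of_hasDerivAt_of_tendsto' h1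
    ((integrableOn_ray hΩ hκ hl hg hb hz).smul e) h5
  rw [MeasureTheory.integral_smul] at h7
  rw [rayIntegral, h7]
  simp

/-- Since u is the integral of g from infinity, a bound C on u improves to LC/κ ≤ C/2; iteration
gives 0. -/
theorem eq_zero_of_linear_bound {Ω : Set ℂ} {e l : ℂ} {g u : ℂ → E} {κ L C : ℝ}
    (hΩ : IsRayInvariant e Ω) (he : ‖e‖ = 1) (hκ : 0 < κ) (hl : κ ≤ (l * e).re)
    (hg : ContinuousOn g Ω) (hL : 0 ≤ L) (hLκ : 2 * L ≤ κ) (hb : ∀ z ∈ Ω, ‖g z‖ ≤ L * ‖u z‖)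
    (hu : ∀ z ∈ Ω, HasDerivAt u (l • u z + g z) z)
    (hC : ∀ z ∈ Ω, ‖u z‖ ≤ C) {z : ℂ} (hz : z ∈ Ω) : u z = 0 := by
  have h1 : ∀ n : ℕ, ∀ z ∈ Ω, ‖u z‖ ≤ C * (1 / 2) ^ n := by
    intro n
    induction n with
    | zero => simpa using hC
    | succ n ih =>
      intro z hz
      have h2 : ∀ z ∈ Ω, ‖g z‖ ≤ L * (C * (1 / 2) ^ n) := fun z hz =>
        (hb z hz).trans (mul_le_mul_of_nonneg_left (ih z hz) hL)
      rw [eq_rayIntegral hΩ hκ hl hg h2 hu hC hz]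
      refine (norm_rayIntegral_le hΩ he hκ hl h2 hz).trans ?_
      have h3 : 0 ≤ C * (1 / 2) ^ n := (norm_nonneg _).trans (ih z hz)
      rw [div_le_iff₀ hκ, pow_succ]
      nlinarith
  have h4 : Filter.Tendsto (fun n : ℕ => C * (1 / 2 : ℝ) ^ n) Filter.atTop (𝓝 0) := by
    simpa using (tendsto_pow_atTop_nhds_zero_of_lt_one (by norm_num : (0 : ℝ) ≤ 1 / 2)
      (by norm_num)).const_mul C
  exact norm_le_zero_iff.1 (ge_of_tendsto' h4 fun n => h1 n z hz)

end RayIntegral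

end

noncomputable section

/-! ### Nonlinear equations with a large parameter -/

section Picard

variable {E : Type*} [NormedAddCommGroup E] [NormedSpace ℂ E]

/-- A nonlinearity `G z ħ u` in the equation `u' = l u + G z ħ u`, on the unit ball. -/
structure IsNonlinearity (G : ℂ → ℂ → E → E) (Ω T : Set ℂ) (L : ℝ) : Prop where
  diff_fst : ∀ ħ ∈ T, ∀ u : ℂ → E, DifferentiableOn ℂ u Ω → (∀ z ∈ Ω, ‖u z‖ ≤ 1) →
    DifferentiableOn ℂ (fun z => G z ħ (u z)) Ω
  diff_snd : ∀ z ∈ Ω, ∀ u : ℂ → E, DifferentiableOn ℂ u T → (∀ ħ ∈ T, ‖u ħ‖ ≤ 1) →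
    DifferentiableOn ℂ (fun ħ => G z ħ (u ħ)) T
  bound : ∀ z ∈ Ω, ∀ ħ ∈ T, ∀ u, ‖u‖ ≤ 1 → ‖G z ħ u‖ ≤ L
  lipschitz : ∀ z ∈ Ω, ∀ ħ ∈ T, ∀ u v, ‖u‖ ≤ 1 → ‖v‖ ≤ 1 → ‖G z ħ u - G z ħ v‖ ≤ L * ‖u - v‖

/-- The Picard iterates for `u' = l u + G z ħ u`. -/
def picardIterate (e : ℂ) (l : ℂ → ℂ) (G : ℂ → ℂ → E → E) : ℕ → ℂ → ℂ → E
  | 0 => fun _ _ => 0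
  | n + 1 => fun z ħ => rayIntegral e (l ħ) (fun z => G z ħ (picardIterate e l G n z ħ)) z

variable [CompleteSpace E]

/-- The condition 2L ≤ κ makes the integral operator a contraction with factor 1/2 and keeps the
iterates in the ball of radius L/κ ≤ 1/2. Holomorphy in z and in ħ is carried along separately. -/
theorem picardIterate_props {G : ℂ → ℂ → E → E} {Ω T : Set ℂ} {L κ : ℝ} {e : ℂ} {l : ℂ → ℂ}
    (hG : IsNonlinearity G Ω T L) (hΩo : IsOpen Ω) (hΩ : IsRayInvariant e Ω) (hT : IsOpen T)
    (he : ‖e‖ = 1) (hκ : 0 < κ) (hL : 0 ≤ L) (hLκ : 2 * L ≤ κ) (hl : ∀ ħ ∈ T, κ ≤ (l ħ * e).re)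
    (hld : DifferentiableOn ℂ l T) (n : ℕ) :
    (∀ ħ ∈ T, DifferentiableOn ℂ (fun z => picardIterate e l G n z ħ) Ω) ∧
    (∀ z ∈ Ω, DifferentiableOn ℂ (fun ħ => picardIterate e l G n z ħ) T) ∧
    (∀ z ∈ Ω, ∀ ħ ∈ T, ‖picardIterate e l G n z ħ‖ ≤ L / κ) ∧
    (∀ z ∈ Ω, ∀ ħ ∈ T, ‖picardIterate e l G n z ħ - picardIterate e l G (n + 1) z ħ‖ ≤
      1 / 2 / 2 ^ n) := by
  have hL1 : L / κ ≤ 1 / 2 := by rw [div_le_iff₀ hκ]; linarith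
  have key : ∀ n, (∀ ħ ∈ T, DifferentiableOn ℂ (fun z => picardIterate e l G n z ħ) Ω) ∧
      (∀ z ∈ Ω, DifferentiableOn ℂ (fun ħ => picardIterate e l G n z ħ) T) ∧
      (∀ z ∈ Ω, ∀ ħ ∈ T, ‖picardIterate e l G n z ħ‖ ≤ L / κ) := by
    intro n
    induction n with
    | zero =>
      refine ⟨fun _ _ => differentiableOn_const _, fun _ _ => differentiableOn_const _,
        fun z _ ħ _ => ?_⟩
      simpa [picardIterate] using div_nonneg hL hκ.le
    | succ n ih =>
      obtain ⟨h1, h2, h3⟩ := ih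
      have h4 : ∀ z ∈ Ω, ∀ ħ ∈ T, ‖picardIterate e l G n z ħ‖ ≤ 1 := fun z hz ħ hħ =>
        (h3 z hz ħ hħ).trans (by linarith)
      have h5 : ∀ ħ ∈ T, DifferentiableOn ℂ (fun z => G z ħ (picardIterate e l G n z ħ)) Ω :=
        fun ħ hħ => hG.diff_fst ħ hħ _ (h1 ħ hħ) fun z hz => h4 z hz ħ hħ
      have h6 : ∀ z ∈ Ω, ∀ ħ ∈ T, ‖G z ħ (picardIterate e l G n z ħ)‖ ≤ L := fun z hz ħ hħ =>
        hG.bound z hz ħ hħ _ (h4 z hz ħ hħ)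
      refine ⟨fun ħ hħ => ?_, fun z hz => ?_, fun z hz ħ hħ => ?_⟩
      · exact differentiableOn_rayIntegral hΩo hΩ hκ (hl ħ hħ) (h5 ħ hħ) fun z hz => h6 z hz ħ hħ
      · exact differentiableOn_rayIntegral_param hT hΩ hκ hl hld (fun ħ hħ => (h5 ħ hħ).continuousOn)
          (fun z hz => hG.diff_snd z hz _ (h2 z hz) (h4 z hz)) h6 hz
      · exact norm_rayIntegral_le hΩ he hκ (hl ħ hħ) (fun z hz => h6 z hz ħ hħ) hz
  refine ⟨(key n).1, (key n).2.1, (key n).2.2, ?_⟩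
  induction n with
  | zero =>
    intro z hz ħ hħ
    have := (key 1).2.2 z hz ħ hħ
    simp only [picardIterate, zero_sub, norm_neg] at this ⊢
    refine this.trans ?_
    simpa using hL1
  | succ n ih =>
    intro z hz ħ hħ
    have h1 : ∀ m, ∀ z ∈ Ω, ‖picardIterate e l G m z ħ‖ ≤ 1 := fun m z hz =>
      ((key m).2.2 z hz ħ hħ).trans (by linarith)
    have h2 : ∀ m, ContinuousOn (fun z => G z ħ (picardIterate e l G m z ħ)) Ω := fun m =>
      (hG.diff_fst ħ hħ _ ((key m).1 ħ hħ) (h1 m)).continuousOn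
    have h3 : ∀ m, ∀ z ∈ Ω, ‖G z ħ (picardIterate e l G m z ħ)‖ ≤ L := fun m z hz =>
      hG.bound z hz ħ hħ _ (h1 m z hz)
    have h4 := rayIntegral_sub hΩ hκ (hl ħ hħ) (h2 n) (h3 n) (h2 (n + 1)) (h3 (n + 1)) hz
    refine (congrArg norm h4).le.trans ((norm_rayIntegral_le (K := L * (1 / 2 / 2 ^ n)) hΩ he hκ (hl ħ hħ)
      (fun z hz => ?_) hz).trans ?_)
    · exact (hG.lipschitz z hz ħ hħ _ _ (h1 n z hz) (h1 (n + 1) z hz)).trans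
        (mul_le_mul_of_nonneg_left (ih z hz ħ hħ) hL)
    · rw [div_le_iff₀ hκ, pow_succ]
      have : (0 : ℝ) < 1 / 2 / 2 ^ n := by positivity
      have h5 : (1 : ℝ) / 2 / (2 ^ n * 2) = 1 / 2 / 2 ^ n / 2 := by rw [div_div (1 / 2 : ℝ)]
      rw [h5]
      nlinarith

theorem nonlinear_unique {G : ℂ → ℂ → E → E} {Ω T : Set ℂ} {L κ : ℝ} {e l ħ : ℂ}
    (hG : IsNonlinearity G Ω T L) (hΩ : IsRayInvariant e Ω) (hħ : ħ ∈ T)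
    (he : ‖e‖ = 1) (hκ : 0 < κ) (hL : 0 ≤ L) (hLκ : 2 * L ≤ κ) (hl : κ ≤ (l * e).re)
    {u v : ℂ → E} (hu : ∀ z ∈ Ω, HasDerivAt u (l • u z + G z ħ (u z)) z)
    (hv : ∀ z ∈ Ω, HasDerivAt v (l • v z + G z ħ (v z)) z) (hu1 : ∀ z ∈ Ω, ‖u z‖ ≤ 1)
    (hv1 : ∀ z ∈ Ω, ‖v z‖ ≤ 1) {z : ℂ} (hz : z ∈ Ω) : u z = v z := by
  have hd : ∀ {w : ℂ → E}, (∀ z ∈ Ω, HasDerivAt w (l • w z + G z ħ (w z)) z) →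
      DifferentiableOn ℂ w Ω := fun h z hz => (h z hz).differentiableAt.differentiableWithinAt
  refine sub_eq_zero.1 (eq_zero_of_linear_bound (u := fun z => u z - v z)
    (g := fun z => G z ħ (u z) - G z ħ (v z)) (C := 2) hΩ he hκ hl
    ((hG.diff_fst ħ hħ u (hd hu) hu1).continuousOn.sub
      (hG.diff_fst ħ hħ v (hd hv) hv1).continuousOn) hL hLκ
    (fun z hz => hG.lipschitz z hz ħ hħ _ _ (hu1 z hz) (hv1 z hz)) (fun z hz => ?_)
    (fun z hz => ?_) hz)
  · refine ((hu z hz).sub (hv z hz)).congr_deriv ?_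
    rw [smul_sub]; abel
  · exact (norm_sub_le _ _).trans (by linarith [hu1 z hz, hv1 z hz])

theorem exists_nonlinear_solution {G : ℂ → ℂ → E → E} {Ω T : Set ℂ} {L κ : ℝ} {e : ℂ} {l : ℂ → ℂ}
    (hG : IsNonlinearity G Ω T L) (hΩo : IsOpen Ω) (hΩ : IsRayInvariant e Ω) (hT : IsOpen T)
    (he : ‖e‖ = 1) (hκ : 0 < κ) (hL : 0 ≤ L) (hLκ : 2 * L ≤ κ) (hl : ∀ ħ ∈ T, κ ≤ (l ħ * e).re)
    (hld : DifferentiableOn ℂ l T) :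
    ∃ N : ℂ → ℂ → E, (∀ ħ ∈ T, ∀ z ∈ Ω,
        HasDerivAt (fun z => N z ħ) (l ħ • N z ħ + G z ħ (N z ħ)) z) ∧
      (∀ z ∈ Ω, DifferentiableOn ℂ (N z) T) ∧ ∀ z ∈ Ω, ∀ ħ ∈ T, ‖N z ħ‖ ≤ L / κ := by
  have hL1 : L / κ ≤ 1 / 2 := by rw [div_le_iff₀ hκ]; linarith
  have hp := picardIterate_props hG hΩo hΩ hT he hκ hL hLκ hl hld
  set v := picardIterate e l G with hv
  have hstep : ∀ z ∈ Ω, ∀ ħ ∈ T, ∀ n, dist (v n z ħ) (v (n + 1) z ħ) ≤ 1 / 2 / 2 ^ n :=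
    fun z hz ħ hħ n => by rw [dist_eq_norm]; exact (hp n).2.2.2 z hz ħ hħ
  -- The limit is made total in z and ħ, with the value 0 outside Ω × T, so that it can be chosen as
  -- a function.
  have hlim : ∀ z ħ, ∃ y, z ∈ Ω → ħ ∈ T → Filter.Tendsto (fun n => v n z ħ) Filter.atTop (𝓝 y) := by
    intro z ħ
    by_cases h : z ∈ Ω ∧ ħ ∈ T
    · obtain ⟨y, hy⟩ := cauchySeq_tendsto_of_complete
        (cauchySeq_of_le_geometric_two (C := 1) (hstep z h.1 ħ h.2))
      exact ⟨y, fun _ _ => hy⟩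
    · exact ⟨0, fun h1 h2 => absurd ⟨h1, h2⟩ h⟩
  choose N hN using hlim
  have hdist : ∀ z ∈ Ω, ∀ ħ ∈ T, ∀ n, ‖v n z ħ - N z ħ‖ ≤ 1 / 2 ^ n := fun z hz ħ hħ n => by
    rw [← dist_eq_norm]
    exact dist_le_of_le_geometric_two_of_tendsto (C := 1) (hstep z hz ħ hħ) (hN z ħ hz hħ) n
  have hpow : Filter.Tendsto (fun n : ℕ => 1 / (2 : ℝ) ^ n) Filter.atTop (𝓝 0) := by
    simpa using tendsto_pow_atTop_nhds_zero_of_lt_one (by norm_num : (0 : ℝ) ≤ 1 / 2) (by norm_num)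
  have hunif : ∀ {A : Set ℂ} {w : ℕ → ℂ → E} {y : ℂ → E},
      (∀ p ∈ A, ∀ n, ‖w n p - y p‖ ≤ 1 / 2 ^ n) → TendstoUniformlyOn w y Filter.atTop A := by
    intro A w y h
    rw [Metric.tendstoUniformlyOn_iff]
    intro ε hε
    filter_upwards [hpow.eventually_lt_const hε] with n hn p hp
    rw [dist_comm, dist_eq_norm]
    exact (h p hp n).trans_lt hn
  have hbd : ∀ z ∈ Ω, ∀ ħ ∈ T, ‖N z ħ‖ ≤ L / κ := fun z hz ħ hħ =>
    le_of_tendsto' (hN z ħ hz hħ).norm fun n => (hp n).2.2.1 z hz ħ hħ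
  have hd1 : ∀ ħ ∈ T, DifferentiableOn ℂ (fun z => N z ħ) Ω := fun ħ hħ =>
    (hunif (w := fun n z => v n z ħ) fun z hz n => hdist z hz ħ hħ n).tendstoLocallyUniformlyOn.differentiableOn
      (Filter.Eventually.of_forall fun n => (hp n).1 ħ hħ) hΩo
  refine ⟨N, fun ħ hħ => ?_, fun z hz => ?_, hbd⟩
  · have h1 : ∀ z ∈ Ω, ‖N z ħ‖ ≤ 1 := fun z hz => (hbd z hz ħ hħ).trans (by linarith)
    have h2 : ∀ m, ∀ z ∈ Ω, ‖v m z ħ‖ ≤ 1 := fun m z hz =>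
      ((hp m).2.2.1 z hz ħ hħ).trans (by linarith)
    have h3 := hG.diff_fst ħ hħ _ (hd1 ħ hħ) h1
    have h4 : ∀ z ∈ Ω, ‖G z ħ (N z ħ)‖ ≤ L := fun z hz => hG.bound z hz ħ hħ _ (h1 z hz)
    have h5 : ∀ z ∈ Ω, N z ħ = rayIntegral e (l ħ) (fun z => G z ħ (N z ħ)) z := by
      -- The Lipschitz bound lets the limit pass through the integral, so N satisfies the fixed
      -- point equation and hence the differential equation.
      intro z hz
      refine tendsto_nhds_unique ((Filter.tendsto_add_atTop_iff_nat 1).2 (hN z ħ hz hħ)) ?_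
      rw [tendsto_iff_norm_sub_tendsto_zero]
      refine squeeze_zero (fun _ => norm_nonneg _) (fun n => ?_) hpow
      have h6 := rayIntegral_sub hΩ hκ (hl ħ hħ)
        (hG.diff_fst ħ hħ _ ((hp n).1 ħ hħ) (h2 n)).continuousOn
        (fun z hz => hG.bound z hz ħ hħ _ (h2 n z hz)) h3.continuousOn h4 hz
      refine (congrArg norm h6).le.trans ((norm_rayIntegral_le (K := L * (1 / 2 ^ n)) hΩ he hκ (hl ħ hħ)
        (fun z hz => ?_) hz).trans ?_)
      · exact (hG.lipschitz z hz ħ hħ _ _ (h2 n z hz) (h1 z hz)).trans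
          (mul_le_mul_of_nonneg_left (hdist z hz ħ hħ n) hL)
      · rw [mul_div_right_comm]
        exact mul_le_of_le_one_left (by positivity) (by linarith)
    intro z hz
    have h6 := hasDerivAt_rayIntegral hΩo hΩ he hκ (hl ħ hħ) h3 h4 hz
    rw [← h5 z hz] at h6
    refine h6.congr_of_eventuallyEq ?_
    filter_upwards [hΩo.mem_nhds hz] with y hy using h5 y hy
  · exact (hunif (w := fun n ħ => v n z ħ) fun ħ hħ n =>
      hdist z hz ħ hħ n).tendstoLocallyUniformlyOn.differentiableOn
      (Filter.Eventually.of_forall fun n => (hp n).2.1 z hz) hT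

end Picard

end

noncomputable section

/-! ### Invariant projectors of linear systems with a large parameter -/

section Projector

variable {𝔸 : Type*} [NormedRing 𝔸]

/-- The nonlinear part of the equation for the correction `N` to the leading-order projector `P`. -/
def projectorRest (P P' R N : 𝔸) : 𝔸 :=
  (1 - P - N) * R * (P + N) + (P + N) * P' * (1 - N) - P'

/-- Bounds for a holomorphic family of projectors `P` and for a perturbation `R`. -/
structure ProjectorBounds [NormedAlgebra ℂ 𝔸] (P : ℂ → 𝔸) (R : ℂ → ℂ → 𝔸) (Ω T : Set ℂ)
    (p : ℝ) : Prop where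
  isOpen : IsOpen Ω
  diff : DifferentiableOn ℂ P Ω
  idem : ∀ z ∈ Ω, P z * P z = P z
  bound : ∀ z ∈ Ω, ‖P z‖ ≤ p
  bound_deriv : ∀ z ∈ Ω, ‖deriv P z‖ ≤ p
  diff_fst : ∀ ħ ∈ T, DifferentiableOn ℂ (fun z => R z ħ) Ω
  diff_snd : ∀ z ∈ Ω, DifferentiableOn ℂ (R z) T
  bound_rest : ∀ z ∈ Ω, ∀ ħ ∈ T, ‖R z ħ‖ ≤ p

theorem norm_mul₃_le_of_le {x y z : 𝔸} {a b c : ℝ} (hx : ‖x‖ ≤ a) (hy : ‖y‖ ≤ b) (hz : ‖z‖ ≤ c) :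
    ‖x * y * z‖ ≤ a * b * c :=
  norm_mul_le_of_le (norm_mul_le_of_le hx hy) hz

/-- The expression has degree two in N with coefficients bounded by p, so on the unit ball all
bounds are cubic in p; 8(1 + p)³ is a crude common constant. -/
theorem isNonlinearity_projectorRest [NormedAlgebra ℂ 𝔸] [NormOneClass 𝔸] [CompleteSpace 𝔸]
    {P : ℂ → 𝔸} {R : ℂ → ℂ → 𝔸}
    {Ω T : Set ℂ} {p : ℝ} (h : ProjectorBounds P R Ω T p) (hp : 0 ≤ p) :
    IsNonlinearity (fun z ħ N => projectorRest (P z) (deriv P z) (R z ħ) N) Ω T (8 * (1 + p) ^ 3) where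
  diff_fst ħ hħ u hu _ := by
    have h1 := h.diff
    have h2 := h.diff.deriv h.isOpen
    have h3 := h.diff_fst ħ hħ
    unfold projectorRest
    fun_prop
  diff_snd z hz u hu _ := by
    have h3 := h.diff_snd z hz
    unfold projectorRest
    fun_prop
  bound z hz ħ hħ N hN := by
    have h1 : ‖1 - P z - N‖ ≤ 1 + p + 1 :=
      norm_sub_le_of_le (norm_sub_le_of_le norm_one.le (h.bound z hz)) hN
    have h2 : ‖P z + N‖ ≤ p + 1 := norm_add_le_of_le (h.bound z hz) hN
    have h3 : ‖1 - N‖ ≤ 1 + 1 := norm_sub_le_of_le norm_one.le hN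
    refine (norm_sub_le_of_le (norm_add_le_of_le (norm_mul₃_le_of_le h1 (h.bound_rest z hz ħ hħ) h2)
      (norm_mul₃_le_of_le h2 (h.bound_deriv z hz) h3)) (h.bound_deriv z hz)).trans ?_
    nlinarith [mul_nonneg hp hp, mul_nonneg (mul_nonneg hp hp) hp]
  lipschitz z hz ħ hħ u v hu hv := by
    have h1 : ‖1 - P z - v‖ ≤ 1 + p + 1 :=
      norm_sub_le_of_le (norm_sub_le_of_le norm_one.le (h.bound z hz)) hv
    have h2 : ‖P z + u‖ ≤ p + 1 := norm_add_le_of_le (h.bound z hz) hu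
    have h2' : ‖P z + v‖ ≤ p + 1 := norm_add_le_of_le (h.bound z hz) hv
    have h3 : ‖1 - u‖ ≤ 1 + 1 := norm_sub_le_of_le norm_one.le hu
    -- Each summand of the difference contains u - v once, in the order required by
    -- noncommutativity.
    have e : projectorRest (P z) (deriv P z) (R z ħ) u - projectorRest (P z) (deriv P z) (R z ħ) v =
        (1 - P z - v) * R z ħ * (u - v) - (u - v) * R z ħ * (P z + u) +
          (u - v) * deriv P z * (1 - u) - (P z + v) * deriv P z * (u - v) := by
      unfold projectorRest
      noncomm_ring
    simp only [e]
    refine (norm_sub_le_of_le (norm_add_le_of_le (norm_sub_le_of_le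
      (norm_mul₃_le_of_le h1 (h.bound_rest z hz ħ hħ) le_rfl)
      (norm_mul₃_le_of_le le_rfl (h.bound_rest z hz ħ hħ) h2))
      (norm_mul₃_le_of_le le_rfl (h.bound_deriv z hz) h3))
      (norm_mul₃_le_of_le h2' (h.bound_deriv z hz) le_rfl)).trans ?_
    have h4 := norm_nonneg (u - v)
    have h5 : (1 + p + 1) * p + p * (p + 1) + p * (1 + 1) + (p + 1) * p ≤ 8 * (1 + p) ^ 3 := by
      nlinarith [mul_nonneg hp hp, mul_nonneg (mul_nonneg hp hp) hp]
    calc _ = ((1 + p + 1) * p + p * (p + 1) + p * (1 + 1) + (p + 1) * p) * ‖u - v‖ := by ring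
      _ ≤ _ := mul_le_mul_of_nonneg_right h5 h4

theorem proj_deriv_eq [NormedAlgebra ℂ 𝔸] {P : ℂ → 𝔸} {R : ℂ → ℂ → 𝔸}
    {Ω T : Set ℂ} {p : ℝ} (h : ProjectorBounds P R Ω T p) {z : ℂ} (hz : z ∈ Ω) :
    deriv P z * P z + P z * deriv P z = deriv P z := by
  have h1 := (h.diff.differentiableAt (h.isOpen.mem_nhds hz)).hasDerivAt
  refine (h1.mul h1).unique (h1.congr_of_eventuallyEq ?_)
  filter_upwards [h.isOpen.mem_nhds hz] with y hy using h.idem y hy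

/-- The left side is (PN)' - l PN. The right side is linear in PN with bounded coefficients, so PN
is a bounded solution of a homogeneous equation and must vanish. The hypothesis on P' is the
derivative of P² = P. -/
theorem proj_mul_rest {P P' R N : 𝔸} (hP : P * P = P) (hP' : P' * P + P * P' = P') :
    P' * N + P * projectorRest P P' R N =
      P' * (P * N) - (P * N) * R * (P + N) + (P * N) * P' * (1 - N) := by
  have e : P' * N + P * projectorRest P P' R N -
      (P' * (P * N) - (P * N) * R * (P + N) + (P * N) * P' * (1 - N)) =
      (P - P * P) * R * (P + N) + (P * P - P) * P' * (1 - N) - (P' * P + P * P' - P') * N := by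
    unfold projectorRest
    noncomm_ring
  rw [← sub_eq_zero, e, hP, hP']
  simp

/-- The counterpart of `proj_mul_rest` for N(1 - P). -/
theorem rest_mul_proj {P P' R N : 𝔸} (hP : P * P = P) (hP' : P' * P + P * P' = P') :
    projectorRest P P' R N * (1 - P) - N * P' =
      (1 - P - N) * R * (N * (1 - P)) - (P + N) * P' * (N * (1 - P)) - (N * (1 - P)) * P' := by
  have e : projectorRest P P' R N * (1 - P) - N * P' -
      ((1 - P - N) * R * (N * (1 - P)) - (P + N) * P' * (N * (1 - P)) - (N * (1 - P)) * P') =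
      (1 - P - N) * R * (P - P * P) - N * (P' * P + P * P' - P') +
        (P' * P + P * P' - P') - P * (P' * P + P * P' - P') + (P * P - P) * P' := by
    unfold projectorRest
    noncomm_ring
  rw [← sub_eq_zero, e, hP, hP']
  simp

/-- The conditions say that N maps the range of P to its kernel and kills the kernel; thus N² = 0
and NP = N, and P + N is the projector onto a graph over the range of P. -/
theorem projector_idem {P N : 𝔸} (hP : P * P = P) (h1 : P * N = 0) (h2 : N * (1 - P) = 0) :
    (P + N) * (P + N) = P + N := by
  have h3 : N * P = N := by rw [mul_sub, mul_one, sub_eq_zero] at h2; exact h2.symm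
  have h4 : N * N = 0 := by
    calc N * N = (N * P) * N := by rw [h3]
      _ = 0 := by rw [mul_assoc, h1, mul_zero]
  rw [mul_add, add_mul, add_mul, hP, h1, h3, h4]
  abel

/-- The derivative of the invariant projector. -/
theorem projector_deriv [NormedAlgebra ℂ 𝔸] {P P' R N : 𝔸} {ε : ℂ} {ħ : ℂ} (hħ : ħ ≠ 0) (hP : P * P = P)
    (h1 : P * N = 0) (h2 : N * (1 - P) = 0) :
    ħ • (P' + ((ε / ħ) • N + projectorRest P P' R N)) =
      (1 - (P + N)) * (ε • ((1 / 2 : ℂ) • 1 - P) + ħ • R) * (P + N) +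
        (P + N) * (ħ • (P' * (1 - N))) := by
  have h3 : N * P = N := by rw [mul_sub, mul_one, sub_eq_zero] at h2; exact h2.symm
  have h4 : N * N = 0 := by
    calc N * N = (N * P) * N := by rw [h3]
      _ = 0 := by rw [mul_assoc, h1, mul_zero]
  -- The eigenvalue gap of 1/2 - P is one; this produces the linear term (ε/ħ)N of the equation.
  have h5 : (1 - (P + N)) * ((1 / 2 : ℂ) • 1 - P) * (P + N) = N := by
    have e : (1 - (P + N)) * ((1 / 2 : ℂ) • 1 - P) * (P + N) =
        (1 / 2 : ℂ) • ((P + N) - (P + N) * (P + N)) - (1 - (P + N)) * (P * P + P * N) := by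
      simp only [mul_sub, sub_mul, smul_mul_assoc, mul_smul_comm, mul_one, one_mul, mul_add,
        add_mul, mul_assoc, smul_sub, smul_add]
      abel
    rw [e, projector_idem hP h1 h2, sub_self, smul_zero, hP, h1, add_zero, sub_mul, add_mul, hP, h3]
    simp
  have h6 : (1 - (P + N)) * (ε • ((1 / 2 : ℂ) • 1 - P) + ħ • R) * (P + N) =
      ε • N + ħ • ((1 - (P + N)) * R * (P + N)) := by
    rw [mul_add (1 - (P + N)), add_mul _ _ (P + N), mul_smul_comm, smul_mul_assoc, h5, mul_smul_comm, smul_mul_assoc]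
  rw [h6, smul_add, smul_add, smul_smul, mul_div_cancel₀ _ hħ, projectorRest, mul_smul_comm,
    ← sub_sub 1 P N, ← mul_assoc]
  simp only [smul_add, smul_sub]
  abel

variable [NormedAlgebra ℂ 𝔸] [NormOneClass 𝔸] [CompleteSpace 𝔸]

/-- The constant 16(1 + p)³ is twice the Lipschitz constant 8(1 + p)³, as the contraction requires.
The same inequality forces PN and N(1 - P) to vanish. -/
theorem exists_projector {P : ℂ → 𝔸} {R : ℂ → ℂ → 𝔸} {Ω T : Set ℂ} {p κ : ℝ} {e : ℂ} {l : ℂ → ℂ}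
    (h : ProjectorBounds P R Ω T p) (hp : 0 ≤ p) (hΩ : IsRayInvariant e Ω) (hT : IsOpen T)
    (he : ‖e‖ = 1) (hκ : 16 * (1 + p) ^ 3 ≤ κ) (hl : ∀ ħ ∈ T, κ ≤ (l ħ * e).re)
    (hld : DifferentiableOn ℂ l T) :
    ∃ N : ℂ → ℂ → 𝔸, (∀ ħ ∈ T, ∀ z ∈ Ω, HasDerivAt (fun z => N z ħ)
        (l ħ • N z ħ + projectorRest (P z) (deriv P z) (R z ħ) (N z ħ)) z) ∧
      (∀ z ∈ Ω, DifferentiableOn ℂ (N z) T) ∧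
      (∀ z ∈ Ω, ∀ ħ ∈ T, ‖N z ħ‖ ≤ 8 * (1 + p) ^ 3 / κ) ∧
      (∀ z ∈ Ω, ∀ ħ ∈ T, P z * N z ħ = 0) ∧ ∀ z ∈ Ω, ∀ ħ ∈ T, N z ħ * (1 - P z) = 0 := by
  have hκ0 : 0 < κ := lt_of_lt_of_le (by positivity) hκ
  obtain ⟨N, hN, hNd, hNb⟩ := exists_nonlinear_solution (isNonlinearity_projectorRest h hp)
    h.isOpen hΩ hT he hκ0 (by positivity) (by linarith) hl hld
  have hN1 : ∀ z ∈ Ω, ∀ ħ ∈ T, ‖N z ħ‖ ≤ 1 := fun z hz ħ hħ =>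
    (hNb z hz ħ hħ).trans (by rw [div_le_one hκ0]; linarith [show 0 ≤ (1 + p) ^ 3 by positivity])
  have hNc : ∀ ħ ∈ T, DifferentiableOn ℂ (fun z => N z ħ) Ω := fun ħ hħ z hz =>
    (hN ħ hħ z hz).differentiableAt.differentiableWithinAt
  have hPc := h.diff
  have hPc' := h.diff.deriv h.isOpen
  have hPd : ∀ z ∈ Ω, HasDerivAt P (deriv P z) z := fun z hz =>
    (h.diff.differentiableAt (h.isOpen.mem_nhds hz)).hasDerivAt
  have hL : p + p * (p + 1) + p * (1 + 1) ≤ 8 * (1 + p) ^ 3 := by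
    nlinarith [mul_nonneg hp hp, mul_nonneg (mul_nonneg hp hp) hp]
  have hL' : (1 + p + 1) * p + (p + 1) * p + p ≤ 8 * (1 + p) ^ 3 := by
    nlinarith [mul_nonneg hp hp, mul_nonneg (mul_nonneg hp hp) hp]
  refine ⟨N, hN, hNd, hNb, fun z hz ħ hħ => ?_, fun z hz ħ hħ => ?_⟩
  · have hRc := h.diff_fst ħ hħ
    have hNc' := hNc ħ hħ
    refine eq_zero_of_linear_bound (u := fun z => P z * N z ħ) (g := fun z =>
      deriv P z * (P z * N z ħ) - (P z * N z ħ) * R z ħ * (P z + N z ħ) +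
        (P z * N z ħ) * deriv P z * (1 - N z ħ)) (C := p * 1) hΩ he hκ0 (hl ħ hħ)
      (DifferentiableOn.continuousOn (𝕜 := ℂ) (by fun_prop)) (by positivity)
      (by linarith : 2 * (8 * (1 + p) ^ 3) ≤ κ) (fun z hz => ?_) (fun z hz => ?_)
      (fun z hz => norm_mul_le_of_le (h.bound z hz) (hN1 z hz ħ hħ)) hz
    · refine (norm_add_le_of_le (norm_sub_le_of_le
        (norm_mul_le_of_le (h.bound_deriv z hz) le_rfl)
        (norm_mul₃_le_of_le le_rfl (h.bound_rest z hz ħ hħ)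
          (norm_add_le_of_le (h.bound z hz) (hN1 z hz ħ hħ))))
        (norm_mul₃_le_of_le le_rfl (h.bound_deriv z hz)
          (norm_sub_le_of_le norm_one.le (hN1 z hz ħ hħ)))).trans ?_
      refine le_trans (le_of_eq ?_) (mul_le_mul_of_nonneg_right hL (norm_nonneg _))
      ring
    · refine ((hPd z hz).mul (hN ħ hħ z hz)).congr_deriv ?_
      rw [← proj_mul_rest (h.idem z hz) (proj_deriv_eq h hz), mul_add, mul_smul_comm]
      abel
  · have hRc := h.diff_fst ħ hħ
    have hNc' := hNc ħ hħ
    refine eq_zero_of_linear_bound (u := fun z => N z ħ * (1 - P z)) (g := fun z =>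
      (1 - P z - N z ħ) * R z ħ * (N z ħ * (1 - P z)) -
        (P z + N z ħ) * deriv P z * (N z ħ * (1 - P z)) - (N z ħ * (1 - P z)) * deriv P z)
      (C := 1 * (1 + p)) hΩ he hκ0 (hl ħ hħ)
      (DifferentiableOn.continuousOn (𝕜 := ℂ) (by fun_prop)) (by positivity)
      (by linarith : 2 * (8 * (1 + p) ^ 3) ≤ κ) (fun z hz => ?_) (fun z hz => ?_)
      (fun z hz => norm_mul_le_of_le (hN1 z hz ħ hħ)
        (norm_sub_le_of_le norm_one.le (h.bound z hz))) hz
    · refine (norm_sub_le_of_le (norm_sub_le_of_le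
        (norm_mul₃_le_of_le (norm_sub_le_of_le (norm_sub_le_of_le norm_one.le (h.bound z hz))
          (hN1 z hz ħ hħ)) (h.bound_rest z hz ħ hħ) le_rfl)
        (norm_mul₃_le_of_le (norm_add_le_of_le (h.bound z hz) (hN1 z hz ħ hħ))
          (h.bound_deriv z hz) le_rfl))
        (norm_mul_le_of_le le_rfl (h.bound_deriv z hz))).trans ?_
      refine le_trans (le_of_eq ?_) (mul_le_mul_of_nonneg_right hL' (norm_nonneg _))
      ring
    · refine ((hN ħ hħ z hz).mul ((hPd z hz).const_sub 1)).congr_deriv ?_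
      rw [← rest_mul_proj (h.idem z hz) (proj_deriv_eq h hz), add_mul, smul_mul_assoc, mul_neg]
      abel

theorem projector_unique {P : ℂ → 𝔸} {R : ℂ → ℂ → 𝔸} {Ω T : Set ℂ} {p κ : ℝ} {e l ħ : ℂ}
    (h : ProjectorBounds P R Ω T p) (hp : 0 ≤ p) (hΩ : IsRayInvariant e Ω) (hħ : ħ ∈ T)
    (he : ‖e‖ = 1) (hκ : 16 * (1 + p) ^ 3 ≤ κ) (hl : κ ≤ (l * e).re)
    {u v : ℂ → 𝔸}
    (hu : ∀ z ∈ Ω, HasDerivAt u (l • u z + projectorRest (P z) (deriv P z) (R z ħ) (u z)) z)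
    (hv : ∀ z ∈ Ω, HasDerivAt v (l • v z + projectorRest (P z) (deriv P z) (R z ħ) (v z)) z)
    (hu1 : ∀ z ∈ Ω, ‖u z‖ ≤ 1) (hv1 : ∀ z ∈ Ω, ‖v z‖ ≤ 1) {z : ℂ} (hz : z ∈ Ω) : u z = v z :=
  nonlinear_unique (isNonlinearity_projectorRest h hp) hΩ hħ he
    (lt_of_lt_of_le (by positivity) hκ) (by positivity) (by linarith) hl hu hv hu1 hv1 hz

end Projector

end

noncomputable section

/-! ### The linear system of a Riccati equation -/

/-- The linear operator `(w₁, w₂) ↦ (b w₁ / 2 + c w₂, -a w₁ - b w₂ / 2)`, for which `w₁ / w₂` solves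
the Riccati equation. -/
def companionOp (a b c : ℂ) : (ℂ × ℂ) →L[ℂ] (ℂ × ℂ) :=
  (b / 2) • ((ContinuousLinearMap.inl ℂ ℂ ℂ).comp (ContinuousLinearMap.fst ℂ ℂ ℂ) -
      (ContinuousLinearMap.inr ℂ ℂ ℂ).comp (ContinuousLinearMap.snd ℂ ℂ ℂ)) +
    c • (ContinuousLinearMap.inl ℂ ℂ ℂ).comp (ContinuousLinearMap.snd ℂ ℂ ℂ) -
    a • (ContinuousLinearMap.inr ℂ ℂ ℂ).comp (ContinuousLinearMap.fst ℂ ℂ ℂ)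

@[simp]
theorem companionOp_apply (a b c : ℂ) (w : ℂ × ℂ) :
    companionOp a b c w = (b / 2 * w.1 + c * w.2, -a * w.1 - b / 2 * w.2) := by
  ext <;> simp [companionOp]
  ring

theorem norm_companionOp_le {a b c : ℂ} {m : ℝ} (ha : ‖a‖ ≤ m) (hb : ‖b‖ ≤ m) (hc : ‖c‖ ≤ m) :
    ‖companionOp a b c‖ ≤ 2 * m := by
  have hm : 0 ≤ m := (norm_nonneg _).trans ha
  refine ContinuousLinearMap.opNorm_le_bound _ (by positivity) fun w => ?_
  rw [companionOp_apply, Prod.norm_mk]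
  have h1 : ‖w.1‖ ≤ ‖w‖ := norm_fst_le w
  have h2 : ‖w.2‖ ≤ ‖w‖ := norm_snd_le w
  have h3 : ‖b / 2‖ ≤ m := by rw [norm_div]; simp; linarith [norm_nonneg b]
  refine max_le ?_ ?_
  · refine (norm_add_le_of_le (norm_mul_le_of_le h3 h1) (norm_mul_le_of_le hc h2)).trans ?_
    linarith
  · refine (norm_sub_le_of_le (norm_mul_le_of_le (show ‖-a‖ ≤ m by rwa [norm_neg]) h1)
      (norm_mul_le_of_le h3 h2)).trans ?_
    linarith

theorem DifferentiableOn.companionOp {a b c : ℂ → ℂ} {U : Set ℂ} (ha : DifferentiableOn ℂ a U)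
    (hb : DifferentiableOn ℂ b U) (hc : DifferentiableOn ℂ c U) :
    DifferentiableOn ℂ (fun z => companionOp (a z) (b z) (c z)) U := by
  unfold _root_.companionOp
  fun_prop

/-- The projector to the eigenspace of `companionOp a b c` with eigenvalue `-ε / 2`, when
`b² - 4 a c = 1` and `ε² = 1`. -/
def leadingProjector (ε a b c : ℂ) : (ℂ × ℂ) →L[ℂ] (ℂ × ℂ) :=
  (1 / 2 : ℂ) • 1 - ε • companionOp a b c

theorem leadingProjector_apply (ε a b c : ℂ) (w : ℂ × ℂ) :
    leadingProjector ε a b c w = (1 / 2 * w.1 - ε * (b / 2 * w.1 + c * w.2),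
      1 / 2 * w.2 - ε * (-a * w.1 - b / 2 * w.2)) := by
  ext <;> simp [leadingProjector]

/-- The square of the trace-free matrix is (b²/4 - ac) times the identity, which is 1/4. -/
theorem leadingProjector_idem {ε a b c : ℂ} (hε : ε ^ 2 = 1) (h : b ^ 2 - 4 * a * c = 1) :
    leadingProjector ε a b c * leadingProjector ε a b c = leadingProjector ε a b c := by
  refine ContinuousLinearMap.ext fun w => ?_
  rw [mul_apply_eq_comp, leadingProjector_apply, leadingProjector_apply]
  ext
  · simp only
    linear_combination (w.1 / 4) * h + (w.1 * (b ^ 2 / 4 - a * c)) * hε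
  · simp only
    linear_combination (w.2 / 4) * h + (w.2 * (b ^ 2 / 4 - a * c)) * hε

theorem smul_half_sub_leadingProjector {ε : ℂ} (hε : ε ^ 2 = 1) (a b c : ℂ) :
    ε • ((1 / 2 : ℂ) • 1 - leadingProjector ε a b c) = companionOp a b c := by
  rw [leadingProjector, sub_sub_cancel, smul_smul, ← sq, hε, one_smul]

theorem norm_leadingProjector_le {ε a b c : ℂ} {m : ℝ} (hε : ‖ε‖ = 1) (ha : ‖a‖ ≤ m) (hb : ‖b‖ ≤ m)
    (hc : ‖c‖ ≤ m) : ‖leadingProjector ε a b c‖ ≤ 1 + 2 * m := by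
  refine norm_sub_le_of_le ?_ ?_
  · rw [norm_smul, norm_one]; norm_num
  · rw [norm_smul, hε, one_mul]; exact norm_companionOp_le ha hb hc

/-- The leading-order operator has rank one. -/
theorem leadingProjector_parallel {ε a b c : ℂ} (hε : ε ^ 2 = 1) (h : b ^ 2 - 4 * a * c = 1)
    {u : ℂ × ℂ} (hu : (leadingProjector ε a b c u).2 ≠ 0) (v : ℂ × ℂ) :
    ∃ μ : ℂ, leadingProjector ε a b c v = μ • leadingProjector ε a b c u := by
  refine ⟨(leadingProjector ε a b c v).2 / (leadingProjector ε a b c u).2, ?_⟩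
  have h1 : (leadingProjector ε a b c v).1 * (leadingProjector ε a b c u).2 =
      (leadingProjector ε a b c v).2 * (leadingProjector ε a b c u).1 := by
    simp only [leadingProjector_apply]
    linear_combination -((v.1 * u.2 - v.2 * u.1) / 4) * h -
      (v.1 * u.2 - v.2 * u.1) * (b ^ 2 / 4 - a * c) * hε
  ext
  · rw [Prod.smul_fst, smul_eq_mul, div_mul_eq_mul_div, ← h1, mul_div_cancel_right₀ _ hu]
  · rw [Prod.smul_snd, smul_eq_mul, div_mul_cancel₀ _ hu]

/-- The leading-order solution of the Riccati equation from the leading-order projector. -/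
theorem leading_riccati {ε a b c : ℂ} (hε : ε ^ 2 = 1) (h : b ^ 2 - 4 * a * c = 1)
    {u : ℂ × ℂ} (hu : (leadingProjector ε a b c u).2 ≠ 0) {F : ℂ}
    (hF : F = (leadingProjector ε a b c u).1 / (leadingProjector ε a b c u).2) :
    2 * a * F + b = ε ∧ a * F ^ 2 + b * F + c = 0 := by
  have hF' : F * (leadingProjector ε a b c u).2 = (leadingProjector ε a b c u).1 := by
    rw [hF, div_mul_cancel₀ _ hu]
  simp only [leadingProjector_apply] at hF' hu
  have h1 : 2 * a * F + b = ε := by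
    refine mul_right_cancel₀ hu ?_
    linear_combination 2 * a * hF' + (u.2 * ε / 2) * h - (u.1 * a + u.2 * b / 2) * hε
  have h2 : c = -(ε + b) / 2 * F := by
    refine mul_right_cancel₀ hu ?_
    linear_combination (ε + b) / 2 * hF' - (u.1 * ε / 4) * h - (u.1 * b / 4 + c * u.2 / 2) * hε
  exact ⟨h1, by linear_combination F / 2 * h1 + h2⟩

/-- An invariant projector of rank one gives a solution of the Riccati equation. -/
theorem hasDerivAt_riccati_of_projector {Q : ℂ → (ℂ × ℂ) →L[ℂ] (ℂ × ℂ)}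
    {Q' X : (ℂ × ℂ) →L[ℂ] (ℂ × ℂ)} {a b c ħ z : ℂ} {u : ℂ × ℂ} (hħ : ħ ≠ 0) (hQ : HasDerivAt Q Q' z)
    (hQ' : ħ • Q' = (1 - Q z) * companionOp a b c * Q z + Q z * X)
    (hpar : ∀ v, ∃ μ : ℂ, Q z v = μ • Q z u) (hu : (Q z u).2 ≠ 0) :
    HasDerivAt (fun z => (Q z u).1 / (Q z u).2)
      ((a * ((Q z u).1 / (Q z u).2) ^ 2 + b * ((Q z u).1 / (Q z u).2) + c) / ħ) z := by
  have h1 : HasDerivAt (fun z => Q z u) (Q' u) z := by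
    simpa using hQ.clm_apply (hasDerivAt_const z u)
  -- The derivative of Q u along the line spanned by Q u does not affect the slope. Modulo this
  -- line, ħ(Q u)' is the companion matrix applied to Q u.
  obtain ⟨μ, hμ⟩ := hpar (X u - companionOp a b c (Q z u))
  have h2 : ħ • Q' u = companionOp a b c (Q z u) + μ • Q z u := by
    have := congrArg (fun A : (ℂ × ℂ) →L[ℂ] (ℂ × ℂ) => A u) hQ'
    simp only [smul_apply, add_apply,
      mul_apply_eq_comp, sub_apply,
      one_apply_eq_self] at this
    rw [this, ← hμ, map_sub]
    abel
  have h3 : HasDerivAt (fun z => (Q z u).1) (Q' u).1 z :=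
    (ContinuousLinearMap.fst ℂ ℂ ℂ).hasFDerivAt.comp_hasDerivAt z h1
  have h4 : HasDerivAt (fun z => (Q z u).2) (Q' u).2 z :=
    (ContinuousLinearMap.snd ℂ ℂ ℂ).hasFDerivAt.comp_hasDerivAt z h1
  refine (h3.div h4 hu).congr_deriv ?_
  have h5 := congrArg Prod.fst h2
  have h6 := congrArg Prod.snd h2
  simp only [companionOp_apply, Prod.smul_fst, Prod.smul_snd, Prod.fst_add, Prod.snd_add,
    smul_eq_mul] at h5 h6
  rw [div_eq_div_iff (pow_ne_zero _ hu) hħ]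
  field_simp
  linear_combination (Q z u).2 * h5 - (Q z u).1 * h6

end

noncomputable section

/-! ### Cones of directions -/

/-- The cone spanned by `e` and `e'`. -/
def rayCone (e e' : ℂ) : Set ℂ := {z | ∃ p q : ℝ, 0 ≤ p ∧ 0 ≤ q ∧ z = p * e + q * e'}

theorem rayCone_subset_left (e e' : ℂ) : rayCone e e ⊆ rayCone e e' := by
  rintro z ⟨p, q, hp, hq, rfl⟩
  exact ⟨p + q, 0, add_nonneg hp hq, le_rfl, by push_cast; ring⟩

theorem rayCone_comm (e e' : ℂ) : rayCone e e' = rayCone e' e := by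
  ext z
  constructor <;> rintro ⟨p, q, hp, hq, rfl⟩ <;> exact ⟨q, p, hq, hp, add_comm _ _⟩

theorem isRayInvariant_thickening (e e' : ℂ) (r : ℝ) :
    IsRayInvariant e (Metric.thickening r (rayCone e e')) := by
  intro z hz t ht
  obtain ⟨_, ⟨p, q, hp, hq, rfl⟩, h⟩ := Metric.mem_thickening_iff.1 hz
  refine Metric.mem_thickening_iff.2 ⟨_, ⟨p + t, q, add_nonneg hp ht, hq, rfl⟩, ?_⟩
  rw [dist_eq_norm] at h ⊢
  convert h using 2
  push_cast
  ring

theorem ball_subset_thickening_rayCone (e e' : ℂ) (r : ℝ) :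
    Metric.ball 0 r ⊆ Metric.thickening r (rayCone e e') := fun _ hz =>
  Metric.mem_thickening_iff.2 ⟨0, ⟨0, 0, le_rfl, le_rfl, by simp⟩, hz⟩

/-- If ζ and ω lie on opposite sides of the real axis and Re ω ≥ 0, the point of the half-line
nearest to ζ is no farther from ζ than ω is. -/
theorem exists_norm_sub_real_lt {ζ ω : ℂ} {r : ℝ} (h0 : 0 ≤ ω.re) (h1 : ω.im * ζ.im ≤ 0)
    (h : ‖ζ - ω‖ < r) : ∃ t : ℝ, 0 ≤ t ∧ ‖ζ - t‖ < r := by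
  refine ⟨max ζ.re 0, le_max_right _ _, lt_of_le_of_lt ?_ h⟩
  rw [Complex.norm_def, Complex.norm_def]
  refine Real.sqrt_le_sqrt ?_
  simp only [Complex.normSq_apply, Complex.sub_re, Complex.sub_im, Complex.ofReal_re,
    Complex.ofReal_im]
  rcases le_total ζ.re 0 with h2 | h2
  · rw [max_eq_right h2]; nlinarith [mul_nonpos_of_nonpos_of_nonneg h2 h0, sq_nonneg ω.re, sq_nonneg ω.im]
  · rw [max_eq_left h2]; nlinarith [sq_nonneg (ζ.re - ω.re), sq_nonneg ω.im]

theorem exp_add_mul_I (a b : ℝ) : Complex.exp (((a + b : ℝ) : ℂ) * Complex.I) =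
    Complex.exp ((a : ℂ) * Complex.I) * Complex.exp ((b : ℂ) * Complex.I) := by
  rw [← Complex.exp_add]; push_cast; ring_nf

theorem mem_thickening_ray {e z : ℂ} {r : ℝ} (he : ‖e‖ = 1) {t : ℝ} (ht : 0 ≤ t)
    (h : ‖z / e - t‖ < r) : z ∈ Metric.thickening r (rayCone e e) := by
  have he0 : e ≠ 0 := norm_ne_zero_iff.1 (by rw [he]; exact one_ne_zero)
  refine Metric.mem_thickening_iff.2 ⟨t * e, ⟨t, 0, ht, le_rfl, by simp⟩, ?_⟩
  rw [dist_eq_norm, show z - t * e = (z / e - t) * e by field_simp, norm_mul, he, mul_one]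
  exact h

/-- A neighbourhood of a cone is covered by the rays in it and by neighbourhoods of its boundary
rays. -/
theorem thickening_rayCone_cases {θ θ' ε r : ℝ} (hε : ε = 1 ∨ ε = -1) (h0 : θ ≤ θ')
    (h1 : θ' ≤ θ + Real.pi / 2) {z : ℂ}
    (hz : z ∈ Metric.thickening r (rayCone (ε * Complex.exp (θ * Complex.I))
      (ε * Complex.exp (θ' * Complex.I)))) :
    (∃ φ ∈ Set.Icc θ θ', ∃ t : ℝ, 0 ≤ t ∧ z = ε * t * Complex.exp (φ * Complex.I)) ∨
    z ∈ Metric.thickening r (rayCone (ε * Complex.exp (θ * Complex.I))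
      (ε * Complex.exp (θ * Complex.I))) ∨
    z ∈ Metric.thickening r (rayCone (ε * Complex.exp (θ' * Complex.I))
      (ε * Complex.exp (θ' * Complex.I))) := by
  have hεn : ‖(ε : ℂ)‖ = 1 := by
    rcases hε with rfl | rfl <;> simp
  have hn : ∀ φ : ℝ, ‖ε * Complex.exp (φ * Complex.I)‖ = 1 := fun φ => by
    rw [norm_mul, hεn, Complex.norm_exp_ofReal_mul_I, one_mul]
  have hε0 : (ε : ℂ) ≠ 0 := norm_ne_zero_iff.1 (by rw [hεn]; exact one_ne_zero)
  obtain ⟨h, rfl⟩ : ∃ h, θ' = θ + h := ⟨θ' - θ, by ring⟩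
  have hh0 : 0 ≤ h := by linarith
  have hh1 : h ≤ Real.pi / 2 := by linarith
  have hs : 0 ≤ Real.sin h := Real.sin_nonneg_of_nonneg_of_le_pi hh0 (by linarith [Real.pi_pos])
  have hc : 0 ≤ Real.cos h := Real.cos_nonneg_of_neg_pi_div_two_le_of_le (by linarith) hh1
  set e : ℂ := ε * Complex.exp (θ * Complex.I) with he
  set k : ℂ := Complex.exp (h * Complex.I) with hk
  have hk0 : k ≠ 0 := Complex.exp_ne_zero _
  have he0 : e ≠ 0 := norm_ne_zero_iff.1 (by rw [hn]; exact one_ne_zero)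
  have he' : (ε * Complex.exp ((θ + h : ℝ) * Complex.I) : ℂ) = e * k := by
    rw [exp_add_mul_I, he, mul_assoc]
  have hkre : k.re = Real.cos h := Complex.exp_ofReal_mul_I_re h
  have hkim : k.im = Real.sin h := Complex.exp_ofReal_mul_I_im h
  have hkn : ‖k‖ = 1 := Complex.norm_exp_ofReal_mul_I h
  have hkinv : k⁻¹ = Complex.exp ((-h : ℝ) * Complex.I) := by
    rw [hk, ← Complex.exp_neg]; push_cast; ring_nf
  have hkire : (k⁻¹).re = Real.cos h := by rw [hkinv, Complex.exp_ofReal_mul_I_re, Real.cos_neg]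
  have hkiim : (k⁻¹).im = -Real.sin h := by rw [hkinv, Complex.exp_ofReal_mul_I_im, Real.sin_neg]
  rw [he'] at hz ⊢
  have hen := hn θ
  have hen' := hn (θ + h)
  rw [he'] at hen'
  obtain ⟨w, ⟨p, q, hp, hq, rfl⟩, hw⟩ := Metric.mem_thickening_iff.1 hz
  rw [dist_eq_norm] at hw
  have hw1 : ‖z / e - (p + q * k)‖ < r := by
    rw [show z / e - (p + q * k) = (z - (p * e + q * (e * k))) / e by field_simp, norm_div, hen,
      div_one]
    exact hw
  have hw2 : ‖z / (e * k) - (p * k⁻¹ + q)‖ < r := by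
    rw [show z / (e * k) - (p * k⁻¹ + q) = (z - (p * e + q * (e * k))) / (e * k) by field_simp,
      norm_div, hen', div_one]
    exact hw
  have hζ : z / (e * k) = z / e * k⁻¹ := by rw [← div_div, div_eq_mul_inv (z / e)]
  have hre1 : ((p : ℂ) + q * k).re = p + q * Real.cos h := by simp [hkre]
  have him1 : ((p : ℂ) + q * k).im = q * Real.sin h := by simp [hkim]
  have hre2 : ((p : ℂ) * k⁻¹ + q).re = p * Real.cos h + q := by
    rw [Complex.add_re, Complex.re_ofReal_mul, hkire, Complex.ofReal_re]
  have him2 : ((p : ℂ) * k⁻¹ + q).im = -(p * Real.sin h) := by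
    rw [Complex.add_im, Complex.im_ofReal_mul, hkiim, Complex.ofReal_im]; ring
  -- After division by e the first ray is the positive real axis. A point on its outer side, or on
  -- its line, is handled with this ray; the next case does the same for the second ray after
  -- division by e k.
  by_cases hy : (z / e).im ≤ 0
  · by_cases hy0 : (z / e).im = 0 ∧ 0 ≤ (z / e).re
    · refine Or.inl ⟨θ, ⟨le_rfl, by linarith⟩, (z / e).re, hy0.2, ?_⟩
      have : z / e = ((z / e).re : ℂ) := Complex.ext (by simp) (by simp [hy0.1])
      rw [mul_right_comm, ← he, ← this, mul_div_cancel₀ _ he0]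
    · obtain ⟨t, ht, h2⟩ := exists_norm_sub_real_lt (by rw [hre1]; positivity)
        (by rw [him1]; exact mul_nonpos_of_nonneg_of_nonpos (mul_nonneg hq hs) hy) hw1
      exact Or.inr (Or.inl (mem_thickening_ray hen ht h2))
  push Not at hy
  by_cases hy' : 0 ≤ (z / (e * k)).im
  · obtain ⟨t, ht, h2⟩ := exists_norm_sub_real_lt (by rw [hre2]; positivity)
      (by rw [him2]; exact mul_nonpos_of_nonpos_of_nonneg (by nlinarith) hy') hw2
    exact Or.inr (Or.inr (mem_thickening_ray hen' ht h2))
  push Not at hy'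
  -- Now z/e lies strictly above the first ray and strictly on the inner side of the second. If its
  -- argument exceeded h, the rotated point would have nonnegative imaginary part.
  left
  have harg0 : 0 ≤ (z / e).arg := Complex.arg_nonneg_iff.2 hy.le
  have hpol : z / e = ‖z / e‖ * Complex.exp ((z / e).arg * Complex.I) :=
    (Complex.norm_mul_exp_arg_mul_I _).symm
  refine ⟨θ + (z / e).arg, ⟨by linarith, ?_⟩, ‖z / e‖, norm_nonneg _, ?_⟩
  · by_contra hlt
    push Not at hlt
    refine absurd hy' (not_lt.2 ?_)
    rw [hζ, hpol, hkinv, mul_assoc, ← exp_add_mul_I, Complex.im_ofReal_mul,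
      Complex.exp_ofReal_mul_I_im]
    exact mul_nonneg (norm_nonneg _) (Real.sin_nonneg_of_nonneg_of_le_pi (by linarith)
      (by linarith [Complex.arg_le_pi (z / e)]))
  · rw [exp_add_mul_I, mul_right_comm, ← mul_assoc, ← he, mul_assoc, mul_comm (Complex.exp _),
      ← hpol, mul_div_cancel₀ _ he0]

theorem re_exp_div (θ : ℝ) (ħ : ℂ) : (Complex.exp (θ * Complex.I) / ħ).re =
    Real.cos θ * (ħ⁻¹).re - Real.sin θ * (ħ⁻¹).im := by
  rw [div_eq_mul_inv, Complex.mul_re, Complex.exp_ofReal_mul_I_re, Complex.exp_ofReal_mul_I_im]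

/-- The direction φ is a real linear combination of θ and θ', with coefficients sin(θ' - φ)/sin(θ' -
θ) and sin(φ - θ)/sin(θ' - θ) when the denominator is nonzero. All comparisons of Borel discs rest
on this. -/
theorem sin_mul_re_exp_div (θ φ θ' : ℝ) (ħ : ℂ) :
    Real.sin (θ' - θ) * (Complex.exp (φ * Complex.I) / ħ).re =
      Real.sin (θ' - φ) * (Complex.exp (θ * Complex.I) / ħ).re +
        Real.sin (φ - θ) * (Complex.exp (θ' * Complex.I) / ħ).re := by
  simp only [re_exp_div, Real.sin_sub]
  ring

/-- By subadditivity of the sine the two coefficients of this combination add up to at least 1. -/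
theorem mem_borelDisc_between {θ θ' φ δ : ℝ} {ħ : ℂ} (hδ : 0 < δ) (h1 : θ' ≤ θ + Real.pi / 2)
    (hφ : φ ∈ Set.Icc θ θ') (hħ : ħ ∈ borelDisc θ δ) (hħ' : ħ ∈ borelDisc θ' δ) :
    ħ ∈ borelDisc φ δ := by
  obtain ⟨h2, h3⟩ := hφ
  have hpi := Real.pi_pos
  rcases (h2.trans h3).eq_or_lt with h | h
  · rwa [show φ = θ by linarith]
  simp only [borelDisc, Set.mem_ofPred_eq] at hħ hħ' ⊢
  have e := sin_mul_re_exp_div θ φ θ' ħ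
  have hs : 0 < Real.sin (θ' - θ) := Real.sin_pos_of_pos_of_lt_pi (by linarith) (by linarith)
  have hs1 : 0 ≤ Real.sin (θ' - φ) :=
    Real.sin_nonneg_of_nonneg_of_le_pi (by linarith) (by linarith)
  have hs2 : 0 ≤ Real.sin (φ - θ) :=
    Real.sin_nonneg_of_nonneg_of_le_pi (by linarith) (by linarith)
  have hs3 : Real.sin (θ' - θ) ≤ Real.sin (θ' - φ) + Real.sin (φ - θ) := by
    rw [show θ' - θ = (θ' - φ) + (φ - θ) by ring, Real.sin_add]
    nlinarith [Real.cos_le_one (θ' - φ), Real.cos_le_one (φ - θ)]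
  have hδ' : 0 < 1 / δ := by positivity
  have h6 : 0 < Real.sin (θ' - φ) ∨ 0 < Real.sin (φ - θ) := by
    by_contra! h7
    linarith [h7.1, h7.2]
  have h7 : Real.sin (θ' - θ) * (1 / δ) <
      Real.sin (θ' - θ) * (Complex.exp (φ * Complex.I) / ħ).re := by
    rw [e]
    rcases h6 with h6 | h6 <;> nlinarith
  exact lt_of_mul_lt_mul_left h7 hs.le

/-- Each of the two coefficients is at most 1, because the sine is increasing up to π/2. If both
outer real parts were at most 1/δ, the middle one would be at most 2/δ. -/
theorem borelDisc_half_subset {θ θ' φ δ : ℝ} {ħ : ℂ} (hδ : 0 < δ)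
    (h1 : θ' ≤ θ + Real.pi / 2) (hφ : φ ∈ Set.Icc θ θ') (hħ : ħ ∈ borelDisc φ (δ / 2)) :
    ħ ∈ borelDisc θ δ ∨ ħ ∈ borelDisc θ' δ := by
  obtain ⟨h2, h3⟩ := hφ
  have hpi := Real.pi_pos
  simp only [borelDisc, Set.mem_ofPred_eq] at hħ ⊢
  by_contra! hcon
  obtain ⟨h4, h5⟩ := hcon
  have hδ' : 0 < 1 / δ := by positivity
  have e2 : 1 / (δ / 2) = 2 * (1 / δ) := by rw [one_div_div, mul_one_div]
  rw [e2] at hħ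
  rcases (h2.trans h3).eq_or_lt with h | h
  · have e3 : φ = θ := by linarith
    rw [e3] at hħ
    linarith
  have e := sin_mul_re_exp_div θ φ θ' ħ
  have hs : 0 < Real.sin (θ' - θ) := Real.sin_pos_of_pos_of_lt_pi (by linarith) (by linarith)
  have hs1 : 0 ≤ Real.sin (θ' - φ) :=
    Real.sin_nonneg_of_nonneg_of_le_pi (by linarith) (by linarith)
  have hs2 : 0 ≤ Real.sin (φ - θ) :=
    Real.sin_nonneg_of_nonneg_of_le_pi (by linarith) (by linarith)
  have hs3 : Real.sin (θ' - φ) ≤ Real.sin (θ' - θ) :=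
    Real.sin_le_sin_of_le_of_le_pi_div_two (by linarith) (by linarith) (by linarith)
  have hs4 : Real.sin (φ - θ) ≤ Real.sin (θ' - θ) :=
    Real.sin_le_sin_of_le_of_le_pi_div_two (by linarith) (by linarith) (by linarith)
  have h6 := mul_lt_mul_of_pos_left hħ hs
  have h7 := mul_le_mul_of_nonneg_left h4 hs1
  have h8 := mul_le_mul_of_nonneg_left h5 hs2
  have h9 := mul_le_mul_of_nonneg_right hs3 hδ'.le
  have h10 := mul_le_mul_of_nonneg_right hs4 hδ'.le
  linarith

/-- The two outer real parts add up to 2 cos h times the middle one, and 0 ≤ cos h ≤ 1. Here the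
outer directions may be up to π apart. -/
theorem mem_borelDisc_middle {θ h δ : ℝ} {ħ : ℂ} (hδ : 0 < δ) (h0 : 0 ≤ h) (h1 : h ≤ Real.pi / 2)
    (hħ : ħ ∈ borelDisc θ δ) (hħ' : ħ ∈ borelDisc (θ + 2 * h) δ) : ħ ∈ borelDisc (θ + h) δ := by
  simp only [borelDisc, Set.mem_ofPred_eq] at hħ hħ' ⊢
  have hδ' : 0 < 1 / δ := by positivity
  have e : (Complex.exp (θ * Complex.I) / ħ).re +
      (Complex.exp ((θ + 2 * h : ℝ) * Complex.I) / ħ).re =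
      2 * Real.cos h * (Complex.exp ((θ + h : ℝ) * Complex.I) / ħ).re := by
    simp only [re_exp_div]
    have e1 := Real.cos_add_cos θ (θ + 2 * h)
    have e2 := Real.sin_add_sin θ (θ + 2 * h)
    rw [show (θ + (θ + 2 * h)) / 2 = θ + h by ring, show (θ - (θ + 2 * h)) / 2 = -h by ring,
      Real.cos_neg] at e1 e2
    linear_combination (ħ⁻¹).re * e1 - (ħ⁻¹).im * e2
  have hc : 0 ≤ Real.cos h :=
    Real.cos_nonneg_of_neg_pi_div_two_le_of_le (by linarith [Real.pi_pos]) h1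
  have hc1 := Real.cos_le_one h
  by_contra! hcon
  nlinarith

end

noncomputable section

/-! ### The Liouville coordinate -/

theorem hasDerivAt_liouville {s : ℂ → ℂ} {x₀ : ℂ} {ρ : ℝ}
    (hs : DifferentiableOn ℂ s (Metric.ball x₀ ρ)) {x : ℂ} (hx : x ∈ Metric.ball x₀ ρ) :
    HasDerivAt (liouville s x₀) (s x) x := by
  obtain ⟨G, hG⟩ := hs.isExactOn_ball
  have key : ∀ y ∈ Metric.ball x₀ ρ, liouville s x₀ y = G y - G x₀ := by
    intro y hy
    have hmem : ∀ t ∈ Set.uIcc (0 : ℝ) 1, x₀ + t * (y - x₀) ∈ Metric.ball x₀ ρ := by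
      intro t ht
      rw [Set.uIcc_of_le zero_le_one] at ht
      rw [Metric.mem_ball, dist_eq_norm] at hy ⊢
      rw [add_sub_cancel_left, norm_mul, Complex.norm_real, Real.norm_of_nonneg ht.1]
      exact (mul_le_of_le_one_left (norm_nonneg _) ht.2).trans_lt hy
    have h1 : ∀ t ∈ Set.uIcc (0 : ℝ) 1, HasDerivAt (fun t : ℝ => G (x₀ + t * (y - x₀)))
        (s (x₀ + t * (y - x₀)) * (y - x₀)) t := by
      intro t ht
      have h2 : HasDerivAt (fun t : ℝ => x₀ + t * (y - x₀)) (y - x₀) t := by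
        simpa using ((Complex.ofRealCLM.hasDerivAt (x := t)).mul_const (y - x₀)).const_add x₀
      exact (hG _ (hmem t ht)).comp t h2
    rw [liouville, intervalIntegral.integral_eq_sub_of_hasDerivAt h1]
    · simp
    · refine ContinuousOn.intervalIntegrable (ContinuousOn.mul ?_ continuousOn_const)
      exact hs.continuousOn.comp (by fun_prop) hmem
  refine ((hG x hx).sub_const (G x₀)).congr_of_eventuallyEq ?_
  filter_upwards [Metric.isOpen_ball.mem_nhds hx] with y hy using key y hy

theorem liouville_self (s : ℂ → ℂ) (x₀ : ℂ) : liouville s x₀ x₀ = 0 := by simp [liouville]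

/-- The inverse function theorem; it transfers statements about germs at x₀ to germs at 0 in the
Liouville coordinate. -/
theorem map_nhds_liouville {s : ℂ → ℂ} {x₀ : ℂ} {ρ : ℝ} (hρ : 0 < ρ)
    (hs : DifferentiableOn ℂ s (Metric.ball x₀ ρ)) (h0 : s x₀ ≠ 0) :
    Filter.map (liouville s x₀) (𝓝 x₀) = 𝓝 0 := by
  have hd : DifferentiableOn ℂ (liouville s x₀) (Metric.ball x₀ ρ) := fun x hx =>
    (hasDerivAt_liouville hs hx).differentiableAt.differentiableWithinAt
  have h1 := (hd.analyticAt (Metric.ball_mem_nhds x₀ hρ)).hasStrictDerivAt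
  rw [(hasDerivAt_liouville hs (Metric.mem_ball_self hρ)).deriv] at h1
  rw [h1.map_nhds_eq h0, liouville_self]

theorem isOpen_halfstrip (z₁ : ℂ) (r θ ε : ℝ) : IsOpen (halfstrip z₁ r θ ε) :=
  Metric.isOpen_thickening

theorem convex_halfstrip (z₁ : ℂ) (r θ ε : ℝ) : Convex ℝ (halfstrip z₁ r θ ε) := by
  refine Convex.thickening ?_ r
  rintro _ ⟨t, ht, rfl⟩ _ ⟨t', ht', rfl⟩ p q hp hq hpq
  refine ⟨p * t + q * t', by positivity, ?_⟩
  rw [Complex.real_smul, Complex.real_smul]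
  have : (p : ℂ) + q = 1 := by exact_mod_cast hpq
  push_cast
  linear_combination z₁ * this

theorem isRayInvariant_halfstrip (z₁ : ℂ) (r θ ε : ℝ) :
    IsRayInvariant (ε * Complex.exp (θ * Complex.I)) (halfstrip z₁ r θ ε) := by
  intro z hz t ht
  obtain ⟨_, ⟨p, hp, rfl⟩, h⟩ := Metric.mem_thickening_iff.1 hz
  refine Metric.mem_thickening_iff.2 ⟨_, ⟨p + t, add_nonneg hp ht, rfl⟩, ?_⟩
  rw [dist_eq_norm] at h ⊢
  convert h using 2
  push_cast
  ring

/-- A small ball around 0 is swept along the ray. The strip thus starts at 0 and not at the unknown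
vertex of the given halfstrip. -/
theorem IsRayInvariant.exists_thickening_subset {e : ℂ} {Ω : Set ℂ} (h : IsRayInvariant e Ω)
    (hΩ : IsOpen Ω) (h0 : (0 : ℂ) ∈ Ω) : ∃ r > 0, Metric.thickening r (rayCone e e) ⊆ Ω := by
  obtain ⟨r, hr, hsub⟩ := Metric.isOpen_iff.1 hΩ 0 h0
  refine ⟨r, hr, fun z hz => ?_⟩
  obtain ⟨_, ⟨p, q, hp, hq, rfl⟩, hw⟩ := Metric.mem_thickening_iff.1 hz
  have h1 : z - (p * e + q * e) ∈ Metric.ball (0 : ℂ) r := by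
    rwa [mem_ball_zero_iff, ← dist_eq_norm]
  have h2 := h _ (hsub h1) (p + q) (add_nonneg hp hq)
  convert h2 using 1
  push_cast
  ring

/-- The inverses of the Liouville transformation on the halfstrips of all directions `θ ∈ Θ` are
restrictions of a single function. -/
theorem exists_inverse_liouville {X : Set ℂ} {ak bk ck : ℕ → ℂ → ℂ}
    (hak : ∀ k, DifferentiableOn ℂ (ak k) X) (hbk : ∀ k, DifferentiableOn ℂ (bk k) X)
    (hck : ∀ k, DifferentiableOn ℂ (ck k) X) {x₀ : ℂ}
    {s : ℂ → ℂ} {ρ : ℝ} (hρ : 0 < ρ)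
    (hs : DifferentiableOn ℂ s (Metric.ball x₀ ρ))
    (hsq : ∀ x ∈ Metric.ball x₀ ρ, s x ^ 2 = leadingDiscriminant ak bk ck x)
    (hs0 : s x₀ ≠ 0) {ε : ℝ} {W : ℝ → Set ℂ} {Θ : Set ℝ} (hΘ : Θ.Nonempty)
    (hW : ∀ θ ∈ Θ, IsWKBHalfstrip X s x₀ θ ε (W θ)) :
    ∃ (Ψ : ℂ → ℂ) (H : ℝ → Set ℂ), (∀ᶠ x in 𝓝 x₀, Ψ (liouville s x₀ x) = x) ∧
      ∀ θ ∈ Θ, IsOpen (H θ) ∧ (0 : ℂ) ∈ H θ ∧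
        IsRayInvariant (ε * Complex.exp (θ * Complex.I)) (H θ) ∧
        DifferentiableOn ℂ Ψ (H θ) ∧ Set.MapsTo Ψ (H θ) X ∧ Set.MapsTo Ψ (H θ) (W θ) ∧
        ∀ z ∈ H θ, deriv Ψ z ^ 2 * leadingDiscriminant ak bk ck (Ψ z) = 1 := by
  classical
  choose! z₁ r ψ hr h0 hψd hψX hψi hψW using hW
  set H : ℝ → Set ℂ := fun θ => halfstrip (z₁ θ) (r θ) θ ε with hH
  have hHo : ∀ θ, IsOpen (H θ) := fun θ => isOpen_halfstrip _ _ _ _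
  have hHc : ∀ θ, Convex ℝ (H θ) := fun θ => convex_halfstrip _ _ _ _
  have hmap := map_nhds_liouville hρ hs hs0
  -- Two halfstrips meet in a convex set containing 0, and near 0 both inverses coincide with the
  -- local inverse of the Liouville transformation.
  have hagree : ∀ θ ∈ Θ, ∀ θ' ∈ Θ, ∀ z ∈ H θ, z ∈ H θ' → ψ θ z = ψ θ' z := by
    intro θ hθ θ' hθ' z hz hz'
    have ho : IsOpen (H θ ∩ H θ') := (hHo θ).inter (hHo θ')
    have h1 : ψ θ =ᶠ[𝓝 0] ψ θ' := by
      rw [Filter.EventuallyEq, ← hmap, Filter.eventually_map]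
      filter_upwards [hψi θ hθ, hψi θ' hθ'] with x hx hx'
      rw [hx, hx']
    exact (((hψd θ hθ).mono Set.inter_subset_left).analyticOnNhd ho).eqOn_of_preconnected_of_eventuallyEq
      (((hψd θ' hθ').mono Set.inter_subset_right).analyticOnNhd ho)
      ((hHc θ).inter (hHc θ')).isPreconnected ⟨h0 θ hθ, h0 θ' hθ'⟩ h1 ⟨hz, hz'⟩
  let Ψ : ℂ → ℂ := fun z => if h : ∃ θ ∈ Θ, z ∈ H θ then ψ h.choose z else 0
  have hΨ : ∀ θ ∈ Θ, Set.EqOn Ψ (ψ θ) (H θ) := by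
    intro θ hθ z hz
    have h : ∃ θ ∈ Θ, z ∈ H θ := ⟨θ, hθ, hz⟩
    simp only [Ψ, dif_pos h]
    exact hagree _ h.choose_spec.1 θ hθ z h.choose_spec.2 hz
  have hΨd : ∀ θ ∈ Θ, DifferentiableOn ℂ Ψ (H θ) := fun θ hθ => (hψd θ hθ).congr (hΨ θ hθ)
  obtain ⟨θ₀, hθ₀⟩ := hΘ
  have hΨi : ∀ᶠ x in 𝓝 x₀, Ψ (liouville s x₀ x) = x := by
    have h1 : ∀ᶠ z in 𝓝 (0 : ℂ), z ∈ H θ₀ := (hHo θ₀).mem_nhds (h0 θ₀ hθ₀)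
    rw [← hmap, Filter.eventually_map] at h1
    filter_upwards [h1, hψi θ₀ hθ₀] with x hx hx'
    rw [hΨ θ₀ hθ₀ hx, hx']
  have hΨX : ∀ θ ∈ Θ, Set.MapsTo Ψ (H θ) X := fun θ hθ z hz => by
    rw [hΨ θ hθ hz]; exact hψX θ hθ hz
  refine ⟨Ψ, H, hΨi, fun θ hθ => ⟨hHo θ, h0 θ hθ, isRayInvariant_halfstrip _ _ _ _, hΨd θ hθ,
    hΨX θ hθ, fun z hz => ?_, ?_⟩⟩
  · rw [hψW θ hθ, hΨ θ hθ hz]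
    exact Set.mem_image_of_mem _ hz
  -- The relation Ψ'·s = 1 makes sense only near x₀, where s is defined. Its square involves D₀
  -- alone and extends to the whole halfstrip by the identity theorem.
  · have hDd : DifferentiableOn ℂ (leadingDiscriminant ak bk ck) X :=
      ((hbk 0).pow 2).sub (((hak 0).const_mul 4).mul (hck 0))
    have h1 : DifferentiableOn ℂ
        (fun z => deriv Ψ z ^ 2 * leadingDiscriminant ak bk ck (Ψ z)) (H θ) :=
      (((hΨd θ hθ).deriv (hHo θ)).pow 2).mul (hDd.comp (hΨd θ hθ) (hΨX θ hθ))
    have h2 : (fun z => deriv Ψ z ^ 2 * leadingDiscriminant ak bk ck (Ψ z)) =ᶠ[𝓝 0] fun _ => 1 := by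
      rw [Filter.EventuallyEq, ← hmap, Filter.eventually_map]
      have h3 : ∀ᶠ z in 𝓝 (0 : ℂ), z ∈ H θ := (hHo θ).mem_nhds (h0 θ hθ)
      rw [← hmap, Filter.eventually_map] at h3
      filter_upwards [h3, hΨi.eventually_nhds, Metric.ball_mem_nhds x₀ hρ] with x hx hx' hxρ
      have h4 := ((hΨd θ hθ).differentiableAt ((hHo θ).mem_nhds hx)).hasDerivAt.comp x
        (hasDerivAt_liouville hs hxρ)
      have h5 : HasDerivAt (Ψ ∘ liouville s x₀) 1 x := (hasDerivAt_id x).congr_of_eventuallyEq hx'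
      have h6 := h4.unique h5
      rw [hx'.self_of_nhds, ← hsq x hxρ, ← mul_pow, h6, one_pow]
    exact fun z hz => (h1.analyticOnNhd (hHo θ)).eqOn_of_preconnected_of_eventuallyEq
      ((differentiableOn_const _).analyticOnNhd (hHo θ)) (hHc θ).isPreconnected (h0 θ hθ) h2 hz

end

noncomputable section

/-! ### Solutions of normalized Riccati equations near infinity -/

/-- Bounds for the coefficients `a`, `b`, `c` of a Riccati equation, and for their leading orders,
on `Ω × T`; the leading-order discriminant is normalized to `1`. -/
structure NormalizedRiccati (a b c : ℂ → ℂ → ℂ) (a₀ b₀ c₀ : ℂ → ℂ) (Ω T : Set ℂ) (m : ℝ) :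
    Prop where
  diff_fst : ∀ ħ ∈ T, DifferentiableOn ℂ (fun z => a z ħ) Ω ∧
    DifferentiableOn ℂ (fun z => b z ħ) Ω ∧ DifferentiableOn ℂ (fun z => c z ħ) Ω
  diff_snd : ∀ z ∈ Ω, DifferentiableOn ℂ (a z) T ∧ DifferentiableOn ℂ (b z) T ∧
    DifferentiableOn ℂ (c z) T
  diff_zero : DifferentiableOn ℂ a₀ Ω ∧ DifferentiableOn ℂ b₀ Ω ∧ DifferentiableOn ℂ c₀ Ω
  disc : ∀ z ∈ Ω, b₀ z ^ 2 - 4 * a₀ z * c₀ z = 1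
  bound_zero : ∀ z ∈ Ω, ‖a₀ z‖ ≤ m ∧ ‖b₀ z‖ ≤ m ∧ ‖c₀ z‖ ≤ m
  bound_sub : ∀ z ∈ Ω, ∀ ħ ∈ T, ‖a z ħ - a₀ z‖ ≤ m * ‖ħ‖ ∧ ‖b z ħ - b₀ z‖ ≤ m * ‖ħ‖ ∧
    ‖c z ħ - c₀ z‖ ≤ m * ‖ħ‖

theorem NormalizedRiccati.mono {a b c : ℂ → ℂ → ℂ} {a₀ b₀ c₀ : ℂ → ℂ} {Ω Ω' T T' : Set ℂ} {m : ℝ}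
    (h : NormalizedRiccati a b c a₀ b₀ c₀ Ω T m) (hΩ : Ω' ⊆ Ω) (hT : T' ⊆ T) :
    NormalizedRiccati a b c a₀ b₀ c₀ Ω' T' m where
  diff_fst ħ hħ := ⟨(h.diff_fst ħ (hT hħ)).1.mono hΩ, (h.diff_fst ħ (hT hħ)).2.1.mono hΩ,
    (h.diff_fst ħ (hT hħ)).2.2.mono hΩ⟩
  diff_snd z hz := ⟨(h.diff_snd z (hΩ hz)).1.mono hT, (h.diff_snd z (hΩ hz)).2.1.mono hT,
    (h.diff_snd z (hΩ hz)).2.2.mono hT⟩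
  diff_zero := ⟨h.diff_zero.1.mono hΩ, h.diff_zero.2.1.mono hΩ, h.diff_zero.2.2.mono hΩ⟩
  disc z hz := h.disc z (hΩ hz)
  bound_zero z hz := h.bound_zero z (hΩ hz)
  bound_sub z hz ħ hħ := h.bound_sub z (hΩ hz) ħ (hT hħ)

theorem ball_subset_thickening_two_mul {Γ : Set ℂ} {r : ℝ} {z : ℂ}
    (hz : z ∈ Metric.thickening r Γ) : Metric.ball z r ⊆ Metric.thickening (2 * r) Γ := by
  intro y hy
  obtain ⟨w, hw, hzw⟩ := Metric.mem_thickening_iff.1 hz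
  refine Metric.mem_thickening_iff.2 ⟨w, hw, ?_⟩
  linarith [dist_triangle y z w, Metric.mem_ball.1 hy]

/-- The perturbation is (A - A₀)/ħ, bounded because A - A₀ = O(ħ). The width is reduced from 2r to r
so that Cauchy's estimate on circles of radius r/2 bounds P', giving the factor 2/r. -/
theorem NormalizedRiccati.projectorBounds {a b c : ℂ → ℂ → ℂ} {a₀ b₀ c₀ : ℂ → ℂ} {Γ T : Set ℂ}
    {m r : ℝ} {ε : ℂ} (hε : ε ^ 2 = 1) (hε' : ‖ε‖ = 1) (hm : 0 ≤ m) (hr : 0 < r)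
    (hT : ∀ ħ ∈ T, ħ ≠ 0)
    (h : NormalizedRiccati a b c a₀ b₀ c₀ (Metric.thickening (2 * r) Γ) T m) :
    ProjectorBounds (fun z => leadingProjector ε (a₀ z) (b₀ z) (c₀ z))
      (fun z ħ => companionOp ((a z ħ - a₀ z) / ħ) ((b z ħ - b₀ z) / ħ) ((c z ħ - c₀ z) / ħ))
      (Metric.thickening r Γ) T ((1 + 2 * m) * (1 + 2 / r)) := by
  have hsub : Metric.thickening r Γ ⊆ Metric.thickening (2 * r) Γ :=
    Metric.thickening_mono (by linarith) _
  have hP : ∀ z ∈ Metric.thickening (2 * r) Γ, ‖leadingProjector ε (a₀ z) (b₀ z) (c₀ z)‖ ≤ 1 + 2 * m :=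
    fun z hz => norm_leadingProjector_le hε' (h.bound_zero z hz).1 (h.bound_zero z hz).2.1
      (h.bound_zero z hz).2.2
  have hPd : DifferentiableOn ℂ (fun z => leadingProjector ε (a₀ z) (b₀ z) (c₀ z))
      (Metric.thickening (2 * r) Γ) :=
    ((h.diff_zero.1.companionOp h.diff_zero.2.1 h.diff_zero.2.2).const_smul ε).const_sub _
  have hdiv : ∀ {v ħ : ℂ}, ħ ∈ T → ‖v‖ ≤ m * ‖ħ‖ → ‖v / ħ‖ ≤ m := fun hħ hv => by
    rw [norm_div, div_le_iff₀ (norm_pos_iff.2 (hT _ hħ))]; exact hv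
  have hr' : 0 < 2 / r := by positivity
  refine ⟨Metric.isOpen_thickening, hPd.mono hsub, fun z hz => leadingProjector_idem hε
    (h.disc z (hsub hz)), fun z hz => (hP z (hsub hz)).trans ?_, fun z hz => ?_, fun ħ hħ => ?_,
    fun z hz => ?_, fun z hz ħ hħ => ?_⟩
  · nlinarith
  · have h1 : ‖deriv (fun z => leadingProjector ε (a₀ z) (b₀ z) (c₀ z)) z‖ ≤ (1 + 2 * m) / (r / 2) := by
      refine Complex.norm_deriv_le_of_forall_mem_sphere_norm_le (by positivity)
        (hPd.diffContOnCl_ball ?_) fun y hy => hP y ?_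
      · exact (Metric.closedBall_subset_ball (by linarith)).trans (ball_subset_thickening_two_mul hz)
      · exact ball_subset_thickening_two_mul hz
          (Metric.sphere_subset_closedBall.trans (Metric.closedBall_subset_ball (by linarith)) hy)
    refine h1.trans ?_
    rw [div_div_eq_mul_div, mul_div_assoc]
    exact mul_le_mul_of_nonneg_left (by linarith) (by positivity)
  · obtain ⟨h1, h2, h3⟩ := h.diff_fst ħ hħ
    obtain ⟨h4, h5, h6⟩ := h.diff_zero
    exact DifferentiableOn.companionOp (((h1.sub h4).div_const ħ).mono hsub)
      (((h2.sub h5).div_const ħ).mono hsub) (((h3.sub h6).div_const ħ).mono hsub)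
  · obtain ⟨h1, h2, h3⟩ := h.diff_snd z (hsub hz)
    exact DifferentiableOn.companionOp ((h1.sub_const _).div differentiableOn_id hT)
      ((h2.sub_const _).div differentiableOn_id hT) ((h3.sub_const _).div differentiableOn_id hT)
  · obtain ⟨h1, h2, h3⟩ := h.bound_sub z (hsub hz) ħ hħ
    refine (norm_companionOp_le (hdiv hħ h1) (hdiv hħ h2) (hdiv hħ h3)).trans ?_
    nlinarith

section Gluing

variable {𝔸 : Type*} [NormedRing 𝔸] [NormedAlgebra ℂ 𝔸]

/-- `u` is a small solution on `Ω` of the equation for the correction to the projector `P`. -/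
def IsProjectorCorrection (P : ℂ → 𝔸) (R : ℂ → ℂ → 𝔸) (ε ħ : ℂ) (Ω : Set ℂ) (u : ℂ → 𝔸) : Prop :=
  ∀ z ∈ Ω, HasDerivAt u ((ε / ħ) • u z + projectorRest (P z) (deriv P z) (R z ħ) (u z)) z ∧ ‖u z‖ ≤ 1

theorem IsProjectorCorrection.mono {P : ℂ → 𝔸} {R : ℂ → ℂ → 𝔸} {ε ħ : ℂ} {Ω Ω' : Set ℂ} {u : ℂ → 𝔸}
    (h : IsProjectorCorrection P R ε ħ Ω u) (hΩ : Ω' ⊆ Ω) :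
    IsProjectorCorrection P R ε ħ Ω' u := fun z hz => h z (hΩ hz)

theorem sign_mul_re {ε : ℝ} (hε : ε = 1 ∨ ε = -1) (θ : ℝ) (ħ : ℂ) :
    (ε : ℂ) / ħ * (ε * Complex.exp (θ * Complex.I)) = Complex.exp (θ * Complex.I) / ħ := by
  have : (ε : ℂ) ^ 2 = 1 := by rcases hε with rfl | rfl <;> simp
  rw [div_mul_eq_mul_div, ← mul_assoc, ← sq, this, one_mul]

theorem norm_sign_mul_exp {ε : ℝ} (hε : ε = 1 ∨ ε = -1) (θ : ℝ) :
    ‖(ε : ℂ) * Complex.exp (θ * Complex.I)‖ = 1 := by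
  rw [norm_mul, Complex.norm_exp_ofReal_mul_I, mul_one]
  rcases hε with rfl | rfl <;> simp

variable [NormOneClass 𝔸] [CompleteSpace 𝔸]

/-- Since ε² = 1, the damping rate along the ray εe^{iθ} is Re(e^{iθ}/ħ), which exceeds 1/δ
precisely on the Borel disc. The region may be a cone with a second direction e, as only invariance
under the first is used. -/
theorem exists_projectorCorrection {P : ℂ → 𝔸} {R : ℂ → ℂ → 𝔸} {T : Set ℂ} {p δ r ε θ : ℝ} {e : ℂ}
    (hε : ε = 1 ∨ ε = -1) (hp : 0 ≤ p) (hδ : 0 < δ) (hpδ : 16 * (1 + p) ^ 3 ≤ 1 / δ)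
    (hT : IsOpen T) (hTθ : T ⊆ borelDisc θ δ)
    (h : ProjectorBounds P R
      (Metric.thickening r (rayCone (ε * Complex.exp (θ * Complex.I)) e)) T p) :
    ∃ N : ℂ → ℂ → 𝔸, (∀ ħ ∈ T, IsProjectorCorrection P R ε ħ
        (Metric.thickening r (rayCone (ε * Complex.exp (θ * Complex.I)) e)) fun z => N z ħ) ∧
      ∀ z ∈ Metric.thickening r (rayCone (ε * Complex.exp (θ * Complex.I)) e),
        DifferentiableOn ℂ (N z) T ∧ ∀ ħ ∈ T, ‖N z ħ‖ ≤ 8 * (1 + p) ^ 3 * δ ∧ P z * N z ħ = 0 ∧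
          N z ħ * (1 - P z) = 0 := by
  have hl : ∀ ħ ∈ T, 1 / δ ≤ ((ε : ℂ) / ħ * (ε * Complex.exp (θ * Complex.I))).re := by
    intro ħ hħ
    rw [sign_mul_re hε]
    exact le_of_lt (hTθ hħ)
  have hld : DifferentiableOn ℂ (fun ħ => (ε : ℂ) / ħ) T :=
    (differentiableOn_const _).div differentiableOn_id fun ħ hħ =>
      ne_zero_of_mem_borelDisc hδ (hTθ hħ)
  obtain ⟨N, h1, h2, h3, h4, h5⟩ := exists_projector h hp (isRayInvariant_thickening _ _ _) hT
    (norm_sign_mul_exp hε θ) hpδ hl hld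
  have h6 : 8 * (1 + p) ^ 3 / (1 / δ) = 8 * (1 + p) ^ 3 * δ := by rw [div_div_eq_mul_div, div_one]
  rw [h6] at h3
  have h7 : 8 * (1 + p) ^ 3 * δ ≤ 1 := by
    have := mul_le_mul_of_nonneg_right hpδ hδ.le
    rw [one_div_mul_cancel hδ.ne'] at this
    linarith [show 0 ≤ (1 + p) ^ 3 * δ by positivity]
  exact ⟨N, fun ħ hħ z hz => ⟨h1 ħ hħ z hz, (h3 z hz ħ hħ).trans h7⟩, fun z hz => ⟨h2 z hz,
    fun ħ hħ => ⟨h3 z hz ħ hħ, h4 z hz ħ hħ, h5 z hz ħ hħ⟩⟩⟩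

/-- Uniqueness uses one direction of rays only; the conclusion is kept near 0, where the regions of
all directions overlap. -/
theorem IsProjectorCorrection.unique {P : ℂ → 𝔸} {R : ℂ → ℂ → 𝔸} {T : Set ℂ} {p δ r ε θ : ℝ}
    {e ħ : ℂ} (hε : ε = 1 ∨ ε = -1) (hp : 0 ≤ p) (hpδ : 16 * (1 + p) ^ 3 ≤ 1 / δ)
    (hħ : ħ ∈ T) (hħθ : ħ ∈ borelDisc θ δ)
    (h : ProjectorBounds P R
      (Metric.thickening r (rayCone (ε * Complex.exp (θ * Complex.I)) e)) T p)
    {u v : ℂ → 𝔸} (hu : IsProjectorCorrection P R ε ħ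
      (Metric.thickening r (rayCone (ε * Complex.exp (θ * Complex.I)) e)) u)
    (hv : IsProjectorCorrection P R ε ħ
      (Metric.thickening r (rayCone (ε * Complex.exp (θ * Complex.I)) e)) v)
    {z : ℂ} (hz : z ∈ Metric.ball 0 r) : u z = v z := by
  refine projector_unique h hp (isRayInvariant_thickening _ _ _) hħ (norm_sign_mul_exp hε θ) hpδ
    (l := ε / ħ) ?_ (fun z hz => (hu z hz).1) (fun z hz => (hv z hz).1) (fun z hz => (hu z hz).2)
    (fun z hz => (hv z hz).2) (ball_subset_thickening_rayCone _ _ _ hz)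
  rw [sign_mul_re hε]
  exact le_of_lt hħθ

/-- Corrections for two directions agree if there are bounds on the cone between them. -/
theorem IsProjectorCorrection.agree {P : ℂ → 𝔸} {R : ℂ → ℂ → 𝔸} {p δ r ε θ θ' : ℝ}
    {ħ : ℂ} (hε : ε = 1 ∨ ε = -1) (hp : 0 ≤ p) (hδ : 0 < δ) (hpδ : 16 * (1 + p) ^ 3 ≤ 1 / δ)
    (hħ : ħ ∈ borelDisc θ δ) (hħ' : ħ ∈ borelDisc θ' δ)
    (h : ProjectorBounds P R
      (Metric.thickening r (rayCone (ε * Complex.exp (θ * Complex.I))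
        (ε * Complex.exp (θ' * Complex.I)))) (borelDisc θ δ ∩ borelDisc θ' δ) p)
    (hθ : ProjectorBounds P R (Metric.thickening r (rayCone (ε * Complex.exp (θ * Complex.I))
      (ε * Complex.exp (θ * Complex.I)))) (borelDisc θ δ) p)
    (hθ' : ProjectorBounds P R (Metric.thickening r (rayCone (ε * Complex.exp (θ' * Complex.I))
      (ε * Complex.exp (θ' * Complex.I)))) (borelDisc θ' δ) p)
    {u v : ℂ → 𝔸} (hu : IsProjectorCorrection P R ε ħ
      (Metric.thickening r (rayCone (ε * Complex.exp (θ * Complex.I))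
        (ε * Complex.exp (θ * Complex.I)))) u)
    (hv : IsProjectorCorrection P R ε ħ
      (Metric.thickening r (rayCone (ε * Complex.exp (θ' * Complex.I))
        (ε * Complex.exp (θ' * Complex.I)))) v)
    {z : ℂ} (hz : z ∈ Metric.ball 0 r) : u z = v z := by
  -- The correction on the whole cone restricts to the strips around both boundary rays, where
  -- uniqueness identifies it with u and with v.
  obtain ⟨N, hN, -⟩ := exists_projectorCorrection hε hp hδ hpδ
    ((isOpen_borelDisc θ δ hδ).inter (isOpen_borelDisc θ' δ hδ)) Set.inter_subset_left h
  have h1 : u z = N z ħ := IsProjectorCorrection.unique hε hp hpδ hħ hħ hθ hu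
    ((hN ħ ⟨hħ, hħ'⟩).mono (Metric.thickening_subset_of_subset _ (rayCone_subset_left _ _))) hz
  have h2 : v z = N z ħ := IsProjectorCorrection.unique hε hp hpδ hħ' hħ' hθ' hv
    ((hN ħ ⟨hħ, hħ'⟩).mono (Metric.thickening_subset_of_subset _
      ((rayCone_subset_left _ _).trans (rayCone_comm _ _).subset))) hz
  rw [h1, h2]

/-- The corrections for three directions, of which the middle one bisects the other ones, define a
correction on the union of three Borel discs. -/
theorem exists_glued_projectorCorrection {P : ℂ → 𝔸} {R : ℂ → ℂ → 𝔸} {p δ r ε θ h : ℝ}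
    (hε : ε = 1 ∨ ε = -1) (hp : 0 ≤ p) (hδ : 0 < δ) (hpδ : 16 * (1 + p) ^ 3 ≤ 1 / δ)
    (h0 : 0 ≤ h) (h1 : h ≤ Real.pi / 2)
    (hB : ∀ φ φ' : ℝ, (φ = θ ∨ φ = θ + h ∨ φ = θ + 2 * h) → (φ' = φ ∨ φ' = φ + h) →
      φ' ≤ θ + 2 * h → ProjectorBounds P R
        (Metric.thickening r (rayCone (ε * Complex.exp (φ * Complex.I))
          (ε * Complex.exp (φ' * Complex.I)))) (borelDisc φ δ ∩ borelDisc φ' δ) p) :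
    ∃ N : ℂ → ℂ → 𝔸,
      (∀ ħ ∈ borelDisc θ δ ∪ borelDisc (θ + h) δ ∪ borelDisc (θ + 2 * h) δ,
        IsProjectorCorrection P R ε ħ (Metric.ball 0 r) fun z => N z ħ) ∧
      ∀ z ∈ Metric.ball 0 r,
        DifferentiableOn ℂ (N z) (borelDisc θ δ ∪ borelDisc (θ + h) δ ∪ borelDisc (θ + 2 * h) δ) ∧
        ∀ ħ ∈ borelDisc θ δ ∪ borelDisc (θ + h) δ ∪ borelDisc (θ + 2 * h) δ,
          ‖N z ħ‖ ≤ 8 * (1 + p) ^ 3 * δ ∧ P z * N z ħ = 0 ∧ N z ħ * (1 - P z) = 0 := by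
  classical
  have hB' : ∀ φ : ℝ, (φ = θ ∨ φ = θ + h ∨ φ = θ + 2 * h) → ProjectorBounds P R
        (Metric.thickening r (rayCone (ε * Complex.exp (φ * Complex.I))
          (ε * Complex.exp (φ * Complex.I)))) (borelDisc φ δ) p := by
    intro φ hφ
    have := hB φ φ hφ (Or.inl rfl) (by rcases hφ with rfl | rfl | rfl <;> linarith)
    rwa [Set.inter_self] at this
  have hex := fun (φ : ℝ) (hφ : φ = θ ∨ φ = θ + h ∨ φ = θ + 2 * h) =>
    exists_projectorCorrection hε hp hδ hpδ (isOpen_borelDisc φ δ hδ) subset_rfl (hB' φ hφ)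
  choose! n hn hn' using hex
  have hm0 : θ = θ ∨ θ = θ + h ∨ θ = θ + 2 * h := Or.inl rfl
  have hm1 : θ + h = θ ∨ θ + h = θ + h ∨ θ + h = θ + 2 * h := Or.inr (Or.inl rfl)
  have hm2 : θ + 2 * h = θ ∨ θ + 2 * h = θ + h ∨ θ + 2 * h = θ + 2 * h := Or.inr (Or.inr rfl)
  have hstep : ∀ φ φ' : ℝ, (φ = θ ∨ φ = θ + h ∨ φ = θ + 2 * h) →
      (φ' = θ ∨ φ' = θ + h ∨ φ' = θ + 2 * h) → φ' = φ + h → φ' ≤ θ + 2 * h →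
      ∀ ħ ∈ borelDisc φ δ, ħ ∈ borelDisc φ' δ → ∀ z ∈ Metric.ball 0 r, n φ z ħ = n φ' z ħ :=
    fun φ φ' hφ hφ' h2 h3 ħ hħ hħ' z hz => IsProjectorCorrection.agree hε hp hδ hpδ hħ hħ'
      (hB φ φ' hφ (Or.inr h2) h3) (hB' φ hφ) (hB' φ' hφ') (hn φ hφ ħ hħ) (hn φ' hφ' ħ hħ') hz
  have h01 := hstep θ (θ + h) hm0 hm1 rfl (by linarith)
  have h12 := hstep (θ + h) (θ + 2 * h) hm1 hm2 (by ring) le_rfl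
  -- The order of the cases is immaterial: `hN` shows that N agrees with the correction of every
  -- disc containing ħ.
  let N : ℂ → ℂ → 𝔸 := fun z ħ => if ħ ∈ borelDisc θ δ then n θ z ħ else
    if ħ ∈ borelDisc (θ + h) δ then n (θ + h) z ħ else n (θ + 2 * h) z ħ
  have hN : ∀ φ : ℝ, (φ = θ ∨ φ = θ + h ∨ φ = θ + 2 * h) → ∀ ħ ∈ borelDisc φ δ,
      ∀ z ∈ Metric.ball 0 r, N z ħ = n φ z ħ := by
    rintro φ hφ ħ hħ z hz
    by_cases hc0 : ħ ∈ borelDisc θ δ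
    · simp only [N, if_pos hc0]
      rcases hφ with rfl | rfl | rfl
      · rfl
      · exact h01 ħ hc0 hħ z hz
      -- The outer directions may be too far apart for a direct comparison, but the middle disc
      -- contains the intersection of the outer ones.
      · have hc1 := mem_borelDisc_middle hδ h0 h1 hc0 hħ
        rw [h01 ħ hc0 hc1 z hz, h12 ħ hc1 hħ z hz]
    · simp only [N, if_neg hc0]
      by_cases hc1 : ħ ∈ borelDisc (θ + h) δ
      · rw [if_pos hc1]
        rcases hφ with rfl | rfl | rfl
        · exact absurd hħ hc0
        · rfl
        · exact h12 ħ hc1 hħ z hz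
      · rw [if_neg hc1]
        rcases hφ with rfl | rfl | rfl
        · exact absurd hħ hc0
        · exact absurd hħ hc1
        · rfl
  have hcase : ∀ ħ ∈ borelDisc θ δ ∪ borelDisc (θ + h) δ ∪ borelDisc (θ + 2 * h) δ,
      ∃ φ : ℝ, (φ = θ ∨ φ = θ + h ∨ φ = θ + 2 * h) ∧ ħ ∈ borelDisc φ δ := by
    rintro ħ ((hħ | hħ) | hħ)
    · exact ⟨_, hm0, hħ⟩
    · exact ⟨_, hm1, hħ⟩
    · exact ⟨_, hm2, hħ⟩
  have hball : ∀ φ : ℝ, Metric.ball (0 : ℂ) r ⊆ Metric.thickening r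
      (rayCone (ε * Complex.exp (φ * Complex.I)) (ε * Complex.exp (φ * Complex.I))) := fun φ =>
    ball_subset_thickening_rayCone _ _ _
  refine ⟨N, fun ħ hħ z hz => ?_, fun z hz => ⟨fun ħ hħ => ?_, fun ħ hħ => ?_⟩⟩
  · obtain ⟨φ, hφ, hħφ⟩ := hcase ħ hħ
    obtain ⟨h2, h3⟩ := hn φ hφ ħ hħφ z (hball φ hz)
    simp only [hN φ hφ ħ hħφ z hz]
    refine ⟨h2.congr_of_eventuallyEq ?_, h3⟩
    filter_upwards [Metric.isOpen_ball.mem_nhds hz] with y hy using hN φ hφ ħ hħφ y hy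
  · obtain ⟨φ, hφ, hħφ⟩ := hcase ħ hħ
    have ho := (isOpen_borelDisc φ δ hδ).mem_nhds hħφ
    have h2 := ((hn' φ hφ z (hball φ hz)).1.differentiableAt ho)
    refine DifferentiableAt.differentiableWithinAt (h2.congr_of_eventuallyEq ?_)
    filter_upwards [ho] with y hy using hN φ hφ y hy z hz
  · obtain ⟨φ, hφ, hħφ⟩ := hcase ħ hħ
    rw [hN φ hφ ħ hħφ z hz]
    exact (hn' φ hφ z (hball φ hz)).2 ħ hħφ

end Gluing

end

/-! ### From the invariant projector to a solution of the normalized Riccati equation. -/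

noncomputable section

theorem norm_div_sub_div_le {x y n₁ n₂ : ℂ} {p ν c : ℝ} (hc : 0 < c) (hν : ν ≤ c / 2)
    (hx : ‖x‖ ≤ p) (hyp : ‖y‖ ≤ p) (hy : c ≤ ‖y‖) (h1 : ‖n₁‖ ≤ ν) (h2 : ‖n₂‖ ≤ ν) :
    y + n₂ ≠ 0 ∧ ‖(x + n₁) / (y + n₂) - x / y‖ ≤ 4 * p / c ^ 2 * ν := by
  have h3 : c / 2 ≤ ‖y + n₂‖ := by
    have := norm_sub_le (y + n₂) n₂
    rw [add_sub_cancel_right] at this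
    linarith
  have h4 : y + n₂ ≠ 0 := norm_pos_iff.1 (by linarith)
  have h5 : y ≠ 0 := norm_pos_iff.1 (by linarith)
  refine ⟨h4, ?_⟩
  have hν0 : 0 ≤ ν := (norm_nonneg _).trans h1
  have hp0 : 0 ≤ p := (norm_nonneg _).trans hx
  rw [show (x + n₁) / (y + n₂) - x / y = (n₁ * y - x * n₂) / ((y + n₂) * y) by field_simp; ring,
    norm_div, norm_mul]
  calc ‖n₁ * y - x * n₂‖ / (‖y + n₂‖ * ‖y‖) ≤ (ν * p + p * ν) / (c / 2 * c) := by
        have h6 := norm_sub_le_of_le (norm_mul_le_of_le h1 hyp) (norm_mul_le_of_le hx h2)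
        gcongr
    _ = 4 * p / c ^ 2 * ν := by field_simp; ring

/-- Existence of solutions of the normalized Riccati equation near the origin, on the union of three
Borel discs, that are close to the leading-order solution. -/
theorem exists_normalized_riccati_solution {a b c : ℂ → ℂ → ℂ} {a₀ b₀ c₀ : ℂ → ℂ}
    {m r δ c' ε θ h : ℝ} {u : ℂ × ℂ} (hε : ε = 1 ∨ ε = -1) (hm : 0 ≤ m) (hr : 0 < r) (hδ : 0 < δ)
    (h0 : 0 ≤ h) (h1 : h ≤ Real.pi / 2)
    (hB : ∀ φ φ' : ℝ, (φ = θ ∨ φ = θ + h ∨ φ = θ + 2 * h) → (φ' = φ ∨ φ' = φ + h) →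
      φ' ≤ θ + 2 * h → NormalizedRiccati a b c a₀ b₀ c₀
        (Metric.thickening (2 * r) (rayCone (ε * Complex.exp (φ * Complex.I))
          (ε * Complex.exp (φ' * Complex.I)))) (borelDisc φ δ ∩ borelDisc φ' δ) m)
    (hc' : 0 < c') (hu : ‖u‖ ≤ 1)
    (hlow : ∀ z ∈ Metric.ball 0 r, c' ≤ ‖(leadingProjector ε (a₀ z) (b₀ z) (c₀ z) u).2‖)
    {η : ℝ} (hη : 0 < η) :
    ∃ δ' > 0, δ' ≤ δ ∧ ∃ F : ℂ → ℂ → ℂ,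
      ∀ z ∈ Metric.ball 0 r,
        DifferentiableOn ℂ (F z)
          (borelDisc θ δ' ∪ borelDisc (θ + h) δ' ∪ borelDisc (θ + 2 * h) δ') ∧
        ∀ ħ ∈ borelDisc θ δ' ∪ borelDisc (θ + h) δ' ∪ borelDisc (θ + 2 * h) δ',
          HasDerivAt (fun z => F z ħ) ((a z ħ * F z ħ ^ 2 + b z ħ * F z ħ + c z ħ) / ħ) z ∧
          ‖F z ħ - (leadingProjector ε (a₀ z) (b₀ z) (c₀ z) u).1 /
            (leadingProjector ε (a₀ z) (b₀ z) (c₀ z) u).2‖ ≤ η := by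
  have hε2 : (ε : ℂ) ^ 2 = 1 := by rcases hε with rfl | rfl <;> simp
  have hεn : ‖(ε : ℂ)‖ = 1 := by rcases hε with rfl | rfl <;> simp
  set p : ℝ := (1 + 2 * m) * (1 + 2 / r) with hp
  have hp0 : 0 < p := by positivity
  -- Beyond δ, the three entries provide the contraction condition, keep the denominator of the
  -- slope at least c'/2, and make the slope η-close to its leading order.
  set δ' : ℝ := min δ (min (1 / (16 * (1 + p) ^ 3))
    (min (c' / 2 / (8 * (1 + p) ^ 3)) (η / (4 * p / c' ^ 2 * (8 * (1 + p) ^ 3))))) with hδ'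
  have hδ0 : 0 < δ' := by positivity
  have hδδ : δ' ≤ δ := min_le_left _ _
  have hδ1 : 16 * (1 + p) ^ 3 ≤ 1 / δ' := by
    rw [le_div_iff₀ hδ0, ← le_div_iff₀' (by positivity)]
    exact (min_le_right _ _).trans (min_le_left _ _)
  have hδ2 : 8 * (1 + p) ^ 3 * δ' ≤ c' / 2 := by
    rw [← le_div_iff₀' (by positivity)]
    exact (min_le_right _ _).trans ((min_le_right _ _).trans (min_le_left _ _))
  have hδ3 : 4 * p / c' ^ 2 * (8 * (1 + p) ^ 3 * δ') ≤ η := by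
    rw [← mul_assoc, ← le_div_iff₀' (by positivity)]
    exact (min_le_right _ _).trans ((min_le_right _ _).trans (min_le_right _ _))
  set P : ℂ → (ℂ × ℂ) →L[ℂ] (ℂ × ℂ) := fun z => leadingProjector ε (a₀ z) (b₀ z) (c₀ z) with hP
  set R : ℂ → ℂ → (ℂ × ℂ) →L[ℂ] (ℂ × ℂ) := fun z ħ =>
    companionOp ((a z ħ - a₀ z) / ħ) ((b z ħ - b₀ z) / ħ) ((c z ħ - c₀ z) / ħ) with hR
  have hPB : ∀ φ φ' : ℝ, (φ = θ ∨ φ = θ + h ∨ φ = θ + 2 * h) → (φ' = φ ∨ φ' = φ + h) →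
      φ' ≤ θ + 2 * h → ProjectorBounds P R
        (Metric.thickening r (rayCone (ε * Complex.exp (φ * Complex.I))
          (ε * Complex.exp (φ' * Complex.I)))) (borelDisc φ δ' ∩ borelDisc φ' δ') p :=
    fun φ φ' hφ hφ' h2 => NormalizedRiccati.projectorBounds hε2 hεn hm hr
      (fun ħ hħ => ne_zero_of_mem_borelDisc hδ0 hħ.1)
      ((hB φ φ' hφ hφ' h2).mono subset_rfl
        (Set.inter_subset_inter (borelDisc_mono hδ0 hδδ) (borelDisc_mono hδ0 hδδ)))
  obtain ⟨N, hN, hN'⟩ := exists_glued_projectorCorrection hε hp0.le hδ0 hδ1 h0 h1 hPB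
  have hball : Metric.ball (0 : ℂ) r ⊆ Metric.thickening (2 * r)
      (rayCone (ε * Complex.exp (θ * Complex.I)) (ε * Complex.exp (θ * Complex.I))) :=
    (Metric.ball_subset_ball (by linarith)).trans (ball_subset_thickening_rayCone _ _ _)
  have hB0 := hB θ θ (Or.inl rfl) (Or.inl rfl) (by linarith)
  have hP0 := hPB θ θ (Or.inl rfl) (Or.inl rfl) (by linarith)
  have hPle : ∀ z ∈ Metric.ball (0 : ℂ) r, ‖P z u‖ ≤ p := fun z hz =>
    ((P z).le_opNorm u).trans ((mul_le_of_le_one_right (norm_nonneg _) hu).trans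
      (hP0.bound z (ball_subset_thickening_rayCone _ _ _ hz)))
  have hNle : ∀ z ∈ Metric.ball (0 : ℂ) r,
      ∀ ħ ∈ borelDisc θ δ' ∪ borelDisc (θ + h) δ' ∪ borelDisc (θ + 2 * h) δ',
      ‖N z ħ u‖ ≤ 8 * (1 + p) ^ 3 * δ' := fun z hz ħ hħ =>
    ((N z ħ).le_opNorm u).trans ((mul_le_of_le_one_right (norm_nonneg _) hu).trans
      ((hN' z hz).2 ħ hħ).1)
  have hquot : ∀ z ∈ Metric.ball (0 : ℂ) r,
      ∀ ħ ∈ borelDisc θ δ' ∪ borelDisc (θ + h) δ' ∪ borelDisc (θ + 2 * h) δ', _ := fun z hz ħ hħ =>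
    norm_div_sub_div_le hc' hδ2 ((norm_fst_le _).trans (hPle z hz))
      ((norm_snd_le _).trans (hPle z hz)) (hlow z hz) ((norm_fst_le _).trans (hNle z hz ħ hħ))
      ((norm_snd_le _).trans (hNle z hz ħ hħ))
  refine ⟨δ', hδ0, hδδ, fun z ħ => ((P z + N z ħ) u).1 / ((P z + N z ħ) u).2, fun z hz =>
    ⟨?_, fun ħ hħ => ⟨?_, (hquot z hz ħ hħ).2.trans hδ3⟩⟩⟩
  · have h2 : DifferentiableOn ℂ (fun ħ => (P z + N z ħ) u)
        (borelDisc θ δ' ∪ borelDisc (θ + h) δ' ∪ borelDisc (θ + 2 * h) δ') :=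
      ((hN' z hz).1.const_add (P z)).clm_apply (differentiableOn_const u)
    exact h2.fst.div h2.snd fun ħ hħ => (hquot z hz ħ hħ).1
  · have hħ0 : ħ ≠ 0 := by
      rcases hħ with (hħ | hħ) | hħ <;> exact ne_zero_of_mem_borelDisc hδ0 hħ
    have hdisc := hB0.disc z (hball hz)
    obtain ⟨-, h3, h4⟩ := (hN' z hz).2 ħ hħ
    have hP1 : P z * P z = P z := leadingProjector_idem hε2 hdisc
    have hPd := (hP0.diff.differentiableAt (hP0.isOpen.mem_nhds
      (ball_subset_thickening_rayCone _ _ _ hz))).hasDerivAt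
    have h5 := projector_deriv (P' := deriv P z) (R := R z ħ) (ε := ε) hħ0 hP1 h3 h4
    have h6 : (ε : ℂ) • ((1 / 2 : ℂ) • 1 - P z) + ħ • R z ħ =
        companionOp (a z ħ) (b z ħ) (c z ħ) := by
      rw [hP, smul_half_sub_leadingProjector hε2]
      refine ContinuousLinearMap.ext fun w => ?_
      rw [add_apply, smul_apply, companionOp_apply, companionOp_apply, companionOp_apply]
      ext
      · simp only [Prod.fst_add, Prod.smul_fst, smul_eq_mul]
        field_simp
        ring
      · simp only [Prod.snd_add, Prod.smul_snd, smul_eq_mul]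
        field_simp
        ring
    rw [h6] at h5
    refine hasDerivAt_riccati_of_projector (Q := fun z => P z + N z ħ) hħ0
      (hPd.add (hN ħ hħ z hz).1) h5 (fun v => ?_) (hquot z hz ħ hħ).1
    -- As NP = N, the operator P + N factors through P, so its range is spanned by the image of u
    -- just as that of P is.
    have h7 : N z ħ * P z = N z ħ := by rw [mul_sub, mul_one, sub_eq_zero] at h4; exact h4.symm
    have hy : (P z u).2 ≠ 0 := norm_pos_iff.1 (hc'.trans_le (hlow z hz))
    obtain ⟨μ, hμ⟩ := leadingProjector_parallel hε2 hdisc hy v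
    have h8 : ∀ w, (P z + N z ħ) w = P z w + N z ħ (P z w) := fun w => by
      rw [add_apply, ← mul_apply_eq_comp (N z ħ), h7]
    exact ⟨μ, by rw [h8, h8, show P z v = μ • P z u from hμ, map_smul, smul_add]⟩

end

noncomputable section

/-! ### Solutions of the Riccati equation near the regular point -/

theorem eventually_deriv_inverse_liouville {s Ψ : ℂ → ℂ} {x₀ : ℂ} {ρ : ℝ} {H : Set ℂ} (hρ : 0 < ρ)
    (hs : DifferentiableOn ℂ s (Metric.ball x₀ ρ)) (hs0 : s x₀ ≠ 0)
    (hΨi : ∀ᶠ x in 𝓝 x₀, Ψ (liouville s x₀ x) = x) (hH : IsOpen H) (h0 : (0 : ℂ) ∈ H)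
    (hΨd : DifferentiableOn ℂ Ψ H) :
    ∀ᶠ x in 𝓝 x₀, deriv Ψ (liouville s x₀ x) * s x = 1 := by
  have h3 : ∀ᶠ z in 𝓝 (0 : ℂ), z ∈ H := hH.mem_nhds h0
  rw [← map_nhds_liouville hρ hs hs0, Filter.eventually_map] at h3
  filter_upwards [h3, hΨi.eventually_nhds, Metric.ball_mem_nhds x₀ hρ] with x hx hx' hxρ
  have h4 := (hΨd.differentiableAt (hH.mem_nhds hx)).hasDerivAt.comp x
    (hasDerivAt_liouville hs hxρ)
  exact h4.unique ((hasDerivAt_id x).congr_of_eventuallyEq hx')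

theorem direction_mem_borelDisc (θ : ℝ) {δ : ℝ} (hδ : 0 < δ) :
    ((δ / 2 : ℝ) : ℂ) * Complex.exp (θ * Complex.I) ∈ borelDisc θ δ := by
  have h1 : Complex.exp (θ * Complex.I) / (((δ / 2 : ℝ) : ℂ) * Complex.exp (θ * Complex.I)) =
      ((2 / δ : ℝ) : ℂ) := by
    have := Complex.exp_ne_zero (θ * Complex.I)
    have h2 : (δ : ℂ) ≠ 0 := by exact_mod_cast hδ.ne'
    push_cast
    field_simp
  rw [borelDisc, Set.mem_ofPred_eq, h1, Complex.ofReal_re]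
  gcongr
  norm_num

/-- Gevrey bounds for the coefficients of an asymptotic expansion. -/
theorem HasGevreyBounds.norm_coeff_le {g : ℂ × ℂ → ℂ} {gk : ℕ → ℂ → ℂ} {w : ℂ → ℝ}
    {V : Set ℂ} {A B θ δ : ℝ} (hδ : 0 < δ) (h : HasGevreyBounds g gk w V (borelDisc θ δ) A B)
    {x : ℂ} (hx : x ∈ V) (n : ℕ) : ‖gk n x‖ ≤ w x * (A * B ^ n * n.factorial) := by
  have h1 : ∀ d ∈ Set.Ioo 0 δ, ‖gk n x‖ ≤ w x * (A * B ^ n * n.factorial) +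
      w x * (A * B ^ (n + 1) * (n + 1).factorial) * (d / 2) := by
    -- The coefficient times ħⁿ is the difference of two consecutive remainders at a point of
    -- modulus d/2; the contribution of order n + 1 disappears as d → 0.
    intro d hd
    set ħ : ℂ := ((d / 2 : ℝ) : ℂ) * Complex.exp (θ * Complex.I) with hħ
    have hmem : ħ ∈ borelDisc θ δ := borelDisc_mono hd.1 hd.2.le (direction_mem_borelDisc θ hd.1)
    have hn : ‖ħ‖ = d / 2 := by
      rw [hħ, norm_mul, Complex.norm_exp_ofReal_mul_I, mul_one, Complex.norm_real,
        Real.norm_of_nonneg (by linarith [hd.1])]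
    have hd2 : 0 < d / 2 := by linarith [hd.1]
    have h0 := norm_sub_le_of_le (h n x hx ħ hmem) (h (n + 1) x hx ħ hmem)
    rw [remainder, remainder, Finset.sum_range_succ, sub_sub_sub_cancel_left, add_sub_cancel_left,
      norm_mul, norm_pow, hn] at h0
    refine le_of_mul_le_mul_right (h0.trans_eq ?_) (pow_pos hd2 n)
    ring
  have h2 : Filter.Tendsto (fun d : ℝ => w x * (A * B ^ n * n.factorial) +
      w x * (A * B ^ (n + 1) * (n + 1).factorial) * (d / 2)) (𝓝[>] 0)
      (𝓝 (w x * (A * B ^ n * n.factorial))) := by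
    refine tendsto_nhdsWithin_of_tendsto_nhds (Continuous.tendsto' (by fun_prop) _ _ (by simp))
  refine ge_of_tendsto h2 ?_
  filter_upwards [Ioo_mem_nhdsGT hδ] with d hd using h1 d hd

theorem HasGevreyBounds.norm_sub_coeff_zero_le {g : ℂ × ℂ → ℂ} {gk : ℕ → ℂ → ℂ} {w : ℂ → ℝ}
    {V T : Set ℂ} {A B : ℝ} (h : HasGevreyBounds g gk w V T A B) {x ħ : ℂ} (hx : x ∈ V)
    (hħ : ħ ∈ T) : ‖g (x, ħ) - gk 0 x‖ ≤ w x * (A * B * ‖ħ‖) := by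
  simpa [remainder] using h 1 x hx ħ hħ

/-- In the Liouville coordinate, the coefficients of the Riccati equation are bounded near cones of
copolar directions. -/
theorem exists_normalizedRiccati {X S : Set ℂ} {a b c : ℂ × ℂ → ℂ} {ak bk ck : ℕ → ℂ → ℂ}
    (ha : DifferentiableOn ℂ a (X ×ˢ S)) (hb : DifferentiableOn ℂ b (X ×ˢ S))
    (hc : DifferentiableOn ℂ c (X ×ˢ S))
    (hak : ∀ k, DifferentiableOn ℂ (ak k) X) (hbk : ∀ k, DifferentiableOn ℂ (bk k) X)
    (hck : ∀ k, DifferentiableOn ℂ (ck k) X)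
    {ε δ A B : ℝ} (hε : ε = 1 ∨ ε = -1) (hδ : 0 < δ) (hA : 0 < A) (hB : 0 < B)
    {W H : ℝ → Set ℂ} {Ψ : ℂ → ℂ} {Θ : Set ℝ}
    (hΨ : ∀ θ ∈ Θ, IsOpen (H θ) ∧ (0 : ℂ) ∈ H θ ∧
        IsRayInvariant (ε * Complex.exp (θ * Complex.I)) (H θ) ∧
        DifferentiableOn ℂ Ψ (H θ) ∧ Set.MapsTo Ψ (H θ) X ∧ Set.MapsTo Ψ (H θ) (W θ) ∧
        ∀ z ∈ H θ, deriv Ψ z ^ 2 * leadingDiscriminant ak bk ck (Ψ z) = 1)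
    (hGevrey : ∀ θ ∈ Θ, borelDisc θ δ ⊆ S ∧
        HasGevreyBounds a ak (fun x => √‖leadingDiscriminant ak bk ck x‖)
          (W θ) (borelDisc θ δ) A B ∧
        HasGevreyBounds b bk (fun x => √‖leadingDiscriminant ak bk ck x‖)
          (W θ) (borelDisc θ δ) A B ∧
        HasGevreyBounds c ck (fun x => √‖leadingDiscriminant ak bk ck x‖)
          (W θ) (borelDisc θ δ) A B)
    {φ φ' : ℝ} (hφ : φ ≤ φ') (hφ' : φ' ≤ φ + Real.pi / 2) (hΘ : Set.Icc φ φ' ⊆ Θ) :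
    ∃ r > 0, NormalizedRiccati (fun z ħ => deriv Ψ z * a (Ψ z, ħ))
      (fun z ħ => deriv Ψ z * b (Ψ z, ħ)) (fun z ħ => deriv Ψ z * c (Ψ z, ħ))
      (fun z => deriv Ψ z * ak 0 (Ψ z)) (fun z => deriv Ψ z * bk 0 (Ψ z))
      (fun z => deriv Ψ z * ck 0 (Ψ z))
      (Metric.thickening r (rayCone (ε * Complex.exp (φ * Complex.I))
          (ε * Complex.exp (φ' * Complex.I)))) (borelDisc φ δ ∩ borelDisc φ' δ)
      (A + A * B) := by
  have hφm : φ ∈ Θ := hΘ ⟨le_rfl, hφ⟩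
  have hφm' : φ' ∈ Θ := hΘ ⟨hφ, le_rfl⟩
  obtain ⟨r₁, hr₁, hr₁'⟩ := (hΨ φ hφm).2.2.1.exists_thickening_subset (hΨ φ hφm).1 (hΨ φ hφm).2.1
  obtain ⟨r₂, hr₂, hr₂'⟩ := (hΨ φ' hφm').2.2.1.exists_thickening_subset (hΨ φ' hφm').1
    (hΨ φ' hφm').2.1
  refine ⟨min r₁ r₂, lt_min hr₁ hr₂, ?_⟩
  set Ω := Metric.thickening (min r₁ r₂) (rayCone (ε * Complex.exp (φ * Complex.I))
    (ε * Complex.exp (φ' * Complex.I))) with hΩ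
  -- Here the halfstrips of all intermediate directions are needed: the inside of the cone is swept
  -- by their rays from 0, whose strips have no common width, and only the two boundary rays use a
  -- definite width.
  have hcov : ∀ z ∈ Ω, ∃ θ ∈ Set.Icc φ φ', z ∈ H θ := by
    intro z hz
    rcases thickening_rayCone_cases hε hφ hφ' hz with ⟨θ, hθ, t, ht, rfl⟩ | h | h
    · refine ⟨θ, hθ, ?_⟩
      have := (hΨ θ (hΘ hθ)).2.2.1 0 (hΨ θ (hΘ hθ)).2.1 t ht
      rwa [zero_add, mul_right_comm] at this
    · exact ⟨φ, ⟨le_rfl, hφ⟩, hr₁' (Metric.thickening_mono (min_le_left _ _) _ h)⟩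
    · exact ⟨φ', ⟨hφ, le_rfl⟩, hr₂' (Metric.thickening_mono (min_le_right _ _) _ h)⟩
  have hS : borelDisc φ δ ∩ borelDisc φ' δ ⊆ S := fun ħ hħ => (hGevrey φ hφm).1 hħ.1
  have hΨd : ∀ z ∈ Ω, DifferentiableAt ℂ Ψ z ∧ DifferentiableAt ℂ (deriv Ψ) z ∧ Ψ z ∈ X := by
    intro z hz
    obtain ⟨θ, hθ, hzθ⟩ := hcov z hz
    have h := hΨ θ (hΘ hθ)
    exact ⟨h.2.2.2.1.differentiableAt (h.1.mem_nhds hzθ),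
      (h.2.2.2.1.deriv h.1).differentiableAt (h.1.mem_nhds hzθ), h.2.2.2.2.1 hzθ⟩
  have hX : Set.MapsTo Ψ Ω X := fun z hz => (hΨd z hz).2.2
  have hd0 : DifferentiableOn ℂ Ψ Ω := fun z hz => (hΨd z hz).1.differentiableWithinAt
  have hd1 : DifferentiableOn ℂ (deriv Ψ) Ω := fun z hz => (hΨd z hz).2.1.differentiableWithinAt
  have hfst : ∀ {g : ℂ × ℂ → ℂ}, DifferentiableOn ℂ g (X ×ˢ S) → ∀ ħ ∈ S,
      DifferentiableOn ℂ (fun z => deriv Ψ z * g (Ψ z, ħ)) Ω := fun hg ħ hħ =>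
    hd1.mul (hg.comp (hd0.prodMk (differentiableOn_const ħ)) fun z hz => ⟨hX hz, hħ⟩)
  have hsnd : ∀ {g : ℂ × ℂ → ℂ}, DifferentiableOn ℂ g (X ×ˢ S) → ∀ z ∈ Ω,
      DifferentiableOn ℂ (fun ħ => deriv Ψ z * g (Ψ z, ħ)) (borelDisc φ δ ∩ borelDisc φ' δ) :=
    fun hg z hz => DifferentiableOn.const_mul (hg.comp
      ((differentiableOn_const (Ψ z)).prodMk differentiableOn_id) fun ħ hħ => ⟨hX hz, hS hħ⟩) _
  have hzero : ∀ {gk : ℕ → ℂ → ℂ}, (∀ k, DifferentiableOn ℂ (gk k) X) →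
      DifferentiableOn ℂ (fun z => deriv Ψ z * gk 0 (Ψ z)) Ω := fun hg =>
    hd1.mul ((hg 0).comp hd0 hX)
  -- The scale √|D₀| cancels against |Ψ'|; the bounds in the Liouville coordinate are therefore
  -- uniform out to infinity.
  have hone : ∀ θ ∈ Θ, ∀ z ∈ H θ,
      ‖deriv Ψ z‖ * √‖leadingDiscriminant ak bk ck (Ψ z)‖ = 1 := by
    intro θ hθ z hz
    have h1 := congrArg norm ((hΨ θ hθ).2.2.2.2.2.2 z hz)
    rw [norm_mul, norm_pow, norm_one] at h1
    have h2 := congrArg Real.sqrt h1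
    rwa [Real.sqrt_one, Real.sqrt_mul (by positivity), Real.sqrt_sq (norm_nonneg _)] at h2
  have hbz : ∀ {g : ℂ × ℂ → ℂ} {gk : ℕ → ℂ → ℂ}, (∀ θ ∈ Θ, HasGevreyBounds g gk
      (fun x => √‖leadingDiscriminant ak bk ck x‖) (W θ) (borelDisc θ δ) A B) → ∀ z ∈ Ω,
      ‖deriv Ψ z * gk 0 (Ψ z)‖ ≤ A + A * B := by
    intro g gk hg z hz
    obtain ⟨θ, hθ, hzθ⟩ := hcov z hz
    have h1 := (hg θ (hΘ hθ)).norm_coeff_le hδ ((hΨ θ (hΘ hθ)).2.2.2.2.2.1 hzθ) 0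
    simp only [pow_zero, mul_one, Nat.factorial_zero, Nat.cast_one] at h1
    rw [norm_mul]
    refine (mul_le_mul_of_nonneg_left h1 (norm_nonneg _)).trans ?_
    rw [← mul_assoc, hone θ (hΘ hθ) z hzθ, one_mul]
    linarith [mul_pos hA hB]
  have hbs : ∀ {g : ℂ × ℂ → ℂ} {gk : ℕ → ℂ → ℂ}, (∀ θ ∈ Θ, HasGevreyBounds g gk
      (fun x => √‖leadingDiscriminant ak bk ck x‖) (W θ) (borelDisc θ δ) A B) → ∀ z ∈ Ω,
      ∀ ħ ∈ borelDisc φ δ ∩ borelDisc φ' δ,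
      ‖deriv Ψ z * g (Ψ z, ħ) - deriv Ψ z * gk 0 (Ψ z)‖ ≤ (A + A * B) * ‖ħ‖ := by
    intro g gk hg z hz ħ hħ
    obtain ⟨θ, hθ, hzθ⟩ := hcov z hz
    have h1 := (hg θ (hΘ hθ)).norm_sub_coeff_zero_le ((hΨ θ (hΘ hθ)).2.2.2.2.2.1 hzθ)
      (mem_borelDisc_between hδ hφ' hθ hħ.1 hħ.2)
    rw [← mul_sub, norm_mul]
    refine (mul_le_mul_of_nonneg_left h1 (norm_nonneg _)).trans ?_
    rw [← mul_assoc, hone θ (hΘ hθ) z hzθ, one_mul]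
    exact mul_le_mul_of_nonneg_right (by linarith) (norm_nonneg _)
  have hGa := fun θ hθ => (hGevrey θ hθ).2.1
  have hGb := fun θ hθ => (hGevrey θ hθ).2.2.1
  have hGc := fun θ hθ => (hGevrey θ hθ).2.2.2
  exact {
    diff_fst := fun ħ hħ => ⟨hfst ha ħ (hS hħ), hfst hb ħ (hS hħ), hfst hc ħ (hS hħ)⟩
    diff_snd := fun z hz => ⟨hsnd ha z hz, hsnd hb z hz, hsnd hc z hz⟩
    diff_zero := ⟨hzero hak, hzero hbk, hzero hck⟩
    disc := fun z hz => by
      obtain ⟨θ, hθ, hzθ⟩ := hcov z hz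
      rw [← (hΨ θ (hΘ hθ)).2.2.2.2.2.2 z hzθ, leadingDiscriminant]
      ring
    bound_zero := fun z hz => ⟨hbz hGa z hz, hbz hGb z hz, hbz hGc z hz⟩
    bound_sub := fun z hz ħ hħ => ⟨hbs hGa z hz ħ hħ, hbs hGb z hz ħ hħ, hbs hGc z hz ħ hħ⟩ }

end

/-! ### Local existence in the original variable x. -/

noncomputable section

/-- A vector whose projection to the leading-order line is not horizontal. -/
theorem exists_leadingProjector_snd_ne_zero {ε a b c : ℂ} (hε : ε ≠ 0)
    (h : a = 0 → 1 + ε * b ≠ 0) :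
    ∃ u : ℂ × ℂ, ‖u‖ ≤ 1 ∧ (leadingProjector ε a b c u).2 ≠ 0 := by
  by_cases ha : a = 0
  · refine ⟨(0, 1), by simp [Prod.norm_def], ?_⟩
    rw [leadingProjector_apply]
    intro h0
    simp only at h0
    exact h ha (by linear_combination 2 * h0)
  · refine ⟨(1, 0), by simp [Prod.norm_def], ?_⟩
    rw [leadingProjector_apply]
    simpa using ⟨hε, ha⟩

/-- The union of the Borel discs of three equidistant copolar directions. -/
def copolarDiscs (ϑ₁ ϑ₂ d : ℝ) : Set ℂ :=
  borelDisc (ϑ₁ + Real.pi / 2) d ∪ borelDisc (ϑ₁ + Real.pi / 2 + (ϑ₂ - ϑ₁ - Real.pi) / 2) d ∪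
    borelDisc (ϑ₁ + Real.pi / 2 + 2 * ((ϑ₂ - ϑ₁ - Real.pi) / 2)) d

/-- Existence of holomorphic solutions of the Riccati equation near `x₀` that are close to the
leading-order solution. -/
theorem exists_local_riccati_solution
    {X S : Set ℂ} {ϑ₁ ϑ₂ : ℝ} (hA₁ : Real.pi ≤ ϑ₂ - ϑ₁) (hA₂ : ϑ₂ - ϑ₁ ≤ 2 * Real.pi)
    {a b c : ℂ × ℂ → ℂ} {ak bk ck : ℕ → ℂ → ℂ}
    (ha : DifferentiableOn ℂ a (X ×ˢ S)) (hb : DifferentiableOn ℂ b (X ×ˢ S))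
    (hc : DifferentiableOn ℂ c (X ×ˢ S))
    (hak : ∀ k, DifferentiableOn ℂ (ak k) X) (hbk : ∀ k, DifferentiableOn ℂ (bk k) X)
    (hck : ∀ k, DifferentiableOn ℂ (ck k) X)
    {x₀ : ℂ} {s : ℂ → ℂ} {ρ : ℝ} (hρ : 0 < ρ)
    (hs : DifferentiableOn ℂ s (Metric.ball x₀ ρ))
    (hsq : ∀ x ∈ Metric.ball x₀ ρ, s x ^ 2 = leadingDiscriminant ak bk ck x) (hs0 : s x₀ ≠ 0)
    {ε : ℝ} (hε : ε = 1 ∨ ε = -1) (hbranch : ak 0 x₀ = 0 → bk 0 x₀ = s x₀)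
    {W : ℝ → Set ℂ} (hW : ∀ θ ∈ copolarArc ϑ₁ ϑ₂, IsWKBHalfstrip X s x₀ θ ε (W θ))
    (hWa : ε = -1 → ∀ θ ∈ copolarArc ϑ₁ ϑ₂, ∀ x ∈ W θ, ak 0 x ≠ 0)
    {δ A B : ℝ} (hδ : 0 < δ) (hA : 0 < A) (hB : 0 < B)
    (hGevrey : ∀ θ ∈ copolarArc ϑ₁ ϑ₂, borelDisc θ δ ⊆ S ∧
        HasGevreyBounds a ak (fun x => √‖leadingDiscriminant ak bk ck x‖)
          (W θ) (borelDisc θ δ) A B ∧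
        HasGevreyBounds b bk (fun x => √‖leadingDiscriminant ak bk ck x‖)
          (W θ) (borelDisc θ δ) A B ∧
        HasGevreyBounds c ck (fun x => √‖leadingDiscriminant ak bk ck x‖)
          (W θ) (borelDisc θ δ) A B) :
    ∃ R > 0, R ≤ ρ ∧ (∀ φ : ℝ, (φ = ϑ₁ + Real.pi / 2 ∨
        φ = ϑ₁ + Real.pi / 2 + (ϑ₂ - ϑ₁ - Real.pi) / 2 ∨
        φ = ϑ₁ + Real.pi / 2 + 2 * ((ϑ₂ - ϑ₁ - Real.pi) / 2)) → Metric.ball x₀ R ⊆ W φ) ∧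
      ∃ f₀ : ℂ → ℂ, DifferentiableOn ℂ f₀ (Metric.ball x₀ R) ∧
      (∀ x ∈ Metric.ball x₀ R, 2 * ak 0 x * f₀ x + bk 0 x = ε * s x ∧
        ak 0 x * f₀ x ^ 2 + bk 0 x * f₀ x + ck 0 x = 0) ∧
      ∀ η > 0, ∃ δ' > 0, δ' ≤ δ ∧ ∃ f : ℂ × ℂ → ℂ, ∀ x ∈ Metric.ball x₀ R,
        DifferentiableOn ℂ (fun ħ => f (x, ħ)) (copolarDiscs ϑ₁ ϑ₂ δ') ∧
        ∀ ħ ∈ copolarDiscs ϑ₁ ϑ₂ δ', DifferentiableAt ℂ (fun y => f (y, ħ)) x ∧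
          ħ * deriv (fun y => f (y, ħ)) x = a (x, ħ) * f (x, ħ) ^ 2 + b (x, ħ) * f (x, ħ) +
            c (x, ħ) ∧ ‖f (x, ħ) - f₀ x‖ ≤ η := by
  set θ := ϑ₁ + Real.pi / 2 with hθ
  set h := (ϑ₂ - ϑ₁ - Real.pi) / 2 with hh
  have h0 : 0 ≤ h := by rw [hh]; linarith
  have h1 : h ≤ Real.pi / 2 := by rw [hh]; linarith
  have hend : θ + 2 * h = ϑ₂ - Real.pi / 2 := by rw [hθ, hh]; ring
  have hΘ : copolarArc ϑ₁ ϑ₂ = Set.Icc θ (θ + 2 * h) := by rw [hend]; rfl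
  have hmem : ∀ φ : ℝ, (φ = θ ∨ φ = θ + h ∨ φ = θ + 2 * h) → φ ∈ copolarArc ϑ₁ ϑ₂ := by
    rw [hΘ]
    rintro φ (rfl | rfl | rfl) <;> constructor <;> linarith
  have hθm : θ ∈ copolarArc ϑ₁ ϑ₂ := hmem θ (Or.inl rfl)
  have hε2 : (ε : ℂ) ^ 2 = 1 := by rcases hε with rfl | rfl <;> simp
  have hε0 : (ε : ℂ) ≠ 0 := by rcases hε with rfl | rfl <;> simp
  obtain ⟨Ψ, H, hΨi, hΨ⟩ := exists_inverse_liouville hak hbk hck hρ hs hsq hs0 ⟨θ, hθm⟩ hW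
  obtain ⟨hHo, hH0, -, hΨd, hΨX, hΨW, hΨD⟩ := hΨ θ hθm
  have hderiv := eventually_deriv_inverse_liouville hρ hs hs0 hΨi hHo hH0 hΨd
  have hΨ0 : Ψ 0 = x₀ := by have := hΨi.self_of_nhds; rwa [liouville_self] at this
  have hd0 : deriv Ψ 0 * s x₀ = 1 := by have := hderiv.self_of_nhds; rwa [liouville_self] at this
  -- coefficients in the Liouville coordinate
  have hpair : ∀ φ φ' : ℝ, ∃ r > 0, (φ = θ ∨ φ = θ + h ∨ φ = θ + 2 * h) → (φ' = φ ∨ φ' = φ + h) →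
      φ' ≤ θ + 2 * h → NormalizedRiccati (fun z ħ => deriv Ψ z * a (Ψ z, ħ))
      (fun z ħ => deriv Ψ z * b (Ψ z, ħ)) (fun z ħ => deriv Ψ z * c (Ψ z, ħ))
      (fun z => deriv Ψ z * ak 0 (Ψ z)) (fun z => deriv Ψ z * bk 0 (Ψ z))
      (fun z => deriv Ψ z * ck 0 (Ψ z))
      (Metric.thickening r (rayCone (ε * Complex.exp (φ * Complex.I))
          (ε * Complex.exp (φ' * Complex.I)))) (borelDisc φ δ ∩ borelDisc φ' δ)
      (A + A * B) := by
    intro φ φ'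
    by_cases hcase : (φ = θ ∨ φ = θ + h ∨ φ = θ + 2 * h) ∧ (φ' = φ ∨ φ' = φ + h) ∧ φ' ≤ θ + 2 * h
    · obtain ⟨hφ, hφ', hle⟩ := hcase
      have h2 : φ ≤ φ' := by rcases hφ' with rfl | rfl <;> linarith
      have h3 : φ' ≤ φ + Real.pi / 2 := by rcases hφ' with rfl | rfl <;> linarith [Real.pi_pos]
      obtain ⟨r, hr, hN⟩ := exists_normalizedRiccati ha hb hc hak hbk hck hε hδ hA hB hΨ hGevrey h2 h3
        (by
          rw [hΘ]
          refine Set.Icc_subset_Icc ?_ hle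
          rcases hφ with rfl | rfl | rfl <;> linarith)
      exact ⟨r, hr, fun _ _ _ => hN⟩
    · exact ⟨1, one_pos, fun h2 h3 h4 => absurd ⟨h2, h3, h4⟩ hcase⟩
  choose r hr hrN using hpair
  set a₀ : ℂ → ℂ := fun z => deriv Ψ z * ak 0 (Ψ z) with ha₀
  set b₀ : ℂ → ℂ := fun z => deriv Ψ z * bk 0 (Ψ z) with hb₀
  set c₀ : ℂ → ℂ := fun z => deriv Ψ z * ck 0 (Ψ z) with hc₀
  set P : ℂ → (ℂ × ℂ) →L[ℂ] (ℂ × ℂ) := fun z => leadingProjector ε (a₀ z) (b₀ z) (c₀ z) with hP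
  have hΨ'd := hΨd.deriv hHo
  have ha₀d : DifferentiableOn ℂ a₀ (H θ) := hΨ'd.mul ((hak 0).comp hΨd hΨX)
  have hb₀d : DifferentiableOn ℂ b₀ (H θ) := hΨ'd.mul ((hbk 0).comp hΨd hΨX)
  have hc₀d : DifferentiableOn ℂ c₀ (H θ) := hΨ'd.mul ((hck 0).comp hΨd hΨX)
  have hdisc : ∀ z ∈ H θ, b₀ z ^ 2 - 4 * a₀ z * c₀ z = 1 := fun z hz => by
    rw [← hΨD z hz, leadingDiscriminant, ha₀, hb₀, hc₀]
    ring
  have hPd : DifferentiableOn ℂ P (H θ) :=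
    ((ha₀d.companionOp hb₀d hc₀d).const_smul (ε : ℂ)).const_sub _
  -- If a₀ vanishes at the base point, the branch condition makes the normalized b₀ equal to 1, so
  -- the expression is 2 for ε = 1; for ε = -1 zeros of a₀ are excluded on the halfstrip.
  have hu : a₀ 0 = 0 → 1 + ε * b₀ 0 ≠ 0 := by
    intro h2
    have h3 : ak 0 x₀ = 0 := by
      simp only [ha₀, hΨ0] at h2
      exact (mul_eq_zero.1 h2).resolve_left (left_ne_zero_of_mul_eq_one hd0)
    have h4 : b₀ 0 = 1 := by rw [← hd0, hb₀, ← hbranch h3]; simp only [hΨ0]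
    rcases hε with rfl | rfl
    · rw [h4]; norm_num
    · have h5 := hWa rfl θ hθm _ (hΨW hH0)
      rw [hΨ0] at h5
      exact absurd h3 h5
  obtain ⟨u, hu1, hu0⟩ := exists_leadingProjector_snd_ne_zero hε0 hu
  have hPu : DifferentiableOn ℂ (fun z => P z u) (H θ) := hPd.clm_apply (differentiableOn_const u)
  have hlow : ∀ᶠ z in 𝓝 (0 : ℂ), ‖(P 0 u).2‖ / 2 < ‖(P z u).2‖ :=
    (continuous_norm.continuousAt.comp (hPu.snd.continuousOn.continuousAt
      (hHo.mem_nhds hH0))).eventually_const_lt (half_lt_self (norm_pos_iff.2 hu0))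
  obtain ⟨r₁, hr₁, hball₁⟩ := Metric.eventually_nhds_iff_ball.1 (hlow.and (hHo.mem_nhds hH0))
  -- The six widths belong to the possible pairs of equal or adjacent directions. The minimum is
  -- halved because bounds are required at width 2r₀.
  set r₀ : ℝ := min r₁ (min (r θ θ) (min (r θ (θ + h)) (min (r (θ + h) (θ + h))
    (min (r (θ + h) (θ + h + h)) (min (r (θ + 2 * h) (θ + 2 * h))
      (r (θ + 2 * h) (θ + 2 * h + h))))))) / 2 with hr₀
  have hr₀0 : 0 < r₀ := by
    have := hr θ θ
    have := hr θ (θ + h)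
    have := hr (θ + h) (θ + h)
    have := hr (θ + h) (θ + h + h)
    have := hr (θ + 2 * h) (θ + 2 * h)
    have := hr (θ + 2 * h) (θ + 2 * h + h)
    positivity
  have hr₀r : r₀ ≤ r₁ := (half_le_self (by linarith)).trans (min_le_left _ _)
  have hB : ∀ φ φ' : ℝ, (φ = θ ∨ φ = θ + h ∨ φ = θ + 2 * h) → (φ' = φ ∨ φ' = φ + h) →
      φ' ≤ θ + 2 * h → NormalizedRiccati (fun z ħ => deriv Ψ z * a (Ψ z, ħ))
        (fun z ħ => deriv Ψ z * b (Ψ z, ħ)) (fun z ħ => deriv Ψ z * c (Ψ z, ħ)) a₀ b₀ c₀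
        (Metric.thickening (2 * r₀) (rayCone (ε * Complex.exp (φ * Complex.I))
          (ε * Complex.exp (φ' * Complex.I)))) (borelDisc φ δ ∩ borelDisc φ' δ)
        (A + A * B) := by
    intro φ φ' hφ hφ' hle
    refine (hrN φ φ' hφ hφ' hle).mono (Metric.thickening_mono ?_ _) subset_rfl
    rw [hr₀, mul_div_cancel₀ _ two_ne_zero]
    rcases hφ with rfl | rfl | rfl <;> rcases hφ' with rfl | rfl <;> simp
  have hmap := map_nhds_liouville hρ hs hs0
  have hnear : ∀ᶠ x in 𝓝 x₀, liouville s x₀ x ∈ Metric.ball 0 r₀ ∧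
      (∀ φ : ℝ, (φ = θ ∨ φ = θ + h ∨ φ = θ + 2 * h) → liouville s x₀ x ∈ H φ) ∧
      Ψ (liouville s x₀ x) = x ∧ deriv Ψ (liouville s x₀ x) * s x = 1 ∧ x ∈ Metric.ball x₀ ρ := by
    have h2 : ∀ᶠ z in 𝓝 (0 : ℂ), z ∈ Metric.ball 0 r₀ ∧ z ∈ H θ ∧ z ∈ H (θ + h) ∧
        z ∈ H (θ + 2 * h) := by
      filter_upwards [Metric.ball_mem_nhds (0 : ℂ) hr₀0, hHo.mem_nhds hH0,
        (hΨ (θ + h) (hmem _ (by simp))).1.mem_nhds (hΨ (θ + h) (hmem _ (by simp))).2.1,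
        (hΨ (θ + 2 * h) (hmem _ (by simp))).1.mem_nhds (hΨ (θ + 2 * h) (hmem _ (by simp))).2.1]
        with z h3 h4 h5 h6 using ⟨h3, h4, h5, h6⟩
    rw [← hmap, Filter.eventually_map] at h2
    filter_upwards [h2, hΨi, hderiv, Metric.ball_mem_nhds x₀ hρ] with x h3 h4 h5 h6
    refine ⟨h3.1, ?_, h4, h5, h6⟩
    rintro φ (rfl | rfl | rfl)
    exacts [h3.2.1, h3.2.2.1, h3.2.2.2]
  obtain ⟨R, hR, hball⟩ := Metric.eventually_nhds_iff_ball.1 hnear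
  set R' := min R ρ with hR'
  have hRsub : Metric.ball x₀ R' ⊆ Metric.ball x₀ R := Metric.ball_subset_ball (min_le_left _ _)
  refine ⟨R', lt_min hR hρ, min_le_right _ _, fun φ hφ x hx => ?_,
    fun x => (P (liouville s x₀ x) u).1 / (P (liouville s x₀ x) u).2, ?_, ?_, ?_⟩
  · obtain ⟨-, h2, h3, -, -⟩ := hball x (hRsub hx)
    have := (hΨ φ (hmem φ hφ)).2.2.2.2.2.1 (h2 φ hφ)
    rwa [h3] at this
  · have hΦ : DifferentiableOn ℂ (liouville s x₀) (Metric.ball x₀ R') := fun x hx =>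
      (hasDerivAt_liouville hs (hball x (hRsub hx)).2.2.2.2).differentiableAt.differentiableWithinAt
    have h2 : DifferentiableOn ℂ (fun x => P (liouville s x₀ x) u) (Metric.ball x₀ R') :=
      hPu.comp hΦ fun x hx => (hball x (hRsub hx)).2.1 θ (Or.inl rfl)
    refine h2.fst.div h2.snd fun x hx => norm_pos_iff.1 (lt_of_le_of_lt (by positivity)
      (hball₁ _ (Metric.ball_subset_ball hr₀r (hball x (hRsub hx)).1)).1)
  · intro x hx
    obtain ⟨h2, h3, h4, h5, h6⟩ := hball x (hRsub hx)
    have hx0 : (P (liouville s x₀ x) u).2 ≠ 0 := norm_pos_iff.1 (lt_of_le_of_lt (by positivity)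
      (hball₁ _ (Metric.ball_subset_ball hr₀r h2)).1)
    obtain ⟨F, hF⟩ : ∃ F, F = (P (liouville s x₀ x) u).1 / (P (liouville s x₀ x) u).2 := ⟨_, rfl⟩
    obtain ⟨h7, h8⟩ := leading_riccati hε2 (hdisc _ (h3 θ (Or.inl rfl))) hx0 hF
    simp only [← hF]
    simp only [ha₀, hb₀, hc₀, h4] at h7 h8
    constructor
    · rw [← h7]
      linear_combination (-(2 * ak 0 x * F + bk 0 x)) * h5
    · refine (mul_eq_zero.1 ?_).resolve_left (left_ne_zero_of_mul_eq_one h5)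
      rw [← h8]
      ring
  · intro η hη
    obtain ⟨δ', hδ', hδδ, F, hF⟩ := exists_normalized_riccati_solution hε (by positivity) hr₀0 hδ
      h0 h1 hB (half_pos (norm_pos_iff.2 hu0)) hu1 (fun z hz =>
        (hball₁ z (Metric.ball_subset_ball hr₀r hz)).1.le) hη
    refine ⟨δ', hδ', hδδ, fun q => F (liouville s x₀ q.1) q.2, fun x hx => ?_⟩
    obtain ⟨h2, h3, h4, h5, h6⟩ := hball x (hRsub hx)
    obtain ⟨h7, h8⟩ := hF _ h2
    refine ⟨h7, fun ħ hħ => ?_⟩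
    obtain ⟨h9, h10⟩ := h8 ħ hħ
    -- The chain rule contributes the factor s, which cancels the factor Ψ' of the normalized
    -- coefficients.
    have h11 := h9.comp x (hasDerivAt_liouville hs h6)
    have hħ0 : ħ ≠ 0 := by
      rcases hħ with (hħ | hħ) | hħ <;> exact ne_zero_of_mem_borelDisc hδ' hħ
    refine ⟨h11.differentiableAt, ?_, h10⟩
    refine (congrArg (ħ * ·) h11.deriv).trans ?_
    simp only [h4]
    field_simp
    linear_combination (a (x, ħ) * F (liouville s x₀ x) ħ ^ 2 + b (x, ħ) * F (liouville s x₀ x) ħ +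
      c (x, ħ)) * h5

end

noncomputable section

/-! ### The proof of the main theorem -/

theorem HasGevreyBounds.mono {g : ℂ × ℂ → ℂ} {gk : ℕ → ℂ → ℂ} {w : ℂ → ℝ} {V V' T T' : Set ℂ}
    {A B : ℝ} (h : HasGevreyBounds g gk w V T A B) (hV : V' ⊆ V) (hT : T' ⊆ T) :
    HasGevreyBounds g gk w V' T' A B := fun n x hx ħ hħ => h n x (hV hx) ħ (hT hħ)

theorem HasGevreyBounds.of_scale_le {g : ℂ × ℂ → ℂ} {gk : ℕ → ℂ → ℂ} {w : ℂ → ℝ} {V T : Set ℂ}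
    {A B K : ℝ} (h : HasGevreyBounds g gk w V T A B) (hA : 0 ≤ A) (hB : 0 ≤ B)
    (hw : ∀ x ∈ V, w x ≤ K) : HasGevreyBounds g gk (fun _ => 1) V T (K * A) B := by
  intro n x hx ħ hħ
  refine (h n x hx ħ hħ).trans ((mul_le_mul_of_nonneg_right (hw x hx) (by positivity)).trans_eq ?_)
  ring

theorem IsFormalSolution.mono {ak bk ck fk : ℕ → ℂ → ℂ} {U U' : Set ℂ}
    (h : IsFormalSolution ak bk ck fk U) (hU : U' ⊆ U) : IsFormalSolution ak bk ck fk U' :=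
  ⟨fun k => (h.1 k).mono hU, fun x hx => h.2 x (hU hx)⟩

/-- Subtracting the quadratic equations gives (g - f)e = 0 without dividing by a, so zeros of a₀
cause no ambiguity. -/
theorem labelled_leading_unique {a b c e f g : ℂ} (he : e ≠ 0) (hf : 2 * a * f + b = e)
    (hg : 2 * a * g + b = e) (hf' : a * f ^ 2 + b * f + c = 0) (hg' : a * g ^ 2 + b * g + c = 0) :
    g = f := by
  have h1 : (g - f) * e = 0 := by
    linear_combination hg' - hf' - (g - f) / 2 * (hf + hg)
  exact sub_eq_zero.1 ((mul_eq_zero.1 h1).resolve_right he)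

theorem IsFormalSolution.order_zero {ak bk ck fk : ℕ → ℂ → ℂ} {U : Set ℂ}
    (h : IsFormalSolution ak bk ck fk U) {x : ℂ} (hx : x ∈ U) :
    ak 0 x * fk 0 x ^ 2 + bk 0 x * fk 0 x + ck 0 x = 0 :=
  ((formal_riccati_iff' _ _ _ _ _).1 ((formal_riccati_iff _ _ _ _ _).1 (h.2 x hx))).1

theorem IsLabelledFormalSolution.unique {ak bk ck fk gk : ℕ → ℂ → ℂ} {s : ℂ → ℂ} {ε : ℝ} {U : Set ℂ}
    (hU : IsOpen U) (hs : ∀ x ∈ U, (ε : ℂ) * s x ≠ 0)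
    (hf : IsLabelledFormalSolution ak bk ck s ε fk U)
    (hg : IsLabelledFormalSolution ak bk ck s ε gk U) (k : ℕ) : Set.EqOn (gk k) (fk k) U :=
  formal_solution_unique hU hf.1 hg.1 (fun x hx => by rw [hf.2 x hx]; exact hs x hx)
    (fun x hx => labelled_leading_unique (hs x hx) (hf.2 x hx) (hg.2 x hx) (hf.1.order_zero hx)
      (hg.1.order_zero hx)) k

/-- A holomorphic function of `ħ` is determined by its Gevrey asymptotics in a copolar direction. -/
theorem eqOn_borelDisc_of_gevrey {f g : ℂ → ℂ} {fk : ℕ → ℂ} {θ δ C C' M M' : ℝ} (hδ : 0 < δ)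
    (hC : 0 ≤ C) (hC' : 0 ≤ C') (hM : 0 < M) (hM' : 0 < M')
    (hf : DifferentiableOn ℂ f (borelDisc θ δ)) (hg : DifferentiableOn ℂ g (borelDisc θ δ))
    (hfb : ∀ n : ℕ, ∀ ħ ∈ borelDisc θ δ, ‖f ħ - ∑ k ∈ Finset.range n, fk k * ħ ^ k‖ ≤
      C * M ^ n * n.factorial * ‖ħ‖ ^ n)
    (hgb : ∀ n : ℕ, ∀ ħ ∈ borelDisc θ δ, ‖g ħ - ∑ k ∈ Finset.range n, fk k * ħ ^ k‖ ≤
      C' * M' ^ n * n.factorial * ‖ħ‖ ^ n) : Set.EqOn g f (borelDisc θ δ) := by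
  have h1 := gevreyHalfPlane_of_borelDisc (F := fun ħ => g ħ - f ħ) (g := fun _ => 0) (C := C' + C)
    (M := max M M') hδ (by positivity) (lt_max_of_lt_left hM) (hg.sub hf) (by
      intro n ħ hħ
      have h2 := norm_sub_le_of_le (hgb n ħ hħ) (hfb n ħ hħ)
      rw [sub_sub_sub_cancel_right] at h2
      simp only [zero_mul, Finset.sum_const_zero, sub_zero]
      refine h2.trans ?_
      have h3 : M ^ n ≤ max M M' ^ n := pow_le_pow_left₀ hM.le (le_max_left _ _) n
      have h4 : M' ^ n ≤ max M M' ^ n := pow_le_pow_left₀ hM'.le (le_max_right _ _) n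
      calc _ ≤ C' * max M M' ^ n * n.factorial * ‖ħ‖ ^ n + C * max M M' ^ n * n.factorial * ‖ħ‖ ^ n := by
            gcongr
        _ = _ := by ring)
  simp only [zero_mul] at h1
  intro ħ hħ
  have hħ0 := ne_zero_of_mem_borelDisc hδ hħ
  have h3 := h1.eq_zero (w := Complex.exp (θ * Complex.I) / ħ) hħ
  rw [div_div_cancel₀ (Complex.exp_ne_zero _)] at h3
  exact sub_eq_zero.1 h3

/-- Since |A| ≤ 2π, neighbouring directions among the three are at most π/2 apart, as
`borelDisc_half_subset` requires. -/
theorem copolarDomain_subset_copolarDiscs {ϑ₁ ϑ₂ δ : ℝ}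
    (hA₂ : ϑ₂ - ϑ₁ ≤ 2 * Real.pi) (hδ : 0 < δ) :
    copolarDomain ϑ₁ ϑ₂ (δ / 2) ⊆ copolarDiscs ϑ₁ ϑ₂ δ := by
  intro ħ hħ
  obtain ⟨φ, hφ, hħφ⟩ := Set.mem_iUnion₂.1 hħ
  obtain ⟨h1, h2⟩ := hφ
  rcases le_total φ (ϑ₁ + Real.pi / 2 + (ϑ₂ - ϑ₁ - Real.pi) / 2) with h | h
  · exact Or.inl (borelDisc_half_subset hδ (by linarith) ⟨h1, h⟩ hħφ)
  · rcases borelDisc_half_subset hδ (θ' := ϑ₁ + Real.pi / 2 + 2 * ((ϑ₂ - ϑ₁ - Real.pi) / 2))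
      (by linarith) ⟨h, by linarith⟩ hħφ with h3 | h3
    · exact Or.inl (Or.inr h3)
    · exact Or.inr h3

/-- Uniqueness of functions with given Gevrey asymptotics along a closed arc of length at
least `π`. -/
theorem eqOn_of_hasUnifGevreyAsymptotics {f g : ℂ × ℂ → ℂ} {fk : ℕ → ℂ → ℂ} {U S : Set ℂ}
    {ϑ₁ ϑ₂ : ℝ} (hA₁ : Real.pi ≤ ϑ₂ - ϑ₁) (hS : IsOpen S) (hSc : IsPreconnected S)
    (hf : DifferentiableOn ℂ f (U ×ˢ S)) (hg : DifferentiableOn ℂ g (U ×ˢ S))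
    (hfa : HasUnifGevreyAsymptotics f fk U S ϑ₁ ϑ₂) (hga : HasUnifGevreyAsymptotics g fk U S ϑ₁ ϑ₂) :
    Set.EqOn g f (U ×ˢ S) := by
  obtain ⟨T, hTS, hT, C, hC, M, hM, hfb⟩ := hfa
  obtain ⟨T', hTS', hT', C', hC', M', hM', hgb⟩ := hga
  have hθ : ϑ₁ + Real.pi / 2 ∈ copolarArc ϑ₁ ϑ₂ := ⟨le_rfl, by linarith⟩
  obtain ⟨d, hd, hdT⟩ := hT.exists_borelDisc _ hθ
  obtain ⟨d', hd', hdT'⟩ := hT'.exists_borelDisc _ hθ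
  set D := borelDisc (ϑ₁ + Real.pi / 2) (min d d') with hD
  have hm : 0 < min d d' := lt_min hd hd'
  have hDT : D ⊆ T := (borelDisc_mono hm (min_le_left _ _)).trans hdT
  have hDT' : D ⊆ T' := (borelDisc_mono hm (min_le_right _ _)).trans hdT'
  have hsl : ∀ {h : ℂ × ℂ → ℂ}, DifferentiableOn ℂ h (U ×ˢ S) → ∀ x ∈ U,
      DifferentiableOn ℂ (fun ħ => h (x, ħ)) S := fun hh x hx =>
    hh.comp ((differentiableOn_const x).prodMk differentiableOn_id) fun ħ hħ => ⟨hx, hħ⟩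
  rintro ⟨x, ħ⟩ ⟨hx, hħ⟩
  have h1 : Set.EqOn (fun ħ => g (x, ħ)) (fun ħ => f (x, ħ)) D := by
    refine eqOn_borelDisc_of_gevrey (fk := fun k => fk k x) hm hC.le hC'.le hM hM'
      ((hsl hf x hx).mono (hDT.trans hTS)) ((hsl hg x hx).mono (hDT.trans hTS)) (fun n ħ hħ => ?_)
      fun n ħ hħ => ?_
    · have := hfb n x hx ħ (hDT hħ); rwa [one_mul] at this
    · have := hgb n x hx ħ (hDT' hħ); rwa [one_mul] at this
  have h2 := direction_mem_borelDisc (ϑ₁ + Real.pi / 2) hm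
  -- A single Borel disc common to both domains of asymptotics suffices; the identity theorem in ħ
  -- spreads the equality over S.
  exact ((hsl hg x hx).analyticOnNhd hS).eqOn_of_preconnected_of_eventuallyEq
    ((hsl hf x hx).analyticOnNhd hS) hSc (hTS (hDT h2))
    (h1.eventuallyEq_of_mem ((isOpen_borelDisc _ _ hm).mem_nhds h2)) hħ

end

theorem mainTheorem8
    -- the domain `X`, and the sectorial domain `S` with opening `A = (ϑ₁, ϑ₂)`, `π ≤ |A| ≤ 2π`
    (X S : Set ℂ) (hXo : IsOpen X) (hXc : IsConnected X)
    (ϑ₁ ϑ₂ : ℝ) (hA₁ : Real.pi ≤ ϑ₂ - ϑ₁) (hA₂ : ϑ₂ - ϑ₁ ≤ 2 * Real.pi)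
    (hS : IsSectorialDomain S ϑ₁ ϑ₂)
    -- the coefficients and their asymptotic expansions
    (a b c : ℂ × ℂ → ℂ) (ak bk ck : ℕ → ℂ → ℂ)
    (ha : DifferentiableOn ℂ a (X ×ˢ S)) (hb : DifferentiableOn ℂ b (X ×ˢ S))
    (hc : DifferentiableOn ℂ c (X ×ˢ S))
    (hak : ∀ k, DifferentiableOn ℂ (ak k) X) (hbk : ∀ k, DifferentiableOn ℂ (bk k) X)
    (hck : ∀ k, DifferentiableOn ℂ (ck k) X)
    (haa : HasLocUnifAsymptotics a ak X S ϑ₁ ϑ₂) (hbb : HasLocUnifAsymptotics b bk X S ϑ₁ ϑ₂)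
    (hcc : HasLocUnifAsymptotics c ck X S ϑ₁ ϑ₂)
    -- the regular point, the square-root branch near it, and the sign
    (x₀ : ℂ) (hx₀ : x₀ ∈ X) (hreg : leadingDiscriminant ak bk ck x₀ ≠ 0)
    (s : ℂ → ℂ) (ρ : ℝ) (hρ : 0 < ρ) (hρX : Metric.ball x₀ ρ ⊆ X)
    (hs : DifferentiableOn ℂ s (Metric.ball x₀ ρ))
    (hsq : ∀ x ∈ Metric.ball x₀ ρ, s x ^ 2 = leadingDiscriminant ak bk ck x)
    (ε : ℝ) (hε : ε = 1 ∨ ε = -1)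
    -- the leading-order solution with label `ε` is holomorphic at `x₀`
    (hbranch : ak 0 x₀ = 0 → bk 0 x₀ = s x₀)
    -- for every copolar direction `θ`: a WKB halfstrip containing `x₀`
    (W : ℝ → Set ℂ)
    (hW : ∀ θ ∈ copolarArc ϑ₁ ϑ₂, IsWKBHalfstrip X s x₀ θ ε (W θ))
    (hWa : ε = -1 → ∀ θ ∈ copolarArc ϑ₁ ϑ₂, ∀ x ∈ W θ, ak 0 x ≠ 0)
    -- for every copolar direction `θ`: Gevrey asymptotics on it with respect to `√D₀`,
    -- with constants independent of `θ`
    (hGevrey : ∃ δ > 0, ∃ A > 0, ∃ B > 0,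
      ∀ θ ∈ copolarArc ϑ₁ ϑ₂, borelDisc θ δ ⊆ S ∧
        HasGevreyBounds a ak (fun x => √‖leadingDiscriminant ak bk ck x‖)
          (W θ) (borelDisc θ δ) A B ∧
        HasGevreyBounds b bk (fun x => √‖leadingDiscriminant ak bk ck x‖)
          (W θ) (borelDisc θ δ) A B ∧
        HasGevreyBounds c ck (fun x => √‖leadingDiscriminant ak bk ck x‖)
          (W θ) (borelDisc θ δ) A B) :
    ∃ U₀ S₀ : Set ℂ, IsOpen U₀ ∧ IsConnected U₀ ∧ x₀ ∈ U₀ ∧ U₀ ⊆ Metric.ball x₀ ρ ∧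
      S₀ ⊆ S ∧ IsSectorialDomain S₀ ϑ₁ ϑ₂ ∧
      -- the formal solution `f̂_α`, which is unique
      ∃ fk : ℕ → ℂ → ℂ, IsLabelledFormalSolution ak bk ck s ε fk U₀ ∧
        (∀ gk : ℕ → ℂ → ℂ, IsLabelledFormalSolution ak bk ck s ε gk U₀ →
          ∀ k, Set.EqOn (gk k) (fk k) U₀) ∧
        -- the exact solution, which is unique
        ∃ f : ℂ × ℂ → ℂ, IsHolomorphicSolution a b c f U₀ S₀ ∧
          HasUnifGevreyAsymptotics f fk U₀ S₀ ϑ₁ ϑ₂ ∧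
          (∀ g : ℂ × ℂ → ℂ, IsHolomorphicSolution a b c g U₀ S₀ →
            HasUnifGevreyAsymptotics g fk U₀ S₀ ϑ₁ ϑ₂ → Set.EqOn g f (U₀ ×ˢ S₀)) ∧
          IsGluedFromLaplace f fk U₀ S₀ (copolarArc ϑ₁ ϑ₂) := by
  classical
  obtain ⟨δ, hδ, A, hA, B, hB, hG⟩ := hGevrey
  have hs0 : s x₀ ≠ 0 := by
    intro h0
    refine hreg ?_
    rw [← hsq x₀ (Metric.mem_ball_self hρ), h0]
    ring
  have hεn : ‖(ε : ℂ)‖ = 1 := by rcases hε with rfl | rfl <;> simp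
  obtain ⟨R₁, hR₁, hR₁ρ, hRW, f₀, hf₀, hf₀eq, hex⟩ := exists_local_riccati_solution hA₁ hA₂ ha hb hc
    hak hbk hck hρ hs hsq hs0 hε hbranch hW hWa hδ hA hB hG
  have hS' : ∀ d, 0 < d → d ≤ δ → ∀ θ ∈ copolarArc ϑ₁ ϑ₂, borelDisc θ d ⊆ S := fun d hd hdδ θ hθ =>
    (borelDisc_mono hd hdδ).trans (hG θ hθ).1
  -- a small disc around the regular point
  have hsc := hs.continuousOn.continuousAt (Metric.ball_mem_nhds x₀ hρ)
  have hfc := hf₀.continuousOn.continuousAt (Metric.ball_mem_nhds x₀ hR₁)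
  have hev : ∀ᶠ x in 𝓝 x₀, ‖s x‖ < ‖s x₀‖ + 1 ∧ ‖s x₀‖ / 2 < ‖s x‖ ∧ ‖f₀ x‖ < ‖f₀ x₀‖ + 1 :=
    (hsc.norm.eventually_lt_const (lt_add_one _)).and
      ((hsc.norm.eventually_const_lt (half_lt_self (norm_pos_iff.2 hs0))).and
        (hfc.norm.eventually_lt_const (lt_add_one _)))
  obtain ⟨R₂, hR₂, hball⟩ := Metric.eventually_nhds_iff_ball.1 hev
  set R : ℝ := min 1 (min R₁ R₂) with hR
  have hR0 : 0 < R := by positivity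
  have hR1 : R ≤ 1 := min_le_left _ _
  have hRR₁ : Metric.ball x₀ R ⊆ Metric.ball x₀ R₁ :=
    Metric.ball_subset_ball ((min_le_right _ _).trans (min_le_left _ _))
  have hRR₂ : Metric.ball x₀ R ⊆ Metric.ball x₀ R₂ :=
    Metric.ball_subset_ball ((min_le_right _ _).trans (min_le_right _ _))
  have hRρ : Metric.ball x₀ R ⊆ Metric.ball x₀ ρ :=
    hRR₁.trans (Metric.ball_subset_ball hR₁ρ)
  have hRX : Metric.ball x₀ R ⊆ X := hRρ.trans hρX
  set K : ℝ := ‖s x₀‖ + 1 with hK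
  -- On the small disc |s| exceeds |s x₀|/2 = 2σ. One σ is reserved for the deviation of f from f₀,
  -- and the other remains as lower bound for the linearisation.
  set σ : ℝ := ‖s x₀‖ / 4 with hσ
  have hσ0 : 0 < σ := by have := norm_pos_iff.2 hs0; positivity
  have hK0 : 0 < K := by positivity
  have hw : ∀ x ∈ Metric.ball x₀ R, √‖leadingDiscriminant ak bk ck x‖ ≤ K := by
    intro x hx
    rw [← hsq x (hRρ hx), norm_pow, Real.sqrt_sq (norm_nonneg _)]
    exact (hball x (hRR₂ hx)).1.le
  have hs2 : ∀ x ∈ Metric.ball x₀ R, 2 * σ ≤ ‖(ε : ℂ) * s x‖ := by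
    intro x hx
    rw [norm_mul, hεn, one_mul, hσ]
    linarith [(hball x (hRR₂ hx)).2.1]
  have hne : ∀ x ∈ Metric.ball x₀ R, (ε : ℂ) * s x ≠ 0 := fun x hx =>
    norm_pos_iff.1 (lt_of_lt_of_le (by positivity) (hs2 x hx))
  -- Gevrey bounds for the coefficients with a constant scale
  have hdirs : ∀ φ : ℝ, (φ = ϑ₁ + Real.pi / 2 ∨ φ = ϑ₁ + Real.pi / 2 + (ϑ₂ - ϑ₁ - Real.pi) / 2 ∨
      φ = ϑ₁ + Real.pi / 2 + 2 * ((ϑ₂ - ϑ₁ - Real.pi) / 2)) → φ ∈ copolarArc ϑ₁ ϑ₂ := by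
    rintro φ (rfl | rfl | rfl) <;> constructor <;> linarith
  have hθm := hdirs _ (Or.inl rfl)
  have hGd : ∀ {g : ℂ × ℂ → ℂ} {gk : ℕ → ℂ → ℂ} {d : ℝ}, 0 < d → d ≤ δ →
      (∀ θ ∈ copolarArc ϑ₁ ϑ₂, HasGevreyBounds g gk (fun x => √‖leadingDiscriminant ak bk ck x‖)
        (W θ) (borelDisc θ δ) A B) →
      HasGevreyBounds g gk (fun _ => 1) (Metric.ball x₀ R) (copolarDiscs ϑ₁ ϑ₂ d) (K * A) B := by
    intro g gk d hd hdδ h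
    have h1 : ∀ φ : ℝ, (φ = ϑ₁ + Real.pi / 2 ∨ φ = ϑ₁ + Real.pi / 2 + (ϑ₂ - ϑ₁ - Real.pi) / 2 ∨
        φ = ϑ₁ + Real.pi / 2 + 2 * ((ϑ₂ - ϑ₁ - Real.pi) / 2)) →
        HasGevreyBounds g gk (fun _ => 1) (Metric.ball x₀ R) (borelDisc φ d) (K * A) B :=
      fun φ hφ => ((h φ (hdirs φ hφ)).mono (hRR₁.trans (hRW φ hφ))
        (borelDisc_mono hd hdδ)).of_scale_le hA.le hB.le hw
    rintro n x hx ħ ((hħ | hħ) | hħ)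
    · exact h1 _ (Or.inl rfl) n x hx ħ hħ
    · exact h1 _ (Or.inr (Or.inl rfl)) n x hx ħ hħ
    · exact h1 _ (Or.inr (Or.inr rfl)) n x hx ħ hħ
  have hGa := fun θ hθ => (hG θ hθ).2.1
  have hGb := fun θ hθ => (hG θ hθ).2.2.1
  have hGc := fun θ hθ => (hG θ hθ).2.2.2
  have hcoef : ∀ {g : ℂ × ℂ → ℂ} {gk : ℕ → ℂ → ℂ},
      (∀ θ ∈ copolarArc ϑ₁ ϑ₂, HasGevreyBounds g gk (fun x => √‖leadingDiscriminant ak bk ck x‖)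
        (W θ) (borelDisc θ δ) A B) →
      ∀ k, ∀ x ∈ Metric.ball x₀ R, ‖gk k x‖ ≤ K * A * B ^ k * k.factorial := by
    intro g gk h k x hx
    have := ((hGd hδ le_rfl h).mono subset_rfl
      (T' := borelDisc (ϑ₁ + Real.pi / 2) δ) fun ħ hħ => Or.inl (Or.inl hħ)).norm_coeff_le hδ hx k
    rwa [one_mul] at this
  have hKA : 0 < K * A := by positivity
  -- the exact and the formal solution
  obtain ⟨δ', hδ', hδδ, f, hf⟩ := hex (σ / (K * A + 1)) (by positivity)
  obtain ⟨fk, hfk0, hfk⟩ := exists_formal_solution Metric.isOpen_ball (fun k => (hak k).mono hRX)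
    (fun k => (hbk k).mono hRX) (fun k => (hck k).mono hRX) (hf₀.mono hRR₁)
    (fun x hx => by rw [(hf₀eq x (hRR₁ hx)).1]; exact hne x hx) fun x hx => (hf₀eq x (hRR₁ hx)).2
  have hħ0 : ∀ ħ ∈ copolarDiscs ϑ₁ ϑ₂ δ', ħ ≠ 0 := by
    rintro ħ ((hħ | hħ) | hħ) <;> exact ne_zero_of_mem_borelDisc hδ' hħ
  have hclose : ∀ x ∈ Metric.ball x₀ R, ∀ ħ ∈ copolarDiscs ϑ₁ ϑ₂ δ',
      ‖f (x, ħ) - f₀ x‖ ≤ σ / (K * A + 1) := fun x hx ħ hħ => ((hf x (hRR₁ hx)).2 ħ hħ).2.2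
  set K₀ : ℝ := ‖f₀ x₀‖ + 1 + σ / (K * A + 1) with hK₀
  have hK₀0 : 0 < K₀ := by positivity
  have hfb : ∀ x ∈ Metric.ball x₀ R, ∀ ħ ∈ copolarDiscs ϑ₁ ϑ₂ δ', ‖f (x, ħ)‖ ≤ K₀ := by
    intro x hx ħ hħ
    have h1 := norm_add_le_of_le (hball x (hRR₂ hx)).2.2.le (hclose x hx ħ hħ)
    rwa [add_sub_cancel] at h1
  obtain ⟨C, hC, M, hM, hfG⟩ := hasGevreyBounds_of_bounded (f := f) (K₀ := K₀) hR0 hR1 hKA.le hB.le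
    hσ0 hħ0 (hGd hδ' hδδ hGa) (hGd hδ' hδδ hGb) (hGd hδ' hδδ hGc) (hcoef hGa) (hcoef hGb)
    (hcoef hGc) hfk
    (fun ħ hħ x hx => ((hf x (hRR₁ hx)).2 ħ hħ).1.differentiableWithinAt)
    (fun x hx ħ hħ => ((hf x (hRR₁ hx)).2 ħ hħ).2.1)
    (fun x hx => by
      rw [hfk0]
      exact (hball x (hRR₂ hx)).2.2.le.trans (le_add_of_nonneg_right (by positivity)))
    hfb
    (fun x hx => by
      rw [hfk0, (hf₀eq x (hRR₁ hx)).1]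
      linarith [hs2 x hx])
    (fun x hx ħ hħ => by
      have h1 : ‖ak 0 x * (f (x, ħ) - f₀ x)‖ ≤ σ := by
        have h2 := hcoef hGa 0 x hx
        simp only [pow_zero, mul_one, Nat.factorial_zero, Nat.cast_one] at h2
        refine (norm_mul_le_of_le h2 (hclose x hx ħ hħ)).trans ?_
        rw [mul_div_assoc', div_le_iff₀ (by positivity)]
        nlinarith
      have h3 := norm_sub_le_of_le (le_refl ‖ak 0 x * (f (x, ħ) + f₀ x) + bk 0 x‖) h1
      rw [hfk0]
      have h4 : ak 0 x * (f (x, ħ) + f₀ x) + bk 0 x - ak 0 x * (f (x, ħ) - f₀ x) = ε * s x := by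
        rw [← (hf₀eq x (hRR₁ hx)).1]; ring
      rw [h4] at h3
      linarith [hs2 x hx])
  -- the domains
  set U₀ := Metric.ball x₀ (R / 2) with hU₀
  -- The halved diameter places the discs of all copolar directions inside the three on which f is
  -- defined; the halved radius of U₀ is the price of the Gevrey estimate.
  set S₀ := copolarDomain ϑ₁ ϑ₂ (δ' / 2) with hS₀
  have hU₀R : U₀ ⊆ Metric.ball x₀ R := Metric.ball_subset_ball (by linarith)
  have hS₀d : S₀ ⊆ copolarDiscs ϑ₁ ϑ₂ δ' := copolarDomain_subset_copolarDiscs hA₂ hδ'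
  have hδ2 : 0 < δ' / 2 := half_pos hδ'
  have hS₀sec := isSectorialDomain_copolarDomain hδ2 hA₁ hA₂
  have hS₀S : S₀ ⊆ S := Set.iUnion₂_subset fun θ hθ =>
    hS' (δ' / 2) hδ2 (by linarith) θ hθ
  have hfd : DifferentiableOn ℂ f (U₀ ×ˢ S₀) := by
    refine differentiableOn_prod_of_separately Metric.isOpen_ball hS₀sec.isOpen
      (fun ħ hħ x hx => ((hf x (hRR₁ (hU₀R hx))).2 ħ (hS₀d hħ)).1.differentiableWithinAt)
      (fun x hx => (hf x (hRR₁ (hU₀R hx))).1.mono hS₀d) fun x hx ħ hħ =>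
        ⟨U₀, Metric.isOpen_ball.mem_nhds hx, S₀, hS₀sec.isOpen.mem_nhds hħ, K₀,
          fun x' hx' ħ' hħ' => hfb x' (hU₀R hx') ħ' (hS₀d hħ')⟩
  have hlab : IsLabelledFormalSolution ak bk ck s ε fk U₀ :=
    ⟨hfk.mono hU₀R, fun x hx => by rw [hfk0]; exact (hf₀eq x (hRR₁ (hU₀R hx))).1⟩
  have hfG₀ : HasGevreyBounds f fk (fun _ => 1) U₀ S₀ C M := hfG.mono subset_rfl hS₀d
  have hunif : HasUnifGevreyAsymptotics f fk U₀ S₀ ϑ₁ ϑ₂ :=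
    ⟨S₀, subset_rfl, hS₀sec, C, hC, M, hM, hfG₀⟩
  refine ⟨U₀, S₀, Metric.isOpen_ball, Metric.isConnected_ball (half_pos hR0),
    Metric.mem_ball_self (half_pos hR0), hU₀R.trans hRρ, hS₀S, hS₀sec, fk, hlab, fun gk hgk k =>
      hlab.unique Metric.isOpen_ball (fun x hx => hne x (hU₀R hx)) hgk k,
    f, ⟨hfd, fun x hx ħ hħ => ((hf x (hRR₁ (hU₀R hx))).2 ħ (hS₀d hħ)).2.1⟩, hunif,
    fun g hg hga => eqOn_of_hasUnifGevreyAsymptotics hA₁ hS₀sec.isOpen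
      hS₀sec.isSimplyConnected.isPathConnected.isConnected.isPreconnected hfd hg.1 hunif hga, ?_⟩
  exact isGluedFromLaplace_of_gevrey Metric.isOpen_ball ⟨_, hθm⟩ hδ2 hC hM
    (fun θ hθ ħ hħ => Set.mem_iUnion₂.2 ⟨θ, hθ, hħ⟩) hfd hlab.1.1 hfG₀
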